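/- **Theorem (pseudo-stable and -unstable bundles under discretization).** *Setting.* Let $\mathbb K\in\{\mathbb R,\mathbb C\}$, let $\mathbb I\subseteq\mathbb Z$ be an unbounded discrete interval, $\mathbb I'=\{t\in\mathbb I: t+1\in\mathbb I\}$, and $\Omega\subset\mathbb R^\kappa$ open and bounded. $L^r_d(\Omega)$ denotes the space of $\mathbb K^d$-valued functions with norm $\|u\|_r=(\sum_{j=1}^d\int_\Omega|u_j|^r)^{1/r}$; accordingly $\mathbb K^d$ (the values of $u\in L^p_d$) carries the $\ell^p$-norm, $\mathbb K^e$ (the values of $v\in L^q_e$) the $\ell^q$-norm, and matrices and multilinear maps carry the operator norms. Let $m\in\mathbb N$, $m\ge1$, and $p,q\in(1,\infty)$ with $mq<p$, $\frac1q+\frac1{q'}=1$, $r:=\frac{pq}{p-q}$. Consider $$u_{t+1}=\mathcal F_t(u_t),\qquad \mathcal F_t(u)=\int_\Omega k_t(\cdot,y)g_t(y,u(y))\,dy\qquad(t\in\mathbb I')\qquad(I_0)$$ on $L^p_d(\Omega)$, and put $\mathcal K_tv=\int_\Omega k_t(\cdot,y)v(y)\,dy$. *Hypotheses.* (i) $k_t:\Omega\times\Omega\to\mathbb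 K^{d\times e}$ is measurable with $\kappa_t:=\big(\int_\Omega(\int_\Omega|k_t(x,y)|^{q'}dy)^{p/q'}dx\big)^{1/p}<\infty$; and for a linear subspace $X(\Omega)\subseteq L^p_d(\Omega)$ with a (semi)norm $\|\cdot\|_{X(\Omega)}$ one has $\mathcal K_tL^q_e(\Omega)\subseteq X(\Omega)$ and $\|\mathcal K_tv\|_{X(\Omega)}\le C_t\|v\|_q$ with reals $C_t\ge0$, for all $t\in\mathbb I'$. (ii) For $0\le\ell\le m$ and $t\in\mathbb I'$, $D_2^\ell g_t(x,\cdot):\mathbb K^d\to L_\ell(\mathbb K^d,\mathbb K^e)$ exists and is continuous for a.a. $x$, $D_2^\ell g_t(\cdot,z)$ is measurable for all $z$, and $|D_2^\ell g_t(x,z)|\le c(x)+c_\ell|z|^{(p-\ell q)/q}$ for a.a. $x$ and all $z$, with $c\in L^{pq/(p-mq)}(\Omega)$ and $c_\ell\ge0$ independent of $t$, and $c_2=\dots=c_m=0$. Moreover $g_t(x,0)=0$, and there are measurable $\lambda_t,\bar\lambda_t:\Omega\to[0,\infty)$ with $|D_2g_t(x,z)-D_2g_t(x,0)|\le\lambda_t(x)$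 and $|g_t(x,z)-g_t(x,\bar z)|\le\bar\lambda_t(x)|z-\bar z|$ for a.a. $x$ and all $z,\bar z$, such that (with $\|\lambda\|_r=(\int_\Omega\lambda^r)^{1/r}$) $$\sup_{t\in\mathbb I'}C_t\|\bar\lambda_t\|_r<\infty,\qquad L:=\sup_{t\in\mathbb I'}\kappa_t\|\lambda_t\|_r<\infty,\qquad\sup_{t\in\mathbb I'}\kappa_t\|\bar\lambda_t\|_r<\infty .$$ (iii) For $n\ge1$ let $\pi_n$ be a bounded projection of $L^p(\Omega)$ onto a finite-dimensional subspace $X_n$, $X_n^d=X_n\times\dots\times X_n$ and $\Pi_n=\mathrm{diag}(\pi_n,\dots,\pi_n)$ on $L^p_d(\Omega)$. There is a function $\Gamma>0$ on $(0,\infty)$ with $\lim_{\varrho\searrow0}\Gamma(\varrho)=0$ and $\|u-\Pi_nu\|_p\le\Gamma(\frac1n)\|u\|_{X(\Omega)}$ for all $n\ge1$, $u\in X(\Omega)$. The discretizations are $u_{t+1}=\mathcal F^n_t(u_t)$ with $\mathcal F^0_t=\mathcal F_t$ and $\mathcal F^n_t=\Pi_n\mathcal F_t$ for $n\ge1$ $(I_n)$;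 $\varphi^n(t;\tau,u)$ is the solution at time $t\ge\tau$ starting from $u$ at time $\tau$. *Spectrum.* The variational equation is $v_{t+1}=\mathcal L_tv_t$, $\mathcal L_tv=\int_\Omega k_t(\cdot,y)D_2g_t(y,0)v(y)\,dy$ $(V_0)$, with evolution operator $\Phi$. A linear equation $v_{t+1}=\mathcal A_tv_t$ with evolution operator $\Phi_{\mathcal A}$ has an exponential dichotomy on $\mathbb I$ if there are bounded projections $P_t$ ($t\in\mathbb I$), $K_0\ge1$ and $a\in(0,1)$ such that, for $t\in\mathbb I'$, $P_{t+1}\mathcal A_t=\mathcal A_tP_t$ and $\mathcal A_t:N(P_t)\to N(P_{t+1})$ is an isomorphism, and $\|\Phi_{\mathcal A}(t,s)P_s\|\le K_0a^{t-s}$, $\|\Phi_{\mathcal A}(s,t)[\mathrm{id}-P_t]\|\le K_0a^{t-s}$ for all $s\le t$ in $\mathbb I$. The dichotomy spectrum $\Sigma_{\mathbb I}$ is the set of $\gamma>0$ for which $v_{t+1}=\frac1\gamma\mathcal L_tv_t$ has no exponential dichotomy on $\mathbb I$. Let $0<\alpha_j<\gamma_j<\beta_j$ with $[\alpha_j,\beta_j]\cap\Sigma_{\mathbb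 I}=\emptyset$, and let $\mathcal V_j^+$ be the set of $(\tau,u)\in\mathbb I\times L^p_d(\Omega)$ with $\sup_{t\ge\tau}\gamma_j^{\tau-t}\|\Phi(t,\tau)u\|_p<\infty$, and $\mathcal V_j^-$ the set of those $(\tau,u)$ for which $(V_0)$ has a solution $(\phi_t)_{t\in\mathbb I}$ with $\phi_\tau=u$ and $\sup_{t\le\tau}\gamma_j^{\tau-t}\|\phi_t\|_p<\infty$. Their $\tau$-fibers are linear spaces. *Claim.* There is $K\ge1$, depending only on $(V_0)$ and the gap $(\alpha_j,\gamma_j,\beta_j)$, such that for every $\delta\in(4KL,\frac{\beta_j-\alpha_j}2]$ there is $N\ge1$ such that, with $\Gamma_j:=[\alpha_j+\delta,\beta_j-\delta]$, the following holds for $n=0$ and all $n\ge N$. (a) Let $\mathbb I$ be unbounded above. The pseudo-stable bundle $\mathcal W^n_{j,+}=\{(\tau,u)\in\mathbb I\times L^p_d(\Omega):\sup_{t\ge\tau}\gamma^{\tau-t}\|\varphi^n(t;\tau,u)\|_p<\infty\}$ is forward invariant for $(I_n)$, independent of $\gamma\in\Gamma_j$, and $\mathcal W^n_{j,+}=\{(\tau,v+w^n_{j,+}(\tau,v)):(\tau,v)\in\mathcal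 V_j^+\}$ with continuous maps $w^n_{j,+}:\mathcal V_j^+\to L^p_d(\Omega)$, $w^n_{j,+}(\tau,0)=0$, such that: ($a_1$) $\mathrm{lip}\,w^n_{j,+}(\tau,\cdot)\le C_0^+(n)$, where $C_0^+(0)=\frac{K^2L}{\delta-2KL}$, $C_0^+(n)>0$ for $n\ge N$ and $C_0^+(n)\to C_0^+(0)$ as $n\to\infty$; and there is $N_0^+>0$ with $\|w^n_{j,+}(\tau,v)-w^0_{j,+}(\tau,v)\|_p\le N_0^+\Gamma(\frac1n)\|v\|_p$ for all $n\ge N$, $(\tau,v)\in\mathcal V_j^+$. ($a_2$) If $1\le m_+\le m$, $\alpha_j^{m_+}<\beta_j$, $\delta\le\alpha_j\Big(\sqrt[m_+]{\tfrac{\alpha_j+\beta_j}{\alpha_j+\alpha_j^{m_+}}}-1\Big)$ and, in case $m_+\ge2$, also $\sup_{t\in\mathbb I'}\kappa_t<\infty$ and $\sup_{t\in\mathbb I'}C_t<\infty$, then $w^n_{j,+}(\tau,\cdot)$ is of class $C^{m_+}$ on the fiber $\mathcal V_j^+(\tau)$, and for $1\le\ell<m_+$ there is $N_\ell^+>0$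 with $\|D_2^\ell w^n_{j,+}(\tau,v)-D_2^\ell w^0_{j,+}(\tau,v)\|\le N_\ell^+\Gamma(\frac1n)(1+\|v\|_p)$ for all $n\ge N$, $(\tau,v)\in\mathcal V_j^+$. (b) Let $\mathbb I$ be unbounded below. The fibers of $\mathcal V_j^-$ are finite-dimensional, of the same dimension. The pseudo-unstable bundle $\mathcal W^n_{j,-}$ of all $(\tau,u)\in\mathbb I\times L^p_d(\Omega)$ for which $(I_n)$ has a solution $(\phi_t)_{t\in\mathbb I}$ with $\phi_\tau=u$ and $\sup_{t\le\tau}\gamma^{\tau-t}\|\phi_t\|_p<\infty$ is invariant for $(I_n)$, independent of $\gamma\in\Gamma_j$, contained in $\mathbb I\times X(\Omega)$ for $n=0$ and in $\mathbb I\times X_n^d$ for $n\ge N$, and $\mathcal W^n_{j,-}=\{(\tau,v+w^n_{j,-}(\tau,v)):(\tau,v)\in\mathcal V_j^-\}$ with continuous maps $w^n_{j,-}:\mathcal V_j^-\to L^p_d(\Omega)$, $w^n_{j,-}(\tau,0)=0$, such that: ($b_1$) the statement of ($a_1$) holds with $+$ replaced by $-$; ($b_2$) if $1\le m_-\le m$,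 $\alpha_j<\beta_j^{m_-}$, $\delta\le\beta_j\Big(1-\sqrt[m_-]{\tfrac{\alpha_j+\beta_j}{\beta_j+\beta_j^{m_-}}}\Big)$ and, in case $m_-\ge2$, also $\sup_t\kappa_t<\infty$ and $\sup_tC_t<\infty$, then $w^n_{j,-}(\tau,\cdot)$ is of class $C^{m_-}$ on $\mathcal V_j^-(\tau)$, and for $1\le\ell<m_-$ there is $N_\ell^->0$ with $\|D_2^\ell w^n_{j,-}(\tau,v)-D_2^\ell w^0_{j,-}(\tau,v)\|\le N_\ell^-\Gamma(\frac1n)(1+\|v\|_p)$ for all $n\ge N$, $(\tau,v)\in\mathcal V_j^-$. (c) If $\mathbb I=\mathbb Z$ and $L<\frac{\delta}{6K}$, then $\mathcal W^n_{j,+}\cap\mathcal W^n_{j,-}=\mathbb Z\times\{0\}$, and for every $\gamma\in\Gamma_j$ the zero solution is the only entire solution $\phi$ of $(I_n)$ with $\sup_{t\in\mathbb Z}\gamma^{-t}\|\phi_t\|_p<\infty$. -/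

import Mathlib

open MeasureTheory Set Filter Topology
open scoped ENNReal NNReal

noncomputable section

namespace IDE

/-! ### Nonautonomous difference equations on a discrete interval -/

/-- `𝕀' = {t ∈ 𝕀 : t + 1 ∈ 𝕀}`. -/
def prime (I : Set ℤ) : Set ℤ := {t | t ∈ I ∧ t + 1 ∈ I}

section Abstract

variable {X : Type*}

/-- The `k`-fold composition `F_{τ+k-1} ∘ ⋯ ∘ F_τ` applied to `u`. -/
def iter (F : ℤ → X → X) (τ : ℤ) (u : X) : ℕ → X
  | 0 => u
  | k + 1 => F (τ + k) (iter F τ u k)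

/-- General solution `φ(t; τ, u)` of `u_{t+1} = F_t(u_t)`; only used for `τ ≤ t`. -/
def sol (F : ℤ → X → X) (t τ : ℤ) (u : X) : X := iter F τ u (t - τ).toNat

/-- `(φ_t)_{t ∈ 𝕀}` is an (entire) solution of `u_{t+1} = F_t(u_t)` on `𝕀`. -/
def IsSolution (I : Set ℤ) (F : ℤ → X → X) (φ : ℤ → X) : Prop :=
  ∀ t ∈ prime I, φ (t + 1) = F t (φ t)

/-- The `t`-fiber of a nonautonomous set. -/
def fiber (W : Set (ℤ × X)) (t : ℤ) : Set X := {u | (t, u) ∈ W}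

def ForwardInvariant (I : Set ℤ) (F : ℤ → X → X) (W : Set (ℤ × X)) : Prop :=
  ∀ t ∈ prime I, F t '' fiber W t ⊆ fiber W (t + 1)

def Invariant (I : Set ℤ) (F : ℤ → X → X) (W : Set (ℤ × X)) : Prop :=
  ∀ t ∈ prime I, F t '' fiber W t = fiber W (t + 1)

variable [NormedAddCommGroup X]

/-- All `(τ, u) ∈ 𝕀 × X` with `sup_{τ ≤ t} γ^{τ-t} ‖φ(t; τ, u)‖ < ∞`. -/
def stableSet (I : Set ℤ) (F : ℤ → X → X) (γ : ℝ) : Set (ℤ × X) :=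
  {z | z.1 ∈ I ∧ ∃ M : ℝ, ∀ t ∈ I, z.1 ≤ t → γ ^ (z.1 - t) * ‖sol F t z.1 z.2‖ ≤ M}

/-- All `(τ, u) ∈ 𝕀 × X` for which there is a solution `(φ_t)_{t ∈ 𝕀}` with `φ_τ = u` and
`sup_{t ≤ τ} γ^{τ-t} ‖φ_t‖ < ∞`. -/
def unstableSet (I : Set ℤ) (F : ℤ → X → X) (γ : ℝ) : Set (ℤ × X) :=
  {z | z.1 ∈ I ∧ ∃ φ : ℤ → X, IsSolution I F φ ∧
    (∃ M : ℝ, ∀ t ∈ I, t ≤ z.1 → γ ^ (z.1 - t) * ‖φ t‖ ≤ M) ∧ φ z.1 = z.2}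

/-! ### Linear equations, exponential dichotomies, dichotomy spectrum -/

variable {𝕂 : Type*} [RCLike 𝕂] [NormedSpace 𝕂 X]

/-- `L_{s+k-1} ⋯ L_s`. -/
def evolIter (L : ℤ → X →L[𝕂] X) (s : ℤ) : ℕ → X →L[𝕂] X
  | 0 => ContinuousLinearMap.id 𝕂 X
  | k + 1 => (L (s + k)).comp (evolIter L s k)

/-- Evolution operator `Φ(t, s)`, for `s ≤ t`. -/
def evol (L : ℤ → X →L[𝕂] X) (t s : ℤ) : X →L[𝕂] X := evolIter L s (t - s).toNat

/-- Exponential dichotomy on `𝕀`. In the last clause `v` is `Φ(s, t)[id - P_t] u`, that is, the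
point of `N(P_s)` which `Φ(t, s)` maps to `[id - P_t] u`. -/
def HasExpDichotomy (I : Set ℤ) (L : ℤ → X →L[𝕂] X) : Prop :=
  ∃ (P : ℤ → X →L[𝕂] X) (K a : ℝ), 1 ≤ K ∧ 0 < a ∧ a < 1 ∧
    (∀ t ∈ I, (P t).comp (P t) = P t) ∧
    (∀ t ∈ prime I, (P (t + 1)).comp (L t) = (L t).comp (P t)) ∧
    (∀ t ∈ prime I, BijOn (L t) {v | P t v = 0} {v | P (t + 1) v = 0}) ∧
    (∀ s ∈ I, ∀ t ∈ I, s ≤ t → ‖(evol L t s).comp (P s)‖ ≤ K * a ^ (t - s)) ∧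
    (∀ s ∈ I, ∀ t ∈ I, s ≤ t → ∀ u v : X, P s v = 0 → evol L t s v = u - P t u →
      ‖v‖ ≤ K * a ^ (t - s) * ‖u‖)

/-- The dichotomy spectrum `Σ_𝕀(L) ⊆ (0, ∞)`. -/
def dichotomySpectrum (I : Set ℤ) (L : ℤ → X →L[𝕂] X) : Set ℝ :=
  {γ | 0 < γ ∧ ¬ HasExpDichotomy I (fun t => ((γ⁻¹ : ℝ) : 𝕂) • L t)}

/-- The `τ`-fiber of the linear bundle of all `(τ, u)` with
`sup_{τ ≤ t} γ^{τ-t} ‖Φ(t, τ) u‖ < ∞` (used for `γ > 0`, where the absolute value is void). -/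
def stableFiber (I : Set ℤ) (L : ℤ → X →L[𝕂] X) (γ : ℝ) (τ : ℤ) : Submodule 𝕂 X where
  carrier := {u | ∃ M : ℝ, ∀ t ∈ I, τ ≤ t → |γ ^ (τ - t)| * ‖evol L t τ u‖ ≤ M}
  zero_mem' := ⟨0, by simp⟩
  add_mem' := by
    rintro u v ⟨M, hM⟩ ⟨M', hM'⟩
    refine ⟨M + M', fun t ht hτ => ?_⟩
    have h1 := hM t ht hτ
    have h2 := hM' t ht hτ
    have h3 := mul_le_mul_of_nonneg_left (norm_add_le (evol L t τ u) (evol L t τ v))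
      (abs_nonneg (γ ^ (τ - t)))
    rw [map_add]
    linarith
  smul_mem' := by
    rintro c u ⟨M, hM⟩
    refine ⟨‖c‖ * M, fun t ht hτ => ?_⟩
    have h1 := mul_le_mul_of_nonneg_left (hM t ht hτ) (norm_nonneg c)
    rw [map_smul, norm_smul]
    linarith

/-- The `τ`-fiber of the linear bundle of all `(τ, u)` for which there is a solution
`(φ_t)_{t ∈ 𝕀}` of the linear equation with `φ_τ = u` and
`sup_{t ≤ τ} γ^{τ-t} ‖φ_t‖ < ∞`. -/
def unstableFiber (I : Set ℤ) (L : ℤ → X →L[𝕂] X) (γ : ℝ) (τ : ℤ) : Submodule 𝕂 X where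
  carrier := {u | ∃ φ : ℤ → X, IsSolution I (fun t => L t) φ ∧
    (∃ M : ℝ, ∀ t ∈ I, t ≤ τ → |γ ^ (τ - t)| * ‖φ t‖ ≤ M) ∧ φ τ = u}
  zero_mem' := ⟨0, by intro t _; simp, ⟨0, by simp⟩, rfl⟩
  add_mem' := by
    rintro u v ⟨φ, h, ⟨M, hM⟩, rfl⟩ ⟨ψ, h', ⟨M', hM'⟩, rfl⟩
    refine ⟨φ + ψ, fun t ht => ?_, ⟨M + M', fun t ht hτ => ?_⟩, rfl⟩
    · simp [h t ht, h' t ht]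
    · have h1 := hM t ht hτ
      have h2 := hM' t ht hτ
      have h3 := mul_le_mul_of_nonneg_left (norm_add_le (φ t) (ψ t)) (abs_nonneg (γ ^ (τ - t)))
      rw [Pi.add_apply]
      linarith
  smul_mem' := by
    rintro c u ⟨φ, h, ⟨M, hM⟩, rfl⟩
    refine ⟨c • φ, fun t ht => ?_, ⟨‖c‖ * M, fun t ht hτ => ?_⟩, rfl⟩
    · simp [h t ht]
    · have h1 := mul_le_mul_of_nonneg_left (hM t ht hτ) (norm_nonneg c)
      rw [Pi.smul_apply, norm_smul]
      linarith

/-- The nonautonomous set `{(τ, v + w(τ, v)) : τ ∈ 𝕀, v ∈ V(τ)}`. -/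
def graphOver (I : Set ℤ) (V : ℤ → Submodule 𝕂 X) (w : (τ : ℤ) → V τ → X) : Set (ℤ × X) :=
  {z | z.1 ∈ I ∧ ∃ v : V z.1, z.2 = (v : X) + w z.1 v}

end Abstract

/-! ### Hammerstein integrodifference equations and their discretizations -/

/-- `𝕂^d` with the norm `(∑ |z_j|^r)^{1/r}`. -/
abbrev Vec (𝕂 : Type*) (r : ℝ≥0∞) (d : ℕ) : Type _ := PiLp r (fun _ : Fin d => 𝕂)

/-- Lebesgue measure on `Ω`. -/
abbrev leb {κ : ℕ} (Ω : Set (EuclideanSpace ℝ (Fin κ))) : Measure (EuclideanSpace ℝ (Fin κ)) :=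
  volume.restrict Ω

/-- `L^r_d(Ω)`, with norm `(∑_j ∫_Ω |u_j|^r)^{1/r}`. -/
abbrev LpSpace (𝕂 : Type*) [RCLike 𝕂] {κ : ℕ} (Ω : Set (EuclideanSpace ℝ (Fin κ)))
    (r : ℝ≥0∞) [Fact (1 ≤ r)] (d : ℕ) : Type _ :=
  Lp (Vec 𝕂 r d) r (leb Ω)

/-- The class in `L^r` of a function; `0` for a function that is not in `L^r`. -/
def lpClass {E F : Type*} [MeasurableSpace E] [NormedAddCommGroup F] (r : ℝ≥0∞) (μ : Measure E)
    (f : E → F) : Lp F r μ :=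
  open Classical in if h : MemLp f r μ then h.toLp f else 0

section Hammerstein

variable {𝕂 : Type*} [RCLike 𝕂] {κ : ℕ} {Ω : Set (EuclideanSpace ℝ (Fin κ))}
  {p q : ℝ≥0∞} [Fact (1 ≤ p)] [Fact (1 ≤ q)] {d e : ℕ}

/-- Fredholm operator `v ↦ ∫_Ω k(·, y) v(y) dy` from `L^q_e(Ω)` to `L^p_d(Ω)`; a `d × e` matrix
is a linear map `𝕂^e → 𝕂^d` with its operator norm. -/
def fredholm (k : EuclideanSpace ℝ (Fin κ) → EuclideanSpace ℝ (Fin κ) →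
    (Vec 𝕂 q e →L[𝕂] Vec 𝕂 p d)) (v : LpSpace 𝕂 Ω q e) : LpSpace 𝕂 Ω p d :=
  lpClass p (leb Ω) (fun x => ∫ y in Ω, k x y (v y))

/-- Nemytskii operator `u ↦ g(·, u(·))` from `L^p_d(Ω)` to `L^q_e(Ω)`. -/
def nemytskii (g : EuclideanSpace ℝ (Fin κ) → Vec 𝕂 p d → Vec 𝕂 q e)
    (u : LpSpace 𝕂 Ω p d) : LpSpace 𝕂 Ω q e :=
  lpClass q (leb Ω) (fun x => g x (u x))

/-- `(∫_Ω (∫_Ω |k(x, y)|^{q'} dy)^{p/q'} dx)^{1/p}` with `1/q + 1/q' = 1`. -/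
def hilleTamarkin (Ω : Set (EuclideanSpace ℝ (Fin κ)))
    (k : EuclideanSpace ℝ (Fin κ) → EuclideanSpace ℝ (Fin κ) →
      (Vec 𝕂 q e →L[𝕂] Vec 𝕂 p d)) : ℝ≥0∞ :=
  (∫⁻ x in Ω, (∫⁻ y in Ω, ‖k x y‖ₑ ^ (q.toReal / (q.toReal - 1))) ^
    (p.toReal / (q.toReal / (q.toReal - 1)))) ^ (1 / p.toReal)

/-- `(∫_Ω l(y)^r dy)^{1/r}`, with `r = pq/(p-q)`, i.e. `1/q = 1/p + 1/r`. -/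
def weightNorm (Ω : Set (EuclideanSpace ℝ (Fin κ))) (p q : ℝ≥0∞)
    (l : EuclideanSpace ℝ (Fin κ) → ℝ≥0) : ℝ≥0∞ :=
  (∫⁻ y in Ω, (l y : ℝ≥0∞) ^ (p.toReal * q.toReal / (p.toReal - q.toReal))) ^
    ((p.toReal - q.toReal) / (p.toReal * q.toReal))

variable (𝕂 Ω p q d e) in
/-- The functions entering a Hammerstein equation and its hypotheses: kernels `k_t`, growth
functions `g_t`, a space `X(Ω)` with its norm, the smoothing constants `C_t` and the weights
`λ_t`, `λ̄_t`. -/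
structure Hammerstein where
  k : ℤ → EuclideanSpace ℝ (Fin κ) → EuclideanSpace ℝ (Fin κ) → (Vec 𝕂 q e →L[𝕂] Vec 𝕂 p d)
  g : ℤ → EuclideanSpace ℝ (Fin κ) → Vec 𝕂 p d → Vec 𝕂 q e
  XΩ : Submodule 𝕂 (LpSpace 𝕂 Ω p d)
  normX : Seminorm 𝕂 XΩ
  C : ℤ → ℝ
  lam : ℤ → EuclideanSpace ℝ (Fin κ) → ℝ≥0
  lamBar : ℤ → EuclideanSpace ℝ (Fin κ) → ℝ≥0

namespace Hammerstein

/-- Right-hand side `F_t(u) = ∫_Ω k_t(·, y) g_t(y, u(y)) dy`. -/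
def rhs (D : Hammerstein 𝕂 Ω p q d e) (t : ℤ) (u : LpSpace 𝕂 Ω p d) : LpSpace 𝕂 Ω p d :=
  fredholm (D.k t) (nemytskii (D.g t) u)

/-- `L = sup_{t ∈ 𝕀'} (∫_Ω (∫_Ω |k_t|^{q'})^{p/q'})^{1/p} (∫_Ω λ_t^{pq/(p-q)})^{(p-q)/(pq)}`. -/
def lipConst (D : Hammerstein 𝕂 Ω p q d e) (I : Set ℤ) : ℝ≥0∞ :=
  ⨆ t ∈ prime I, hilleTamarkin Ω (D.k t) * weightNorm Ω p q (D.lam t)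

/-- Hille–Tamarkin condition and `X(Ω)`-smoothing. -/
structure KernelHyp (D : Hammerstein 𝕂 Ω p q d e) (I : Set ℤ) : Prop where
  measurable : ∀ t ∈ prime I, AEStronglyMeasurable
    (fun z : EuclideanSpace ℝ (Fin κ) × EuclideanSpace ℝ (Fin κ) => D.k t z.1 z.2)
    ((leb Ω).prod (leb Ω))
  finite : ∀ t ∈ prime I, hilleTamarkin Ω (D.k t) < ⊤
  C_nonneg : ∀ t ∈ prime I, 0 ≤ D.C t
  smoothing : ∀ t ∈ prime I, ∀ v : LpSpace 𝕂 Ω q e,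
    ∃ h : fredholm (D.k t) v ∈ D.XΩ, D.normX ⟨fredholm (D.k t) v, h⟩ ≤ D.C t * ‖v‖

/-- Carathéodory conditions of order `m` with `c_2 = ⋯ = c_m = 0`, the trivial solution, and the
Lipschitz conditions. -/
structure GrowthHyp (D : Hammerstein 𝕂 Ω p q d e) (I : Set ℤ) (m : ℕ) : Prop where
  smooth : ∀ t ∈ prime I, ∀ᵐ x ∂(leb Ω), ContDiff 𝕂 m (D.g t x)
  measurable : ∀ t ∈ prime I, ∀ l : ℕ, l ≤ m → ∀ z : Vec 𝕂 p d,
    AEStronglyMeasurable (fun x => iteratedFDeriv 𝕂 l (D.g t x) z) (leb Ω)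
  bound : ∃ (c : EuclideanSpace ℝ (Fin κ) → ℝ) (cc : ℕ → ℝ),
    MemLp c (ENNReal.ofReal (p.toReal * q.toReal / (p.toReal - m * q.toReal))) (leb Ω) ∧
    (∀ l, 0 ≤ cc l) ∧ (∀ l, 2 ≤ l → cc l = 0) ∧
    ∀ t ∈ prime I, ∀ l : ℕ, l ≤ m → ∀ᵐ x ∂(leb Ω), ∀ z : Vec 𝕂 p d,
      ‖iteratedFDeriv 𝕂 l (D.g t x) z‖ ≤
        c x + cc l * ‖z‖ ^ ((p.toReal - l * q.toReal) / q.toReal)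
  zero : ∀ t ∈ prime I, ∀ᵐ x ∂(leb Ω), D.g t x 0 = 0
  lam_measurable : ∀ t ∈ prime I, AEMeasurable (D.lam t) (leb Ω)
  lamBar_measurable : ∀ t ∈ prime I, AEMeasurable (D.lamBar t) (leb Ω)
  deriv_bound : ∀ t ∈ prime I, ∀ᵐ x ∂(leb Ω), ∀ z : Vec 𝕂 p d,
    ‖fderiv 𝕂 (D.g t x) z - fderiv 𝕂 (D.g t x) 0‖ ≤ D.lam t x
  lipschitz : ∀ t ∈ prime I, ∀ᵐ x ∂(leb Ω), ∀ z z' : Vec 𝕂 p d,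
    ‖D.g t x z - D.g t x z'‖ ≤ D.lamBar t x * ‖z - z'‖
  smoothing_finite :
    (⨆ t ∈ prime I, ENNReal.ofReal (D.C t) * weightNorm Ω p q (D.lamBar t)) < ⊤
  lipConst_finite : D.lipConst I < ⊤
  lamBar_finite :
    (⨆ t ∈ prime I, hilleTamarkin Ω (D.k t) * weightNorm Ω p q (D.lamBar t)) < ⊤

/-- `L` is the linear equation `v_{t+1} = ∫_Ω k_t(·, y) D₂g_t(y, 0) v_t(y) dy`. -/
def IsVariational (D : Hammerstein 𝕂 Ω p q d e) (I : Set ℤ)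
    (L : ℤ → LpSpace 𝕂 Ω p d →L[𝕂] LpSpace 𝕂 Ω p d) : Prop :=
  ∀ t ∈ prime I, ∀ v : LpSpace 𝕂 Ω p d,
    L t v =ᵐ[leb Ω] fun x => ∫ y in Ω, D.k t x y (fderiv 𝕂 (D.g t y) 0 (v y))

/-- `sup_{t ∈ 𝕀'} (∫_Ω (∫_Ω |k_t|^{q'})^{p/q'})^{1/p} < ∞` and `sup_{t ∈ 𝕀'} C_t < ∞`. -/
def UniformKernel (D : Hammerstein 𝕂 Ω p q d e) (I : Set ℤ) : Prop :=
  (⨆ t ∈ prime I, hilleTamarkin Ω (D.k t)) < ⊤ ∧ ∃ B : ℝ, ∀ t ∈ prime I, D.C t ≤ B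

end Hammerstein

variable (𝕂 Ω p) in
/-- Bounded projections `π_n`, `n ≥ 1`, of `L^p(Ω)` onto finite-dimensional subspaces `X_n`. -/
structure ProjectionMethod where
  π : ℕ → Lp 𝕂 p (leb Ω) →L[𝕂] Lp 𝕂 p (leb Ω)
  idem : ∀ n, 1 ≤ n → (π n).comp (π n) = π n
  finite : ∀ n, 1 ≤ n → FiniteDimensional 𝕂 (LinearMap.range (π n).toLinearMap)

variable (𝕂 Ω p) in
/-- The `i`-th component `L^p_d(Ω) → L^p(Ω)`. -/
def component (i : Fin d) : LpSpace 𝕂 Ω p d →L[𝕂] Lp 𝕂 p (leb Ω) :=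
  (PiLp.proj p (fun _ : Fin d => 𝕂) i).compLpL p (leb Ω)

variable (𝕂 Ω p) in
/-- The embedding of `L^p(Ω)` as `i`-th component of `L^p_d(Ω)`. -/
def embed (i : Fin d) : Lp 𝕂 p (leb Ω) →L[𝕂] LpSpace 𝕂 Ω p d :=
  (((PiLp.continuousLinearEquiv p 𝕂 (fun _ : Fin d => 𝕂)).symm :
      (Fin d → 𝕂) →L[𝕂] Vec 𝕂 p d).comp
    (ContinuousLinearMap.single 𝕂 (fun _ : Fin d => 𝕂) i)).compLpL p (leb Ω)

namespace ProjectionMethod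

/-- `Π_n = diag(π_n, …, π_n)` on `L^p_d(Ω)`. -/
def Proj (M : ProjectionMethod 𝕂 Ω p) (d n : ℕ) : LpSpace 𝕂 Ω p d →L[𝕂] LpSpace 𝕂 Ω p d :=
  ∑ i : Fin d, (embed 𝕂 Ω p i).comp ((M.π n).comp (component 𝕂 Ω p i))

/-- `X_n^d = X_n × ⋯ × X_n` with `X_n = R(π_n)`. -/
def space (M : ProjectionMethod 𝕂 Ω p) (d n : ℕ) : Set (LpSpace 𝕂 Ω p d) :=
  {u | ∀ i : Fin d, component 𝕂 Ω p i u ∈ range (M.π n)}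

/-- `‖u - Π_n u‖_p ≤ Γ(1/n) ‖u‖_{X(Ω)}` with `Γ > 0` and `Γ(ϱ) → 0` as `ϱ ↘ 0`. -/
structure ErrorHyp (M : ProjectionMethod 𝕂 Ω p) (D : Hammerstein 𝕂 Ω p q d e) (Γ : ℝ → ℝ) :
    Prop where
  pos : ∀ ϱ, 0 < ϱ → 0 < Γ ϱ
  tendsto : Tendsto Γ (𝓝[>] 0) (𝓝 0)
  error : ∀ n : ℕ, 1 ≤ n → ∀ u : D.XΩ,
    ‖(u : LpSpace 𝕂 Ω p d) - M.Proj d n u‖ ≤ Γ (1 / n) * D.normX u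

end ProjectionMethod

/-- Right-hand sides of the discretizations: `F_t^0 = F_t` and `F_t^n = Π_n F_t` for `n ≥ 1`. -/
def rhsN (D : Hammerstein 𝕂 Ω p q d e) (M : ProjectionMethod 𝕂 Ω p) (n : ℕ) (t : ℤ)
    (u : LpSpace 𝕂 Ω p d) : LpSpace 𝕂 Ω p d :=
  if n = 0 then D.rhs t u else M.Proj d n (D.rhs t u)

end Hammerstein

end IDE

end

/-! The growth condition defining each bundle is recast as a Lyapunov–Perron equation. Inside the
spectral gap the variational equation splits along projections P_t, with forward rate α on R(P_t)
and backward rate β on N(P_t) (`exists_isSplitting_of_gap`), so its Green's function G(t, s+1) is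
bounded by K α^(t-s-1) for s < t and by K β^(t-s-1) for s ≥ t. With F_t = ℒ_t + R_t, a forward
solution grows at most like γ^(t-τ) exactly if φ_t = Φ(t,τ)v + Σ_s G(t,s+1) R_s(φ_s) for some v in
the pseudo-stable fiber; backward solutions are treated alike over the pseudo-unstable fiber
(`mem_stableSet_iff`, `mem_unstableSet_iff`). In the weight γ^(t-τ) with α+δ ≤ γ ≤ β-δ two geometric
series bound the summation operator by 2K/δ, so the equation is a contraction as soon as 2K lip(R) <
δ. The graph is w(τ,v) = φ_τ(v) - v. At t = τ only one of the two series contributes, which produces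
the constant K²L/(δ-2KL). Uniqueness in every admissible weight makes the bundle independent of γ
and yields the trivial intersection on ℤ.

The discretization enters through F_t = T ∘ N with a Fredholm operator T : L^q → L^p and a Nemytskii
operator N : L^p → L^q (`exists_factorization`). As T maps into X(Ω), the operator (id - Π_n) T has
norm at most Γ(1/n) C_t, although id - Π_n itself need not be small. So Π_n F_t differs from F_t by
a map with Lipschitz constant O(Γ(1/n)), all estimates are uniform for large n, and fixed points are
Γ(1/n)-close. The same smallness makes Π_n ℒ_t injective on N(P_t) for some n, which bounds the
dimension of the pseudo-unstable fibers.

Higher derivatives of φ_t with respect to v grow faster: the derivative of order l lives in the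
weight ω ρ^(l-1), and the gap conditions on δ say that these weights are still admissible
(`pow_mem_of_gap`, `pow_mem_of_gap'`). Differentiability comes from linear equations with a
parameter (`cBound_of_linear`), bootstrapped to the nonlinear equation (`cBound_fderiv`) and applied
to differences of solutions (`cBound_sub`). The last step costs one derivative, hence ℓ < m. Kernel
and weight are kept abstract, so that both time directions and all orders of differentiation are
instances of the same estimates. -/

noncomputable section

set_option maxSynthPendingDepth 3

namespace IDE

/-! ### Weighted summation operators -/

section Weights

variable {ι : Type*}

/-- `ω` is a positive weight with `∑ₛ g k s * ω s ≤ M * ω k` for a nonnegative kernel `g`. -/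
structure Admissible (g : ι → ι → ℝ) (M : ℝ) (ω : ι → ℝ) : Prop where
  pos : ∀ k, 0 < ω k
  kernel_nonneg : ∀ k s, 0 ≤ g k s
  summable : ∀ k, Summable fun s => g k s * ω s
  tsum_le : ∀ k, ∑' s, g k s * ω s ≤ M * ω k

namespace Admissible

variable {g : ι → ι → ℝ} {M : ℝ} {ω : ι → ℝ}

lemma const_nonneg (h : Admissible g M ω) (k : ι) : 0 ≤ M := by
  have h1 : 0 ≤ ∑' s, g k s * ω s :=
    tsum_nonneg fun s => mul_nonneg (h.kernel_nonneg k s) (h.pos s).le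
  exact nonneg_of_mul_nonneg_left (h1.trans (h.tsum_le k)) (h.pos k)

lemma summable_mul (h : Admissible g M ω) {a : ι → ℝ} {D : ℝ} (h0 : ∀ s, 0 ≤ a s)
    (hD : ∀ s, a s ≤ D * ω s) (k : ι) : Summable fun s => g k s * a s := by
  refine Summable.of_nonneg_of_le (fun s => mul_nonneg (h.kernel_nonneg k s) (h0 s))
    (fun s => ?_) ((h.summable k).mul_left D)
  calc g k s * a s ≤ g k s * (D * ω s) := mul_le_mul_of_nonneg_left (hD s) (h.kernel_nonneg k s)
    _ = D * (g k s * ω s) := by ring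

lemma tsum_mul_le (h : Admissible g M ω) {a : ι → ℝ} {D : ℝ} (h0 : ∀ s, 0 ≤ a s)
    (hD : ∀ s, a s ≤ D * ω s) (k : ι) : ∑' s, g k s * a s ≤ M * D * ω k := by
  have hD0 : 0 ≤ D := nonneg_of_mul_nonneg_left ((h0 k).trans (hD k)) (h.pos k)
  calc ∑' s, g k s * a s ≤ ∑' s, D * (g k s * ω s) := by
        refine (h.summable_mul h0 hD k).tsum_le_tsum (fun s => ?_) ((h.summable k).mul_left D)
        calc g k s * a s ≤ g k s * (D * ω s) :=
              mul_le_mul_of_nonneg_left (hD s) (h.kernel_nonneg k s)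
          _ = D * (g k s * ω s) := by ring
    _ = D * ∑' s, g k s * ω s := tsum_mul_left
    _ ≤ D * (M * ω k) := mul_le_mul_of_nonneg_left (h.tsum_le k) hD0
    _ = M * D * ω k := by ring

/-- Gronwall-type estimate for weighted summation inequalities. -/
lemma le_of_le_tsum (h : Admissible g M ω) {L : ℝ} (hL : 0 ≤ L) (hq : M * L < 1)
    {e : ι → ℝ} {C c : ℝ} (he : ∀ k, 0 ≤ e k) (hC : ∀ k, e k ≤ C * ω k) (hc : 0 ≤ c)
    (hle : ∀ k, e k ≤ c * ω k + ∑' s, g k s * (L * e s)) (k : ι) :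
    e k ≤ c / (1 - M * L) * ω k := by
  have hM : 0 ≤ M := h.const_nonneg k
  have hq0 : 0 ≤ M * L := mul_nonneg hM hL
  have hq1 : 0 < 1 - M * L := by linarith
  -- Inserting the inequality into itself improves the a priori bound by the factor M * L each time,
  -- so the size of `C` drops out in the limit.
  have key : ∀ n : ℕ, ∀ k, e k ≤ (c / (1 - M * L) + (M * L) ^ n * |C|) * ω k := by
    intro n
    induction n with
    | zero =>
      intro k
      refine (hC k).trans (mul_le_mul_of_nonneg_right ?_ (h.pos k).le)
      have := div_nonneg hc hq1.le
      have := le_abs_self C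
      simp only [pow_zero, one_mul]; linarith
    | succ n ih =>
      intro k
      have h1 := h.tsum_mul_le (a := fun s => L * e s)
        (D := L * (c / (1 - M * L) + (M * L) ^ n * |C|))
        (fun s => mul_nonneg hL (he s))
        (fun s => by rw [mul_assoc]; exact mul_le_mul_of_nonneg_left (ih s) hL) k
      refine (hle k).trans ((add_le_add le_rfl h1).trans (le_of_eq ?_))
      rw [pow_succ]
      field_simp
      ring
  have ht : Tendsto (fun n : ℕ => (c / (1 - M * L) + (M * L) ^ n * |C|) * ω k) atTop
      (𝓝 ((c / (1 - M * L) + 0 * |C|) * ω k)) :=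
    (((tendsto_pow_atTop_nhds_zero_of_lt_one hq0 hq).mul_const _).const_add _).mul_const _
  simp only [zero_mul, add_zero] at ht
  exact ge_of_tendsto' ht fun n => key n k

/-- Dominated convergence: the weight supplies a summable majorant, so pointwise convergence in `s`
is enough. -/
lemma tendsto_tsum_zero (h : Admissible g M ω) {α : Type*} {l : Filter α} {r : α → ι → ℝ} {C : ℝ}
    (hr : ∀ᶠ a in l, ∀ s, 0 ≤ r a s ∧ r a s ≤ C * ω s)
    (hr0 : ∀ s, Tendsto (fun a => r a s) l (𝓝 0)) (k : ι) :
    Tendsto (fun a => ∑' s, g k s * r a s) l (𝓝 0) := by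
  have := tendsto_tsum_of_dominated_convergence (𝓕 := l) (f := fun a s => g k s * r a s)
    (g := fun _ => (0 : ℝ)) (bound := fun s => g k s * (C * ω s))
    (((h.summable k).mul_left C).congr fun s => by ring)
    (fun s => by simpa using (hr0 s).const_mul (g k s)) (by
      filter_upwards [hr] with a ha s
      rw [Real.norm_of_nonneg (mul_nonneg (h.kernel_nonneg k s) (ha s).1)]
      exact mul_le_mul_of_nonneg_left (ha s).2 (h.kernel_nonneg k s))
  simpa using this

/-- A family which is dominated by the weight and satisfies a weighted summation inequality with
vanishing perturbations vanishes pointwise in the limit. -/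
lemma tendsto_zero_of_le_tsum (h : Admissible g M ω) {L : ℝ} (hL : 0 ≤ L) (hq : M * L < 1)
    {α : Type*} {l : Filter α} {e r r₀ : α → ι → ℝ} {C : ℝ}
    (he : ∀ᶠ a in l, ∀ k, 0 ≤ e a k ∧ e a k ≤ C * ω k)
    (hr : ∀ᶠ a in l, ∀ s, 0 ≤ r a s ∧ r a s ≤ C * ω s)
    (hle : ∀ᶠ a in l, ∀ k, e a k ≤ r₀ a k + ∑' s, g k s * (L * e a s + r a s))
    (hr0 : ∀ s, Tendsto (fun a => r a s) l (𝓝 0))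
    (hr₀ : ∀ s, Tendsto (fun a => r₀ a s) l (𝓝 0)) (k : ι) :
    Tendsto (fun a => e a k) l (𝓝 0) := by
  have hM : 0 ≤ M := h.const_nonneg k
  have hq0 : 0 ≤ M * L := mul_nonneg hM hL
  -- This expresses limsup e ≤ (ML)^n |C| ω as convergence to 0 of the excess over that bound. A
  -- pass through the inequality gains a factor M * L, and dominated convergence handles the excess
  -- under the sum.
  have key : ∀ n : ℕ, ∀ k, Tendsto (fun a => max (e a k - (M * L) ^ n * |C| * ω k) 0) l (𝓝 0) := by
    intro n
    induction n with
    | zero =>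
      intro k
      refine tendsto_const_nhds.congr' ?_
      filter_upwards [he] with a ha
      symm
      apply max_eq_right
      have := (ha k).2
      have h2 := mul_le_mul_of_nonneg_right (le_abs_self C) (h.pos k).le
      simp only [pow_zero, one_mul]; linarith
    | succ n ih =>
      intro k
      set e' : α → ι → ℝ := fun a s => max (e a s - (M * L) ^ n * |C| * ω s) 0 with he'
      have hb : ∀ᶠ a in l, ∀ s, 0 ≤ L * e' a s + r a s ∧
          L * e' a s + r a s ≤ (L * |C| + C) * ω s := by
        filter_upwards [he, hr] with a ha hra s
        have h1 : 0 ≤ e' a s := le_max_right _ _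
        have h2 : e' a s ≤ |C| * ω s := by
          refine max_le ?_ (mul_nonneg (abs_nonneg _) (h.pos s).le)
          have h3 := (ha s).2
          have h4 := mul_le_mul_of_nonneg_right (le_abs_self C) (h.pos s).le
          have h5 : 0 ≤ (M * L) ^ n * |C| * ω s :=
            mul_nonneg (mul_nonneg (pow_nonneg hq0 n) (abs_nonneg C)) (h.pos s).le
          linarith
        refine ⟨add_nonneg (mul_nonneg hL h1) (hra s).1, ?_⟩
        have := mul_le_mul_of_nonneg_left h2 hL
        have := (hra s).2
        linarith
      have ht := (h.tendsto_tsum_zero hb (fun s => by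
        simpa using ((ih s).const_mul L).add (hr0 s)) k).add (hr₀ k)
      rw [add_zero] at ht
      have ht' := ht.max (tendsto_const_nhds (x := (0 : ℝ)))
      rw [max_self] at ht'
      refine squeeze_zero' (Eventually.of_forall fun a => le_max_right _ _) ?_ ht'
      filter_upwards [he, hr, hle, hb] with a ha hra hla hba
      refine max_le_max ?_ le_rfl
      have h1 := hla k
      have h2 : ∑' s, g k s * (L * e a s + r a s) ≤
          ∑' s, g k s * (L * ((M * L) ^ n * |C| * ω s)) + ∑' s, g k s * (L * e' a s + r a s) := by
        have hs1 : Summable fun s => g k s * (L * ((M * L) ^ n * |C| * ω s)) :=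
          ((h.summable k).mul_left (L * ((M * L) ^ n * |C|))).congr fun s => by ring
        have hs2 := h.summable_mul (fun s => (hba s).1) (fun s => (hba s).2) k
        rw [← hs1.tsum_add hs2]
        refine Summable.tsum_le_tsum (fun s => ?_) ?_ (hs1.add hs2)
        · rw [← mul_add]
          refine mul_le_mul_of_nonneg_left ?_ (h.kernel_nonneg k s)
          have h3 : e a s ≤ (M * L) ^ n * |C| * ω s + e' a s := by
            have := le_max_left (e a s - (M * L) ^ n * |C| * ω s) 0
            simp only [he']; linarith
          have := mul_le_mul_of_nonneg_left h3 hL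
          linarith
        · refine h.summable_mul (D := L * C + C)
            (fun s => add_nonneg (mul_nonneg hL (ha s).1) (hra s).1) (fun s => ?_) k
          have := mul_le_mul_of_nonneg_left (ha s).2 hL
          have := (hra s).2
          linarith
      have h3 : ∑' s, g k s * (L * ((M * L) ^ n * |C| * ω s)) ≤ (M * L) ^ (n + 1) * |C| * ω k := by
        have := h.tsum_mul_le (a := fun s => L * ((M * L) ^ n * |C| * ω s))
          (D := L * ((M * L) ^ n * |C|))
          (fun s => mul_nonneg hL (mul_nonneg (mul_nonneg (pow_nonneg hq0 n) (abs_nonneg C))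
            (h.pos s).le)) (fun s => by rw [mul_assoc L]) k
        refine this.trans (le_of_eq ?_)
        rw [pow_succ]; ring
      linarith
  rw [Metric.tendsto_nhds]
  intro ε hε
  have ht : Tendsto (fun n : ℕ => (M * L) ^ n * |C| * ω k) atTop (𝓝 (0 * |C| * ω k)) :=
    ((tendsto_pow_atTop_nhds_zero_of_lt_one hq0 hq).mul_const _).mul_const _
  simp only [zero_mul] at ht
  obtain ⟨n, hn⟩ := (ht.eventually (gt_mem_nhds (half_pos hε))).exists
  filter_upwards [he, (key n k).eventually (gt_mem_nhds (half_pos hε))] with a ha hka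
  rw [Real.dist_eq, sub_zero, abs_of_nonneg (ha k).1]
  have := (le_max_left _ _).trans_lt hka
  linarith

/-! ### Fixed point equations with an operator-valued kernel -/

section Fixed

variable {𝕂 : Type*} [RCLike 𝕂] {Y : Type*} [NormedAddCommGroup Y] [NormedSpace 𝕂 Y]
  {G : ι → ι → Y →L[𝕂] Y}

lemma norm_apply_le_kernel (hG : ∀ k s, ‖G k s‖ ≤ g k s) (k s : ι) (y : Y) :
    ‖G k s y‖ ≤ g k s * ‖y‖ :=
  ((G k s).le_opNorm y).trans (mul_le_mul_of_nonneg_right (hG k s) (norm_nonneg y))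

lemma summable_apply [CompleteSpace Y] (h : Admissible g M ω) (hG : ∀ k s, ‖G k s‖ ≤ g k s)
    {a : ι → Y} {D : ℝ} (hD : ∀ s, ‖a s‖ ≤ D * ω s) (k : ι) : Summable fun s => G k s (a s) :=
  Summable.of_norm_bounded (h.summable_mul (fun s => norm_nonneg (a s)) hD k)
    fun s => norm_apply_le_kernel hG k s (a s)

lemma norm_tsum_apply_le (h : Admissible g M ω) (hG : ∀ k s, ‖G k s‖ ≤ g k s)
    {a : ι → Y} {b : ι → ℝ} {D : ℝ} (hb : ∀ s, ‖a s‖ ≤ b s) (hD : ∀ s, b s ≤ D * ω s) (k : ι) :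
    ‖∑' s, G k s (a s)‖ ≤ ∑' s, g k s * b s := by
  refine tsum_of_norm_bounded
    (h.summable_mul (fun s => (norm_nonneg (a s)).trans (hb s)) hD k).hasSum fun s => ?_
  exact (norm_apply_le_kernel hG k s (a s)).trans
    (mul_le_mul_of_nonneg_left (hb s) (h.kernel_nonneg k s))

lemma norm_tsum_apply_le' (h : Admissible g M ω) (hG : ∀ k s, ‖G k s‖ ≤ g k s)
    {a : ι → Y} {D : ℝ} (hD : ∀ s, ‖a s‖ ≤ D * ω s) (k : ι) :
    ‖∑' s, G k s (a s)‖ ≤ M * D * ω k :=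
  (h.norm_tsum_apply_le hG (fun _ => le_rfl) hD k).trans
    (h.tsum_mul_le (fun s => norm_nonneg (a s)) hD k)

/-- Existence of a weighted bounded solution of `φ = η + G T(φ)`. -/
lemma exists_fixed [CompleteSpace Y] (h : Admissible g M ω) (hG : ∀ k s, ‖G k s‖ ≤ g k s)
    {L : ℝ} (hL : 0 ≤ L) (hq : M * L < 1) {T : ι → Y → Y} (hT0 : ∀ s, T s 0 = 0)
    (hT : ∀ s y y', ‖T s y - T s y'‖ ≤ L * ‖y - y'‖) {η : ι → Y} {C : ℝ}
    (hη : ∀ k, ‖η k‖ ≤ C * ω k) :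
    ∃ φ : ι → Y, (∃ D, ∀ k, ‖φ k‖ ≤ D * ω k) ∧ ∀ k, φ k = η k + ∑' s, G k s (T s (φ s)) := by
  rcases isEmpty_or_nonempty ι with hι | ⟨⟨k₀⟩⟩
  · exact ⟨fun _ => 0, ⟨0, fun k => hι.elim k⟩, fun k => hι.elim k⟩
  have hM : 0 ≤ M := h.const_nonneg k₀
  have hq0 : 0 ≤ M * L := mul_nonneg hM hL
  have hC : 0 ≤ C := nonneg_of_mul_nonneg_left ((norm_nonneg _).trans (hη k₀)) (h.pos k₀)
  have hTn : ∀ s y, ‖T s y‖ ≤ L * ‖y‖ := fun s y => by simpa [hT0 s] using hT s y 0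
  -- Picard iteration from 0. Consecutive iterates differ by at most C (ML)^n ω, so they are Cauchy
  -- at each index and no weighted sequence space is needed.
  let φ : ℕ → ι → Y := fun n =>
    Nat.rec (fun _ => 0) (fun _ ψ k => η k + ∑' s, G k s (T s (ψ s))) n
  have hφ0 : φ 0 = fun _ => 0 := rfl
  have hφs : ∀ n k, φ (n + 1) k = η k + ∑' s, G k s (T s (φ n s)) := fun _ _ => rfl
  have hbd : ∀ n, ∃ D, ∀ k, ‖φ n k‖ ≤ D * ω k := by
    intro n
    induction n with
    | zero => exact ⟨0, fun k => by simp [hφ0]⟩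
    | succ n ih =>
      obtain ⟨D, hD⟩ := ih
      refine ⟨C + M * (L * D), fun k => ?_⟩
      rw [hφs, add_mul]
      refine (norm_add_le _ _).trans (add_le_add (hη k) ?_)
      refine h.norm_tsum_apply_le' hG (fun s => (hTn s _).trans ?_) k
      rw [mul_assoc]
      exact mul_le_mul_of_nonneg_left (hD s) hL
  have hdiff : ∀ n k, ‖φ (n + 1) k - φ n k‖ ≤ C * (M * L) ^ n * ω k := by
    intro n
    induction n with
    | zero => intro k; simpa [hφs, hφ0, hT0] using hη k
    | succ n ih =>
      intro k
      obtain ⟨D, hD⟩ := hbd n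
      obtain ⟨D', hD'⟩ := hbd (n + 1)
      have hs : ∀ n, ∀ D, (∀ k, ‖φ n k‖ ≤ D * ω k) → Summable fun s => G k s (T s (φ n s)) :=
        fun n D hD => h.summable_apply (D := L * D) hG (fun s => (hTn s _).trans (by
          rw [mul_assoc]; exact mul_le_mul_of_nonneg_left (hD s) hL)) k
      rw [hφs (n + 1), hφs n, add_sub_add_left_eq_sub, ← (hs (n + 1) D' hD').tsum_sub (hs n D hD)]
      simp_rw [← map_sub]
      refine (h.norm_tsum_apply_le' hG (D := L * (C * (M * L) ^ n))
        (fun s => (hT s _ _).trans ?_) k).trans (le_of_eq ?_)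
      · rw [mul_assoc L]
        exact mul_le_mul_of_nonneg_left (ih s) hL
      · rw [pow_succ]; ring
  have hcau : ∀ k, CauchySeq fun n => φ n k := fun k =>
    cauchySeq_of_le_geometric (M * L) (C * ω k) hq fun n => by
      rw [dist_comm, dist_eq_norm]
      exact (hdiff n k).trans (le_of_eq (by ring))
  choose ψ hψ using fun k => cauchySeq_tendsto_of_complete (hcau k)
  -- A bound independent of `n` serves as the majorant when the limit is taken under the sum.
  have hunif : ∀ n k, ‖φ n k‖ ≤ C / (1 - M * L) * ω k := by
    intro n k
    have h2 : ∀ n, ∀ k, ‖φ n k‖ ≤ (∑ i ∈ Finset.range n, C * (M * L) ^ i) * ω k := by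
      intro n k
      induction n with
      | zero => simp [hφ0]
      | succ n ih =>
        rw [Finset.sum_range_succ, add_mul]
        calc ‖φ (n + 1) k‖ = ‖φ n k + (φ (n + 1) k - φ n k)‖ := by congr 1; abel
          _ ≤ _ := (norm_add_le _ _).trans (add_le_add ih (hdiff n k))
    refine (h2 n k).trans (mul_le_mul_of_nonneg_right ?_ (h.pos k).le)
    rw [← Finset.mul_sum, div_eq_mul_inv, ← tsum_geometric_of_lt_one hq0 hq]
    exact mul_le_mul_of_nonneg_left ((summable_geometric_of_lt_one hq0 hq).sum_le_tsum _
      fun i _ => pow_nonneg hq0 i) hC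
  refine ⟨ψ, ⟨C / (1 - M * L), fun k => le_of_tendsto' (hψ k).norm fun n => hunif n k⟩,
    fun k => ?_⟩
  refine tendsto_nhds_unique ((hψ k).comp (tendsto_add_atTop_nat 1)) ?_
  simp only [Function.comp_def, hφs]
  refine tendsto_const_nhds.add ?_
  refine tendsto_tsum_of_dominated_convergence
    (bound := fun s => g k s * (L * (C / (1 - M * L)) * ω s))
    (((h.summable k).mul_left (L * (C / (1 - M * L)))).congr fun s => by ring) (fun s => ?_)
    (Eventually.of_forall fun n s => ?_)
  · refine ((G k s).continuous.tendsto _).comp ?_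
    rw [tendsto_iff_norm_sub_tendsto_zero]
    refine squeeze_zero (fun _ => norm_nonneg _) (fun n => hT s _ _) ?_
    simpa using (tendsto_iff_norm_sub_tendsto_zero.1 (hψ s)).const_mul L
  · refine (norm_apply_le_kernel hG k s _).trans
      (mul_le_mul_of_nonneg_left ((hTn s _).trans ?_) (h.kernel_nonneg k s))
    rw [mul_assoc]
    exact mul_le_mul_of_nonneg_left (hunif n s) hL

/-- Two solutions of `φ = η + G T(φ)` differ by at most what the inhomogeneities and nonlinearities
differ by. -/
lemma norm_sub_le_of_fixed [CompleteSpace Y] (h : Admissible g M ω) (hG : ∀ k s, ‖G k s‖ ≤ g k s)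
    {L : ℝ} (hL : 0 ≤ L) (hq : M * L < 1) {a a' φ φ' η η' : ι → Y} {B C D c : ℝ}
    (hB : ∀ s, ‖a s‖ ≤ B * ω s) (hB' : ∀ s, ‖a' s‖ ≤ B * ω s)
    (ha : ∀ s, ‖a s - a' s‖ ≤ L * ‖φ s - φ' s‖ + c * ω s)
    (hη : ∀ k, ‖η k - η' k‖ ≤ C * ω k) (hC : 0 ≤ C) (hc : 0 ≤ c)
    (hD : ∀ k, ‖φ k - φ' k‖ ≤ D * ω k)
    (hφ : ∀ k, φ k = η k + ∑' s, G k s (a s)) (hφ' : ∀ k, φ' k = η' k + ∑' s, G k s (a' s))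
    (k : ι) : ‖φ k - φ' k‖ ≤ (C + M * c) / (1 - M * L) * ω k := by
  have hM : 0 ≤ M := h.const_nonneg k
  refine h.le_of_le_tsum hL hq (e := fun k => ‖φ k - φ' k‖) (fun k => norm_nonneg _) hD
    (by positivity) (fun k => ?_) k
  have h1 : φ k - φ' k = (η k - η' k) + ∑' s, G k s (a s - a' s) := by
    simp_rw [map_sub]
    rw [(h.summable_apply hG hB k).tsum_sub (h.summable_apply hG hB' k), hφ k, hφ' k]
    abel
  have hs1 := h.summable_mul (a := fun s => L * ‖φ s - φ' s‖) (D := L * D)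
    (fun s => mul_nonneg hL (norm_nonneg _))
    (fun s => by rw [mul_assoc]; exact mul_le_mul_of_nonneg_left (hD s) hL) k
  have hs2 := h.summable_mul (a := fun s => c * ω s) (D := c)
    (fun s => mul_nonneg hc (h.pos s).le) (fun s => le_rfl) k
  have h2 : ‖∑' s, G k s (a s - a' s)‖ ≤
      ∑' s, g k s * (L * ‖φ s - φ' s‖) + ∑' s, g k s * (c * ω s) := by
    rw [← hs1.tsum_add hs2]
    simp_rw [← mul_add]
    refine h.norm_tsum_apply_le hG ha (D := L * D + c) (fun s => ?_) k
    rw [add_mul, mul_assoc]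
    exact add_le_add (mul_le_mul_of_nonneg_left (hD s) hL) le_rfl
  have h3 := h.tsum_mul_le (a := fun s => c * ω s) (D := c)
    (fun s => mul_nonneg hc (h.pos s).le) (fun s => le_rfl) k
  have h4 := hη k
  simp only [h1]
  refine (norm_add_le _ _).trans ?_
  rw [add_mul]
  linarith

end Fixed

end Admissible

end Weights

/-! ### Functions with weighted bounds on their derivatives -/

section CBound

variable {𝕂 : Type*} [RCLike 𝕂] {V Y Z W : Type*} [NormedAddCommGroup V] [NormedSpace 𝕂 V]
  [NormedAddCommGroup Y] [NormedSpace 𝕂 Y] [NormedAddCommGroup Z] [NormedSpace 𝕂 Z]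
  [NormedAddCommGroup W] [NormedSpace 𝕂 W]

variable (𝕂) in
/-- `f` is of class `C^n` with `‖D^l f(v)‖ ≤ b(v) ρ^l` for `l ≤ n`. -/
def CBound (n : ℕ) (b : V → ℝ) (ρ : ℝ) (f : V → Y) : Prop :=
  ContDiff 𝕂 n f ∧ ∀ l ≤ n, ∀ v, ‖iteratedFDeriv 𝕂 l f v‖ ≤ b v * ρ ^ l

namespace CBound

variable {n : ℕ} {b b' : V → ℝ} {ρ : ℝ} {f f' : V → Y}

lemma norm_le (h : CBound 𝕂 n b ρ f) (v : V) : ‖f v‖ ≤ b v := by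
  simpa [norm_iteratedFDeriv_zero] using h.2 0 (Nat.zero_le n) v

lemma nonneg (h : CBound 𝕂 n b ρ f) (v : V) : 0 ≤ b v := (norm_nonneg _).trans (h.norm_le v)

lemma of_le {m : ℕ} (h : CBound 𝕂 n b ρ f) (hm : m ≤ n) : CBound 𝕂 m b ρ f :=
  ⟨h.1.of_le (by exact_mod_cast hm), fun l hl v => h.2 l (hl.trans hm) v⟩

lemma mono (h : CBound 𝕂 n b ρ f) (hρ : 0 ≤ ρ) (hb : ∀ v, b v ≤ b' v) : CBound 𝕂 n b' ρ f :=
  ⟨h.1, fun l hl v => (h.2 l hl v).trans (mul_le_mul_of_nonneg_right (hb v) (pow_nonneg hρ l))⟩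

/-- Each differentiation moves one factor ρ into the bound; this is how the weights ω ρ^l arise. -/
lemma fderiv (h : CBound 𝕂 (n + 1) b ρ f) : CBound 𝕂 n (fun v => b v * ρ) ρ (fderiv 𝕂 f) := by
  refine ⟨h.1.fderiv_right (by norm_cast), fun l hl v => ?_⟩
  rw [norm_iteratedFDeriv_fderiv]
  refine (h.2 (l + 1) (by omega) v).trans (le_of_eq (by ring))

lemma differentiable (h : CBound 𝕂 (n + 1) b ρ f) : Differentiable 𝕂 f :=
  h.1.differentiable (by exact_mod_cast Nat.succ_ne_zero n)

lemma of_fderiv (hf : Differentiable 𝕂 f) (hb : ∀ v, ‖f v‖ ≤ b v)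
    (h : CBound 𝕂 n (fun v => b v * ρ) ρ (_root_.fderiv 𝕂 f)) : CBound 𝕂 (n + 1) b ρ f := by
  refine ⟨?_, fun l hl v => ?_⟩
  · push_cast
    exact contDiff_succ_iff_fderiv.2 ⟨hf, by simp, h.1⟩
  · cases l with
    | zero => simpa [norm_iteratedFDeriv_zero] using hb v
    | succ l =>
      rw [← norm_iteratedFDeriv_fderiv]
      exact (h.2 l (by omega) v).trans (le_of_eq (by ring))

lemma norm_sub_le {E : ℝ} (h : CBound 𝕂 (n + 1) b ρ f) (hE : ∀ v, b v * ρ ≤ E) (v v' : V) :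
    ‖f v - f v'‖ ≤ E * ‖v - v'‖ := by
  have hE0 : 0 ≤ E := ((h.fderiv.nonneg v).trans (hE v))
  have := lipschitzWith_of_nnnorm_fderiv_le (𝕜 := 𝕂) (C := ⟨E, hE0⟩) h.differentiable
    (fun x => (h.fderiv.norm_le x).trans (hE x))
  have h2 := this.dist_le_mul v v'
  rw [dist_eq_norm, dist_eq_norm] at h2
  exact h2

lemma add (h : CBound 𝕂 n b ρ f) (h' : CBound 𝕂 n b' ρ f') :
    CBound 𝕂 n (fun v => b v + b' v) ρ (fun v => f v + f' v) := by
  refine ⟨h.1.add h'.1, fun l hl v => ?_⟩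
  have hl' : ((l : ℕ) : WithTop ℕ∞) ≤ n := by exact_mod_cast hl
  have := iteratedFDeriv_add_apply (x := v) (h.1.of_le hl').contDiffAt (h'.1.of_le hl').contDiffAt
  have h2 : iteratedFDeriv 𝕂 l (fun v => f v + f' v) v = _ := this
  rw [h2, add_mul]
  exact (norm_add_le _ _).trans (add_le_add (h.2 l hl v) (h'.2 l hl v))

lemma sub (h : CBound 𝕂 n b ρ f) (h' : CBound 𝕂 n b' ρ f') :
    CBound 𝕂 n (fun v => b v + b' v) ρ (fun v => f v - f' v) := by
  refine ⟨h.1.sub h'.1, fun l hl v => ?_⟩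
  have hl' : ((l : ℕ) : WithTop ℕ∞) ≤ n := by exact_mod_cast hl
  have := iteratedFDeriv_sub_apply (x := v) (h.1.of_le hl').contDiffAt (h'.1.of_le hl').contDiffAt
  have h2 : iteratedFDeriv 𝕂 l (fun v => f v - f' v) v = _ := this
  rw [h2, add_mul]
  exact (_root_.norm_sub_le _ _).trans (add_le_add (h.2 l hl v) (h'.2 l hl v))

lemma clm_comp (h : CBound 𝕂 n b ρ f) (T : Y →L[𝕂] Z) {c : ℝ} (hT : ‖T‖ ≤ c) :
    CBound 𝕂 n (fun v => c * b v) ρ (fun v => T (f v)) := by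
  refine ⟨T.contDiff.comp h.1, fun l hl v => ?_⟩
  have hc : 0 ≤ c := (norm_nonneg T).trans hT
  refine (T.norm_iteratedFDeriv_comp_left h.1.contDiffAt (by exact_mod_cast hl)).trans ?_
  rw [mul_assoc]
  exact mul_le_mul hT (h.2 l hl v) (norm_nonneg _) hc

/-- Leibniz rule: both factors carry the same base ρ, so every term contains ρ^l and the binomial
coefficients add up to 2^l. -/
lemma bilin {g : V → Z} (h : CBound 𝕂 n b ρ f) (h' : CBound 𝕂 n b' ρ g)
    (B : Y →L[𝕂] Z →L[𝕂] W) (hB : ‖B‖ ≤ 1) (hρ : 0 ≤ ρ) :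
    CBound 𝕂 n (fun v => 2 ^ n * (b v * b' v)) ρ (fun v => B (f v) (g v)) := by
  refine ⟨B.isBoundedBilinearMap.contDiff.comp (h.1.prodMk h'.1), fun l hl v => ?_⟩
  have hl' : ((l : ℕ) : WithTop ℕ∞) ≤ n := by exact_mod_cast hl
  refine (B.norm_iteratedFDeriv_le_of_bilinear_of_le_one h.1 h'.1 v hl' hB).trans ?_
  calc ∑ i ∈ Finset.range (l + 1), (l.choose i : ℝ) * ‖iteratedFDeriv 𝕂 i f v‖ *
        ‖iteratedFDeriv 𝕂 (l - i) g v‖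
      ≤ ∑ i ∈ Finset.range (l + 1), (l.choose i : ℝ) * (b v * b' v * ρ ^ l) := by
        refine Finset.sum_le_sum fun i hi => ?_
        have hi' : i ≤ l := Nat.lt_succ_iff.1 (Finset.mem_range.1 hi)
        rw [mul_assoc]
        refine mul_le_mul_of_nonneg_left ?_ (Nat.cast_nonneg _)
        refine (mul_le_mul (h.2 i (hi'.trans hl) v) (h'.2 (l - i) ((Nat.sub_le _ _).trans hl) v)
          (norm_nonneg _) (mul_nonneg (h.nonneg v) (pow_nonneg hρ i))).trans (le_of_eq ?_)
        rw [show ρ ^ l = ρ ^ i * ρ ^ (l - i) by rw [← pow_add]; congr 1; omega]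
        ring
    _ = 2 ^ l * (b v * b' v * ρ ^ l) := by
        rw [← Finset.sum_mul]
        congr 1
        exact_mod_cast Nat.sum_range_choose l
    _ ≤ 2 ^ n * (b v * b' v) * ρ ^ l := by
        rw [mul_assoc (2 ^ n : ℝ)]
        refine mul_le_mul_of_nonneg_right (pow_le_pow_right₀ (by norm_num) hl) ?_
        exact mul_nonneg (mul_nonneg (h.nonneg v) (h'.nonneg v)) (pow_nonneg hρ l)

/-- Termwise differentiation. Admissibility of ζ ρ^l with one constant `M` for every order makes the
sum cost only a factor `M`. The uniform bound `E` serves summability alone; the estimate obtained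
keeps the dependence η(v). -/
lemma tsum [CompleteSpace Y] {ι : Type*} {g : ι → ι → ℝ} {M c : ℝ} {ζ ρ : ι → ℝ}
    {G : ι → ι → Y →L[𝕂] Y} {η : V → ℝ} {E : ℝ} {f : ι → V → Y}
    (hadm : ∀ l ≤ n, Admissible g M fun k => ζ k * ρ k ^ l) (hG : ∀ k s, ‖G k s‖ ≤ g k s)
    (hc : 0 ≤ c) (hη : ∀ v, η v ≤ E)
    (hf : ∀ s, CBound 𝕂 n (fun v => c * η v * ζ s) (ρ s) (f s)) (k : ι) :
    CBound 𝕂 n (fun v => M * (c * η v) * ζ k) (ρ k) (fun v => ∑' s, G k s (f s v)) := by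
  have hcd : ∀ s, ContDiff 𝕂 ((n : ℕ∞) : WithTop ℕ∞) fun v => G k s (f s v) :=
    fun s => (G k s).contDiff.comp (hf s).1
  have hle : ∀ (l : ℕ) (s : ι) (v : V), l ≤ n →
      ‖iteratedFDeriv 𝕂 l (fun v => G k s (f s v)) v‖ ≤
        g k s * ((c * η v) * (ζ s * ρ s ^ l)) := fun l s v hl => by
    refine (((hf s).clm_comp (G k s) (hG k s)).2 l hl v).trans (le_of_eq (by ring))
  have hle' : ∀ (l : ℕ) (s : ι) (v : V), (l : ℕ∞) ≤ n →
      ‖iteratedFDeriv 𝕂 l (fun v => G k s (f s v)) v‖ ≤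
        (fun l s => g k s * ((c * E) * (ζ s * ρ s ^ l))) l s := fun l s v hl => by
    have hl' : l ≤ n := by exact_mod_cast hl
    refine (hle l s v hl').trans (mul_le_mul_of_nonneg_left ?_ ((hadm l hl').kernel_nonneg k s))
    exact mul_le_mul_of_nonneg_right (mul_le_mul_of_nonneg_left (hη v) hc) ((hadm l hl').pos s).le
  have hsum : ∀ l : ℕ, (l : ℕ∞) ≤ n →
      Summable ((fun l s => g k s * ((c * E) * (ζ s * ρ s ^ l))) l) := fun l hl =>
    (((hadm l (by exact_mod_cast hl)).summable k).mul_left (c * E)).congr fun s => by ring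
  refine ⟨contDiff_tsum hcd hsum hle', fun l hl v => ?_⟩
  rw [iteratedFDeriv_tsum_apply hcd hsum hle' (by exact_mod_cast hl)]
  have had := hadm l hl
  have h0 : ∀ s, 0 ≤ (c * η v) * (ζ s * ρ s ^ l) := fun s => by
    have h1 := (hf s).nonneg v
    have h2 := had.pos s
    have h3 := (hadm 0 (Nat.zero_le n)).pos s
    simp only [pow_zero, mul_one] at h3
    exact mul_nonneg (nonneg_of_mul_nonneg_left h1 h3) h2.le
  refine (tsum_of_norm_bounded (had.summable_mul h0 (fun s => le_rfl) k).hasSum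
    (fun s => hle l s v hl)).trans ?_
  exact (had.tsum_mul_le h0 (fun s => le_rfl) k).trans (le_of_eq (by ring))

/-- Composition with a function all of whose derivatives are bounded. -/
lemma comp_left {F : Y → Z} {c D : ℝ} (hF : ContDiff 𝕂 n F)
    (hFb : ∀ l ≤ n, ∀ y, ‖iteratedFDeriv 𝕂 l F y‖ ≤ c) (hf : ContDiff 𝕂 n f) (hD : 1 ≤ D)
    (hρ : 0 ≤ ρ)
    (hfb : ∀ l, 1 ≤ l → l ≤ n → ∀ v, ‖iteratedFDeriv 𝕂 l f v‖ ≤ D * ρ ^ l) :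
    CBound 𝕂 n (fun _ => n.factorial * c * D ^ n) ρ (fun v => F (f v)) := by
  refine ⟨hF.comp hf, fun l hl v => ?_⟩
  have hl' : ((l : ℕ) : WithTop ℕ∞) ≤ n := by exact_mod_cast hl
  have hc : 0 ≤ c := (norm_nonneg _).trans (hFb 0 (Nat.zero_le n) (f v))
  have := norm_iteratedFDeriv_comp_le (hF) hf hl' v (C := c) (D := D * ρ)
    (fun i hi => hFb i (hi.trans hl) _) (fun i hi1 hi2 => by
      refine (hfb i hi1 (hi2.trans hl) v).trans ?_
      rw [mul_pow]
      exact mul_le_mul_of_nonneg_right (le_self_pow₀ hD (by omega)) (pow_nonneg hρ i))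
  refine this.trans ?_
  rw [mul_pow, ← mul_assoc]
  refine mul_le_mul_of_nonneg_right ?_ (pow_nonneg hρ l)
  refine mul_le_mul (mul_le_mul_of_nonneg_right ?_ hc) (pow_le_pow_right₀ hD hl) (by positivity)
    (by positivity)
  exact_mod_cast Nat.factorial_le hl

end CBound

end CBound

/-! ### Differentiability of solutions of weighted summation equations -/

section Fixed

variable {𝕂 : Type*} [RCLike 𝕂] {V Y : Type*} [NormedAddCommGroup V] [NormedSpace 𝕂 V]
  [NormedAddCommGroup Y] [NormedSpace 𝕂 Y]
  {ι : Type*} {g : ι → ι → ℝ} {M : ℝ} {ω : ι → ℝ} {G : ι → ι → Y →L[𝕂] Y}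

/-- Postcomposition with `T`, as an operator on `V →L Y`. -/
abbrev postL (V : Type*) [NormedAddCommGroup V] [NormedSpace 𝕂 V] (T : Y →L[𝕂] Y) :
    (V →L[𝕂] Y) →L[𝕂] (V →L[𝕂] Y) :=
  ContinuousLinearMap.compL 𝕂 V Y Y T

lemma norm_postL_le (T : Y →L[𝕂] Y) : ‖postL V T‖ ≤ ‖T‖ :=
  ContinuousLinearMap.opNorm_le_bound _ (norm_nonneg T)
    fun B => ContinuousLinearMap.opNorm_comp_le T B

/-- The candidate `B` solves the linearized equation, `T` being the derivative of the nonlinearity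
in the unknown and `Q` that in the parameter. The error of first-order approximation divided by ‖a -
v‖ then satisfies a summation inequality with perturbation `r`, and `tendsto_zero_of_le_tsum`
applies. The remainders have to vanish only pointwise in `s`, not uniformly relative to the weight.
-/
lemma hasFDerivAt_of_fixed [CompleteSpace Y] (h : Admissible g M ω) (hG : ∀ k s, ‖G k s‖ ≤ g k s)
    {L : ℝ} (hL : 0 ≤ L) (hq : M * L < 1) {φ τ H : ι → V → Y} {T : ι → Y →L[𝕂] Y}
    {H' Q B : ι → V →L[𝕂] Y} {r : V → ι → ℝ} {v : V} {C : ℝ}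
    (hφ : ∀ k a, φ k a = H k a + ∑' s, G k s (τ s a))
    (hτ : ∀ a, ∃ D, ∀ s, ‖τ s a‖ ≤ D * ω s)
    (hH : ∀ k, HasFDerivAt (H k) (H' k) v)
    (hlip : ∀ k a, ‖φ k a - φ k v‖ ≤ C * ω k * ‖a - v‖)
    (hT : ∀ s, ‖T s‖ ≤ L) (hQ : ∀ s, ‖Q s‖ ≤ C * ω s) (hB : ∀ k, ‖B k‖ ≤ C * ω k)
    (hBeq : ∀ k, B k = H' k + ∑' s, postL V (G k s) ((T s).comp (B s) + Q s))
    (hr : ∀ a s, 0 ≤ r a s ∧ r a s ≤ C * ω s)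
    (hr0 : ∀ s, Tendsto (fun a => r a s) (𝓝 v) (𝓝 0))
    (hrem : ∀ a s, ‖τ s a - τ s v - (T s (φ s a - φ s v) + Q s (a - v))‖ ≤ r a s * ‖a - v‖)
    (k : ι) : HasFDerivAt (φ k) (B k) v := by
  rw [hasFDerivAt_iff_tendsto]
  have hG' : ∀ k s, ‖postL V (G k s)‖ ≤ g k s := fun k s => (norm_postL_le _).trans (hG k s)
  refine h.tendsto_zero_of_le_tsum hL hq (C := 2 * C + C)
    (e := fun a k => ‖a - v‖⁻¹ * ‖φ k a - φ k v - B k (a - v)‖) (r := r)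
    (r₀ := fun a k => ‖a - v‖⁻¹ * ‖H k a - H k v - H' k (a - v)‖)
    (Eventually.of_forall fun a k => ⟨by positivity, ?_⟩)
    (Eventually.of_forall fun a s => ⟨(hr a s).1, (hr a s).2.trans ?_⟩)
    (Eventually.of_forall fun a k => ?_) hr0 (fun s => hasFDerivAt_iff_tendsto.1 (hH s)) k
  · have h1 : ‖φ k a - φ k v - B k (a - v)‖ ≤ 2 * C * ω k * ‖a - v‖ := by
      refine (norm_sub_le _ _).trans ?_
      have := hlip k a
      have := ((B k).le_opNorm (a - v)).trans (mul_le_mul_of_nonneg_right (hB k) (norm_nonneg _))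
      linarith
    have hC0 : 0 ≤ C * ω k := (norm_nonneg _).trans (hB k)
    calc ‖a - v‖⁻¹ * ‖φ k a - φ k v - B k (a - v)‖
        ≤ ‖a - v‖⁻¹ * (2 * C * ω k * ‖a - v‖) := mul_le_mul_of_nonneg_left h1 (by positivity)
      _ = 2 * (C * ω k) * (‖a - v‖⁻¹ * ‖a - v‖) := by ring
      _ ≤ 2 * (C * ω k) * 1 := mul_le_mul_of_nonneg_left inv_mul_le_one (by positivity)
      _ ≤ (2 * C + C) * ω k := by linarith
  · have hC0 : 0 ≤ C * ω s := (norm_nonneg _).trans (hB s)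
    linarith
  · obtain ⟨D, hD⟩ := hτ a
    obtain ⟨D', hD'⟩ := hτ v
    have hQB : ∀ s, ‖(T s).comp (B s) + Q s‖ ≤ (L * C + C) * ω s := fun s => by
      refine (norm_add_le _ _).trans ?_
      have h1 := (ContinuousLinearMap.opNorm_comp_le (T s) (B s)).trans
        (mul_le_mul (hT s) (hB s) (norm_nonneg _) hL)
      have := hQ s
      linarith
    have hsB := h.summable_apply hG' hQB k
    have hBa : B k (a - v) = H' k (a - v) + ∑' s, G k s (T s (B s (a - v)) + Q s (a - v)) := by
      rw [hBeq k, add_apply]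
      congr 1
      exact (ContinuousLinearMap.apply 𝕂 Y (a - v)).map_tsum hsB
    have hsBa : Summable fun s => G k s (T s (B s (a - v)) + Q s (a - v)) := by
      refine h.summable_apply hG (D := (L * C + C) * ‖a - v‖) (fun s => ?_) k
      refine (((T s).comp (B s) + Q s).le_opNorm (a - v)).trans ?_
      refine (mul_le_mul_of_nonneg_right (hQB s) (norm_nonneg _)).trans (le_of_eq (by ring))
    have hs1 := h.summable_apply hG hD k
    have hs2 := h.summable_apply hG hD' k
    have heq : φ k a - φ k v - B k (a - v) = (H k a - H k v - H' k (a - v)) +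
        ∑' s, G k s (τ s a - τ s v - (T s (B s (a - v)) + Q s (a - v))) := by
      simp_rw [map_sub (G k _)]
      rw [(hs1.sub hs2).tsum_sub hsBa, hs1.tsum_sub hs2, hBa, hφ k a, hφ k v]
      abel
    have hpt : ∀ s, ‖τ s a - τ s v - (T s (B s (a - v)) + Q s (a - v))‖ ≤
        L * ‖φ s a - φ s v - B s (a - v)‖ + r a s * ‖a - v‖ := fun s => by
      have : τ s a - τ s v - (T s (B s (a - v)) + Q s (a - v)) =
          T s (φ s a - φ s v - B s (a - v)) +
          (τ s a - τ s v - (T s (φ s a - φ s v) + Q s (a - v))) := by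
        simp only [map_sub]; abel
      rw [this]
      refine (norm_add_le _ _).trans (add_le_add ?_ (hrem a s))
      exact ((T s).le_opNorm _).trans (mul_le_mul_of_nonneg_right (hT s) (norm_nonneg _))
    have hbd : ∀ s, L * ‖φ s a - φ s v - B s (a - v)‖ + r a s * ‖a - v‖ ≤
        ((L * (2 * C) + C) * ‖a - v‖) * ω s := fun s => by
      have h1 : ‖φ s a - φ s v - B s (a - v)‖ ≤ 2 * C * ω s * ‖a - v‖ := by
        refine (norm_sub_le _ _).trans ?_
        have := hlip s a
        have := ((B s).le_opNorm (a - v)).trans (mul_le_mul_of_nonneg_right (hB s) (norm_nonneg _))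
        linarith
      have h2 := mul_le_mul_of_nonneg_left h1 hL
      have h3 := mul_le_mul_of_nonneg_right (hr a s).2 (norm_nonneg (a - v))
      linarith
    rw [heq]
    have h4 := h.norm_tsum_apply_le hG hpt hbd k
    calc ‖a - v‖⁻¹ * ‖(H k a - H k v - H' k (a - v)) +
          ∑' s, G k s (τ s a - τ s v - (T s (B s (a - v)) + Q s (a - v)))‖
        ≤ ‖a - v‖⁻¹ * (‖H k a - H k v - H' k (a - v)‖ +
          ∑' s, g k s * (L * ‖φ s a - φ s v - B s (a - v)‖ + r a s * ‖a - v‖)) :=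
          mul_le_mul_of_nonneg_left ((norm_add_le _ _).trans (add_le_add le_rfl h4)) (by positivity)
      _ = ‖a - v‖⁻¹ * ‖H k a - H k v - H' k (a - v)‖ +
          ∑' s, ‖a - v‖⁻¹ *
            (g k s * (L * ‖φ s a - φ s v - B s (a - v)‖ + r a s * ‖a - v‖)) := by
          rw [mul_add, tsum_mul_left]
      _ ≤ _ := by
          refine add_le_add le_rfl (Summable.tsum_le_tsum (fun s => ?_) ?_ ?_)
          · calc ‖a - v‖⁻¹ * (g k s * (L * ‖φ s a - φ s v - B s (a - v)‖ + r a s * ‖a - v‖))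
                = g k s * (L * (‖a - v‖⁻¹ * ‖φ s a - φ s v - B s (a - v)‖) +
                    r a s * (‖a - v‖⁻¹ * ‖a - v‖)) := by ring
              _ ≤ _ := by
                refine mul_le_mul_of_nonneg_left (add_le_add le_rfl ?_) (h.kernel_nonneg k s)
                exact mul_le_of_le_one_right (hr a s).1 inv_mul_le_one
          · refine Summable.mul_left _ (h.summable_mul (fun s => ?_) hbd k)
            exact add_nonneg (mul_nonneg hL (norm_nonneg _))
              (mul_nonneg (hr a s).1 (norm_nonneg _))
          · refine h.summable_mul (D := L * (2 * C) + C) (fun s => ?_) (fun s => ?_) k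
            · exact add_nonneg (mul_nonneg hL (by positivity)) (hr a s).1
            · have h1 : ‖a - v‖⁻¹ * ‖φ s a - φ s v - B s (a - v)‖ ≤ 2 * (C * ω s) := by
                have h1 : ‖φ s a - φ s v - B s (a - v)‖ ≤ 2 * C * ω s * ‖a - v‖ := by
                  refine (norm_sub_le _ _).trans ?_
                  have := hlip s a
                  have := ((B s).le_opNorm (a - v)).trans
                    (mul_le_mul_of_nonneg_right (hB s) (norm_nonneg _))
                  linarith
                have hC0 : 0 ≤ C * ω s := (norm_nonneg _).trans (hB s)
                calc ‖a - v‖⁻¹ * ‖φ s a - φ s v - B s (a - v)‖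
                    ≤ ‖a - v‖⁻¹ * (2 * C * ω s * ‖a - v‖) :=
                      mul_le_mul_of_nonneg_left h1 (by positivity)
                  _ = 2 * (C * ω s) * (‖a - v‖⁻¹ * ‖a - v‖) := by ring
                  _ ≤ 2 * (C * ω s) * 1 := mul_le_mul_of_nonneg_left inv_mul_le_one (by positivity)
                  _ = 2 * (C * ω s) := by ring
              have h2 := mul_le_mul_of_nonneg_left h1 hL
              have := (hr a s).2
              linarith

end Fixed

/-! ### Linear equations depending on a parameter -/

section Linear

universe u

/-- Constants in the derivative bounds for solutions of parametrized linear equations. -/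
def linConst (M L Cm : ℝ) : ℕ → ℝ → ℝ
  | 0, c => c / (1 - M * L)
  | n + 1, c => max (linConst M L Cm n c)
      (linConst M L Cm n (c + M * (2 ^ n * (Cm * linConst M L Cm n c))))

lemma linConst_nonneg {M L Cm : ℝ} (hq : M * L < 1) (n : ℕ) {c : ℝ}
    (hc : 0 ≤ c) : 0 ≤ linConst M L Cm n c := by
  induction n generalizing c with
  | zero => exact div_nonneg hc (by linarith)
  | succ n ih => exact (ih hc).trans (le_max_left _ _)

variable {𝕂 : Type*} [RCLike 𝕂] {V : Type u} [NormedAddCommGroup V] [NormedSpace 𝕂 V]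
  {ι : Type*} {g : ι → ι → ℝ} {M L Cm : ℝ} {ρ : ι → ℝ} {η : V → ℝ} {E : ℝ}

lemma norm_flip_le {Y : Type*} [NormedAddCommGroup Y] [NormedSpace 𝕂 Y] :
    ‖((ContinuousLinearMap.flipₗᵢ 𝕂 V Y Y).toContinuousLinearEquiv :
      (V →L[𝕂] Y →L[𝕂] Y) →L[𝕂] (Y →L[𝕂] V →L[𝕂] Y))‖ ≤ 1 :=
  ContinuousLinearMap.opNorm_le_bound _ zero_le_one fun T => by
    rw [one_mul]
    exact ((ContinuousLinearMap.flipₗᵢ 𝕂 V Y Y).norm_map T).le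

/-- Weighted derivative bounds for the solution of `A = H + G (T A)`. -/
theorem cBound_of_linear (hρ : ∀ k, 1 ≤ ρ k) (hL : 0 ≤ L) (hq : M * L < 1) (hCm : 0 ≤ Cm)
    (hη : ∀ v, η v ≤ E) (hη0 : ∀ v, 0 ≤ η v) (n : ℕ) :
    ∀ {Y : Type u} [NormedAddCommGroup Y] [NormedSpace 𝕂 Y] [CompleteSpace Y]
      {G : ι → ι → Y →L[𝕂] Y} {ζ : ι → ℝ} {c : ℝ} {T : ι → V → Y →L[𝕂] Y} {H A : ι → V → Y},
      (∀ l ≤ n, Admissible g M fun k => ζ k * ρ k ^ l) → (∀ k s, ‖G k s‖ ≤ g k s) → 0 ≤ c →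
      (∀ s v, ‖T s v‖ ≤ L) → (∀ s, CBound 𝕂 n (fun _ => Cm) (ρ s) (T s)) →
      (∀ k, CBound 𝕂 n (fun v => c * η v * ζ k) (ρ k) (H k)) →
      (∀ v, ∃ D, ∀ k, ‖A k v‖ ≤ D * ζ k) →
      (∀ k v, A k v = H k v + ∑' s, G k s (T s v (A s v))) →
      ∀ k, CBound 𝕂 n (fun v => linConst M L Cm n c * η v * ζ k) (ρ k) (A k) := by
  induction n with
  | zero =>
    intro Y _ _ _ G ζ c T H A hadm hG hc hTL hT hH hA heq k
    have had : Admissible g M ζ := by simpa using hadm 0 le_rfl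
    have hTA : ∀ v D, (∀ k, ‖A k v‖ ≤ D * ζ k) → ∀ s, ‖T s v (A s v)‖ ≤ L * D * ζ s :=
      fun v D hD s => ((T s v).le_opNorm _).trans (by
        rw [mul_assoc]; exact mul_le_mul (hTL s v) (hD s) (norm_nonneg _) hL)
    have hbd : ∀ k v, ‖A k v‖ ≤ c / (1 - M * L) * η v * ζ k := by
      intro k v
      obtain ⟨D, hD⟩ := hA v
      have := had.norm_sub_le_of_fixed hG hL hq (a := fun s => T s v (A s v)) (a' := fun _ => 0)
        (φ := fun k => A k v) (φ' := fun _ => 0) (η := fun k => H k v) (η' := fun _ => 0)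
        (B := L * D) (C := c * η v) (D := D) (c := 0) (hTA v D hD)
        (fun s => by simpa using (norm_nonneg _).trans (hTA v D hD s))
        (fun s => by
          simpa using ((T s v).le_opNorm _).trans
            (mul_le_mul_of_nonneg_right (hTL s v) (norm_nonneg _)))
        (fun k => by simpa using (hH k).norm_le v) (mul_nonneg hc (hη0 v)) le_rfl
        (fun k => by simpa using hD k) (fun k => heq k v) (fun k => by simp) k
      simp only [sub_zero, mul_zero, add_zero] at this
      exact this.trans (le_of_eq (by ring))
    refine ⟨?_, fun l hl v => ?_⟩
    · simp only [Nat.cast_zero, contDiff_zero]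
      -- A(a) - A(v) solves an equation of the same form, forced by H(a) - H(v) and (T(a) - T(v))
      -- A(v), which tend to 0 at each index.
      refine continuous_iff_continuousAt.2 fun v => ?_
      have hc1 : ∀ s, Continuous (T s) := fun s => (hT s).1.continuous
      have hc2 : ∀ s, Continuous (H s) := fun s => (hH s).1.continuous
      rw [ContinuousAt, tendsto_iff_norm_sub_tendsto_zero]
      have hq1 : 0 < 1 - M * L := by linarith
      have hE : 0 ≤ E := (hη0 v).trans (hη v)
      set D : ℝ := c / (1 - M * L) * E with hDdef
      have hD0 : 0 ≤ D := mul_nonneg (div_nonneg hc hq1.le) hE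
      have hD : ∀ a k, ‖A k a‖ ≤ D * ζ k := fun a k => (hbd k a).trans
        (mul_le_mul_of_nonneg_right (mul_le_mul_of_nonneg_left (hη a) (div_nonneg hc hq1.le))
          (had.pos k).le)
      have hζ : ∀ s, 0 ≤ D * ζ s := fun s => mul_nonneg hD0 (had.pos s).le
      refine had.tendsto_zero_of_le_tsum hL hq (C := 2 * D + 2 * L * D)
        (e := fun a k => ‖A k a - A k v‖) (r := fun a s => ‖T s a - T s v‖ * ‖A s v‖)
        (r₀ := fun a k => ‖H k a - H k v‖)
        (Eventually.of_forall fun a k => ⟨norm_nonneg _, ?_⟩)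
        (Eventually.of_forall fun a s => ⟨by positivity, ?_⟩)
        (Eventually.of_forall fun a k => ?_) (fun s => ?_) (fun s => ?_) k
      · have h1 := norm_sub_le (A k a) (A k v)
        have h2 := hD a k
        have h3 := hD v k
        have := mul_nonneg hL (hζ k)
        nlinarith
      · have h1 := (norm_sub_le (T s a) (T s v)).trans (add_le_add (hTL s a) (hTL s v))
        have h2 := mul_le_mul h1 (hD v s) (norm_nonneg _) (by positivity)
        have := hζ s
        nlinarith
      · have h1 : A k a - A k v = (H k a - H k v) +
            ∑' s, G k s (T s a (A s a) - T s v (A s v)) := by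
          simp_rw [map_sub]
          rw [(had.summable_apply hG (hTA a D (hD a)) k).tsum_sub
            (had.summable_apply hG (hTA v D (hD v)) k), heq k a, heq k v]
          abel
        rw [h1]
        refine (norm_add_le _ _).trans (add_le_add le_rfl ?_)
        refine had.norm_tsum_apply_le hG (D := L * (2 * D) + (L + L) * D) (fun s => ?_)
          (fun s => ?_) k
        · have : T s a (A s a) - T s v (A s v) =
              T s a (A s a - A s v) + (T s a - T s v) (A s v) := by
            simp only [map_sub, sub_apply]; abel
          rw [this]
          refine (norm_add_le _ _).trans (add_le_add ?_ ?_)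
          · exact ((T s a).le_opNorm _).trans (mul_le_mul_of_nonneg_right (hTL s a) (norm_nonneg _))
          · exact (T s a - T s v).le_opNorm _
        · have h1 := (norm_sub_le (T s a) (T s v)).trans (add_le_add (hTL s a) (hTL s v))
          have h2 := mul_le_mul h1 (hD v s) (norm_nonneg _) (by positivity)
          have h3 := (norm_sub_le (A s a) (A s v)).trans (add_le_add (hD a s) (hD v s))
          have h4 := mul_le_mul_of_nonneg_left h3 hL
          linarith
      · have := (tendsto_iff_norm_sub_tendsto_zero.1 ((hc1 s).tendsto v)).mul_const ‖A s v‖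
        simpa using this
      · exact tendsto_iff_norm_sub_tendsto_zero.1 ((hc2 s).tendsto v)
    · obtain rfl : l = 0 := by omega
      simpa [norm_iteratedFDeriv_zero, linConst] using hbd k v
  | succ n ih =>
    intro Y _ _ _ G ζ c T H A hadm hG hc hTL hT hH hA heq k₀
    have hM : 0 ≤ M := (hadm 0 (Nat.zero_le _)).const_nonneg k₀
    have hζ : ∀ k, 0 < ζ k := fun k => by simpa using (hadm 0 (Nat.zero_le _)).pos k
    have hρ0 : ∀ k, 0 ≤ ρ k := fun k => zero_le_one.trans (hρ k)
    have hq1 : 0 < 1 - M * L := by linarith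
    set lc := linConst M L Cm n c with hlc
    have hlc0 : 0 ≤ lc := linConst_nonneg hq n hc
    have hA1 : ∀ k, CBound 𝕂 n (fun v => lc * η v * ζ k) (ρ k) (A k) :=
      ih (fun l hl => hadm l (hl.trans (Nat.le_succ n))) hG hc hTL
        (fun s => (hT s).of_le (Nat.le_succ n)) (fun k => (hH k).of_le (Nat.le_succ n)) hA heq
    -- The derivative is sought in the weight ζρ, and its orders up to `n` use the orders up to `n +
    -- 1` for ζ.
    have hadm' : ∀ l ≤ n, Admissible g M fun k => (ζ k * ρ k) * ρ k ^ l := fun l hl => by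
      have := hadm (l + 1) (by omega)
      simpa [pow_succ, mul_assoc, mul_comm, mul_left_comm] using this
    have had : Admissible g M fun k => ζ k * ρ k := by simpa using hadm' 0 (Nat.zero_le n)
    have hG' : ∀ k s, ‖postL V (G k s)‖ ≤ g k s := fun k s => (norm_postL_le _).trans (hG k s)
    set FB : (V →L[𝕂] Y →L[𝕂] Y) →L[𝕂] (Y →L[𝕂] V →L[𝕂] Y) :=
      ((ContinuousLinearMap.flipₗᵢ 𝕂 V Y Y).toContinuousLinearEquiv :
        (V →L[𝕂] Y →L[𝕂] Y) →L[𝕂] (Y →L[𝕂] V →L[𝕂] Y)) with hFB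
    have hFBa : ∀ S y a, FB S y a = S a y := fun S y a => rfl
    have hFBn : ∀ S y, ‖FB S y‖ ≤ ‖S‖ * ‖y‖ := fun S y => by
      refine ((FB S).le_opNorm y).trans (mul_le_mul_of_nonneg_right ?_ (norm_nonneg y))
      refine (FB.le_opNorm S).trans (mul_le_of_le_one_left (norm_nonneg _) norm_flip_le)
    -- The part of the derivative of T(v)A(v) that falls on T; flipping leaves the direction of
    -- differentiation as the free variable.
    set Q : ι → V → V →L[𝕂] Y := fun s v => FB (fderiv 𝕂 (T s) v) (A s v) with hQdef
    have hQ : ∀ s, CBound 𝕂 n (fun v => 2 ^ n * (Cm * lc) * η v * (ζ s * ρ s)) (ρ s) (Q s) :=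
      fun s => ((hT s).fderiv.bilin (hA1 s) FB norm_flip_le (hρ0 s)).mono (hρ0 s)
        fun v => le_of_eq (by ring)
    set H' : ι → V → V →L[𝕂] Y := fun k v =>
      fderiv 𝕂 (H k) v + ∑' s, postL V (G k s) (Q s v) with hH'def
    set c' := c + M * (2 ^ n * (Cm * lc)) with hc'
    have hc'0 : 0 ≤ c' := by positivity
    have hQs := CBound.tsum (𝕂 := 𝕂) hadm' hG' (c := 2 ^ n * (Cm * lc)) (by positivity) hη hQ
    have hH' : ∀ k, CBound 𝕂 n (fun v => c' * η v * (ζ k * ρ k)) (ρ k) (H' k) := fun k =>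
      ((hH k).fderiv.add (hQs k)).mono (hρ0 k) fun v => le_of_eq (by rw [hc']; ring)
    -- The candidate for the derivative comes first, as a fixed point with values in V →L Y; only
    -- afterwards is it shown to be the derivative.
    have hex : ∀ v, ∃ B : ι → V →L[𝕂] Y, (∃ D, ∀ k, ‖B k‖ ≤ D * (ζ k * ρ k)) ∧
        ∀ k, B k = H' k v + ∑' s, postL V (G k s) (postL V (T s v) (B s)) := fun v =>
      had.exists_fixed hG' hL hq (T := fun s => postL V (T s v)) (fun s => map_zero _)
        (fun s y y' => by
          rw [← map_sub]
          exact ((postL V (T s v)).le_opNorm _).trans (mul_le_mul_of_nonneg_right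
            ((norm_postL_le _).trans (hTL s v)) (norm_nonneg _)))
        (fun k => (hH' k).norm_le v)
    choose B hBbd hBeq using hex
    -- The candidate again solves a linear equation with a parameter. The induction hypothesis
    -- covers all value spaces, so it applies with V →L Y.
    have hB : ∀ k, CBound 𝕂 n (fun v => linConst M L Cm n c' * η v * (ζ k * ρ k)) (ρ k)
        (fun v => B v k) := by
      refine ih (G := fun k s => postL V (G k s)) (T := fun s v => postL V (T s v)) (H := H')
        hadm' hG' hc'0 (fun s v => (norm_postL_le _).trans (hTL s v)) (fun s => ?_) hH' hBbd
        (fun k v => hBeq v k)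
      refine (((hT s).of_le (Nat.le_succ n)).clm_comp (ContinuousLinearMap.compL 𝕂 V Y Y)
        (ContinuousLinearMap.norm_compL_le 𝕂 V Y Y)).mono (hρ0 s) fun v => by simp
    have hder : ∀ v k, HasFDerivAt (A k) (B v k) v := by
      intro v k
      have hE : 0 ≤ E := (hη0 v).trans (hη v)
      set D : ℝ := lc * E with hDdef
      have hD0 : 0 ≤ D := mul_nonneg hlc0 hE
      have hD : ∀ a k, ‖A k a‖ ≤ D * ζ k := fun a k => ((hA1 k).norm_le a).trans
        (mul_le_mul_of_nonneg_right (mul_le_mul_of_nonneg_left (hη a) hlc0) (hζ k).le)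
      have hζρ : ∀ k, ζ k ≤ ζ k * ρ k := fun k => le_mul_of_one_le_right (hζ k).le (hρ k)
      have hτ : ∀ a s, ‖T s a (A s a)‖ ≤ L * D * (ζ s * ρ s) := fun a s => by
        refine ((T s a).le_opNorm _).trans ((mul_le_mul (hTL s a) (hD a s) (norm_nonneg _)
          hL).trans ?_)
        rw [← mul_assoc]
        exact mul_le_mul_of_nonneg_left (hζρ s) (by positivity)
      have hTlip : ∀ s a, ‖T s a - T s v‖ ≤ Cm * ρ s * ‖a - v‖ := fun s a =>
        (hT s).norm_sub_le (fun _ => le_rfl) a v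
      have hHlip : ∀ k a, ‖H k a - H k v‖ ≤ c * E * ζ k * ρ k * ‖a - v‖ := fun k a =>
        (hH k).norm_sub_le (fun x => mul_le_mul_of_nonneg_right (mul_le_mul_of_nonneg_right
          (mul_le_mul_of_nonneg_left (hη x) hc) (hζ k).le) (hρ0 k)) a v
      set C1 : ℝ := (c * E + M * (Cm * D)) / (1 - M * L) with hC1
      have hC10 : 0 ≤ C1 := div_nonneg (by positivity) hq1.le
      have hlip : ∀ k a, ‖A k a - A k v‖ ≤ C1 * (ζ k * ρ k) * ‖a - v‖ := by
        intro k a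
        have := had.norm_sub_le_of_fixed hG hL hq (a := fun s => T s a (A s a))
          (a' := fun s => T s v (A s v)) (φ := fun k => A k a) (φ' := fun k => A k v)
          (η := fun k => H k a) (η' := fun k => H k v) (B := L * D) (C := c * E * ‖a - v‖)
          (D := D + D) (c := Cm * D * ‖a - v‖) (hτ a) (hτ v)
          (fun s => by
            have : T s a (A s a) - T s v (A s v) =
                T s a (A s a - A s v) + (T s a - T s v) (A s v) := by
              simp only [map_sub, sub_apply]; abel
            rw [this]
            refine (norm_add_le _ _).trans (add_le_add ?_ ?_)
            · exact ((T s a).le_opNorm _).trans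
                (mul_le_mul_of_nonneg_right (hTL s a) (norm_nonneg _))
            · refine ((T s a - T s v).le_opNorm _).trans ((mul_le_mul (hTlip s a) (hD v s)
                (norm_nonneg _) (mul_nonneg (mul_nonneg hCm (hρ0 s)) (norm_nonneg _))).trans
                (le_of_eq (by ring))))
          (fun k => (hHlip k a).trans (le_of_eq (by ring))) (by positivity) (by positivity)
          (fun k => by
            refine (norm_sub_le _ _).trans ((add_le_add (hD a k) (hD v k)).trans ?_)
            rw [← add_mul]
            exact mul_le_mul_of_nonneg_left (hζρ k) (by positivity))
          (fun k => heq k a) (fun k => heq k v) k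
        refine this.trans (le_of_eq ?_)
        rw [hC1]; ring
      obtain ⟨DB, hDB⟩ := hBbd v
      have hfd : ∀ s, ‖fderiv 𝕂 (T s) v‖ ≤ Cm * ρ s := fun s => (hT s).fderiv.norm_le v
      have hQn : ∀ s, ‖Q s v‖ ≤ Cm * D * (ζ s * ρ s) := fun s =>
        (hFBn _ _).trans ((mul_le_mul (hfd s) (hD v s) (norm_nonneg _)
          (mul_nonneg hCm (hρ0 s))).trans (le_of_eq (by ring)))
      have hrem : ∀ s a, ‖T s a - T s v - fderiv 𝕂 (T s) v (a - v)‖ ≤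
          2 * (Cm * ρ s) * ‖a - v‖ := fun s a => by
        refine (norm_sub_le _ _).trans ?_
        have h1 := hTlip s a
        have h2 := ((fderiv 𝕂 (T s) v).le_opNorm (a - v)).trans
          (mul_le_mul_of_nonneg_right (hfd s) (norm_nonneg _))
        linarith
      set C : ℝ := C1 + |DB| + 4 * (Cm * D) with hCdef
      have hpos : ∀ s, 0 < ζ s * ρ s := had.pos
      have hCm4 : 0 ≤ Cm * D := by positivity
      refine hasFDerivAt_of_fixed had hG hL hq (τ := fun s a => T s a (A s a)) (H := H)
        (H' := fun k => fderiv 𝕂 (H k) v) (T := fun s => T s v) (Q := fun s => Q s v)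
        (B := fun k => B v k) (C := C)
        (r := fun a s => (‖a - v‖⁻¹ * ‖T s a - T s v - fderiv 𝕂 (T s) v (a - v)‖) * ‖A s v‖ +
          Cm * ρ s * ‖A s a - A s v‖)
        (fun k a => heq k a) (fun a => ⟨L * D, hτ a⟩)
        (fun k => ((hH k).differentiable v).hasFDerivAt) (fun k a => ?_) (fun s => hTL s v)
        (fun s => ?_) (fun k => ?_) (fun k => ?_) (fun a s => ⟨?_, ?_⟩) (fun s => ?_)
        (fun a s => ?_) k
      · refine (hlip k a).trans (mul_le_mul_of_nonneg_right (mul_le_mul_of_nonneg_right ?_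
          (hpos k).le) (norm_nonneg _))
        have := abs_nonneg DB
        linarith
      · refine (hQn s).trans (mul_le_mul_of_nonneg_right ?_ (hpos s).le)
        have := abs_nonneg DB
        linarith
      · refine (hDB k).trans (mul_le_mul_of_nonneg_right ?_ (hpos k).le)
        have := le_abs_self DB
        linarith
      · have hs1 := had.summable_apply hG' hQn k
        have hs2 : Summable fun s => postL V (G k s) (postL V (T s v) (B v s)) :=
          had.summable_apply hG' (D := L * DB) (fun s =>
            ((postL V (T s v)).le_opNorm _).trans (by
              rw [mul_assoc]
              exact mul_le_mul ((norm_postL_le _).trans (hTL s v)) (hDB s) (norm_nonneg _) hL)) k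
        have : ∀ s, postL V (G k s) ((T s v).comp (B v s) + Q s v) =
            postL V (G k s) (postL V (T s v) (B v s)) + postL V (G k s) (Q s v) := fun s => by
          rw [map_add]; rfl
        simp_rw [this]
        rw [hs2.tsum_add hs1, hBeq v k]
        simp only [hH'def]
        abel
      · exact add_nonneg (by positivity)
          (mul_nonneg (mul_nonneg hCm (hρ0 s)) (norm_nonneg _))
      · have h1 : ‖a - v‖⁻¹ * ‖T s a - T s v - fderiv 𝕂 (T s) v (a - v)‖ ≤ 2 * (Cm * ρ s) :=
          calc ‖a - v‖⁻¹ * ‖T s a - T s v - fderiv 𝕂 (T s) v (a - v)‖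
              ≤ ‖a - v‖⁻¹ * (2 * (Cm * ρ s) * ‖a - v‖) :=
                mul_le_mul_of_nonneg_left (hrem s a) (by positivity)
            _ = 2 * (Cm * ρ s) * (‖a - v‖⁻¹ * ‖a - v‖) := by ring
            _ ≤ 2 * (Cm * ρ s) * 1 := mul_le_mul_of_nonneg_left inv_mul_le_one
                (by have := mul_nonneg hCm (hρ0 s); linarith)
            _ = 2 * (Cm * ρ s) := mul_one _
        have hCρ := mul_nonneg hCm (hρ0 s)
        have h2 := mul_le_mul h1 (hD v s) (norm_nonneg _) (by linarith)
        have h3 := mul_le_mul_of_nonneg_left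
          ((norm_sub_le (A s a) (A s v)).trans (add_le_add (hD a s) (hD v s))) hCρ
        have h4 : 0 ≤ (C1 + |DB|) * (ζ s * ρ s) := mul_nonneg (by positivity) (hpos s).le
        rw [hCdef]
        linarith
      · have h1 := (hasFDerivAt_iff_tendsto.1 ((hT s).differentiable v).hasFDerivAt).mul_const
          ‖A s v‖
        have h2 := (tendsto_iff_norm_sub_tendsto_zero.1
          ((hA1 s).1.continuous.tendsto v)).const_mul (Cm * ρ s)
        simpa using h1.add h2
      · have : T s a (A s a) - T s v (A s v) - (T s v (A s a - A s v) + Q s v (a - v)) =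
            (T s a - T s v - fderiv 𝕂 (T s) v (a - v)) (A s v) +
            (T s a - T s v) (A s a - A s v) := by
          simp only [map_sub, sub_apply, hQdef, hFBa]; abel
        rw [this, add_mul]
        refine (norm_add_le _ _).trans (add_le_add ?_ ?_)
        · refine ((T s a - T s v - fderiv 𝕂 (T s) v (a - v)).le_opNorm _).trans ?_
          rcases eq_or_ne a v with rfl | hne
          · simp
          · have : ‖a - v‖ ≠ 0 := norm_ne_zero_iff.2 (sub_ne_zero.2 hne)
            refine le_of_eq ?_
            field_simp
        · refine ((T s a - T s v).le_opNorm _).trans ?_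
          refine (mul_le_mul_of_nonneg_right (hTlip s a) (norm_nonneg _)).trans
            (le_of_eq (by ring))
    have hfdA : ∀ k, fderiv 𝕂 (A k) = fun v => B v k := fun k => funext fun v => (hder v k).fderiv
    refine CBound.of_fderiv (fun v => (hder v k₀).differentiableAt) (fun v => ?_) ?_
    · refine ((hA1 k₀).norm_le v).trans (mul_le_mul_of_nonneg_right
        (mul_le_mul_of_nonneg_right (le_max_left _ _) (hη0 v)) (hζ k₀).le)
    · rw [hfdA k₀]
      refine (hB k₀).mono (hρ0 k₀) fun v => ?_
      rw [mul_assoc _ (ζ k₀)]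
      exact mul_le_mul_of_nonneg_right
        (mul_le_mul_of_nonneg_right (le_max_right _ _) (hη0 v)) (had.pos k₀).le

end Linear

/-! ### Smooth dependence of solutions of nonlinear summation equations -/

section Nonlinear

universe u

variable {𝕂 : Type*} [RCLike 𝕂] {V X : Type u} [NormedAddCommGroup V] [NormedSpace 𝕂 V]
  [NormedAddCommGroup X] [NormedSpace 𝕂 X]

lemma cBound_const {Y : Type*} [NormedAddCommGroup Y] [NormedSpace 𝕂 Y] {n : ℕ} {ρ c : ℝ}
    (hρ : 0 ≤ ρ) {y : Y} (hy : ‖y‖ ≤ c) : CBound 𝕂 n (fun _ : V => c) ρ (fun _ => y) := by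
  refine ⟨contDiff_const, fun l _ v => ?_⟩
  cases l with
  | zero => simpa [norm_iteratedFDeriv_zero] using hy
  | succ l =>
    rw [iteratedFDeriv_const_of_ne (Nat.succ_ne_zero l)]
    simpa using mul_nonneg ((norm_nonneg y).trans hy) (pow_nonneg hρ (l + 1))

/-- Constants in `cBound_comp_sub_comp`. -/
def compSubConst (c D : ℝ) : ℕ → ℝ
  | 0 => c
  | n + 1 => c + 2 ^ n * (compSubConst c D n * D + n.factorial * c * D ^ n)

lemma compSubConst_nonneg {c D : ℝ} (hc : 0 ≤ c) (hD : 0 ≤ D) (n : ℕ) :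
    0 ≤ compSubConst c D n := by
  induction n with
  | zero => exact hc
  | succ n ih => simp only [compSubConst]; positivity

/-- Derivative bounds for the difference of two compositions with the same outer function. -/
lemma cBound_comp_sub_comp {c D ρ : ℝ} {b : V → ℝ} {φ φ' : V → X} (hρ : 0 ≤ ρ) (hD : 1 ≤ D)
    (n : ℕ) : ∀ {Z : Type u} [NormedAddCommGroup Z] [NormedSpace 𝕂 Z] {F : X → Z},
      ContDiff 𝕂 (n + 1 : ℕ) F → (∀ l ≤ n + 1, ∀ y, ‖iteratedFDeriv 𝕂 l F y‖ ≤ c) →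
      ContDiff 𝕂 n φ → ContDiff 𝕂 n φ' →
      (∀ l, 1 ≤ l → l ≤ n → ∀ v, ‖iteratedFDeriv 𝕂 l φ v‖ ≤ D * ρ ^ l) →
      (∀ l, 1 ≤ l → l ≤ n → ∀ v, ‖iteratedFDeriv 𝕂 l φ' v‖ ≤ D * ρ ^ l) →
      CBound 𝕂 n b ρ (fun v => φ v - φ' v) →
      CBound 𝕂 n (fun v => compSubConst c D n * b v) ρ (fun v => F (φ v) - F (φ' v)) := by
  have hval : ∀ {Z : Type u} [NormedAddCommGroup Z] [NormedSpace 𝕂 Z] {F : X → Z} {n : ℕ},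
      ContDiff 𝕂 (n + 1 : ℕ) F → (∀ l ≤ n + 1, ∀ y, ‖iteratedFDeriv 𝕂 l F y‖ ≤ c) →
      CBound 𝕂 n b ρ (fun v => φ v - φ' v) → ∀ v, ‖F (φ v) - F (φ' v)‖ ≤ c * b v := by
    intro Z _ _ F n hF hFb hb v
    have hc : 0 ≤ c := (norm_nonneg _).trans (hFb 0 (Nat.zero_le _) (φ v))
    have hF1 : CBound 𝕂 1 (fun _ => c) 1 F :=
      ⟨hF.of_le (by exact_mod_cast (by omega : 1 ≤ n + 1)), fun l hl y => by
        simpa using hFb l (by omega) y⟩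
    exact (hF1.norm_sub_le (E := c) (fun _ => by simp) _ _).trans
      (mul_le_mul_of_nonneg_left (hb.norm_le v) hc)
  induction n with
  | zero =>
    intro Z _ _ F hF hFb hφ hφ' h1 h2 hb
    refine ⟨(((hF.of_le (by simp)).comp hφ).sub ((hF.of_le (by simp)).comp hφ')), fun l hl v => ?_⟩
    obtain rfl : l = 0 := by omega
    simpa [norm_iteratedFDeriv_zero, compSubConst] using hval hF hFb hb v
  | succ n ih =>
    intro Z _ _ F hF hFb hφ hφ' h1 h2 hb
    have hc : 0 ≤ c := by
      by_cases hV : Nonempty V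
      · obtain ⟨v⟩ := hV
        exact (norm_nonneg _).trans (hFb 0 (Nat.zero_le _) (φ v))
      · exact absurd ⟨0⟩ hV
    have hdF : Differentiable 𝕂 F := hF.differentiable (by exact_mod_cast Nat.succ_ne_zero (n + 1))
    have hdφ : Differentiable 𝕂 φ := hφ.differentiable (by exact_mod_cast Nat.succ_ne_zero n)
    have hdφ' : Differentiable 𝕂 φ' := hφ'.differentiable (by exact_mod_cast Nat.succ_ne_zero n)
    have hF' : ContDiff 𝕂 (n + 1 : ℕ) (fderiv 𝕂 F) := hF.fderiv_right (by norm_cast)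
    have hF'b : ∀ l ≤ n + 1, ∀ y, ‖iteratedFDeriv 𝕂 l (fderiv 𝕂 F) y‖ ≤ c := fun l hl y => by
      rw [norm_iteratedFDeriv_fderiv]; exact hFb (l + 1) (by omega) y
    have hn : ((n : ℕ) : WithTop ℕ∞) ≤ ((n + 1 : ℕ) : WithTop ℕ∞) := by
      exact_mod_cast Nat.le_succ n
    have hDφ : CBound 𝕂 n (fun _ => D * ρ) ρ (fderiv 𝕂 φ) := by
      refine ⟨hφ.fderiv_right (by norm_cast), fun l hl v => ?_⟩
      rw [norm_iteratedFDeriv_fderiv]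
      exact (h1 (l + 1) (by omega) (by omega) v).trans (le_of_eq (by ring))
    have hA := ih hF' hF'b (hφ.of_le hn) (hφ'.of_le hn) (fun l hl hl' => h1 l hl (by omega))
      (fun l hl hl' => h2 l hl (by omega)) (hb.of_le (Nat.le_succ n))
    have hB : CBound 𝕂 n (fun _ => n.factorial * c * D ^ n) ρ (fun v => fderiv 𝕂 F (φ' v)) :=
      CBound.comp_left (hF'.of_le hn) (fun l hl y => hF'b l (by omega) y) (hφ'.of_le hn) hD hρ
        (fun l hl hl' => h2 l hl (by omega))
    -- DF(φ')Dφ is added and subtracted: the first summand falls under the induction hypothesis for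
    -- the outer function DF, the second under the bound on φ - φ'.
    have hder : fderiv 𝕂 (fun v => F (φ v) - F (φ' v)) = fun v =>
        ContinuousLinearMap.compL 𝕂 V X Z (fderiv 𝕂 F (φ v) - fderiv 𝕂 F (φ' v)) (fderiv 𝕂 φ v) +
        ContinuousLinearMap.compL 𝕂 V X Z (fderiv 𝕂 F (φ' v))
          (fderiv 𝕂 (fun v => φ v - φ' v) v) := by
      funext v
      have e1 : fderiv 𝕂 (fun v => F (φ v)) v = (fderiv 𝕂 F (φ v)).comp (fderiv 𝕂 φ v) :=
        fderiv_comp v (hdF _) (hdφ v)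
      have e2 : fderiv 𝕂 (fun v => F (φ' v)) v = (fderiv 𝕂 F (φ' v)).comp (fderiv 𝕂 φ' v) :=
        fderiv_comp v (hdF _) (hdφ' v)
      have d1 : DifferentiableAt 𝕂 (fun v => F (φ v)) v := (hdF _).comp v (hdφ v)
      have d2 : DifferentiableAt 𝕂 (fun v => F (φ' v)) v := (hdF _).comp v (hdφ' v)
      rw [fderiv_fun_sub d1 d2, fderiv_fun_sub (hdφ v) (hdφ' v), e1, e2]
      ext x
      simp
    refine CBound.of_fderiv ((hdF.comp hdφ).sub (hdF.comp hdφ')) (fun v => ?_) ?_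
    · refine (hval hF hFb hb v).trans (mul_le_mul_of_nonneg_right ?_ (hb.nonneg v))
      have := compSubConst_nonneg hc (zero_le_one.trans hD) n
      have hD0 : 0 ≤ D := zero_le_one.trans hD
      simp only [compSubConst]
      have : 0 ≤ 2 ^ n * (compSubConst c D n * D + n.factorial * c * D ^ n) := by positivity
      linarith
    · rw [hder]
      have hcl := ContinuousLinearMap.norm_compL_le 𝕂 V X Z
      refine ((hA.bilin hDφ _ hcl hρ).add (hB.bilin hb.fderiv _ hcl hρ)).mono hρ fun v => ?_
      have h0 : 0 ≤ c * (b v * ρ) := mul_nonneg hc (mul_nonneg (hb.nonneg v) hρ)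
      simp only [compSubConst]
      linarith

variable {ι : Type*} {g : ι → ι → ℝ} {M L K : ℝ} {ω ρ : ι → ℝ}
  {G : ι → ι → X →L[𝕂] X}

/-- A solution `φ` of `φ(v) = S v + G R(φ(v))`, weighted bounded for each `v`. -/
structure IsFixedFamily (G : ι → ι → X →L[𝕂] X) (ω : ι → ℝ) (S : ι → V →L[𝕂] X)
    (R : ι → X → X) (φ : ι → V → X) : Prop where
  bdd : ∀ v, ∃ D, ∀ k, ‖φ k v‖ ≤ D * ω k
  eq : ∀ k v, φ k v = S k v + ∑' s, G k s (R s (φ s v))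

/-- Data of a summation equation: kernel bound, contraction condition, Lipschitz nonlinearity. -/
structure FixedData (g : ι → ι → ℝ) (M L K : ℝ) (ω : ι → ℝ) (G : ι → ι → X →L[𝕂] X)
    (S : ι → V →L[𝕂] X) (R : ι → X → X) : Prop where
  adm : Admissible g M ω
  kernel : ∀ k s, ‖G k s‖ ≤ g k s
  L_nonneg : 0 ≤ L
  contr : M * L < 1
  K_nonneg : 0 ≤ K
  S_le : ∀ k, ‖S k‖ ≤ K * ω k
  zero : ∀ s, R s 0 = 0
  lip : ∀ s x y, ‖R s x - R s y‖ ≤ L * ‖x - y‖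

namespace FixedData

variable {S : ι → V →L[𝕂] X} {R R' : ι → X → X} {φ φ' : ι → V → X}

lemma norm_le (h : FixedData g M L K ω G S R) (s : ι) (x : X) : ‖R s x‖ ≤ L * ‖x‖ := by
  simpa [h.zero s] using h.lip s x 0

lemma norm_comp_le (h : FixedData g M L K ω G S R) {D : ℝ} {x : ι → X}
    (hD : ∀ k, ‖x k‖ ≤ D * ω k) (s : ι) : ‖R s (x s)‖ ≤ L * D * ω s :=
  (h.norm_le s _).trans (by rw [mul_assoc]; exact mul_le_mul_of_nonneg_left (hD s) h.L_nonneg)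

lemma S_apply_le (h : FixedData g M L K ω G S R) (k : ι) (v : V) :
    ‖S k v‖ ≤ K * ‖v‖ * ω k :=
  ((S k).le_opNorm v).trans ((mul_le_mul_of_nonneg_right (h.S_le k) (norm_nonneg v)).trans
    (le_of_eq (by ring)))

variable [CompleteSpace X]

lemma exists_family (h : FixedData g M L K ω G S R) :
    ∃ φ : ι → V → X, IsFixedFamily G ω S R φ := by
  choose φ hφ1 hφ2 using fun v => h.adm.exists_fixed h.kernel h.L_nonneg h.contr h.zero h.lip
    (fun k => h.S_apply_le k v)
  exact ⟨fun k v => φ v k, hφ1, fun k v => hφ2 v k⟩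

/-- The difference of two solutions is weighted bounded and has no forcing, so the contraction kills
it. This identifies any solution of prescribed growth with a member of the family. -/
lemma unique (h : FixedData g M L K ω G S R) (hφ : IsFixedFamily G ω S R φ) {v : V} {x : ι → X}
    (hx : ∃ D, ∀ k, ‖x k‖ ≤ D * ω k) (hxeq : ∀ k, x k = S k v + ∑' s, G k s (R s (x s)))
    (k : ι) : x k = φ k v := by
  obtain ⟨D, hD⟩ := hφ.bdd v
  obtain ⟨D', hD'⟩ := hx
  have hb : ∀ (D'' : ℝ) (y : ι → X), (∀ k, ‖y k‖ ≤ D'' * ω k) →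
      (D'' = D ∨ D'' = D') → ∀ s, ‖R s (y s)‖ ≤ (L * (|D| + |D'|)) * ω s := by
    intro D'' y hy hor s
    refine (h.norm_comp_le hy s).trans (mul_le_mul_of_nonneg_right
      (mul_le_mul_of_nonneg_left ?_ h.L_nonneg) (h.adm.pos s).le)
    have := le_abs_self D; have := le_abs_self D'; have := abs_nonneg D; have := abs_nonneg D'
    rcases hor with rfl | rfl <;> linarith
  have := h.adm.norm_sub_le_of_fixed h.kernel h.L_nonneg h.contr (φ := x) (φ' := fun k => φ k v)
    (a := fun s => R s (x s)) (a' := fun s => R s (φ s v)) (η := fun k => S k v)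
    (η' := fun k => S k v) (B := L * (|D| + |D'|)) (C := 0) (c := 0) (D := D' + D)
    (hb D' x hD' (Or.inr rfl)) (hb D _ hD (Or.inl rfl))
    (fun s => by simpa using h.lip s _ _) (fun k => by simp) le_rfl le_rfl
    (fun k => (norm_sub_le _ _).trans (by rw [add_mul]; exact add_le_add (hD' k) (hD k)))
    hxeq (fun k => hφ.eq k v) k
  simp only [mul_zero, add_zero, zero_div, zero_mul] at this
  exact sub_eq_zero.1 (norm_le_zero_iff.1 this)

lemma norm_sub_le (h : FixedData g M L K ω G S R) (hφ : IsFixedFamily G ω S R φ) (v v' : V)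
    (k : ι) : ‖φ k v - φ k v'‖ ≤ K / (1 - M * L) * ω k * ‖v - v'‖ := by
  obtain ⟨D, hD⟩ := hφ.bdd v
  obtain ⟨D', hD'⟩ := hφ.bdd v'
  have h1 : ∀ s, ‖R s (φ s v)‖ ≤ (L * (|D| + |D'|)) * ω s := fun s => by
    refine (h.norm_comp_le hD s).trans (mul_le_mul_of_nonneg_right
      (mul_le_mul_of_nonneg_left ?_ h.L_nonneg) (h.adm.pos s).le)
    have := le_abs_self D; have := abs_nonneg D'
    linarith
  have h2 : ∀ s, ‖R s (φ s v')‖ ≤ (L * (|D| + |D'|)) * ω s := fun s => by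
    refine (h.norm_comp_le hD' s).trans (mul_le_mul_of_nonneg_right
      (mul_le_mul_of_nonneg_left ?_ h.L_nonneg) (h.adm.pos s).le)
    have := le_abs_self D'; have := abs_nonneg D
    linarith
  have := h.adm.norm_sub_le_of_fixed h.kernel h.L_nonneg h.contr (φ := fun k => φ k v)
    (φ' := fun k => φ k v')
    (a := fun s => R s (φ s v)) (a' := fun s => R s (φ s v')) (η := fun k => S k v)
    (η' := fun k => S k v') (B := L * (|D| + |D'|)) (C := K * ‖v - v'‖) (c := 0) (D := D + D')
    h1 h2 (fun s => by simpa using h.lip s _ _)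
    (fun k => by rw [← map_sub]; exact h.S_apply_le k _)
    (mul_nonneg h.K_nonneg (norm_nonneg _)) le_rfl
    (fun k => (_root_.norm_sub_le _ _).trans (by rw [add_mul]; exact add_le_add (hD k) (hD' k)))
    (fun k => hφ.eq k v) (fun k => hφ.eq k v') k
  refine this.trans (le_of_eq (by ring))

lemma apply_zero (h : FixedData g M L K ω G S R) (hφ : IsFixedFamily G ω S R φ) (k : ι) :
    φ k 0 = 0 :=
  (h.unique hφ (v := 0) (x := fun _ => 0) ⟨0, fun k => by simp⟩ (fun k => by simp [h.zero]) k).symm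

lemma norm_apply_le (h : FixedData g M L K ω G S R) (hφ : IsFixedFamily G ω S R φ) (v : V)
    (k : ι) : ‖φ k v‖ ≤ K / (1 - M * L) * ω k * ‖v‖ := by
  simpa [h.apply_zero hφ] using h.norm_sub_le hφ v 0 k

/-- Solutions of nearby equations are close. -/
lemma norm_sub_le_of_close (h : FixedData g M L K ω G S R) (h' : FixedData g M L K ω G S R')
    (hφ : IsFixedFamily G ω S R φ) (hφ' : IsFixedFamily G ω S R' φ') {ε : ℝ} (hε : 0 ≤ ε)
    (hR : ∀ s x, ‖R s x - R' s x‖ ≤ ε * ‖x‖) (v : V) (k : ι) :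
    ‖φ k v - φ' k v‖ ≤ M * (ε * (K / (1 - M * L)) * ‖v‖) / (1 - M * L) * ω k := by
  have hq1 : 0 < 1 - M * L := by linarith [h.contr]
  have hK := h.K_nonneg
  set D := K / (1 - M * L) * ‖v‖ with hD
  have hD0 : 0 ≤ D := by positivity
  have hb : ∀ k, ‖φ k v‖ ≤ D * ω k := fun k => (h.norm_apply_le hφ v k).trans
    (le_of_eq (by rw [hD]; ring))
  have hb' : ∀ k, ‖φ' k v‖ ≤ D * ω k := fun k => (h'.norm_apply_le hφ' v k).trans
    (le_of_eq (by rw [hD]; ring))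
  have := h.adm.norm_sub_le_of_fixed h.kernel h.L_nonneg h.contr (φ := fun k => φ k v)
    (φ' := fun k => φ' k v)
    (a := fun s => R s (φ s v)) (a' := fun s => R' s (φ' s v)) (η := fun k => S k v)
    (η' := fun k => S k v) (B := L * D) (C := 0) (c := ε * D) (D := D + D)
    (h.norm_comp_le hb) (h'.norm_comp_le hb') (fun s => by
      have e : R s (φ s v) - R' s (φ' s v) =
        (R s (φ s v) - R s (φ' s v)) + (R s (φ' s v) - R' s (φ' s v)) := by abel
      rw [e]
      refine (norm_add_le _ _).trans (add_le_add (h.lip s _ _) ((hR s _).trans ?_))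
      rw [mul_assoc]
      exact mul_le_mul_of_nonneg_left (hb' s) hε)
    (fun k => by simp) le_rfl (by positivity)
    (fun k => (_root_.norm_sub_le _ _).trans (by rw [add_mul]; exact add_le_add (hb k) (hb' k)))
    (fun k => hφ.eq k v) (fun k => hφ'.eq k v) k
  refine this.trans (le_of_eq ?_)
  rw [hD]; ring

end FixedData

end Nonlinear

/-! ### Differentiability and derivative bounds for nonlinear summation equations -/

section Smooth

universe u

variable {𝕂 : Type*} [RCLike 𝕂] {V X : Type u} [NormedAddCommGroup V] [NormedSpace 𝕂 V]
  [NormedAddCommGroup X] [NormedSpace 𝕂 X] {ι : Type*} {g : ι → ι → ℝ}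
  {M L K : ℝ} {ω ρ : ι → ℝ} {G : ι → ι → X →L[𝕂] X}
  {S : ι → V →L[𝕂] X} {R R' : ι → X → X} {φ φ' : ι → V → X}

lemma norm_fderiv_le_of_lip {R : X → X} (hL : 0 ≤ L) (h : ∀ x y, ‖R x - R y‖ ≤ L * ‖x - y‖)
    (x : X) : ‖fderiv 𝕂 R x‖ ≤ L :=
  norm_fderiv_le_of_lipschitz 𝕂 (C := ⟨L, hL⟩)
    (LipschitzWith.of_dist_le_mul fun x y => by rw [dist_eq_norm, dist_eq_norm]; exact h x y)

namespace FixedData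

variable [CompleteSpace X]

/-- The solution depends differentiably on the parameter, and its derivative solves the
linearized equation. -/
lemma exists_hasFDerivAt (h : FixedData g M L K ω G S R) (hφ : IsFixedFamily G ω S R φ)
    (hR : ∀ s, ContDiff 𝕂 1 (R s)) (v : V) :
    ∃ B : ι → V →L[𝕂] X, (∃ D, ∀ k, ‖B k‖ ≤ D * ω k) ∧
      (∀ k, B k = S k + ∑' s, postL V (G k s) (postL V (fderiv 𝕂 (R s) (φ s v)) (B s))) ∧
      ∀ k, HasFDerivAt (φ k) (B k) v := by
  have hq1 : 0 < 1 - M * L := by linarith [h.contr]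
  have hL := h.L_nonneg
  have hG' : ∀ k s, ‖postL V (G k s)‖ ≤ g k s := fun k s => (norm_postL_le _).trans (h.kernel k s)
  have hTL : ∀ s x, ‖fderiv 𝕂 (R s) x‖ ≤ L := fun s => norm_fderiv_le_of_lip h.L_nonneg (h.lip s)
  obtain ⟨B, ⟨DB, hDB⟩, hBeq⟩ := h.adm.exists_fixed hG' h.L_nonneg h.contr
    (T := fun s => postL V (fderiv 𝕂 (R s) (φ s v))) (fun s => map_zero _)
    (fun s y y' => by
      rw [← map_sub]
      exact ((postL V (fderiv 𝕂 (R s) (φ s v))).le_opNorm _).trans (mul_le_mul_of_nonneg_right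
        ((norm_postL_le _).trans (hTL s _)) (norm_nonneg _))) h.S_le
  refine ⟨B, ⟨DB, hDB⟩, hBeq, ?_⟩
  set C1 := K / (1 - M * L) with hC1
  have hC10 : 0 ≤ C1 := div_nonneg h.K_nonneg hq1.le
  have hlip : ∀ k a, ‖φ k a - φ k v‖ ≤ C1 * ω k * ‖a - v‖ := fun k a => h.norm_sub_le hφ a v k
  have hpos := h.adm.pos
  have hdR : ∀ s, Differentiable 𝕂 (R s) := fun s => (hR s).differentiable one_ne_zero
  -- The Taylor remainder of R along the solution is o(‖a - v‖) at each index, because φ is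
  -- Lipschitz in the parameter.
  set rem : V → ι → X := fun a s =>
    R s (φ s a) - R s (φ s v) - fderiv 𝕂 (R s) (φ s v) (φ s a - φ s v) with hrem
  have hremb : ∀ a s, ‖rem a s‖ ≤ 2 * L * C1 * ω s * ‖a - v‖ := fun a s => by
    refine (_root_.norm_sub_le _ _).trans ?_
    have h1 := h.lip s (φ s a) (φ s v)
    have h2 := ((fderiv 𝕂 (R s) (φ s v)).le_opNorm (φ s a - φ s v)).trans
      (mul_le_mul_of_nonneg_right (hTL s _) (norm_nonneg _))
    have h3 := mul_le_mul_of_nonneg_left (hlip s a) h.L_nonneg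
    linarith
  have hcont : ∀ s, Tendsto (φ s) (𝓝 v) (𝓝 (φ s v)) := fun s => by
    rw [tendsto_iff_norm_sub_tendsto_zero]
    refine squeeze_zero (fun _ => norm_nonneg _) (fun a => hlip s a) ?_
    simpa using (tendsto_iff_norm_sub_tendsto_zero.1
      (tendsto_id : Tendsto (fun a : V => a) (𝓝 v) (𝓝 v))).const_mul (C1 * ω s)
  refine hasFDerivAt_of_fixed h.adm h.kernel h.L_nonneg h.contr (τ := fun s a => R s (φ s a))
    (H := fun k a => S k a) (H' := S) (T := fun s => fderiv 𝕂 (R s) (φ s v)) (Q := fun _ => 0)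
    (B := B) (C := C1 + |DB| + 2 * L * C1) (r := fun a s => ‖a - v‖⁻¹ * ‖rem a s‖)
    (fun k a => hφ.eq k a) (fun a => ?_) (fun k => (S k).hasFDerivAt) (fun k a => ?_)
    (fun s => hTL s _) (fun s => ?_) (fun k => ?_) (fun k => ?_) (fun a s => ⟨by positivity, ?_⟩)
    (fun s => ?_) (fun a s => ?_)
  · obtain ⟨D, hD⟩ := hφ.bdd a
    exact ⟨L * D, h.norm_comp_le hD⟩
  · refine (hlip k a).trans (mul_le_mul_of_nonneg_right (mul_le_mul_of_nonneg_right ?_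
      (hpos k).le) (norm_nonneg _))
    have := abs_nonneg DB
    have : 0 ≤ 2 * L * C1 := by positivity
    linarith
  · have := abs_nonneg DB
    simpa using mul_nonneg (by positivity : 0 ≤ C1 + |DB| + 2 * L * C1) (hpos s).le
  · refine (hDB k).trans (mul_le_mul_of_nonneg_right ?_ (hpos k).le)
    have := le_abs_self DB
    have : 0 ≤ 2 * L * C1 := by positivity
    linarith
  · simp only [add_zero]
    exact hBeq k
  · calc ‖a - v‖⁻¹ * ‖rem a s‖ ≤ ‖a - v‖⁻¹ * (2 * L * C1 * ω s * ‖a - v‖) :=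
          mul_le_mul_of_nonneg_left (hremb a s) (by positivity)
      _ = 2 * L * C1 * ω s * (‖a - v‖⁻¹ * ‖a - v‖) := by ring
      _ ≤ 2 * L * C1 * ω s * 1 := mul_le_mul_of_nonneg_left inv_mul_le_one
          (mul_nonneg (by positivity) (hpos s).le)
      _ ≤ _ := by
        rw [mul_one]
        exact mul_le_mul_of_nonneg_right (by have := abs_nonneg DB; linarith) (hpos s).le
  · have hd : HasFDerivAt (fun a => rem a s) (0 : V →L[𝕂] X) v := by
      refine HasFDerivAt.of_isLittleO ?_
      have h1 := ((hdR s (φ s v)).hasFDerivAt.isLittleO).comp_tendsto (hcont s)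
      have h2 : (fun a => φ s a - φ s v) =O[𝓝 v] fun a => a - v :=
        Asymptotics.IsBigO.of_bound (C1 * ω s) (Eventually.of_forall fun a => hlip s a)
      refine (h1.trans_isBigO h2).congr_left fun a => ?_
      simp [hrem]
    have := hasFDerivAt_iff_tendsto.1 hd
    simpa [hrem] using this
  · have e : R s (φ s a) - R s (φ s v) - (fderiv 𝕂 (R s) (φ s v) (φ s a - φ s v) +
        (0 : V →L[𝕂] X) (a - v)) = rem a s := by simp [hrem]
    rw [e]
    rcases eq_or_ne a v with rfl | hne
    · simp [hrem]
    · have : ‖a - v‖ ≠ 0 := norm_ne_zero_iff.2 (sub_ne_zero.2 hne)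
      refine le_of_eq ?_
      field_simp

lemma differentiable (h : FixedData g M L K ω G S R) (hφ : IsFixedFamily G ω S R φ)
    (hR : ∀ s, ContDiff 𝕂 1 (R s)) (k : ι) : Differentiable 𝕂 (φ k) := fun v => by
  obtain ⟨B, -, -, hB⟩ := h.exists_hasFDerivAt hφ hR v
  exact (hB k).differentiableAt

lemma fderiv_bdd (h : FixedData g M L K ω G S R) (hφ : IsFixedFamily G ω S R φ)
    (hR : ∀ s, ContDiff 𝕂 1 (R s)) (v : V) : ∃ D, ∀ k, ‖fderiv 𝕂 (φ k) v‖ ≤ D * ω k := by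
  obtain ⟨B, ⟨D, hD⟩, -, hB⟩ := h.exists_hasFDerivAt hφ hR v
  exact ⟨D, fun k => by rw [(hB k).fderiv]; exact hD k⟩

lemma fderiv_eq (h : FixedData g M L K ω G S R) (hφ : IsFixedFamily G ω S R φ)
    (hR : ∀ s, ContDiff 𝕂 1 (R s)) (k : ι) (v : V) : fderiv 𝕂 (φ k) v =
      S k + ∑' s, postL V (G k s) (postL V (fderiv 𝕂 (R s) (φ s v)) (fderiv 𝕂 (φ s) v)) := by
  obtain ⟨B, -, hBeq, hB⟩ := h.exists_hasFDerivAt hφ hR v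
  simp_rw [fun s => (hB s).fderiv]
  exact hBeq k

end FixedData

/-- Constants in the derivative bounds for solutions of nonlinear summation equations. -/
def nonlinConst (M L K CR : ℝ) : ℕ → ℝ
  | 0 => linConst M L CR 0 K
  | n + 1 => linConst M L
      ((n + 1).factorial * CR * max 1 (nonlinConst M L K CR n) ^ (n + 1)) (n + 1) K

section Bounds

/-- The derivative of order l is bounded by c ω ρ^(l-1); with ω ≤ ρ this takes the form D ρ^l needed
for compositions. Order 0 is excluded, as φ itself grows with v. -/
lemma norm_iteratedFDeriv_le_of_fderiv {n : ℕ} {c ρ ω : ℝ} {φ : V → X} (hρ : 1 ≤ ρ) (hω : 0 ≤ ω)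
    (hωρ : ω ≤ ρ) (hc : CBound 𝕂 n (fun _ => c * 1 * ω) ρ (fderiv 𝕂 φ)) (l : ℕ)
    (hl1 : 1 ≤ l) (hl : l ≤ n + 1) (v : V) :
    ‖iteratedFDeriv 𝕂 l φ v‖ ≤ max 1 c * ρ ^ l := by
  obtain ⟨l, rfl⟩ : ∃ l', l = l' + 1 := ⟨l - 1, by omega⟩
  rw [← norm_iteratedFDeriv_fderiv]
  have hρ0 : 0 ≤ ρ := zero_le_one.trans hρ
  refine (hc.2 l (by omega) v).trans ?_
  rw [pow_succ, ← mul_assoc, mul_one, mul_right_comm]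
  exact mul_le_mul (mul_le_mul_of_nonneg_right (le_max_right _ _) (pow_nonneg hρ0 l)) hωρ hω
    (mul_nonneg (zero_le_one.trans (le_max_left _ _)) (pow_nonneg hρ0 l))

lemma contDiff_succ_of_fderiv {n : ℕ} {φ : V → X} (hd : Differentiable 𝕂 φ)
    (h : ContDiff 𝕂 n (fderiv 𝕂 φ)) : ContDiff 𝕂 (n + 1 : ℕ) φ := by
  push_cast
  exact contDiff_succ_iff_fderiv.2 ⟨hd, by simp, h⟩

end Bounds

namespace FixedData

/-- The linearization along the solution, acting on `V →L X`, satisfies derivative bounds if the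
solution does. -/
lemma cBound_linearization {n : ℕ} {c CR ρ : ℝ} {R : X → X} {φ : V → X} (hρ : 1 ≤ ρ)
    (hR : ContDiff 𝕂 (n + 1 : ℕ) R)
    (hRb : ∀ l, 1 ≤ l → l ≤ n + 1 → ∀ x, ‖iteratedFDeriv 𝕂 l R x‖ ≤ CR)
    (hφ : ContDiff 𝕂 n φ)
    (hφb : ∀ l, 1 ≤ l → l ≤ n → ∀ v, ‖iteratedFDeriv 𝕂 l φ v‖ ≤ max 1 c * ρ ^ l) :
    CBound 𝕂 n (fun _ => n.factorial * CR * max 1 c ^ n) ρ (fun v => fderiv 𝕂 R (φ v)) :=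
  CBound.comp_left (hR.fderiv_right (by norm_cast))
    (fun l hl x => by rw [norm_iteratedFDeriv_fderiv]; exact hRb (l + 1) (by omega) (by omega) x)
    hφ (le_max_left _ _) (zero_le_one.trans hρ) hφb

lemma cBound_postL {n : ℕ} {c ρ : ℝ} {T : V → X →L[𝕂] X} (hρ : 0 ≤ ρ)
    (h : CBound 𝕂 n (fun _ => c) ρ T) : CBound 𝕂 n (fun _ => c) ρ (fun v => postL V (T v)) :=
  (h.clm_comp (ContinuousLinearMap.compL 𝕂 V X X)
    (ContinuousLinearMap.norm_compL_le 𝕂 V X X)).mono hρ fun v => by simp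

variable [CompleteSpace X]

/-- Weighted bounds on all derivatives of the solution. -/
theorem cBound_fderiv (h : FixedData g M L K ω G S R) (hφ : IsFixedFamily G ω S R φ)
    (hρ : ∀ k, 1 ≤ ρ k) (hωρ : ∀ k, ω k ≤ ρ k) {CR : ℝ} (hCR : L ≤ CR) (n : ℕ)
    (hadm : ∀ l ≤ n, Admissible g M fun k => ω k * ρ k ^ l)
    (hR : ∀ s, ContDiff 𝕂 (n + 1 : ℕ) (R s))
    (hRb : ∀ s l, 1 ≤ l → l ≤ n + 1 → ∀ x, ‖iteratedFDeriv 𝕂 l (R s) x‖ ≤ CR) :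
    ∀ k, CBound 𝕂 n (fun _ => nonlinConst M L K CR n * 1 * ω k) (ρ k) (fderiv 𝕂 (φ k)) := by
  have hL := h.L_nonneg
  have hCR0 : 0 ≤ CR := h.L_nonneg.trans hCR
  have hG' : ∀ k s, ‖postL V (G k s)‖ ≤ g k s := fun k s => (norm_postL_le _).trans (h.kernel k s)
  have hρ0 : ∀ k, 0 ≤ ρ k := fun k => zero_le_one.trans (hρ k)
  have hTL : ∀ s v, ‖postL V (fderiv 𝕂 (R s) (φ s v))‖ ≤ L := fun s v =>
    (norm_postL_le _).trans (norm_fderiv_le_of_lip h.L_nonneg (h.lip s) _)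
  have hR1 : ∀ s, ContDiff 𝕂 1 (R s) := fun s => (hR s).of_le (by
    exact_mod_cast (by omega : 1 ≤ n + 1))
  have hS : ∀ m k, CBound 𝕂 m (fun _ : V => K * 1 * ω k) (ρ k) (fun _ => S k) := fun m k =>
    cBound_const (hρ0 k) (by simpa using h.S_le k)
  have hbdd := h.fderiv_bdd hφ hR1
  have heq := h.fderiv_eq hφ hR1
  have hdiff := h.differentiable hφ hR1
  induction n with
  | zero =>
    refine cBound_of_linear (L := L) hρ h.L_nonneg h.contr hCR0 (fun _ => le_rfl)
      (fun _ => zero_le_one) 0 (H := fun k _ => S k) (A := fun k => fderiv 𝕂 (φ k))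
      (T := fun s v => postL V (fderiv 𝕂 (R s) (φ s v))) (G := fun k s => postL V (G k s))
      hadm hG' h.K_nonneg hTL (fun s => ?_) (hS 0) hbdd heq
    refine cBound_postL (hρ0 s) ⟨?_, fun l hl v => ?_⟩
    · simp only [Nat.cast_zero, contDiff_zero]
      exact ((hR1 s).continuous_fderiv one_ne_zero).comp (hdiff s).continuous
    · obtain rfl : l = 0 := by omega
      simpa [norm_iteratedFDeriv_zero] using
        (norm_fderiv_le_of_lip h.L_nonneg (h.lip s) (φ s v)).trans hCR
  | succ n ih =>
    -- Bootstrap: bounds on φ up to order n + 1 give bounds on the coefficient DR(φ) up to order n +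
    -- 1, and the linear theory then bounds Dφ to that order.
    have ih' := ih (fun l hl => hadm l (by omega))
      (fun s => (hR s).of_le (by exact_mod_cast Nat.le_succ _))
      (fun s l hl hl' => hRb s l hl (by omega))
    refine cBound_of_linear (L := L) hρ h.L_nonneg h.contr (by positivity) (fun _ => le_rfl)
      (fun _ => zero_le_one) (n + 1) (H := fun k _ => S k) (A := fun k => fderiv 𝕂 (φ k))
      (T := fun s v => postL V (fderiv 𝕂 (R s) (φ s v))) (G := fun k s => postL V (G k s))
      hadm hG' h.K_nonneg hTL (fun s => ?_) (hS (n + 1)) hbdd heq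
    refine cBound_postL (hρ0 s) (cBound_linearization (hρ s) (hR s)
      (hRb s) (contDiff_succ_of_fderiv (hdiff s) (ih' s).1) fun l hl hl' v => ?_)
    exact norm_iteratedFDeriv_le_of_fderiv (hρ s) (h.adm.pos s).le (hωρ s) (ih' s) l hl hl' v

theorem contDiff (h : FixedData g M L K ω G S R) (hφ : IsFixedFamily G ω S R φ)
    (hρ : ∀ k, 1 ≤ ρ k) (hωρ : ∀ k, ω k ≤ ρ k) {CR : ℝ} (hCR : L ≤ CR) (n : ℕ)
    (hadm : ∀ l ≤ n, Admissible g M fun k => ω k * ρ k ^ l)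
    (hR : ∀ s, ContDiff 𝕂 (n + 1 : ℕ) (R s))
    (hRb : ∀ s l, 1 ≤ l → l ≤ n + 1 → ∀ x, ‖iteratedFDeriv 𝕂 l (R s) x‖ ≤ CR) (k : ι) :
    ContDiff 𝕂 (n + 1 : ℕ) (φ k) :=
  contDiff_succ_of_fderiv
    (h.differentiable hφ (fun s => (hR s).of_le (by exact_mod_cast (by omega : 1 ≤ n + 1))) k)
    (h.cBound_fderiv hφ hρ hωρ hCR n hadm hR hRb k).1

end FixedData

/-- Constants in the bounds for the difference of the derivatives of two solutions. -/
def cmpConst (M L CR CE c d : ℝ) : ℕ → ℝ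
  | 0 => d
  | j + 1 => max (cmpConst M L CR CE c d j)
      (linConst M L (j.factorial * CR * max 1 c ^ j) j
        (M * (2 ^ j * (max (j.factorial * CE * max 1 c ^ j +
            compSubConst CR (max 1 c) j * cmpConst M L CR CE c d j)
          (2 * (j.factorial * CR * max 1 c ^ j)) * c))))

lemma cmpConst_nonneg {M L CR CE c d : ℝ} (hd : 0 ≤ d) (n : ℕ) :
    0 ≤ cmpConst M L CR CE c d n := by
  induction n with
  | zero => exact hd
  | succ n ih => exact ih.trans (le_max_left _ _)

namespace FixedData

/-- The difference of the derivatives of two solutions solves a linear equation. -/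
lemma fderiv_sub_eq [CompleteSpace X] (h : FixedData g M L K ω G S R)
    (h' : FixedData g M L K ω G S R') (hφ : IsFixedFamily G ω S R φ)
    (hφ' : IsFixedFamily G ω S R' φ') (hR : ∀ s, ContDiff 𝕂 1 (R s))
    (hR' : ∀ s, ContDiff 𝕂 1 (R' s)) (k : ι) (v : V) :
    fderiv 𝕂 (φ k) v - fderiv 𝕂 (φ' k) v =
      ∑' s, postL V (G k s) (postL V (fderiv 𝕂 (R s) (φ s v) - fderiv 𝕂 (R' s) (φ' s v))
        (fderiv 𝕂 (φ' s) v)) +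
      ∑' s, postL V (G k s) (postL V (fderiv 𝕂 (R s) (φ s v))
        (fderiv 𝕂 (φ s) v - fderiv 𝕂 (φ' s) v)) := by
  have hL := h.L_nonneg
  have hG' : ∀ k s, ‖postL V (G k s)‖ ≤ g k s := fun k s => (norm_postL_le _).trans (h.kernel k s)
  obtain ⟨D, hD⟩ := h.fderiv_bdd hφ hR v
  obtain ⟨D', hD'⟩ := h'.fderiv_bdd hφ' hR' v
  have hn : ∀ (T : X →L[𝕂] X) (B : V →L[𝕂] X) (a b w : ℝ), 0 ≤ a → ‖T‖ ≤ a → ‖B‖ ≤ b * w →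
      ‖postL V T B‖ ≤ a * b * w := fun T B a b w ha hT hB =>
    (ContinuousLinearMap.opNorm_comp_le T B).trans
      ((mul_le_mul hT hB (norm_nonneg _) ha).trans (le_of_eq (by ring)))
  have hT : ∀ s, ‖fderiv 𝕂 (R s) (φ s v)‖ ≤ L := fun s => norm_fderiv_le_of_lip hL (h.lip s) _
  have hT' : ∀ s, ‖fderiv 𝕂 (R' s) (φ' s v)‖ ≤ L := fun s => norm_fderiv_le_of_lip hL (h'.lip s) _
  have hs1 := h.adm.summable_apply hG' (fun s => hn _ _ _ _ _ hL (hT s) (hD s)) k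
  have hs2 := h.adm.summable_apply hG' (fun s => hn _ _ _ _ _ hL (hT' s) (hD' s)) k
  have hs3 := h.adm.summable_apply hG' (fun s => hn _ _ _ _ _ (add_nonneg hL hL)
    ((_root_.norm_sub_le _ _).trans (add_le_add (hT s) (hT' s))) (hD' s)) k
  have hs4 := h.adm.summable_apply hG' (fun s => hn _ _ L (D + D') (ω s) hL (hT s)
    ((_root_.norm_sub_le _ _).trans ((add_le_add (hD s) (hD' s)).trans
      (le_of_eq (add_mul _ _ _).symm)))) k
  rw [h.fderiv_eq hφ hR k v, h'.fderiv_eq hφ' hR' k v, add_sub_add_left_eq_sub,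
    ← hs1.tsum_sub hs2, ← hs3.tsum_add hs4]
  refine tsum_congr fun s => ?_
  rw [← map_sub, ← map_add]
  congr 1
  ext x
  simp

set_option maxHeartbeats 400000 in
/-- The derivatives of the solutions of two nearby equations are close. -/
theorem cBound_sub [CompleteSpace X] (h : FixedData g M L K ω G S R) (h' : FixedData g M L K ω G S R')
    (hφ : IsFixedFamily G ω S R φ) (hφ' : IsFixedFamily G ω S R' φ')
    (hρ : ∀ k, 1 ≤ ρ k) (hωρ : ∀ k, ω k ≤ ρ k) {CR CE ε : ℝ} (hM : 0 ≤ M)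
    (hCE : 0 ≤ CE) (hCR : L ≤ CR) (hε : 0 ≤ ε) {n : ℕ}
    (hadm : ∀ l ≤ n + 1, Admissible g M fun k => ω k * ρ k ^ l)
    (hR : ∀ s, ContDiff 𝕂 (n + 2 : ℕ) (R s)) (hR' : ∀ s, ContDiff 𝕂 (n + 2 : ℕ) (R' s))
    (hRb : ∀ s l, 1 ≤ l → l ≤ n + 2 → ∀ x, ‖iteratedFDeriv 𝕂 l (R s) x‖ ≤ CR)
    (hRb' : ∀ s l, 1 ≤ l → l ≤ n + 2 → ∀ x, ‖iteratedFDeriv 𝕂 l (R' s) x‖ ≤ CR)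
    (hE0 : ∀ s x, ‖R s x - R' s x‖ ≤ ε * CE * ‖x‖)
    (hEb : ∀ s l, 1 ≤ l → l ≤ n + 2 → ∀ x,
      ‖iteratedFDeriv 𝕂 l (fun x => R s x - R' s x) x‖ ≤ ε * CE)
    (j : ℕ) (hj : j ≤ n + 1) (k : ι) :
    CBound 𝕂 j (fun v => cmpConst M L CR CE (nonlinConst M L K CR n)
      (M * (CE * (K / (1 - M * L))) / (1 - M * L)) j * (ε * (1 + ‖v‖)) * ω k) (ρ k)
      (fun v => φ k v - φ' k v) := by
  have hq1 : 0 < 1 - M * L := by linarith [h.contr]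
  have hK := h.K_nonneg
  have hCR0 : 0 ≤ CR := h.L_nonneg.trans hCR
  have hpos := h.adm.pos
  have hρ0 : ∀ k, 0 ≤ ρ k := fun k => zero_le_one.trans (hρ k)
  have hG' : ∀ k s, ‖postL V (G k s)‖ ≤ g k s := fun k s => (norm_postL_le _).trans (h.kernel k s)
  set c := nonlinConst M L K CR n with hc
  set d := M * (CE * (K / (1 - M * L))) / (1 - M * L) with hd
  have hd0 : 0 ≤ d := div_nonneg (mul_nonneg hM (mul_nonneg hCE (div_nonneg hK hq1.le))) hq1.le
  set D := max 1 c with hD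
  have hD1 : 1 ≤ D := le_max_left _ _
  have hD0 : 0 ≤ D := zero_le_one.trans hD1
  have hn1 : ((n + 1 : ℕ) : WithTop ℕ∞) ≤ ((n + 2 : ℕ) : WithTop ℕ∞) := by
    exact_mod_cast Nat.le_succ _
  have h1n : (1 : WithTop ℕ∞) ≤ ((n + 2 : ℕ) : WithTop ℕ∞) := by
    exact_mod_cast (by omega : 1 ≤ n + 2)
  have hR1 : ∀ s, ContDiff 𝕂 1 (R s) := fun s => (hR s).of_le h1n
  have hR1' : ∀ s, ContDiff 𝕂 1 (R' s) := fun s => (hR' s).of_le h1n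
  have hA := h.cBound_fderiv hφ hρ hωρ hCR n (fun l hl => hadm l (by omega))
    (fun s => (hR s).of_le hn1) (fun s l hl hl' => hRb s l hl (by omega))
  have hA' := h'.cBound_fderiv hφ' hρ hωρ hCR n (fun l hl => hadm l (by omega))
    (fun s => (hR' s).of_le hn1) (fun s l hl hl' => hRb' s l hl (by omega))
  rw [← hc] at hA hA'
  have hdφ := h.differentiable hφ hR1
  have hdφ' := h'.differentiable hφ' hR1'
  have hcφ : ∀ k, ContDiff 𝕂 (n + 1 : ℕ) (φ k) := fun k =>
    contDiff_succ_of_fderiv (hdφ k) (hA k).1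
  have hcφ' : ∀ k, ContDiff 𝕂 (n + 1 : ℕ) (φ' k) := fun k =>
    contDiff_succ_of_fderiv (hdφ' k) (hA' k).1
  have hφb : ∀ k l, 1 ≤ l → l ≤ n + 1 → ∀ v, ‖iteratedFDeriv 𝕂 l (φ k) v‖ ≤ D * ρ k ^ l :=
    fun k => norm_iteratedFDeriv_le_of_fderiv (hρ k) (hpos k).le (hωρ k) (hA k)
  have hφb' : ∀ k l, 1 ≤ l → l ≤ n + 1 → ∀ v, ‖iteratedFDeriv 𝕂 l (φ' k) v‖ ≤ D * ρ k ^ l :=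
    fun k => norm_iteratedFDeriv_le_of_fderiv (hρ k) (hpos k).le (hωρ k) (hA' k)
  have hval : ∀ k v, ‖φ k v - φ' k v‖ ≤ d * (ε * (1 + ‖v‖)) * ω k := fun k v => by
    have := h.norm_sub_le_of_close h' hφ hφ' (mul_nonneg hε hCE) hE0 v k
    refine this.trans (mul_le_mul_of_nonneg_right ?_ (hpos k).le)
    have e : M * (ε * CE * (K / (1 - M * L)) * ‖v‖) / (1 - M * L) = d * (ε * ‖v‖) := by
      rw [hd]; ring
    rw [e]
    refine mul_le_mul_of_nonneg_left (mul_le_mul_of_nonneg_left ?_ hε) hd0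
    linarith
  induction j generalizing k with
  | zero =>
    refine ⟨?_, fun l hl v => ?_⟩
    · exact ((hcφ k).sub (hcφ' k)).of_le (by exact_mod_cast Nat.zero_le _)
    · obtain rfl : l = 0 := by omega
      simpa [norm_iteratedFDeriv_zero, cmpConst] using hval k v
  | succ j ih =>
    have hjn : j ≤ n := by omega
    have ih' := ih (by omega)
    have hcj : ∀ m : ℕ, m ≤ n + 1 → ((m : ℕ) : WithTop ℕ∞) ≤ ((n + 1 : ℕ) : WithTop ℕ∞) :=
      fun m hm => by exact_mod_cast hm
    have hcj2 : ∀ m : ℕ, m ≤ n + 2 → ((m : ℕ) : WithTop ℕ∞) ≤ ((n + 2 : ℕ) : WithTop ℕ∞) :=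
      fun m hm => by exact_mod_cast hm
    set dj := cmpConst M L CR CE c d j with hdj
    have hdj0 : 0 ≤ dj := cmpConst_nonneg hd0 j
    set Cm := (j.factorial : ℝ) * CR * D ^ j with hCm
    have hCm0 : 0 ≤ Cm := by positivity
    set t1 := (j.factorial : ℝ) * CE * D ^ j + compSubConst CR D j * dj with ht1
    have ht10 : 0 ≤ t1 := add_nonneg (by positivity)
      (mul_nonneg (compSubConst_nonneg hCR0 hD0 j) hdj0)
    set t := max t1 (2 * Cm) with ht
    have ht0 : 0 ≤ t := ht10.trans (le_max_left _ _)
    have hTb : ∀ s, CBound 𝕂 j (fun _ => Cm) (ρ s) (fun v => fderiv 𝕂 (R s) (φ s v)) := fun s =>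
      cBound_linearization (hρ s) ((hR s).of_le (hcj2 _ (by omega)))
        (fun l hl hl' => hRb s l hl (by omega)) ((hcφ s).of_le (hcj _ (by omega)))
        (fun l hl hl' => hφb s l hl (by omega))
    have hTb' : ∀ s, CBound 𝕂 j (fun _ => Cm) (ρ s) (fun v => fderiv 𝕂 (R' s) (φ' s v)) :=
      fun s => cBound_linearization (hρ s) ((hR' s).of_le (hcj2 _ (by omega)))
        (fun l hl hl' => hRb' s l hl (by omega)) ((hcφ' s).of_le (hcj _ (by omega)))
        (fun l hl hl' => hφb' s l hl (by omega))
    set T2 : ι → V → X →L[𝕂] X := fun s v => fderiv 𝕂 (R s) (φ s v) - fderiv 𝕂 (R' s) (φ' s v)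
      with hT2
    -- The cut-off at 1 is needed since `CBound.tsum` and `cBound_of_linear` require a bounded η.
    -- For large v the uniform bounds on both linearizations suffice.
    set η : V → ℝ := fun v => min (ε * (1 + ‖v‖)) 1 with hη
    have hη0 : ∀ v, 0 ≤ η v := fun v => le_min (by positivity) zero_le_one
    have hT2b : ∀ s, CBound 𝕂 j (fun v => t * η v * ρ s) (ρ s) (T2 s) := by
      intro s
      have hdR := (hR1 s).differentiable one_ne_zero
      have hdR' := (hR1' s).differentiable one_ne_zero
      -- DR(φ) - DR'(φ') splits into D(R - R')(φ), of size ε, and DR'(φ) - DR'(φ'), controlled by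
      -- the induction hypothesis on φ - φ'. The second part uses derivatives of R' up to order j +
      -- 2 to reach order j + 1, which is the loss of one derivative.
      have hEj : CBound 𝕂 j (fun _ => j.factorial * (ε * CE) * D ^ j) (ρ s)
          (fun v => fderiv 𝕂 (fun x => R s x - R' s x) (φ s v)) := by
        refine cBound_linearization (hρ s)
          (((hR s).sub (hR' s)).of_le (hcj2 _ (by omega)))
          (fun l hl hl' => hEb s l hl (by omega)) ((hcφ s).of_le (hcj _ (by omega)))
          (fun l hl hl' => hφb s l hl (by omega))
      have hcs := cBound_comp_sub_comp (𝕂 := 𝕂) (c := CR) (D := D) (hρ0 s) hD1 j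
        (F := fderiv 𝕂 (R' s)) (φ := φ s) (φ' := φ' s)
        (((hR' s).of_le (hcj2 (j + 2) (by omega))).fderiv_right (by norm_cast))
        (fun l hl y => by
          rw [norm_iteratedFDeriv_fderiv]; exact hRb' s (l + 1) (by omega) (by omega) y)
        ((hcφ s).of_le (hcj _ (by omega))) ((hcφ' s).of_le (hcj _ (by omega)))
        (fun l hl hl' => hφb s l hl (by omega)) (fun l hl hl' => hφb' s l hl (by omega)) (ih' s)
      have hsum := hEj.add hcs
      have hfun : (fun v => fderiv 𝕂 (fun x => R s x - R' s x) (φ s v) +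
          (fderiv 𝕂 (R' s) (φ s v) - fderiv 𝕂 (R' s) (φ' s v))) = T2 s := by
        funext v
        rw [fderiv_fun_sub (hdR _) (hdR' _)]
        simp only [hT2]; abel
      rw [hfun] at hsum
      have hcr := (hTb s).sub (hTb' s)
      refine ⟨hsum.1, fun l hl v => ?_⟩
      have h1 := hsum.2 l hl v
      have h2 : ‖iteratedFDeriv 𝕂 l (T2 s) v‖ ≤ (Cm + Cm) * ρ s ^ l := hcr.2 l hl v
      have hρl : 0 ≤ ρ s ^ l := pow_nonneg (hρ0 s) l
      have hCs := compSubConst_nonneg hCR0 hD0 j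
      beta_reduce
      rcases le_total (ε * (1 + ‖v‖)) 1 with hle | hle
      · have : η v = ε * (1 + ‖v‖) := min_eq_left hle
        rw [this]
        refine h1.trans (mul_le_mul_of_nonneg_right ?_ hρl)
        have e1 : (j.factorial : ℝ) * (ε * CE) * D ^ j ≤
            (j.factorial : ℝ) * CE * D ^ j * (ε * (1 + ‖v‖)) * ρ s := by
          have a1 : ε * 1 * 1 ≤ ε * (1 + ‖v‖) * ρ s :=
            mul_le_mul (mul_le_mul_of_nonneg_left (by linarith [norm_nonneg v]) hε) (hρ s)
              zero_le_one (by positivity)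
          have a2 := mul_le_mul_of_nonneg_left a1
            (by positivity : 0 ≤ (j.factorial : ℝ) * CE * D ^ j)
          linarith
        have e2 : compSubConst CR D j * (dj * (ε * (1 + ‖v‖)) * ω s) ≤
            compSubConst CR D j * dj * (ε * (1 + ‖v‖)) * ρ s := by
          have a1 := mul_le_mul_of_nonneg_left (hωρ s)
            (by positivity : 0 ≤ compSubConst CR D j * dj * (ε * (1 + ‖v‖)))
          linarith
        have e3 : t1 * (ε * (1 + ‖v‖)) * ρ s ≤ t * (ε * (1 + ‖v‖)) * ρ s :=
          mul_le_mul_of_nonneg_right (mul_le_mul_of_nonneg_right (le_max_left _ _)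
            (by positivity)) (hρ0 s)
        refine (add_le_add e1 e2).trans (le_trans (le_of_eq ?_) e3)
        rw [ht1]; ring
      · have : η v = 1 := min_eq_right hle
        rw [this, mul_one]
        refine h2.trans (mul_le_mul_of_nonneg_right ?_ hρl)
        calc Cm + Cm = 2 * Cm * 1 := by ring
          _ ≤ t * ρ s := mul_le_mul (le_max_right _ _) (hρ s) zero_le_one ht0
    have hc0 : 0 ≤ c := by
      have := (hA k).nonneg 0
      rw [mul_one] at this
      exact nonneg_of_mul_nonneg_left this (hpos k)
    have hprod : ∀ s, CBound 𝕂 j (fun v => 2 ^ j * (t * c) * η v * (ω s * ρ s)) (ρ s)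
        (fun v => postL V (T2 s v) (fderiv 𝕂 (φ' s) v)) := fun s =>
      ((hT2b s).bilin ((hA' s).of_le hjn) (ContinuousLinearMap.compL 𝕂 V X X)
        (ContinuousLinearMap.norm_compL_le 𝕂 V X X) (hρ0 s)).mono (hρ0 s)
        fun v => le_of_eq (by ring)
    have hadm' : ∀ l ≤ j, Admissible g M fun k => (ω k * ρ k) * ρ k ^ l := fun l hl => by
      have := hadm (l + 1) (by omega)
      simpa [pow_succ, mul_assoc, mul_comm, mul_left_comm] using this
    have had : Admissible g M fun k => ω k * ρ k := by simpa using hadm' 0 (Nat.zero_le j)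
    have hH := CBound.tsum (𝕂 := 𝕂) hadm' hG' (by positivity) (fun v => min_le_right _ _) hprod
    have hωρ1 : ∀ k, ω k ≤ ω k * ρ k := fun k => le_mul_of_one_le_right (hpos k).le (hρ k)
    have hlin := cBound_of_linear (𝕂 := 𝕂) (L := L) (Cm := Cm) hρ h.L_nonneg h.contr hCm0
      (fun v => min_le_right (ε * (1 + ‖v‖)) 1) hη0 j (G := fun k s => postL V (G k s))
      (ζ := fun k => ω k * ρ k) (c := M * (2 ^ j * (t * c)))
      (T := fun s v => postL V (fderiv 𝕂 (R s) (φ s v)))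
      (H := fun k v => ∑' s, postL V (G k s) (postL V (T2 s v) (fderiv 𝕂 (φ' s) v)))
      (A := fun k v => fderiv 𝕂 (φ k) v - fderiv 𝕂 (φ' k) v) hadm' hG' (by positivity)
      (fun s v => (norm_postL_le _).trans (norm_fderiv_le_of_lip h.L_nonneg (h.lip s) _))
      (fun s => cBound_postL (hρ0 s) (hTb s))
      (fun k => (hH k).mono (hρ0 k) fun v => le_of_eq (by ring))
      (fun v => by
        refine ⟨c + c, fun k => ?_⟩
        have h1 := (hA k).norm_le v
        have h2 := (hA' k).norm_le v
        have h3 := mul_le_mul_of_nonneg_left (hωρ1 k) (by positivity : 0 ≤ c + c)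
        refine (_root_.norm_sub_le _ _).trans ?_
        linarith)
      (fun k v => h.fderiv_sub_eq h' hφ hφ' hR1 hR1' k v)
    have hfd : fderiv 𝕂 (fun v => φ k v - φ' k v) =
        fun v => fderiv 𝕂 (φ k) v - fderiv 𝕂 (φ' k) v :=
      funext fun v => fderiv_fun_sub (hdφ k v) (hdφ' k v)
    have hmax : dj ≤ cmpConst M L CR CE c d (j + 1) := le_max_left _ _
    refine CBound.of_fderiv ((hdφ k).sub (hdφ' k)) (fun v => ?_) ?_
    · refine ((ih' k).norm_le v).trans (mul_le_mul_of_nonneg_right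
        (mul_le_mul_of_nonneg_right hmax (by positivity)) (hpos k).le)
    · rw [hfd]
      refine (hlin k).mono (hρ0 k) fun v => ?_
      have hmax2 : linConst M L Cm j (M * (2 ^ j * (t * c))) ≤ cmpConst M L CR CE c d (j + 1) :=
        le_max_right _ _
      have hl0 : 0 ≤ linConst M L Cm j (M * (2 ^ j * (t * c))) :=
        linConst_nonneg h.contr j (by positivity)
      rw [mul_assoc _ (ω k)]
      refine mul_le_mul_of_nonneg_right ?_ (had.pos k).le
      exact mul_le_mul hmax2 (min_le_left _ _) (hη0 v) (hl0.trans hmax2)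

end FixedData

end Smooth

/-! ### Evolution operators and exponential dichotomies -/

section Dichotomy

variable {X : Type*} [NormedAddCommGroup X] {𝕂 : Type*} [RCLike 𝕂] [NormedSpace 𝕂 X]
  {I : Set ℤ} {L : ℤ → X →L[𝕂] X}

@[simp] lemma evol_self (L : ℤ → X →L[𝕂] X) (t : ℤ) :
    evol L t t = ContinuousLinearMap.id 𝕂 X := by simp [evol, evolIter]

lemma evol_succ (L : ℤ → X →L[𝕂] X) {s t : ℤ} (h : s ≤ t) :
    evol L (t + 1) s = (L t).comp (evol L t s) := by
  have e : (t + 1 - s).toNat = (t - s).toNat + 1 := by omega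
  have e' : s + ((t - s).toNat : ℤ) = t := by omega
  rw [evol, e, evolIter, e', evol]

lemma evol_comp (L : ℤ → X →L[𝕂] X) {r s t : ℤ} (h : r ≤ s) (h' : s ≤ t) :
    evol L t r = (evol L t s).comp (evol L s r) := by
  induction t, h' using Int.leInduction with
  | base => simp
  | succ t hst ih => rw [evol_succ L (h.trans hst), evol_succ L hst, ih]; rfl

lemma evol_smul (L : ℤ → X →L[𝕂] X) (c : 𝕂) {s t : ℤ} (h : s ≤ t) :
    evol (fun t => c • L t) t s = c ^ (t - s).toNat • evol L t s := by
  induction t, h using Int.leInduction with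
  | base => simp
  | succ t hst ih =>
    have e : (t + 1 - s).toNat = (t - s).toNat + 1 := by omega
    rw [evol_succ _ hst, evol_succ _ hst, ih, e, pow_succ]
    ext x
    simp [smul_smul, mul_comm]

lemma mem_of_le_of_not_bddAbove (hI : I.OrdConnected) (hu : ¬ BddAbove I) {τ t : ℤ} (hτ : τ ∈ I)
    (h : τ ≤ t) : t ∈ I := by
  obtain ⟨s, hs, hts⟩ := not_bddAbove_iff.1 hu t
  exact hI.out hτ hs ⟨h, hts.le⟩

lemma mem_of_le_of_not_bddBelow (hI : I.OrdConnected) (hu : ¬ BddBelow I) {τ t : ℤ} (hτ : τ ∈ I)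
    (h : t ≤ τ) : t ∈ I := by
  obtain ⟨s, hs, hts⟩ := not_bddBelow_iff.1 hu t
  exact hI.out hs hτ ⟨hts.le, h⟩

lemma mem_prime_of_lt (hI : I.OrdConnected) {s t u : ℤ} (hs : s ∈ I) (hu : u ∈ I) (h : s ≤ t)
    (h' : t < u) : t ∈ prime I :=
  ⟨hI.out hs hu ⟨h, h'.le⟩, hI.out hs hu ⟨by omega, by omega⟩⟩

/-- A sequence of projections splitting the linear equation with growth rates `a < b`. -/
structure IsSplitting (I : Set ℤ) (L : ℤ → X →L[𝕂] X) (P : ℤ → X →L[𝕂] X) (K a b : ℝ) :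
    Prop where
  one_le : 1 ≤ K
  pos : 0 < a
  lt : a < b
  idem : ∀ t ∈ I, ∀ x, P t (P t x) = P t x
  comm : ∀ t ∈ prime I, ∀ x, P (t + 1) (L t x) = L t (P t x)
  bij : ∀ t ∈ prime I, BijOn (L t) {v | P t v = 0} {v | P (t + 1) v = 0}
  forward : ∀ s ∈ I, ∀ t ∈ I, s ≤ t → ‖(evol L t s).comp (P s)‖ ≤ K * a ^ (t - s)
  backward : ∀ s ∈ I, ∀ t ∈ I, s ≤ t → ∀ u v : X, P s v = 0 → evol L t s v = u - P t u →
    ‖v‖ ≤ K * b ^ (s - t) * ‖u‖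

/-- Undoing the scaling by 1/γ turns the dichotomy rates a and 1/a into γa < γ < γ/a. -/
lemma HasExpDichotomy.exists_isSplitting {γ : ℝ} (hγ : 0 < γ)
    (h : HasExpDichotomy I (fun t => ((γ⁻¹ : ℝ) : 𝕂) • L t)) :
    ∃ P K a b, IsSplitting I L P K a b ∧ a < γ ∧ γ < b := by
  obtain ⟨P, K, a, hK, ha, ha1, hid, hcomm, hbij, hf, hb⟩ := h
  have hc : ((γ⁻¹ : ℝ) : 𝕂) ≠ 0 := by
    simpa using hγ.ne'
  have hnorm : ∀ n : ℕ, ‖((γ⁻¹ : ℝ) : 𝕂) ^ n‖ = (γ⁻¹) ^ n := fun n => by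
    rw [norm_pow, RCLike.norm_ofReal, abs_of_pos (inv_pos.2 hγ)]
  refine ⟨P, K, γ * a, γ / a, ⟨hK, mul_pos hγ ha, ?_, fun t ht x => ?_, fun t ht x => ?_,
    fun t ht => ?_, fun s hs t ht hst => ?_, fun s hs t ht hst u v hv huv => ?_⟩, ?_, ?_⟩
  · rw [lt_div_iff₀ ha]
    have : a * a < 1 := by nlinarith
    nlinarith
  · exact congrArg (fun T : X →L[𝕂] X => T x) (hid t ht)
  · have := congrArg (fun T : X →L[𝕂] X => T x) (hcomm t ht)
    simpa [hγ.ne'] using this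
  · refine ⟨fun v hv => ?_, fun v hv v' hv' hvv => ?_, fun v hv => ?_⟩
    · have := (hbij t ht).mapsTo hv
      simpa [hγ.ne'] using this
    · exact (hbij t ht).injOn hv hv' (congrArg (fun y => ((γ⁻¹ : ℝ) : 𝕂) • y) hvv)
    · obtain ⟨u, hu, huv⟩ := (hbij t ht).surjOn hv
      refine ⟨((γ⁻¹ : ℝ) : 𝕂) • u, ?_, by simpa using huv⟩
      have : P t u = 0 := hu
      simp [this]
  · have h1 := hf s hs t ht hst
    obtain ⟨n, rfl⟩ : ∃ n : ℕ, t = s + n := ⟨(t - s).toNat, by omega⟩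
    rw [evol_smul L _ hst, ContinuousLinearMap.smul_comp, norm_smul, hnorm] at h1
    simp only [add_sub_cancel_left, Int.toNat_natCast, zpow_natCast, mul_pow] at h1 ⊢
    rw [inv_pow, inv_mul_le_iff₀ (pow_pos hγ n)] at h1
    linarith
  · obtain ⟨n, rfl⟩ : ∃ n : ℕ, t = s + n := ⟨(t - s).toNat, by omega⟩
    have hcn := pow_ne_zero n hc
    have h1 := hb s hs (s + n) ht hst u ((((γ⁻¹ : ℝ) : 𝕂) ^ n)⁻¹ • v) (by simp [hv]) (by
      rw [evol_smul L _ hst, ← huv]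
      simp [hγ.ne'])
    rw [norm_smul, norm_inv, hnorm] at h1
    have e : s - (s + n) = -(n : ℤ) := by ring
    simp only [add_sub_cancel_left, zpow_natCast, e, zpow_neg, inv_pow, inv_inv, div_pow,
      inv_div] at h1 ⊢
    rw [← le_div_iff₀' (pow_pos hγ n)] at h1
    exact h1.trans (le_of_eq (by ring))
  · nlinarith
  · rw [lt_div_iff₀ ha]; nlinarith

namespace IsSplitting

variable {P : ℤ → X →L[𝕂] X} {K a b : ℝ}

lemma evol_comm (h : IsSplitting I L P K a b) (hI : I.OrdConnected) {s t : ℤ} (hs : s ∈ I)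
    (hst : s ≤ t) : ∀ _ : t ∈ I, ∀ x, P t (evol L t s x) = evol L t s (P s x) := by
  induction t, hst using Int.leInduction with
  | base => simp
  | succ t hst ih =>
    intro ht x
    have hp := mem_prime_of_lt hI hs ht hst (by omega)
    rw [evol_succ _ hst]
    simp [h.comm t hp, ih hp.1]

lemma forward_apply (h : IsSplitting I L P K a b) {s t : ℤ} (hs : s ∈ I) (ht : t ∈ I)
    (hst : s ≤ t) (x : X) : ‖evol L t s (P s x)‖ ≤ K * a ^ (t - s) * ‖x‖ :=
  ((evol L t s).comp (P s)).le_of_opNorm_le (h.forward s hs t ht hst) x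

lemma norm_proj_le (h : IsSplitting I L P K a b) {t : ℤ} (ht : t ∈ I) (x : X) :
    ‖P t x‖ ≤ K * ‖x‖ := by
  simpa using h.forward_apply ht ht le_rfl x

lemma exists_preimage (h : IsSplitting I L P K a b) (hI : I.OrdConnected) {s t : ℤ} (hs : s ∈ I)
    (hst : s ≤ t) : ∀ _ : t ∈ I, ∀ y, P t y = 0 → ∃ x, P s x = 0 ∧ evol L t s x = y := by
  induction t, hst using Int.leInduction with
  | base => intro _ y hy; exact ⟨y, hy, by simp⟩
  | succ t hst ih =>
    intro ht y hy
    have hp := mem_prime_of_lt hI hs ht hst (by omega)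
    obtain ⟨z, hz, hzy⟩ := (h.bij t hp).surjOn hy
    obtain ⟨x, hx, hxz⟩ := ih hp.1 z hz
    exact ⟨x, hx, by rw [evol_succ _ hst]; simp [hxz, hzy]⟩

lemma eq_zero_of_evol (h : IsSplitting I L P K a b) {s t : ℤ} (hs : s ∈ I) (ht : t ∈ I)
    (hst : s ≤ t) {x : X} (hx : P s x = 0) (hx' : evol L t s x = 0) : x = 0 := by
  have := h.backward s hs t ht hst 0 x hx (by simpa using hx')
  simpa using this

/-- The inverse of `Φ(t, s)` on the kernels of the projections. -/
lemma exists_back (h : IsSplitting I L P K a b) (hI : I.OrdConnected) :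
    ∃ B : ℤ → ℤ → X →L[𝕂] X, ∀ s ∈ I, ∀ t ∈ I, s ≤ t →
      (∀ u, P s (B s t u) = 0) ∧ (∀ u, evol L t s (B s t u) = u - P t u) ∧
        ‖B s t‖ ≤ K * b ^ (s - t) := by
  have key : ∀ s t : ℤ, ∃ B : X →L[𝕂] X, s ∈ I → t ∈ I → s ≤ t →
      (∀ u, P s (B u) = 0) ∧ (∀ u, evol L t s (B u) = u - P t u) ∧ ‖B‖ ≤ K * b ^ (s - t) := by
    intro s t
    by_cases hst : s ∈ I ∧ t ∈ I ∧ s ≤ t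
    swap
    · exact ⟨0, fun h1 h2 h3 => absurd ⟨h1, h2, h3⟩ hst⟩
    obtain ⟨hs, ht, hst⟩ := hst
    have hex : ∀ u, ∃ x, P s x = 0 ∧ evol L t s x = u - P t u := fun u =>
      h.exists_preimage hI hs hst ht _ (by simp [h.idem t ht])
    choose f hf1 hf2 using hex
    have huniq : ∀ x y, P s x = 0 → P s y = 0 → evol L t s x = evol L t s y → x = y :=
      fun x y hx hy hxy => sub_eq_zero.1 (h.eq_zero_of_evol hs ht hst (by simp [hx, hy])
        (by simp [hxy]))
    let f' : X →ₗ[𝕂] X :=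
      { toFun := f
        map_add' := fun x y => huniq _ _ (hf1 _) (by simp [hf1]) (by simp [hf2]; abel)
        map_smul' := fun c x => huniq _ _ (hf1 _) (by simp [hf1]) (by simp [hf2, smul_sub]) }
    have hb : ∀ u, ‖f' u‖ ≤ K * b ^ (s - t) * ‖u‖ := fun u =>
      h.backward s hs t ht hst u (f u) (hf1 u) (hf2 u)
    refine ⟨f'.mkContinuous _ hb, fun _ _ _ => ⟨hf1, hf2, ?_⟩⟩
    exact f'.mkContinuous_norm_le (mul_nonneg (zero_le_one.trans h.one_le)
      (zpow_nonneg (h.pos.trans h.lt).le _)) hb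
  choose B hB using key
  exact ⟨B, fun s hs t ht hst => hB s t hs ht hst⟩

end IsSplitting

lemma tendsto_const_mul_zpow_nat {q : ℝ} (hq0 : 0 ≤ q) (hq : q < 1) (c : ℝ) :
    Tendsto (fun n : ℕ => c * q ^ n) atTop (𝓝 0) := by
  simpa using (tendsto_pow_atTop_nhds_zero_of_lt_one hq0 hq).const_mul c

namespace IsSplitting

variable {P : ℤ → X →L[𝕂] X} {K a b γ : ℝ}

/-- By the backward estimate the component u - P u grows at least like b^n, which is incompatible
with growth γ < b unless it vanishes. -/
lemma proj_eq_of_forward_bdd (h : IsSplitting I L P K a b) (hI : I.OrdConnected)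
    (hu : ¬ BddAbove I) (hγ0 : 0 < γ) (hγ : γ < b) {τ : ℤ} (hτ : τ ∈ I) {u : X} {M : ℝ}
    (hM : ∀ t, τ ≤ t → ‖evol L t τ u‖ ≤ M * γ ^ (t - τ)) : P τ u = u := by
  have hb0 : 0 < b := h.pos.trans h.lt
  have key : ∀ n : ℕ, ‖u - P τ u‖ ≤ (K * M) * (γ / b) ^ n := fun n => by
    have hn : τ ≤ τ + n := by omega
    have ht := mem_of_le_of_not_bddAbove hI hu hτ hn
    have h1 := h.backward τ hτ (τ + n) ht hn (evol L (τ + n) τ u) (u - P τ u)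
      (by simp [h.idem τ hτ]) (by simp [h.evol_comm hI hτ hn ht])
    have h2 := hM (τ + n) hn
    have e : τ - (τ + n) = -(n : ℤ) := by ring
    simp only [add_sub_cancel_left, zpow_natCast, e, zpow_neg] at h1 h2
    calc ‖u - P τ u‖ ≤ K * (b ^ n)⁻¹ * ‖evol L (τ + n) τ u‖ := h1
      _ ≤ K * (b ^ n)⁻¹ * (M * γ ^ n) := mul_le_mul_of_nonneg_left h2
          (mul_nonneg (zero_le_one.trans h.one_le) (by positivity))
      _ = (K * M) * (γ / b) ^ n := by rw [div_pow]; ring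
  have h0 : ‖u - P τ u‖ ≤ 0 := ge_of_tendsto' (tendsto_const_mul_zpow_nat (by positivity)
    ((div_lt_one hb0).2 hγ) _) key
  exact (sub_eq_zero.1 (norm_le_zero_iff.1 h0)).symm

/-- The P-component at τ is transported from time τ - n with factor a^n while the solution there is
O(γ^(-n)); as a < γ, the product tends to 0. -/
lemma proj_eq_zero_of_backward_bdd (h : IsSplitting I L P K a b) (hI : I.OrdConnected)
    (hu : ¬ BddBelow I) (hγ : a < γ) {τ : ℤ} (hτ : τ ∈ I) {φ : ℤ → X} {M : ℝ}
    (hφ : ∀ t, t ≤ τ → evol L τ t (φ t) = φ τ)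
    (hM : ∀ t, t ≤ τ → ‖φ t‖ ≤ M * γ ^ (t - τ)) : P τ (φ τ) = 0 := by
  have hγ0 : 0 < γ := h.pos.trans hγ
  have key : ∀ n : ℕ, ‖P τ (φ τ)‖ ≤ (K * M) * (a / γ) ^ n := fun n => by
    have hn : τ - n ≤ τ := by omega
    have ht := mem_of_le_of_not_bddBelow hI hu hτ hn
    have h1 := h.forward_apply ht hτ hn (φ (τ - n))
    rw [← h.evol_comm hI ht hn hτ, hφ _ hn] at h1
    have h2 := hM (τ - n) hn
    have e : τ - (τ - n) = (n : ℤ) := by ring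
    have e' : τ - n - τ = -(n : ℤ) := by ring
    simp only [zpow_natCast, e, e', zpow_neg] at h1 h2
    calc ‖P τ (φ τ)‖ ≤ K * a ^ n * ‖φ (τ - n)‖ := h1
      _ ≤ K * a ^ n * (M * (γ ^ n)⁻¹) := mul_le_mul_of_nonneg_left h2
          (mul_nonneg (zero_le_one.trans h.one_le) (pow_nonneg h.pos.le n))
      _ = (K * M) * (a / γ) ^ n := by rw [div_pow]; ring
  exact norm_le_zero_iff.1 (ge_of_tendsto' (tendsto_const_mul_zpow_nat
    (div_nonneg h.pos.le hγ0.le) ((div_lt_one hγ0).2 hγ) _) key)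

/-- The range of the projection is determined by growth alone. Hence splittings for different γ can
be compared, and the fiber does not depend on γ between the two rates. -/
lemma mem_stableFiber_iff (h : IsSplitting I L P K a b) (hI : I.OrdConnected)
    (hu : ¬ BddAbove I) (hγ : a ≤ γ) (hγ' : γ < b) {τ : ℤ} (hτ : τ ∈ I) {u : X} :
    u ∈ stableFiber I L γ τ ↔ P τ u = u := by
  have hγ0 : 0 < γ := h.pos.trans_le hγ
  constructor
  · rintro ⟨M, hM⟩
    refine h.proj_eq_of_forward_bdd hI hu hγ0 hγ' hτ (M := M) fun t ht => ?_
    have h1 := hM t (mem_of_le_of_not_bddAbove hI hu hτ ht) ht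
    rw [abs_of_pos (zpow_pos hγ0 _), ← neg_sub t τ, zpow_neg,
      inv_mul_le_iff₀ (zpow_pos hγ0 _)] at h1
    linarith
  · intro hP
    refine ⟨K * ‖u‖, fun t ht hτt => ?_⟩
    have h1 := h.forward_apply hτ ht hτt u
    rw [hP] at h1
    rw [abs_of_pos (zpow_pos hγ0 _), ← neg_sub t τ, zpow_neg, inv_mul_le_iff₀ (zpow_pos hγ0 _)]
    have h2 : a ^ (t - τ) ≤ γ ^ (t - τ) := zpow_le_zpow_left₀ (by omega) h.pos.le hγ
    have h3 : 0 ≤ K * ‖u‖ := mul_nonneg (zero_le_one.trans h.one_le) (norm_nonneg u)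
    nlinarith

end IsSplitting

lemma IsSolution.evol_eq {φ : ℤ → X} (hφ : IsSolution I (fun t => L t) φ) (hI : I.OrdConnected)
    {s t : ℤ} (hs : s ∈ I) (hst : s ≤ t) : ∀ _ : t ∈ I, evol L t s (φ s) = φ t := by
  induction t, hst using Int.leInduction with
  | base => simp
  | succ t hst ih =>
    intro ht
    have hp := mem_prime_of_lt hI hs ht hst (by omega)
    rw [evol_succ _ hst, hφ t hp, ← ih hp.1]
    rfl

namespace IsSplitting

variable {P : ℤ → X →L[𝕂] X} {K a b γ : ℝ}

/-- Here growth determines the kernel of the projection: its vectors are those with a backward orbit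
of growth γ. -/
lemma mem_unstableFiber_iff (h : IsSplitting I L P K a b) (hI : I.OrdConnected)
    (hu : ¬ BddBelow I) (hγ : a < γ) (hγ' : γ ≤ b) {τ : ℤ} (hτ : τ ∈ I) {u : X} :
    u ∈ unstableFiber I L γ τ ↔ P τ u = 0 := by
  have hγ0 : 0 < γ := h.pos.trans hγ
  constructor
  · rintro ⟨φ, hφ, ⟨M, hM⟩, rfl⟩
    refine h.proj_eq_zero_of_backward_bdd hI hu hγ hτ (M := M) (fun t ht => ?_) fun t ht => ?_
    · exact hφ.evol_eq hI (mem_of_le_of_not_bddBelow hI hu hτ ht) ht hτ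
    · have h1 := hM t (mem_of_le_of_not_bddBelow hI hu hτ ht) ht
      rw [abs_of_pos (zpow_pos hγ0 _), ← neg_sub t τ, zpow_neg,
        inv_mul_le_iff₀ (zpow_pos hγ0 _)] at h1
      linarith
  · intro hP
    obtain ⟨B, hB⟩ := h.exists_back hI
    have hmem : ∀ t, t ≤ τ → t ∈ I := fun t ht => mem_of_le_of_not_bddBelow hI hu hτ ht
    have hBτ : B τ τ u = u := by
      have := (hB τ hτ τ hτ le_rfl).2.1 u
      simpa [hP] using this
    -- The solution follows the inverse evolution on the kernels up to τ and the forward evolution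
    -- beyond τ.
    refine ⟨fun t => if t ≤ τ then B t τ u else evol L t τ u, fun t ht => ?_,
      ⟨K * ‖u‖, fun t ht htτ => ?_⟩, by simp [hBτ]⟩
    · rcases lt_trichotomy t τ with htτ | rfl | htτ
      · have h1 : t + 1 ≤ τ := htτ
        simp only [htτ.le, h1, if_true]
        obtain ⟨b1, b2, -⟩ := hB t ht.1 τ hτ htτ.le
        obtain ⟨c1, c2, -⟩ := hB (t + 1) ht.2 τ hτ h1
        refine sub_eq_zero.1 (h.eq_zero_of_evol ht.2 hτ h1 ?_ ?_)
        · simp [c1, h.comm t ht, b1]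
        · have e : evol L τ (t + 1) (L t (B t τ u)) = evol L τ t (B t τ u) := by
            rw [evol_comp L (by omega : t ≤ t + 1) h1, evol_succ L le_rfl]; simp
          rw [map_sub, c2, e, b2, sub_self]
      · have h1 : ¬ t + 1 ≤ t := by omega
        simp only [le_rfl, h1, if_true, if_false, hBτ, evol_succ L (le_refl t)]
        simp
      · have h1 : ¬ t + 1 ≤ τ := by omega
        simp only [not_le.2 htτ, h1, if_false, evol_succ L htτ.le]
        rfl
    · simp only [htτ, if_true]
      have h1 := (B t τ).le_of_opNorm_le (hB t ht τ hτ htτ).2.2 u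
      rw [abs_of_pos (zpow_pos hγ0 _), ← neg_sub t τ, zpow_neg,
        inv_mul_le_iff₀ (zpow_pos hγ0 _)]
      have h2 : b ^ (t - τ) ≤ γ ^ (t - τ) := by
        rw [← neg_sub τ t, zpow_neg, zpow_neg]
        exact inv_anti₀ (zpow_pos hγ0 _) (zpow_le_zpow_left₀ (by omega) hγ0.le hγ')
      have h3 : 0 ≤ K * ‖u‖ := mul_nonneg (zero_le_one.trans h.one_le) (norm_nonneg u)
      nlinarith

end IsSplitting

/-! ### One splitting for a whole spectral gap -/

section Gap

variable {α β : ℝ}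

/-- A locally constant function on an interval is constant. It is applied to γ ↦ fiber, to compare
the dichotomies at both ends of the gap. -/
lemma eq_of_locally_eq {Y : Type*} {f : ℝ → Y} (hαβ : α ≤ β)
    (h : ∀ γ ∈ Icc α β, ∃ a b, a < γ ∧ γ < b ∧ ∀ γ', a < γ' → γ' < b → f γ' = f γ) :
    f α = f β := by
  refine isPreconnected_Icc.induction₂ (s := Icc α β) (fun x y => f x = f y) (fun γ hγ => ?_)
    (fun x y z _ _ _ h1 h2 => h1.trans h2) (fun x y _ _ h => h.symm) (left_mem_Icc.2 hαβ)
    (right_mem_Icc.2 hαβ)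
  obtain ⟨a, b, ha, hb, hab⟩ := h γ hγ
  filter_upwards [mem_nhdsWithin_of_mem_nhds (Ioo_mem_nhds ha hb)] with y hy
  exact (hab y hy.1 hy.2).symm

lemma HasExpDichotomy.of_gap (hα : 0 < α) (hgap : Icc α β ∩ dichotomySpectrum I L = ∅) {γ : ℝ}
    (hγ : γ ∈ Icc α β) : HasExpDichotomy I (fun t => ((γ⁻¹ : ℝ) : 𝕂) • L t) := by
  by_contra hn
  have : γ ∈ Icc α β ∩ dichotomySpectrum I L := ⟨hγ, hα.trans_le hγ.1, hn⟩
  simp [hgap] at this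

/-- In a spectral gap `[α, β]` the linear equation splits with rates `α` and `β`. -/
theorem exists_isSplitting_of_gap (hI : I.OrdConnected) (hIu : ¬ BddAbove I ∨ ¬ BddBelow I)
    (hα : 0 < α) (hαβ : α < β) (hgap : Icc α β ∩ dichotomySpectrum I L = ∅) :
    ∃ P K, IsSplitting I L P K α β := by
  have hsp : ∀ γ ∈ Icc α β, ∃ P K a b, IsSplitting I L P K a b ∧ a < γ ∧ γ < b := fun γ hγ =>
    HasExpDichotomy.exists_isSplitting (hα.trans_le hγ.1) (HasExpDichotomy.of_gap hα hgap hγ)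
  -- The dichotomy at α provides a forward rate a < α, the one at β a backward rate b' > β; both
  -- have to hold for a single family of projections.
  obtain ⟨P, K, a, b, hP, haα, hαb⟩ := hsp α (left_mem_Icc.2 hαβ.le)
  obtain ⟨Q, K', a', b', hQ, haβ, hβb⟩ := hsp β (right_mem_Icc.2 hαβ.le)
  have hβ : 0 < β := hα.trans hαβ
  have hK := hP.one_le
  have hK' := hQ.one_le
  have hKp : (0 : ℝ) ≤ K * K' := by positivity
  rcases hIu with hu | hu
  -- If time is unbounded above, the ranges of P and Q agree, though the kernels may differ. P is
  -- kept, and only the backward rate has to be transferred from Q.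
  · have hPQ : ∀ τ ∈ I, ∀ u, P τ u = u ↔ Q τ u = u := fun τ hτ u => by
      have := eq_of_locally_eq (f := fun γ => stableFiber I L γ τ) hαβ.le fun γ hγ => by
        obtain ⟨R, K'', a'', b'', hR, h1, h2⟩ := hsp γ hγ
        refine ⟨a'', b'', h1, h2, fun γ' h1' h2' => ?_⟩
        ext u
        rw [hR.mem_stableFiber_iff hI hu h1'.le h2' hτ, hR.mem_stableFiber_iff hI hu h1.le h2 hτ]
      rw [← hP.mem_stableFiber_iff hI hu haα.le hαb hτ, this,
        hQ.mem_stableFiber_iff hI hu haβ.le hβb hτ]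
    refine ⟨P, (1 + K) * K', by nlinarith, hα, hαβ, hP.idem, hP.comm, hP.bij, ?_, ?_⟩
    · intro s hs t ht hst
      refine (hP.forward s hs t ht hst).trans ?_
      have h1 : a ^ (t - s) ≤ α ^ (t - s) := zpow_le_zpow_left₀ (by omega) hP.pos.le haα.le
      exact mul_le_mul (by nlinarith) h1 (zpow_nonneg hP.pos.le _) (by nlinarith)
    · intro s hs t ht hst u v hv huv
      have h1 := hQ.backward s hs t ht hst u (v - Q s v) (by simp [hQ.idem s hs]) (by
        have : Q t (P t u) = P t u := (hPQ t ht _).1 (hP.idem t ht u)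
        rw [map_sub, ← hQ.evol_comm hI hs hst ht, huv, map_sub, this]
        abel)
      have h2 : P s (Q s v) = Q s v := (hPQ s hs _).2 (hQ.idem s hs v)
      -- As P Q = Q and P v = 0, the vector v is recovered from its component in N(Q) by applying id
      -- - P.
      have e : v = (v - Q s v) - P s (v - Q s v) := by rw [map_sub, hv, h2]; abel
      have h3 : ‖v‖ ≤ ‖v - Q s v‖ + K * ‖v - Q s v‖ := by
        conv_lhs => rw [e]
        exact (norm_sub_le _ _).trans (by linarith [hP.norm_proj_le hs (v - Q s v)])
      have h4 : b' ^ (s - t) ≤ β ^ (s - t) := by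
        rw [← neg_sub t s, zpow_neg, zpow_neg]
        exact inv_anti₀ (zpow_pos hβ _) (zpow_le_zpow_left₀ (by omega) hβ.le hβb.le)
      calc ‖v‖ ≤ (1 + K) * ‖v - Q s v‖ := by linarith
        _ ≤ (1 + K) * (K' * b' ^ (s - t) * ‖u‖) := by gcongr
        _ ≤ (1 + K) * (K' * β ^ (s - t) * ‖u‖) := by gcongr
        _ = _ := by ring
  -- If time is unbounded below, the kernels agree instead. Q is kept, and the forward rate comes
  -- from P.
  · have hPQ : ∀ τ ∈ I, ∀ u, P τ u = 0 ↔ Q τ u = 0 := fun τ hτ u => by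
      have := eq_of_locally_eq (f := fun γ => unstableFiber I L γ τ) hαβ.le fun γ hγ => by
        obtain ⟨R, K'', a'', b'', hR, h1, h2⟩ := hsp γ hγ
        refine ⟨a'', b'', h1, h2, fun γ' h1' h2' => ?_⟩
        ext u
        rw [hR.mem_unstableFiber_iff hI hu h1' h2'.le hτ,
          hR.mem_unstableFiber_iff hI hu h1 h2.le hτ]
      rw [← hP.mem_unstableFiber_iff hI hu haα hαb.le hτ, this,
        hQ.mem_unstableFiber_iff hI hu haβ hβb.le hτ]
    refine ⟨Q, K * K', by nlinarith, hα, hαβ, hQ.idem, hQ.comm, hQ.bij, ?_, ?_⟩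
    · intro s hs t ht hst
      refine ContinuousLinearMap.opNorm_le_bound _ (by positivity) fun x => ?_
      have e : Q t (P t (evol L t s x)) = Q t (evol L t s x) := by
        have := (hPQ t ht (evol L t s x - P t (evol L t s x))).1 (by simp [hP.idem t ht])
        rw [map_sub, sub_eq_zero] at this
        exact this.symm
      have h1 : a ^ (t - s) ≤ α ^ (t - s) := zpow_le_zpow_left₀ (by omega) hP.pos.le haα.le
      calc ‖evol L t s (Q s x)‖ = ‖Q t (evol L t s (P s x))‖ := by
            rw [← hQ.evol_comm hI hs hst ht, ← e, hP.evol_comm hI hs hst ht]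
        _ ≤ K' * (K * a ^ (t - s) * ‖x‖) :=
            (hQ.norm_proj_le ht _).trans (by gcongr; exact hP.forward_apply hs ht hst x)
        _ ≤ K' * (K * α ^ (t - s) * ‖x‖) := by gcongr
        _ = _ := by ring
    · intro s hs t ht hst u v hv huv
      refine (hQ.backward s hs t ht hst u v hv huv).trans ?_
      have h4 : b' ^ (s - t) ≤ β ^ (s - t) := by
        rw [← neg_sub t s, zpow_neg, zpow_neg]
        exact inv_anti₀ (zpow_pos hβ _) (zpow_le_zpow_left₀ (by omega) hβ.le hβb.le)
      have : K' ≤ K * K' := by nlinarith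
      have : 0 ≤ b' ^ (s - t) := zpow_nonneg (hβ.le.trans hβb.le) _
      gcongr

end Gap

end Dichotomy

/-! ### Green's function -/

section Kernel

/-- Bound for Green's function at `(t, s + 1)`. -/
def greenBound (K α β : ℝ) (t s : ℤ) : ℝ :=
  if s < t then K * α ^ (t - s - 1) else K * β ^ (t - s - 1)

lemma greenBound_nonneg {K α β : ℝ} (hK : 0 ≤ K) (hα : 0 ≤ α) (hβ : 0 ≤ β) (t s : ℤ) :
    0 ≤ greenBound K α β t s := by
  unfold greenBound
  split_ifs
  · exact mul_nonneg hK (zpow_nonneg hα _)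
  · exact mul_nonneg hK (zpow_nonneg hβ _)

variable {K α β γ : ℝ}

/-- A geometric series of ratio γ/β over s ≥ t; its counterpart over s < t has ratio α/γ. -/
lemma hasSum_greenBound_future (hγ0 : 0 < γ) (hγβ : γ < β) (t τ : ℤ) :
    HasSum (fun n : ℕ => greenBound K α β t (t + n) * γ ^ (t + n - τ))
      (K / (β - γ) * γ ^ (t - τ)) := by
  have hβ0 : 0 < β := hγ0.trans hγβ
  have h := (hasSum_geometric_of_lt_one (div_nonneg hγ0.le hβ0.le)
    ((div_lt_one hβ0).2 hγβ)).mul_left (K * β⁻¹ * γ ^ (t - τ))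
  have e : K * β⁻¹ * γ ^ (t - τ) * (1 - γ / β)⁻¹ = K / (β - γ) * γ ^ (t - τ) := by
    have : β - γ ≠ 0 := by linarith
    have e1 : 1 - γ / β = (β - γ) / β := by field_simp
    rw [e1]
    field_simp
  rw [e] at h
  refine h.congr_fun fun n => ?_
  have h1 : ¬ t + (n : ℤ) < t := by omega
  have e1 : t - (t + (n : ℤ)) - 1 = -((n + 1 : ℕ) : ℤ) := by push_cast; ring
  have e2 : t + (n : ℤ) - τ = (t - τ) + (n : ℤ) := by ring
  rw [greenBound, if_neg h1, e1, e2, zpow_add₀ hγ0.ne', zpow_neg, zpow_natCast, zpow_natCast,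
    div_pow, pow_succ]
  field_simp

lemma hasSum_greenBound_past (hα0 : 0 < α) (hαγ : α < γ) (t τ : ℤ) :
    HasSum (fun n : ℕ => greenBound K α β t (t + -(n + 1)) * γ ^ (t + -(n + 1 : ℤ) - τ))
      (K / (γ - α) * γ ^ (t - τ)) := by
  have hγ0 : 0 < γ := hα0.trans hαγ
  have h := (hasSum_geometric_of_lt_one (div_nonneg hα0.le hγ0.le)
    ((div_lt_one hγ0).2 hαγ)).mul_left (K * γ⁻¹ * γ ^ (t - τ))
  have e : K * γ⁻¹ * γ ^ (t - τ) * (1 - α / γ)⁻¹ = K / (γ - α) * γ ^ (t - τ) := by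
    have : γ - α ≠ 0 := by linarith
    have e1 : 1 - α / γ = (γ - α) / γ := by field_simp
    rw [e1]
    field_simp
  rw [e] at h
  refine h.congr_fun fun n => ?_
  have h1 : t + -((n : ℤ) + 1) < t := by omega
  have e1 : t - (t + -((n : ℤ) + 1)) - 1 = (n : ℤ) := by ring
  have e2 : t + -((n : ℤ) + 1) - τ = (t - τ) + -((n + 1 : ℕ) : ℤ) := by push_cast; ring
  rw [greenBound, if_pos h1, e1, e2, zpow_add₀ hγ0.ne', zpow_neg, zpow_natCast, zpow_natCast,
    div_pow, pow_succ]
  field_simp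

lemma hasSum_greenBound (hα0 : 0 < α) (hαγ : α < γ) (hγβ : γ < β) (t τ : ℤ) :
    HasSum (fun s : ℤ => greenBound K α β t s * γ ^ (s - τ))
      ((K / (β - γ) + K / (γ - α)) * γ ^ (t - τ)) := by
  have h := HasSum.of_nat_of_neg_add_one
    (f := fun j : ℤ => greenBound K α β t (t + j) * γ ^ (t + j - τ))
    (hasSum_greenBound_future (K := K) (α := α) (hα0.trans hαγ) hγβ t τ)
    (hasSum_greenBound_past (K := K) (β := β) hα0 hαγ t τ)
  rw [← add_mul] at h
  exact (Equiv.addLeft t).hasSum_iff.1 h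

/-- The weights `γ ^ (t - τ)` are admissible for `γ ∈ [α + δ, β - δ]` on every set of times. -/
lemma admissible_greenBound {δ : ℝ} (hK : 0 ≤ K) (hα0 : 0 < α) (hδ : 0 < δ)
    (hγ : γ ∈ Icc (α + δ) (β - δ)) (J : Set ℤ) (τ : ℤ) :
    Admissible (fun t s : J => greenBound K α β t s) (2 * K / δ) (fun t : J => γ ^ ((t : ℤ) - τ)) := by
  have hαγ : α < γ := by linarith [hγ.1]
  have hγβ : γ < β := by linarith [hγ.2]
  have hγ0 : 0 < γ := hα0.trans hαγ
  have hs := fun t : ℤ => hasSum_greenBound (K := K) hα0 hαγ hγβ t τ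
  have hnn : ∀ t s, 0 ≤ greenBound K α β t s :=
    greenBound_nonneg hK hα0.le (hγ0.trans hγβ).le
  refine ⟨fun t => zpow_pos hγ0 _, fun t s => hnn _ _, fun t => (hs t).summable.subtype J,
    fun t => ?_⟩
  refine ((hs t).summable.tsum_subtype_le _ J
    (fun s => mul_nonneg (hnn _ _) (zpow_nonneg hγ0.le _))).trans ?_
  rw [(hs t).tsum_eq]
  refine mul_le_mul_of_nonneg_right ?_ (zpow_nonneg hγ0.le _)
  -- The distance of γ to both ends of the gap is at least δ, so each half contributes at most K/δ.
  have h1 : K / (β - γ) ≤ K / δ := div_le_div_of_nonneg_left hK hδ (by linarith [hγ.2])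
  have h2 : K / (γ - α) ≤ K / δ := div_le_div_of_nonneg_left hK hδ (by linarith [hγ.1])
  calc _ ≤ K / δ + K / δ := add_le_add h1 h2
    _ = 2 * K / δ := by ring

/-- At the initial time only s ≥ τ occurs, hence K/δ instead of 2K/δ. This halving yields the
constant K²L/(δ - 2KL). -/
lemma tsum_greenBound_Ici_le {δ : ℝ} (hK : 0 ≤ K) (hδ : 0 < δ) (hγ0 : 0 < γ) (hγ : γ ≤ β - δ)
    (τ : ℤ) : ∑' s : Ici τ, greenBound K α β τ s * γ ^ ((s : ℤ) - τ) ≤ K / δ := by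
  have h := hasSum_greenBound_future (K := K) (α := α) hγ0 (by linarith : γ < β) τ τ
  let e : ℕ ≃ Ici τ :=
    { toFun := fun n => ⟨τ + n, by simp⟩
      invFun := fun s => ((s : ℤ) - τ).toNat
      left_inv := fun n => by simp
      right_inv := fun s => by
        have : τ ≤ (s : ℤ) := s.2
        ext; simp; omega }
  have e1 := e.tsum_eq (fun s : Ici τ => greenBound K α β τ s * γ ^ ((s : ℤ) - τ))
  rw [← e1]
  refine (le_of_eq h.tsum_eq).trans ?_
  simpa using div_le_div_of_nonneg_left hK hδ (by linarith)

/-- Backward counterpart. The index s = τ is left out because the Green's function on `Iic τ`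
vanishes there. -/
lemma tsum_greenBound_Iic_le {δ : ℝ} (hK : 0 ≤ K) (hα0 : 0 < α) (hδ : 0 < δ)
    (hγ : α + δ ≤ γ) (τ : ℤ) :
    ∑' s : Iic τ, (if (s : ℤ) < τ then greenBound K α β τ s * γ ^ ((s : ℤ) - τ) else 0) ≤
      K / δ := by
  have h := hasSum_greenBound_past (K := K) (β := β) hα0 (by linarith : α < γ) τ τ
  let f : Iic τ → ℝ := fun s =>
    if (s : ℤ) < τ then greenBound K α β τ s * γ ^ ((s : ℤ) - τ) else 0
  let i : ℕ → Iic τ := fun n => ⟨τ + -(n + 1), mem_Iic.2 (by omega)⟩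
  have hi : Function.Injective i := fun n n' hn => by
    have : τ + -((n : ℤ) + 1) = τ + -((n' : ℤ) + 1) := congrArg Subtype.val hn
    omega
  have h1 : HasSum f (K / (γ - α) * γ ^ (τ - τ)) := by
    refine (hi.hasSum_iff fun s hs => ?_).1 (h.congr_fun fun n => ?_)
    · refine if_neg fun hlt => hs ⟨(τ - 1 - s).toNat, ?_⟩
      ext; simp only [i]; omega
    · have : τ + -((n : ℤ) + 1) < τ := by omega
      simp only [Function.comp, f, i, if_pos this]
  refine (le_of_eq h1.tsum_eq).trans ?_
  simpa using div_le_div_of_nonneg_left hK hδ (by linarith)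

end Kernel

/-! ### The operator-valued Green's function -/

section Green

variable {X : Type*} [NormedAddCommGroup X] {𝕂 : Type*} [RCLike 𝕂] [NormedSpace 𝕂 X]
  {I : Set ℤ} {L : ℤ → X →L[𝕂] X} {P : ℤ → X →L[𝕂] X} {B : ℤ → ℤ → X →L[𝕂] X} {K α β γ : ℝ}

/-- A splitting together with the backward evolution operators `B s t = Φ(s, t)(id - P t)`. -/
structure IsSplit (I : Set ℤ) (L P : ℤ → X →L[𝕂] X) (B : ℤ → ℤ → X →L[𝕂] X) (K α β : ℝ) : Prop
    extends IsSplitting I L P K α β where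
  ordConnected : I.OrdConnected
  proj_back : ∀ s ∈ I, ∀ t ∈ I, s ≤ t → ∀ u, P s (B s t u) = 0
  evol_back : ∀ s ∈ I, ∀ t ∈ I, s ≤ t → ∀ u, evol L t s (B s t u) = u - P t u
  norm_back : ∀ s ∈ I, ∀ t ∈ I, s ≤ t → ‖B s t‖ ≤ K * β ^ (s - t)

lemma IsSplitting.exists_isSplit (h : IsSplitting I L P K α β) (hI : I.OrdConnected) :
    ∃ B, IsSplit I L P B K α β := by
  obtain ⟨B, hB⟩ := h.exists_back hI
  exact ⟨B, h, hI, fun s hs t ht hst => (hB s hs t ht hst).1,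
    fun s hs t ht hst => (hB s hs t ht hst).2.1, fun s hs t ht hst => (hB s hs t ht hst).2.2⟩

/-- Green's function `G(t, s + 1)` of a splitting, restricted to the set of times `J`. -/
def green (J : Set ℤ) (L P : ℤ → X →L[𝕂] X) (B : ℤ → ℤ → X →L[𝕂] X) (t s : J) : X →L[𝕂] X :=
  open Classical in
  -- On `Iic τ` the index s = τ refers to time τ + 1 outside J. The value 0 makes the sum at time τ
  -- depend on the strict past only.
  if (s : ℤ) + 1 ∈ J then
    if (s : ℤ) < t then (evol L t (s + 1)).comp (P (s + 1)) else -B t (s + 1)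
  else 0

namespace IsSplit

lemma nonneg (h : IsSplit I L P B K α β) : 0 ≤ K := zero_le_one.trans h.one_le

lemma back_unique (h : IsSplit I L P B K α β) {s t : ℤ} (hs : s ∈ I) (ht : t ∈ I) (hst : s ≤ t)
    {u x : X} (hx : P s x = 0) (hxu : evol L t s x = u - P t u) : x = B s t u :=
  sub_eq_zero.1 (h.eq_zero_of_evol hs ht hst (by simp [hx, h.proj_back s hs t ht hst])
    (by simp [hxu, h.evol_back s hs t ht hst]))

lemma step_back (h : IsSplit I L P B K α β) {s t : ℤ} (hs : s ∈ prime I) (ht : t ∈ I)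
    (hst : s + 1 ≤ t) (u : X) : L s (B s t u) = B (s + 1) t u := by
  refine h.back_unique hs.2 ht hst ?_ ?_
  · simp [h.comm s hs, h.proj_back s hs.1 t ht (by omega)]
  · rw [← h.evol_back s hs.1 t ht (by omega), evol_comp L (by omega : s ≤ s + 1) hst,
      evol_succ L le_rfl]
    simp

lemma norm_green_le (h : IsSplit I L P B K α β) {J : Set ℤ} (hJ : J ⊆ I) (t s : J) :
    ‖green J L P B t s‖ ≤ greenBound K α β t s := by
  have hβ : 0 < β := h.pos.trans h.lt
  unfold green
  split_ifs with h1 h2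
  · refine (h.forward _ (hJ h1) _ (hJ t.2) (by omega)).trans (le_of_eq ?_)
    rw [greenBound, if_pos h2, sub_sub]
  · rw [norm_neg]
    refine (h.norm_back _ (hJ t.2) _ (hJ h1) (by omega)).trans (le_of_eq ?_)
    rw [greenBound, if_neg h2, sub_sub]
  · simpa using greenBound_nonneg h.nonneg h.pos.le hβ.le _ _

/-- Green's function yields solutions of inhomogeneous equations. -/
lemma green_step (h : IsSplit I L P B K α β) {J : Set ℤ} (hJ : J ⊆ I) {t t' : J}
    (htt' : (t' : ℤ) = t + 1) (s : J) (x : X) :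
    green J L P B t' s x - L t (green J L P B t s x) = if s = t then x else 0 := by
  have htp : (t : ℤ) ∈ prime I := ⟨hJ t.2, htt' ▸ hJ t'.2⟩
  unfold green
  by_cases h1 : (s : ℤ) + 1 ∈ J
  swap
  · have : s ≠ t := by rintro rfl; exact h1 (htt' ▸ t'.2)
    simp [h1, this]
  simp only [h1, if_true]
  rcases lt_trichotomy (s : ℤ) t with hst | hst | hst
  · have h2 : (s : ℤ) < t' := by omega
    have h3 : s ≠ t := by rintro rfl; omega
    rw [if_pos h2, if_pos hst, if_neg h3, htt', evol_succ L (by omega : (s : ℤ) + 1 ≤ t)]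
    simp
  -- The unit jump at s = t: the value at t + 1 is P x, while ℒ maps the value at t to -(id - P) x,
  -- and the difference is x.
  · obtain rfl : s = t := Subtype.ext hst
    have h2 : (s : ℤ) < t' := by omega
    rw [if_pos h2, if_neg (lt_irrefl _), if_pos rfl, htt']
    have e := h.evol_back s htp.1 (s + 1) htp.2 (by omega) x
    rw [evol_succ L le_rfl] at e
    simp only [evol_self, ContinuousLinearMap.comp_id] at e
    simp [e]
  · have h2 : ¬ (s : ℤ) < t' := by omega
    have h2' : ¬ (s : ℤ) < t := by omega
    have h3 : s ≠ t := by rintro rfl; omega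
    rw [if_neg h2, if_neg h2', if_neg h3, htt']
    simp [h.step_back htp (hJ h1) (by omega : (t : ℤ) + 1 ≤ s + 1)]

variable {J : Set ℤ} {δ : ℝ} {f : J → X} {D : ℝ} {τ : ℤ}

lemma summable_green [CompleteSpace X] (h : IsSplit I L P B K α β) (hJ : J ⊆ I) (hδ : 0 < δ)
    (hγ : γ ∈ Icc (α + δ) (β - δ)) (hf : ∀ s, ‖f s‖ ≤ D * γ ^ ((s : ℤ) - τ)) (t : J) :
    Summable fun s => green J L P B t s (f s) :=
  (admissible_greenBound h.nonneg h.pos hδ hγ J τ).summable_apply (h.norm_green_le hJ) hf t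

lemma tsum_green_step [CompleteSpace X] (h : IsSplit I L P B K α β) (hJ : J ⊆ I) (hδ : 0 < δ)
    (hγ : γ ∈ Icc (α + δ) (β - δ)) (hf : ∀ s, ‖f s‖ ≤ D * γ ^ ((s : ℤ) - τ)) {t t' : J}
    (htt' : (t' : ℤ) = t + 1) :
    ∑' s, green J L P B t' s (f s) = L t (∑' s, green J L P B t s (f s)) + f t := by
  have h1 := h.summable_green hJ hδ hγ hf t
  have h2 := h.summable_green hJ hδ hγ hf t'
  rw [(L t).map_tsum h1, ← sub_eq_iff_eq_add', ← h2.tsum_sub ((L t).summable h1)]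
  simp_rw [h.green_step hJ htt', tsum_ite_eq]

end IsSplit

end Green

/-! ### Solutions of nonlinear equations -/

section Solutions

variable {X : Type*} {I : Set ℤ} {F : ℤ → X → X}

@[simp] lemma sol_self (F : ℤ → X → X) (t : ℤ) (u : X) : sol F t t u = u := by simp [sol, iter]

lemma sol_succ (F : ℤ → X → X) {τ t : ℤ} (h : τ ≤ t) (u : X) :
    sol F (t + 1) τ u = F t (sol F t τ u) := by
  have e : (t + 1 - τ).toNat = (t - τ).toNat + 1 := by omega
  have e' : τ + ((t - τ).toNat : ℤ) = t := by omega
  rw [sol, e, iter, e', sol]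

lemma sol_eq_of_step {φ : ℤ → X} {τ t : ℤ} (h : τ ≤ t)
    (hφ : ∀ s, τ ≤ s → s < t → φ (s + 1) = F s (φ s)) : sol F t τ (φ τ) = φ t := by
  induction t, h using Int.leInduction with
  | base => simp
  | succ t ht ih =>
    rw [sol_succ F ht, hφ t ht (by omega), ih fun s h1 h2 => hφ s h1 (by omega)]

lemma sol_step (F : ℤ → X → X) {τ t : ℤ} (h : τ + 1 ≤ t) (u : X) :
    sol F t (τ + 1) (F τ u) = sol F t τ u := by
  have e : F τ u = sol F (τ + 1) τ u := by rw [sol_succ F le_rfl, sol_self]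
  rw [e]
  exact sol_eq_of_step (φ := fun t => sol F t τ u) h fun s hs _ => sol_succ F (by omega) u

variable [NormedAddCommGroup X] {γ : ℝ}

lemma forwardInvariant_stableSet (hγ : 0 < γ) :
    ForwardInvariant I F (stableSet I F γ) := by
  rintro t ht _ ⟨u, ⟨-, M, hM⟩, rfl⟩
  refine ⟨ht.2, γ * M, fun s hs hts => ?_⟩
  have h1 := hM s hs (by dsimp only at hts ⊢; omega)
  dsimp only at h1 hts ⊢
  rw [sol_step F hts]
  have e : γ ^ (t + 1 - s) = γ * γ ^ (t - s) := by
    rw [show t + 1 - s = 1 + (t - s) by ring, zpow_add₀ hγ.ne', zpow_one]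
  rw [e, mul_assoc]
  exact mul_le_mul_of_nonneg_left h1 hγ.le

lemma invariant_unstableSet (hγ : 0 < γ) :
    Invariant I F (unstableSet I F γ) := by
  intro t ht
  have e : ∀ s, γ ^ (t + 1 - s) = γ * γ ^ (t - s) := fun s => by
    rw [show t + 1 - s = 1 + (t - s) by ring, zpow_add₀ hγ.ne', zpow_one]
  refine Subset.antisymm ?_ ?_
  · rintro _ ⟨u, ⟨-, φ, hφ, ⟨M, hM⟩, hu⟩, rfl⟩
    dsimp only at hM hu
    -- The maximum covers time t + 1, which the bound up to t does not reach.
    refine ⟨ht.2, φ, hφ, ⟨max (γ * M) ‖φ (t + 1)‖, fun s hs hst => ?_⟩, by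
      simpa [← hu] using hφ t ht⟩
    dsimp only at hst ⊢
    rcases hst.lt_or_eq with h1 | rfl
    · refine le_max_of_le_left ?_
      rw [e, mul_assoc]
      exact mul_le_mul_of_nonneg_left (hM s hs (by omega)) hγ.le
    · exact le_max_of_le_right (by simp)
  · rintro u ⟨-, φ, hφ, ⟨M, hM⟩, hu⟩
    dsimp only at hM hu
    refine ⟨φ t, ⟨ht.1, φ, hφ, ⟨γ⁻¹ * M, fun s hs hst => ?_⟩, rfl⟩, by rw [← hφ t ht, hu]⟩
    dsimp only at hst ⊢
    have h1 := hM s hs (by omega)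
    rw [e, mul_assoc] at h1
    rwa [← div_eq_inv_mul, le_div_iff₀' hγ]

end Solutions

/-! ### Lyapunov–Perron equations -/

section LyapunovPerron

universe u

variable {𝕂 : Type*} [RCLike 𝕂]

section Family

variable {V X : Type u} [NormedAddCommGroup V] [NormedSpace 𝕂 V]
  [NormedAddCommGroup X] [NormedSpace 𝕂 X] [CompleteSpace X] {ι : Type*} {g : ι → ι → ℝ}
  {M L K : ℝ} {ω : ι → ℝ} {G : ι → ι → X →L[𝕂] X} {S : ι → V →L[𝕂] X} {R : ι → X → X}
  {φ : ι → V → X}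

/-- The family of solutions of a summation equation (`0` if there is none). -/
def fixedFamily (G : ι → ι → X →L[𝕂] X) (ω : ι → ℝ) (S : ι → V →L[𝕂] X) (R : ι → X → X) :
    ι → V → X :=
  open Classical in
  if h : ∃ φ : ι → V → X, IsFixedFamily G ω S R φ then h.choose else 0

namespace FixedData

lemma isFixedFamily (h : FixedData g M L K ω G S R) :
    IsFixedFamily G ω S R (fixedFamily G ω S R) := by
  have h' := h.exists_family
  rw [fixedFamily, dif_pos h']
  exact h'.choose_spec

lemma continuous (h : FixedData g M L K ω G S R) (hφ : IsFixedFamily G ω S R φ) (k : ι) :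
    Continuous (φ k) := by
  have hq1 : 0 < 1 - M * L := by linarith [h.contr]
  have hc : 0 ≤ K / (1 - M * L) * ω k :=
    mul_nonneg (div_nonneg h.K_nonneg hq1.le) (h.adm.pos k).le
  refine (LipschitzWith.of_dist_le_mul (K := ⟨_, hc⟩) fun v v' => ?_).continuous
  rw [dist_eq_norm, dist_eq_norm]
  exact h.norm_sub_le hφ v v' k

/-- Lipschitz estimate for the nonlinear part of the solutions. -/
lemma norm_tail_sub_le (h : FixedData g M L K ω G S R) (hφ : IsFixedFamily G ω S R φ) {k : ι}
    {g' : ι → ℝ} {c : ℝ} (hg' : ∀ s, ‖G k s‖ ≤ g' s) (hgs : Summable fun s => g' s * ω s)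
    (hc : ∑' s, g' s * ω s ≤ c) (v v' : V) :
    ‖(φ k v - S k v) - (φ k v' - S k v')‖ ≤ c * L * (K / (1 - M * L)) * ‖v - v'‖ := by
  have hq1 : 0 < 1 - M * L := by linarith [h.contr]
  have hK1 : 0 ≤ K / (1 - M * L) := div_nonneg h.K_nonneg hq1.le
  obtain ⟨D, hD⟩ := hφ.bdd v
  obtain ⟨D', hD'⟩ := hφ.bdd v'
  have s1 := h.adm.summable_apply h.kernel (h.norm_comp_le hD) k
  have s2 := h.adm.summable_apply h.kernel (h.norm_comp_le hD') k
  have e : (φ k v - S k v) - (φ k v' - S k v') =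
      ∑' s, G k s (R s (φ s v) - R s (φ s v')) := by
    simp_rw [map_sub]
    rw [s1.tsum_sub s2, hφ.eq k v, hφ.eq k v']
    abel
  rw [e]
  set C := L * (K / (1 - M * L)) * ‖v - v'‖ with hC
  have hC0 : 0 ≤ C := mul_nonneg (mul_nonneg h.L_nonneg hK1) (norm_nonneg _)
  -- Only row `k` of the kernel matters, so a bound g' sharper than the one used for the contraction
  -- may be inserted.
  have hb : ∀ s, ‖G k s (R s (φ s v) - R s (φ s v'))‖ ≤ C * (g' s * ω s) := fun s => by
    have h1 : ‖R s (φ s v) - R s (φ s v')‖ ≤ C * ω s :=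
      (h.lip s _ _).trans ((mul_le_mul_of_nonneg_left (h.norm_sub_le hφ v v' s)
        h.L_nonneg).trans (le_of_eq (by rw [hC]; ring)))
    calc _ ≤ ‖G k s‖ * ‖R s (φ s v) - R s (φ s v')‖ := (G k s).le_opNorm _
      _ ≤ g' s * (C * ω s) := mul_le_mul (hg' s) h1 (norm_nonneg _)
          ((norm_nonneg _).trans (hg' s))
      _ = _ := by ring
  refine (tsum_of_norm_bounded (hgs.mul_left C).hasSum hb).trans ?_
  rw [tsum_mul_left]
  exact (mul_le_mul_of_nonneg_left hc hC0).trans (le_of_eq (by rw [hC]; ring))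

end FixedData

end Family

variable {X : Type u} [NormedAddCommGroup X] [NormedSpace 𝕂 X]
  {I : Set ℤ} {ℒ P : ℤ → X →L[𝕂] X} {B : ℤ → ℤ → X →L[𝕂] X} {F F' : ℤ → X → X}
  {K α β γ γj δ Λ : ℝ} {τ : ℤ}

/-- The nonlinear part `F t - ℒ t` for `t ∈ 𝕀'`. -/
def resid (I : Set ℤ) (ℒ : ℤ → X →L[𝕂] X) (F : ℤ → X → X) (t : ℤ) (x : X) : X :=
  open Classical in if t ∈ prime I then F t x - ℒ t x else 0

/-- `F` is a perturbation of `ℒ` with Lipschitz constant `Λ`, preserving the zero solution. -/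
structure IsPerturbation (I : Set ℤ) (ℒ : ℤ → X →L[𝕂] X) (F : ℤ → X → X) (Λ : ℝ) : Prop where
  nonneg : 0 ≤ Λ
  zero : ∀ t, resid I ℒ F t 0 = 0
  lip : ∀ t x y, ‖resid I ℒ F t x - resid I ℒ F t y‖ ≤ Λ * ‖x - y‖

lemma IsPerturbation.mono {Λ' : ℝ} (h : IsPerturbation I ℒ F Λ) (hΛ : Λ ≤ Λ') :
    IsPerturbation I ℒ F Λ' :=
  ⟨h.nonneg.trans hΛ, h.zero, fun t x y =>
    (h.lip t x y).trans (mul_le_mul_of_nonneg_right hΛ (norm_nonneg _))⟩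

lemma IsPerturbation.norm_resid_le (h : IsPerturbation I ℒ F Λ) (t : ℤ) (x : X) :
    ‖resid I ℒ F t x‖ ≤ Λ * ‖x‖ := by
  simpa [h.zero t] using h.lip t x 0

lemma eq_add_resid {t : ℤ} (ht : t ∈ prime I) (x : X) :
    F t x = ℒ t x + resid I ℒ F t x := by
  rw [resid, if_pos ht]; abel

lemma IsPerturbation.apply_zero (h : IsPerturbation I ℒ F Λ) {t : ℤ} (ht : t ∈ prime I) :
    F t 0 = 0 := by
  rw [eq_add_resid (ℒ := ℒ) (F := F) ht, h.zero, map_zero, add_zero]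

lemma mul_lt_one_of {K δ Λ : ℝ} (hδ : 0 < δ) (hΛ : 2 * K * Λ < δ) : 2 * K / δ * Λ < 1 := by
  rw [div_mul_eq_mul_div, div_lt_one hδ]
  exact hΛ

/-- Backward growth γ > α excludes a component in the range of P, so the solution lives in the
kernels, where the inverse evolution recovers it from its value at τ. -/
lemma IsSplit.back_eq_of_homogeneous (h : IsSplit I ℒ P B K α β) (hu : ¬ BddBelow I) (hτ : τ ∈ I)
    (hγ : α < γ) {y : ℤ → X} {D : ℝ} (hD : ∀ t, t ≤ τ → ‖y t‖ ≤ D * γ ^ (t - τ))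
    (hy : ∀ t, t < τ → y (t + 1) = ℒ t (y t)) {t : ℤ} (ht : t ≤ τ) :
    P t (y t) = 0 ∧ B t τ (y τ) = y t := by
  have hI := h.ordConnected
  have hγ0 : 0 < γ := h.pos.trans hγ
  have hev : ∀ s t, s ≤ t → t ≤ τ → evol ℒ t s (y s) = y t := fun s t hst => by
    induction t, hst using Int.leInduction with
    | base => simp
    | succ t hst ih =>
      intro ht
      rw [evol_succ ℒ hst, hy t (by omega), ← ih (by omega)]; rfl
  have hP : ∀ t, t ≤ τ → P t (y t) = 0 := fun t ht => by
    refine h.proj_eq_zero_of_backward_bdd hI hu hγ (mem_of_le_of_not_bddBelow hI hu hτ ht)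
      (M := D * γ ^ (t - τ)) (fun s hs => hev s t hs ht) fun s hs => ?_
    refine (hD s (hs.trans ht)).trans (le_of_eq ?_)
    rw [mul_assoc, ← zpow_add₀ hγ0.ne']
    congr 2; ring
  refine ⟨hP t ht, (h.back_unique (mem_of_le_of_not_bddBelow hI hu hτ ht) hτ ht (hP t ht)
    ?_).symm⟩
  rw [hev t τ ht le_rfl, hP τ le_rfl, sub_zero]

namespace IsSplit

/-- The defect of a weighted bounded sequence from the sum with Green's function solves the
linear equation. -/
lemma exists_homogeneous [CompleteSpace X]
    (h : IsSplit I ℒ P B K α β) (hF : IsPerturbation I ℒ F Λ) {J : Set ℤ}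
    (hJ : J ⊆ I) (hδ : 0 < δ) (hγ : γ ∈ Icc (α + δ) (β - δ)) {x : ℤ → X} {D : ℝ}
    (hD : ∀ t ∈ J, ‖x t‖ ≤ D * γ ^ (t - τ))
    (hx : ∀ t ∈ J, t + 1 ∈ J → x (t + 1) = F t (x t)) :
    ∃ (y : ℤ → X) (D' : ℝ), (∀ t : J, x t = y t +
        ∑' s : J, green J ℒ P B t s (resid I ℒ F s (x s))) ∧
      (∀ t ∈ J, ‖y t‖ ≤ D' * γ ^ (t - τ)) ∧
      (∀ t ∈ J, t + 1 ∈ J → y (t + 1) = ℒ t (y t)) := by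
  classical
  have hadm := admissible_greenBound h.nonneg h.pos hδ hγ J τ
  have hf : ∀ s : J, ‖resid I ℒ F s (x s)‖ ≤ Λ * D * γ ^ ((s : ℤ) - τ) := fun s =>
    (hF.norm_resid_le s _).trans ((mul_le_mul_of_nonneg_left (hD s s.2) hF.nonneg).trans
      (le_of_eq (by ring)))
  let ψ : J → X := fun t => ∑' s : J, green J ℒ P B t s (resid I ℒ F s (x s))
  have hψ : ∀ t : J, ‖ψ t‖ ≤ 2 * K / δ * (Λ * D) * γ ^ ((t : ℤ) - τ) :=
    hadm.norm_tsum_apply_le' (h.norm_green_le hJ) hf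
  let y : ℤ → X := fun t => if ht : t ∈ J then x t - ψ ⟨t, ht⟩ else 0
  have hy : ∀ t (ht : t ∈ J), y t = x t - ψ ⟨t, ht⟩ := fun t ht => dif_pos ht
  refine ⟨y, D + 2 * K / δ * (Λ * D), fun t => ?_, fun t ht => ?_, fun t ht ht' => ?_⟩
  · rw [hy t t.2]; simp [ψ]
  · rw [hy t ht, add_mul]
    exact (norm_sub_le _ _).trans (add_le_add (hD t ht) (hψ ⟨t, ht⟩))
  · have h1 := h.tsum_green_step hJ hδ hγ hf (t := ⟨t, ht⟩) (t' := ⟨t + 1, ht'⟩) rfl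
    have h2 : ψ ⟨t + 1, ht'⟩ = ℒ t (ψ ⟨t, ht⟩) + resid I ℒ F t (x t) := h1
    rw [hy _ ht', hy _ ht, h2, hx t ht ht', map_sub, eq_add_resid (ℒ := ℒ) (F := F) ⟨hJ ht, hJ ht'⟩]
    abel

/-! #### Pseudo-stable bundle -/

variable (I ℒ γj) in
/-- The linear part of the Lyapunov–Perron equation in forward time. -/
def stableLin (τ : ℤ) (t : Ici τ) : stableFiber I ℒ γj τ →L[𝕂] X :=
  (evol ℒ t τ).comp (stableFiber I ℒ γj τ).subtypeL

variable (I ℒ P B γj γ F) in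
/-- Solutions of `F` with weighted growth `γ` in forward time, parametrized over the
pseudo-stable fiber. -/
def stableFamily (τ : ℤ) : Ici τ → stableFiber I ℒ γj τ → X :=
  fixedFamily (green (Ici τ) ℒ P B) (fun t => γ ^ ((t : ℤ) - τ)) (stableLin I ℒ γj τ)
    (fun s => resid I ℒ F s)

/-- The spectral gap makes the weight admissible, and 2KΛ < δ is the contraction condition. The
linear part is bounded by K γ^(t-τ), since forward evolution on the fiber has rate α ≤ γ. -/
lemma stableFixedData (h : IsSplit I ℒ P B K α β) (hu : ¬ BddAbove I) (hτ : τ ∈ I)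
    (hγj : γj ∈ Ico α β) (hF : IsPerturbation I ℒ F Λ) (hδ : 0 < δ) (hΛ : 2 * K * Λ < δ)
    (hγ : γ ∈ Icc (α + δ) (β - δ)) :
    FixedData (fun t s : Ici τ => greenBound K α β t s) (2 * K / δ) Λ K
      (fun t : Ici τ => γ ^ ((t : ℤ) - τ)) (green (Ici τ) ℒ P B) (stableLin I ℒ γj τ)
      (fun s => resid I ℒ F s) where
  adm := admissible_greenBound h.nonneg h.pos hδ hγ _ _
  kernel := h.norm_green_le fun t ht => mem_of_le_of_not_bddAbove h.ordConnected hu hτ ht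
  L_nonneg := hF.nonneg
  contr := mul_lt_one_of hδ hΛ
  K_nonneg := h.nonneg
  S_le t := by
    have hγ0 : 0 < γ := by linarith [hγ.1, h.pos]
    refine ContinuousLinearMap.opNorm_le_bound _ (mul_nonneg h.nonneg (zpow_nonneg hγ0.le _))
      fun v => ?_
    have ht : τ ≤ (t : ℤ) := t.2
    have h1 := h.forward_apply hτ (mem_of_le_of_not_bddAbove h.ordConnected hu hτ ht) ht (v : X)
    rw [(h.mem_stableFiber_iff h.ordConnected hu hγj.1 hγj.2 hτ).1 v.2] at h1
    have h2 : α ^ ((t : ℤ) - τ) ≤ γ ^ ((t : ℤ) - τ) :=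
      zpow_le_zpow_left₀ (by omega) h.pos.le (by linarith [hγ.1])
    exact h1.trans (mul_le_mul_of_nonneg_right (mul_le_mul_of_nonneg_left h2 h.nonneg)
      (norm_nonneg _))
  zero s := hF.zero s
  lip s := hF.lip s

lemma stableFamily_isFixedFamily [CompleteSpace X]
    (h : IsSplit I ℒ P B K α β) (hu : ¬ BddAbove I) (hτ : τ ∈ I)
    (hγj : γj ∈ Ico α β) (hF : IsPerturbation I ℒ F Λ) (hδ : 0 < δ) (hΛ : 2 * K * Λ < δ)
    (hγ : γ ∈ Icc (α + δ) (β - δ)) :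
    IsFixedFamily (green (Ici τ) ℒ P B) (fun t : Ici τ => γ ^ ((t : ℤ) - τ))
      (stableLin I ℒ γj τ) (fun s => resid I ℒ F s) (stableFamily I ℒ P B F γ γj τ) :=
  (h.stableFixedData hu hτ hγj hF hδ hΛ hγ).isFixedFamily

/-- The family is built in the smallest weight α + δ, so its members satisfy the growth bound for
all larger γ as well. Conversely, a solution of growth γ solves the same equation in the weight γ,
and uniqueness there identifies it. Therefore the right-hand side is free of γ. -/
theorem mem_stableSet_iff [CompleteSpace X]
    (h : IsSplit I ℒ P B K α β) (hu : ¬ BddAbove I) (hτ : τ ∈ I)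
    (hγj : γj ∈ Ico α β) (hF : IsPerturbation I ℒ F Λ) (hδ : 0 < δ) (hΛ : 2 * K * Λ < δ)
    (hγ : γ ∈ Icc (α + δ) (β - δ)) {u : X} :
    (τ, u) ∈ stableSet I F γ ↔ ∃ v : stableFiber I ℒ γj τ,
      u = stableFamily I ℒ P B F (α + δ) γj τ ⟨τ, self_mem_Ici⟩ v := by
  have hI := h.ordConnected
  have hJ : Ici τ ⊆ I := fun t ht => mem_of_le_of_not_bddAbove hI hu hτ ht
  have hα := h.pos
  have hγ0 : 0 < γ := by linarith [hγ.1]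
  have hγ' : α + δ ∈ Icc (α + δ) (β - δ) := ⟨le_rfl, hγ.1.trans hγ.2⟩
  have hfam := h.stableFamily_isFixedFamily hu hτ hγj hF hδ hΛ hγ'
  have hdat := h.stableFixedData hu hτ hγj hF hδ hΛ hγ
  set φ := stableFamily I ℒ P B F (α + δ) γj τ with hφ
  have hbd : ∀ v, ∃ D, ∀ k : Ici τ, ‖φ k v‖ ≤ D * γ ^ ((k : ℤ) - τ) := fun v => by
    obtain ⟨D, hD⟩ := hfam.bdd v
    refine ⟨|D|, fun k => (hD k).trans ?_⟩
    have hk : τ ≤ (k : ℤ) := k.2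
    exact mul_le_mul (le_abs_self D) (zpow_le_zpow_left₀ (by omega) (by linarith) hγ.1)
      (zpow_nonneg (by linarith) _) (abs_nonneg D)
  have hfam' : IsFixedFamily (green (Ici τ) ℒ P B) (fun t : Ici τ => γ ^ ((t : ℤ) - τ))
      (stableLin I ℒ γj τ) (fun s => resid I ℒ F s) φ := ⟨hbd, hfam.eq⟩
  constructor
  · rintro ⟨-, M, hM⟩
    dsimp only at hM
    have hD : ∀ t ∈ Ici τ, ‖sol F t τ u‖ ≤ M * γ ^ (t - τ) := fun t ht => by
      have h1 := hM t (hJ ht) ht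
      rwa [← neg_sub t τ, zpow_neg, inv_mul_le_iff₀ (zpow_pos hγ0 _), mul_comm] at h1
    -- The defect y solves the linear equation with growth γ < β, so y τ belongs to the
    -- pseudo-stable fiber and is the parameter sought.
    obtain ⟨y, D', hy, hyD, hys⟩ := h.exists_homogeneous hF hJ hδ hγ hD
      fun t ht _ => sol_succ F ht u
    have hyev : ∀ t, τ ≤ t → evol ℒ t τ (y τ) = y t := fun t ht => by
      induction t, ht using Int.leInduction with
      | base => simp
      | succ t ht ih =>
        rw [evol_succ ℒ ht, hys t ht (mem_Ici.2 (by omega)), ← ih]; rfl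
    have hPy : P τ (y τ) = y τ := h.proj_eq_of_forward_bdd hI hu hγ0 (by linarith [hγ.2]) hτ
      (M := D') fun t ht => by rw [hyev t ht]; exact hyD t ht
    have hv : y τ ∈ stableFiber I ℒ γj τ := (h.mem_stableFiber_iff hI hu hγj.1 hγj.2 hτ).2 hPy
    refine ⟨⟨y τ, hv⟩, ?_⟩
    have := hdat.unique hfam' (v := ⟨y τ, hv⟩) (x := fun t => sol F t τ u)
      ⟨M, fun t => hD t t.2⟩ (fun t => (hy t).trans (by
        rw [← hyev t t.2]; rfl)) ⟨τ, self_mem_Ici⟩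
    simpa using this
  · rintro ⟨v, rfl⟩
    obtain ⟨D, hD⟩ := hbd v
    have hf : ∀ s : Ici τ, ‖resid I ℒ F s (φ s v)‖ ≤ Λ * D * γ ^ ((s : ℤ) - τ) := fun s =>
      (hF.norm_resid_le s _).trans ((mul_le_mul_of_nonneg_left (hD s) hF.nonneg).trans
        (le_of_eq (by ring)))
    have hstep : ∀ t (ht : t ∈ Ici τ) (ht' : t + 1 ∈ Ici τ), φ ⟨t + 1, ht'⟩ v = F t (φ ⟨t, ht⟩ v) := by
      intro t ht ht'
      have h1 := h.tsum_green_step hJ hδ hγ hf (t := ⟨t, ht⟩) (t' := ⟨t + 1, ht'⟩) rfl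
      rw [eq_add_resid (ℒ := ℒ) (F := F) ⟨hJ ht, hJ ht'⟩]
      conv_rhs => rw [hfam.eq ⟨t, ht⟩ v]
      rw [hfam.eq ⟨t + 1, _⟩ v, h1, map_add, ← hfam.eq ⟨t, ht⟩ v]
      simp only [stableLin, ContinuousLinearMap.comp_apply, evol_succ ℒ (mem_Ici.1 ht)]
      abel
    have hsol : ∀ t (ht : τ ≤ t), sol F t τ (φ ⟨τ, self_mem_Ici⟩ v) = φ ⟨t, ht⟩ v := by
      intro t ht
      induction t, ht using Int.leInduction with
      | base => simp
      | succ t ht ih => rw [sol_succ F ht, ih, hstep t ht (mem_Ici.2 (by omega))]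
    refine ⟨hτ, D, fun t _ ht => ?_⟩
    dsimp only at ht ⊢
    rw [hsol t ht, ← neg_sub t τ, zpow_neg, inv_mul_le_iff₀ (zpow_pos hγ0 _), mul_comm]
    exact hD ⟨t, ht⟩

/-! #### Pseudo-unstable bundle -/

variable (I ℒ B γj) in
/-- The linear part of the Lyapunov–Perron equation in backward time. -/
def unstableLin (τ : ℤ) (t : Iic τ) : unstableFiber I ℒ γj τ →L[𝕂] X :=
  (B t τ).comp (unstableFiber I ℒ γj τ).subtypeL

variable (I ℒ P B γj γ F) in
/-- Solutions of `F` with weighted growth `γ` in backward time, parametrized over the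
pseudo-unstable fiber. -/
def unstableFamily (τ : ℤ) : Iic τ → unstableFiber I ℒ γj τ → X :=
  fixedFamily (green (Iic τ) ℒ P B) (fun t => γ ^ ((t : ℤ) - τ)) (unstableLin I ℒ B γj τ)
    (fun s => resid I ℒ F s)

lemma zpow_anti {a b : ℝ} (ha : 0 < a) (hab : a ≤ b) {n : ℤ} (hn : n ≤ 0) : b ^ n ≤ a ^ n := by
  have e : ∀ c : ℝ, c ^ n = (c ^ (-n))⁻¹ := fun c => by rw [zpow_neg, inv_inv]
  rw [e, e a]
  exact inv_anti₀ (zpow_pos ha _) (zpow_le_zpow_left₀ (by omega) ha.le hab)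

/-- In backward time the exponents t - τ are nonpositive, so the rate β of the inverse evolution is
dominated by every γ ≤ β - δ. -/
lemma unstableFixedData (h : IsSplit I ℒ P B K α β) (hu : ¬ BddBelow I) (hτ : τ ∈ I)
    (hF : IsPerturbation I ℒ F Λ) (hδ : 0 < δ) (hΛ : 2 * K * Λ < δ)
    (hγ : γ ∈ Icc (α + δ) (β - δ)) :
    FixedData (fun t s : Iic τ => greenBound K α β t s) (2 * K / δ) Λ K
      (fun t : Iic τ => γ ^ ((t : ℤ) - τ)) (green (Iic τ) ℒ P B) (unstableLin I ℒ B γj τ)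
      (fun s => resid I ℒ F s) where
  adm := admissible_greenBound h.nonneg h.pos hδ hγ _ _
  kernel := h.norm_green_le fun t ht => mem_of_le_of_not_bddBelow h.ordConnected hu hτ ht
  L_nonneg := hF.nonneg
  contr := mul_lt_one_of hδ hΛ
  K_nonneg := h.nonneg
  S_le t := by
    have hγ0 : 0 < γ := by linarith [hγ.1, h.pos]
    refine ContinuousLinearMap.opNorm_le_bound _ (mul_nonneg h.nonneg (zpow_nonneg hγ0.le _))
      fun v => ?_
    have ht : (t : ℤ) ≤ τ := t.2
    have h1 := (B t τ).le_of_opNorm_le (h.norm_back t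
      (mem_of_le_of_not_bddBelow h.ordConnected hu hτ ht) τ hτ ht) (v : X)
    have h2 : β ^ ((t : ℤ) - τ) ≤ γ ^ ((t : ℤ) - τ) :=
      zpow_anti hγ0 (by linarith [hγ.2]) (by omega)
    exact h1.trans (mul_le_mul_of_nonneg_right (mul_le_mul_of_nonneg_left h2 h.nonneg)
      (norm_nonneg _))
  zero s := hF.zero s
  lip s := hF.lip s

lemma unstableFamily_isFixedFamily [CompleteSpace X]
    (h : IsSplit I ℒ P B K α β) (hu : ¬ BddBelow I) (hτ : τ ∈ I)
    (hF : IsPerturbation I ℒ F Λ) (hδ : 0 < δ) (hΛ : 2 * K * Λ < δ)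
    (hγ : γ ∈ Icc (α + δ) (β - δ)) :
    IsFixedFamily (green (Iic τ) ℒ P B) (fun t : Iic τ => γ ^ ((t : ℤ) - τ))
      (unstableLin I ℒ B γj τ) (fun s => resid I ℒ F s) (unstableFamily I ℒ P B F γ γj τ) :=
  (h.unstableFixedData hu hτ hF hδ hΛ hγ).isFixedFamily

/-- For t ≤ τ the weight γ^(t-τ) decreases in γ, so now β - δ is the most restrictive choice, and
independence of γ follows from uniqueness as in forward time. -/
theorem mem_unstableSet_iff [CompleteSpace X]
    (h : IsSplit I ℒ P B K α β) (hu : ¬ BddBelow I) (hτ : τ ∈ I)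
    (hγj : γj ∈ Ioc α β) (hF : IsPerturbation I ℒ F Λ) (hδ : 0 < δ) (hΛ : 2 * K * Λ < δ)
    (hγ : γ ∈ Icc (α + δ) (β - δ)) {u : X} :
    (τ, u) ∈ unstableSet I F γ ↔ ∃ v : unstableFiber I ℒ γj τ,
      u = unstableFamily I ℒ P B F (β - δ) γj τ ⟨τ, self_mem_Iic⟩ v := by
  classical
  have hI := h.ordConnected
  have hJ : Iic τ ⊆ I := fun t ht => mem_of_le_of_not_bddBelow hI hu hτ ht
  have hα := h.pos
  have hγ0 : 0 < γ := by linarith [hγ.1]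
  have hγ' : β - δ ∈ Icc (α + δ) (β - δ) := ⟨hγ.1.trans hγ.2, le_rfl⟩
  have hfam := h.unstableFamily_isFixedFamily (γj := γj) hu hτ hF hδ hΛ hγ'
  have hdat := h.unstableFixedData (γj := γj) hu hτ hF hδ hΛ hγ
  set φ := unstableFamily I ℒ P B F (β - δ) γj τ with hφ
  have hbd : ∀ v, ∃ D, ∀ k : Iic τ, ‖φ k v‖ ≤ D * γ ^ ((k : ℤ) - τ) := fun v => by
    obtain ⟨D, hD⟩ := hfam.bdd v
    refine ⟨|D|, fun k => (hD k).trans ?_⟩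
    have hk : (k : ℤ) ≤ τ := k.2
    exact mul_le_mul (le_abs_self D) (zpow_anti hγ0 hγ.2 (by omega))
      (zpow_nonneg (by linarith [hγ.2]) _) (abs_nonneg D)
  have hfam' : IsFixedFamily (green (Iic τ) ℒ P B) (fun t : Iic τ => γ ^ ((t : ℤ) - τ))
      (unstableLin I ℒ B γj τ) (fun s => resid I ℒ F s) φ := ⟨hbd, hfam.eq⟩
  constructor
  · rintro ⟨-, x, hx, ⟨M, hM⟩, hxu⟩
    dsimp only at hM hxu
    have hD : ∀ t ∈ Iic τ, ‖x t‖ ≤ M * γ ^ (t - τ) := fun t ht => by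
      have h1 := hM t (hJ ht) ht
      rwa [← neg_sub t τ, zpow_neg, inv_mul_le_iff₀ (zpow_pos hγ0 _), mul_comm] at h1
    obtain ⟨y, D', hy, hyD, hys⟩ := h.exists_homogeneous hF hJ hδ hγ hD
      fun t ht ht' => hx t ⟨hJ ht, hJ ht'⟩
    have hb := fun t (ht : t ≤ τ) => h.back_eq_of_homogeneous hu hτ
      (by linarith [hγ.1] : α < γ) hyD
      (fun t ht => hys t (mem_Iic.2 ht.le) (mem_Iic.2 ht)) ht
    have hv : y τ ∈ unstableFiber I ℒ γj τ :=
      (h.mem_unstableFiber_iff hI hu hγj.1 hγj.2 hτ).2 (hb τ le_rfl).1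
    refine ⟨⟨y τ, hv⟩, ?_⟩
    have := hdat.unique hfam' (v := ⟨y τ, hv⟩) (x := fun t => x t)
      ⟨M, fun t => hD t t.2⟩ (fun t => (hy t).trans (by
        rw [← (hb t t.2).2]; rfl)) ⟨τ, self_mem_Iic⟩
    rw [← hxu]
    simpa using this
  · rintro ⟨v, rfl⟩
    obtain ⟨D, hD⟩ := hbd v
    have hf : ∀ s : Iic τ, ‖resid I ℒ F s (φ s v)‖ ≤ Λ * D * γ ^ ((s : ℤ) - τ) := fun s =>
      (hF.norm_resid_le s _).trans ((mul_le_mul_of_nonneg_left (hD s) hF.nonneg).trans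
        (le_of_eq (by ring)))
    have hstep : ∀ t (ht : t ∈ Iic τ) (ht' : t + 1 ∈ Iic τ), φ ⟨t + 1, ht'⟩ v = F t (φ ⟨t, ht⟩ v) := by
      intro t ht ht'
      have h1 := h.tsum_green_step hJ hδ hγ hf (t := ⟨t, ht⟩) (t' := ⟨t + 1, ht'⟩) rfl
      have htp : t ∈ prime I := ⟨hJ ht, hJ ht'⟩
      rw [eq_add_resid (ℒ := ℒ) (F := F) htp]
      conv_rhs => rw [hfam.eq ⟨t, ht⟩ v]
      rw [hfam.eq ⟨t + 1, _⟩ v, h1, map_add, ← hfam.eq ⟨t, ht⟩ v]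
      simp only [unstableLin, ContinuousLinearMap.comp_apply]
      rw [h.step_back htp hτ ht']
      abel
    -- No growth is prescribed after τ, where the equation is simply iterated to obtain a solution
    -- on all of 𝕀.
    let x : ℤ → X := fun t => if ht : t ≤ τ then φ ⟨t, ht⟩ v else
      sol F t τ (φ ⟨τ, self_mem_Iic⟩ v)
    have hx1 : ∀ t (ht : t ≤ τ), x t = φ ⟨t, ht⟩ v := fun t ht => dif_pos ht
    have hx2 : ∀ t, τ ≤ t → x t = sol F t τ (φ ⟨τ, self_mem_Iic⟩ v) := fun t ht => by
      rcases ht.lt_or_eq with h1 | rfl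
      · exact dif_neg (not_le.2 h1)
      · rw [hx1 _ le_rfl, sol_self]
    refine ⟨hτ, x, fun t ht => ?_, ⟨D, fun t _ ht => ?_⟩, hx1 τ le_rfl⟩
    · by_cases h1 : t + 1 ≤ τ
      · rw [hx1 _ h1, hx1 t (by omega), hstep t (mem_Iic.2 (by omega)) h1]
      · rw [hx2 _ (by omega), hx2 t (by omega), sol_succ F (by omega)]
    · dsimp only at ht ⊢
      rw [hx1 t ht, ← neg_sub t τ, zpow_neg, inv_mul_le_iff₀ (zpow_pos hγ0 _), mul_comm]
      exact hD ⟨t, ht⟩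

/-! #### Entire solutions -/

/-- With growth γ in both directions the linear defect lies in the range and in the kernel of P and
vanishes. What remains is φ = G R(φ), whose only weighted bounded solution is 0. -/
theorem eq_zero_of_bdd [CompleteSpace X]
    (h : IsSplit univ ℒ P B K α β) (hF : IsPerturbation univ ℒ F Λ)
    (hδ : 0 < δ) (hΛ : 2 * K * Λ < δ) (hγ : γ ∈ Icc (α + δ) (β - δ)) {x : ℤ → X}
    (hx : IsSolution univ F x) {D : ℝ} (hD : ∀ t, ‖x t‖ ≤ D * γ ^ t) (t : ℤ) : x t = 0 := by
  have hα := h.pos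
  have hI := h.ordConnected
  have hγ0 : 0 < γ := by linarith [hγ.1]
  have hu : ¬ BddAbove (univ : Set ℤ) := not_bddAbove_univ
  have hl : ¬ BddBelow (univ : Set ℤ) := not_bddBelow_univ
  obtain ⟨y, D', hy, hyD, hys⟩ := h.exists_homogeneous (τ := 0) hF subset_rfl hδ hγ
    (x := x) (D := D) (fun t _ => by simpa using hD t) fun t _ _ => hx t ⟨trivial, trivial⟩
  have hyD' : ∀ t τ, ‖y t‖ ≤ (D' * γ ^ τ) * γ ^ (t - τ) := fun t τ => by
    refine (hyD t trivial).trans (le_of_eq ?_)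
    rw [mul_assoc, ← zpow_add₀ hγ0.ne']
    congr 2; ring
  have hyev : ∀ τ t, τ ≤ t → evol ℒ t τ (y τ) = y t := fun τ t ht => by
    induction t, ht using Int.leInduction with
    | base => simp
    | succ t ht ih => rw [evol_succ ℒ ht, hys t trivial trivial, ← ih]; rfl
  have hy0 : ∀ τ, y τ = 0 := fun τ => by
    have hP : P τ (y τ) = y τ := h.proj_eq_of_forward_bdd hI hu hγ0 (by linarith [hγ.2])
      (mem_univ τ) fun t ht => by rw [hyev τ t ht]; exact hyD' t τ
    rw [← hP]
    exact (h.back_eq_of_homogeneous hl (mem_univ τ) (by linarith [hγ.1] : α < γ)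
      (fun t _ => hyD' t τ) (fun t _ => hys t trivial trivial) le_rfl).1
  -- There is no linear part on the full time axis, so its bound is 0.
  have hdat : FixedData (fun t s : (univ : Set ℤ) => greenBound K α β t s) (2 * K / δ) Λ 0
      (fun t => γ ^ ((t : ℤ) - 0)) (green univ ℒ P B) (fun _ => (0 : X →L[𝕂] X))
      (fun s => resid univ ℒ F s) :=
    { adm := admissible_greenBound h.nonneg h.pos hδ hγ _ _
      kernel := h.norm_green_le subset_rfl
      L_nonneg := hF.nonneg
      contr := mul_lt_one_of hδ hΛ
      K_nonneg := le_rfl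
      S_le := fun t => by simp
      zero := fun s => hF.zero s
      lip := fun s => hF.lip s }
  refine hdat.unique (φ := fun _ _ => 0) (v := (0 : X)) (x := fun t => x t)
    ⟨fun _ => ⟨0, by simp⟩, fun k v => by simp [hF.zero]⟩ ⟨D, fun t => by simpa using hD t⟩
    (fun t => ?_) ⟨t, trivial⟩
  simpa [hy0] using hy t

/-- Through a common point the forward orbit and the backward solution join to an entire solution of
growth γ on both sides. -/
theorem stableSet_inter_unstableSet [CompleteSpace X]
    (h : IsSplit univ ℒ P B K α β)
    (hF : IsPerturbation univ ℒ F Λ) (hδ : 0 < δ) (hΛ : 2 * K * Λ < δ)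
    (hγ : γ ∈ Icc (α + δ) (β - δ)) :
    stableSet univ F γ ∩ unstableSet univ F γ = univ ×ˢ {0} := by
  have hα := h.pos
  have hγ0 : 0 < γ := by linarith [hγ.1]
  ext ⟨τ, u⟩
  simp only [mem_prod, mem_univ, true_and, mem_singleton_iff]
  constructor
  · rintro ⟨⟨-, M, hM⟩, -, φ, hφ, ⟨M', hM'⟩, hu⟩
    dsimp only at hM hM' hu
    subst hu
    refine h.eq_zero_of_bdd hF hδ hΛ hγ hφ (D := max M M' * γ ^ (-τ)) (fun t => ?_) τ
    have h1 : γ ^ (τ - t) * ‖φ t‖ ≤ max M M' := by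
      rcases le_total τ t with ht | ht
      · rw [← sol_eq_of_step ht fun s _ _ => hφ s ⟨trivial, trivial⟩]
        exact (hM t trivial ht).trans (le_max_left _ _)
      · exact (hM' t trivial ht).trans (le_max_right _ _)
    rw [← neg_sub t τ, zpow_neg, inv_mul_le_iff₀ (zpow_pos hγ0 _), mul_comm] at h1
    rw [mul_assoc, ← zpow_add₀ hγ0.ne', neg_add_eq_sub]
    exact h1
  · rintro rfl
    have h0 : ∀ t, F t 0 = 0 := fun t => hF.apply_zero ⟨trivial, trivial⟩
    refine ⟨⟨trivial, 0, fun t _ ht => ?_⟩, trivial, fun _ => 0, fun t _ => (h0 t).symm,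
      ⟨0, fun t _ _ => by simp⟩, rfl⟩
    dsimp only at ht ⊢
    rw [sol_eq_of_step (φ := fun _ => (0 : X)) ht fun s _ _ => (h0 s).symm]
    simp

end IsSplit

end LyapunovPerron

/-! ### Gap conditions -/

section GapCondition

variable {α β δ : ℝ} {m : ℕ}

/-- If α + δ ≤ 1, the power contributes nothing. Otherwise put r = (α + β)/(α + α^m): the condition
gives (α + δ)^m ≤ α^m r and, as r ≥ 1, also δ ≤ α(r - 1). The two right-hand sides add up to β by
the choice of r. -/
lemma pow_mem_of_gap (hα : 0 < α) (hδ : 0 < δ) (hδ2 : δ ≤ (β - α) / 2) (hm : 1 ≤ m)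
    (hαβ : α ^ m < β) (hgap : δ ≤ α * (((α + β) / (α + α ^ m)) ^ (1 / (m : ℝ)) - 1))
    {l : ℕ} (hl : l + 1 ≤ m) :
    (α + δ) * max 1 (α + δ) ^ l ∈ Icc (α + δ) (β - δ) := by
  have hγ : 0 < α + δ := by linarith
  refine ⟨le_mul_of_one_le_right hγ.le (one_le_pow₀ (le_max_left _ _)), ?_⟩
  rcases le_total (α + δ) 1 with h1 | h1
  · rw [max_eq_left h1]; simp; linarith
  rw [max_eq_right h1, ← pow_succ']
  refine (pow_le_pow_right₀ h1 hl).trans ?_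
  set A := α ^ m with hA
  have hA0 : 0 < A := pow_pos hα m
  set r := (α + β) / (α + A) with hr
  have hr1 : 1 ≤ r := by rw [hr, one_le_div (by positivity)]; linarith
  have hm0 : (m : ℝ) ≠ 0 := by positivity
  have hm1 : (1 : ℝ) ≤ m := by exact_mod_cast hm
  have h2 : α + δ ≤ α * r ^ (1 / (m : ℝ)) := by linarith
  have h3 : (α + δ) ^ m ≤ A * r := by
    refine (pow_le_pow_left₀ hγ.le h2 m).trans (le_of_eq ?_)
    rw [mul_pow, ← Real.rpow_natCast (r ^ _), ← Real.rpow_mul (by linarith), one_div,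
      inv_mul_cancel₀ hm0, Real.rpow_one]
  have h4 : r ^ (1 / (m : ℝ)) ≤ r := by
    conv_rhs => rw [← Real.rpow_one r]
    exact Real.rpow_le_rpow_of_exponent_le hr1 (by rw [div_le_one (by positivity)]; exact hm1)
  have h5 : δ ≤ α * (r - 1) :=
    hgap.trans (mul_le_mul_of_nonneg_left (by linarith) hα.le)
  have h6 : A * r + α * (r - 1) = β := by
    have : r * (α + A) = α + β := by rw [hr]; field_simp
    linarith
  linarith

/-- Mirror image with r = (α + β)/(β + β^m) ≤ 1: here (β - δ)^m ≥ β^m r and δ ≤ β(1 - r), and β^m r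
- β(1 - r) = α. -/
lemma pow_mem_of_gap' (hα : 0 < α) (hδ : 0 < δ) (hδ2 : δ ≤ (β - α) / 2) (hm : 1 ≤ m)
    (hαβ : α < β ^ m) (hgap : δ ≤ β * (1 - ((α + β) / (β + β ^ m)) ^ (1 / (m : ℝ))))
    {l : ℕ} (hl : l + 1 ≤ m) :
    (β - δ) * min 1 (β - δ) ^ l ∈ Icc (α + δ) (β - δ) := by
  have hγ : 0 < β - δ := by linarith
  have hβ : 0 < β := by linarith
  refine ⟨?_, mul_le_of_le_one_right hγ.le
    (pow_le_one₀ (le_min zero_le_one hγ.le) (min_le_left _ _))⟩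
  rcases le_total 1 (β - δ) with h1 | h1
  · rw [min_eq_left h1]; simp; linarith
  rw [min_eq_right h1, ← pow_succ']
  refine le_trans ?_ (pow_le_pow_of_le_one hγ.le h1 hl)
  set b := β ^ m with hb
  have hb0 : 0 < b := pow_pos hβ m
  set r := (α + β) / (β + b) with hr
  have hr0 : 0 ≤ r := by positivity
  have hr1 : r ≤ 1 := by rw [hr, div_le_one (by positivity)]; linarith
  have hm0 : (m : ℝ) ≠ 0 := by positivity
  have hm1 : (1 : ℝ) ≤ m := by exact_mod_cast hm
  have h2 : β * r ^ (1 / (m : ℝ)) ≤ β - δ := by linarith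
  have h3 : b * r ≤ (β - δ) ^ m := by
    refine (le_of_eq ?_).trans (pow_le_pow_left₀ (by positivity) h2 m)
    rw [mul_pow, ← Real.rpow_natCast (r ^ _), ← Real.rpow_mul hr0, one_div,
      inv_mul_cancel₀ hm0, Real.rpow_one]
  have hrp : 0 < r := by positivity
  have h4 : r ≤ r ^ (1 / (m : ℝ)) := by
    conv_lhs => rw [← Real.rpow_one r]
    exact Real.rpow_le_rpow_of_exponent_ge hrp hr1
      (by rw [div_le_one (by positivity)]; exact hm1)
  have h5 : δ ≤ β * (1 - r) :=
    hgap.trans (mul_le_mul_of_nonneg_left (by linarith) hβ.le)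
  have h6 : b * r - β * (1 - r) = α := by
    have : r * (β + b) = α + β := by rw [hr]; field_simp
    linarith
  linarith

end GapCondition

/-! ### Graph representations of the bundles -/

section Graphs

universe u

variable {𝕂 : Type*} [RCLike 𝕂] {X : Type u} [NormedAddCommGroup X] [NormedSpace 𝕂 X]
  {I : Set ℤ} {ℒ P : ℤ → X →L[𝕂] X} {B : ℤ → ℤ → X →L[𝕂] X} {F F' : ℤ → X → X}
  {K α β γ γj δ Λ CR CE ε : ℝ} {τ : ℤ} {m n : ℕ}

/-- The nonlinear parts are of class `C^k` with bounded derivatives. -/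
structure IsSmoothPerturbation (I : Set ℤ) (ℒ : ℤ → X →L[𝕂] X) (F : ℤ → X → X) (k : ℕ)
    (CR : ℝ) : Prop where
  contDiff : ∀ s, ContDiff 𝕂 k (resid I ℒ F s)
  bound : ∀ s l, 1 ≤ l → l ≤ k → ∀ x, ‖iteratedFDeriv 𝕂 l (resid I ℒ F s) x‖ ≤ CR

/-- The Lipschitz bound admissible for all discretizations. -/
def maxLip (K δ : ℝ) : ℝ := δ / (4 * K)

/-- With this Lipschitz bound the contraction factor is 1/2, so the constants derived from it do not
depend on n. -/
lemma two_mul_maxLip_lt (hK : 0 < K) (hδ : 0 < δ) : 2 * K * maxLip K δ < δ := by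
  rw [maxLip]
  field_simp
  norm_num

/-- Constant for the distance of two bundles. -/
def distConst (K δ : ℝ) : ℝ :=
  2 * K / δ * (K / (1 - 2 * K / δ * maxLip K δ)) / (1 - 2 * K / δ * maxLip K δ)

lemma distConst_nonneg (hK : 0 < K) (hδ : 0 < δ) : 0 ≤ distConst K δ := by
  have : 0 < 1 - 2 * K / δ * maxLip K δ := by
    linarith [mul_lt_one_of hδ (two_mul_maxLip_lt hK hδ)]
  unfold distConst
  positivity

/-- Constant for the distance of the derivatives of two bundles. -/
def derivDistConst (K δ CR CE : ℝ) (n j : ℕ) : ℝ :=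
  cmpConst (2 * K / δ) (maxLip K δ) CR CE (nonlinConst (2 * K / δ) (maxLip K δ) K CR n)
    (2 * K / δ * (CE * (K / (1 - 2 * K / δ * maxLip K δ))) / (1 - 2 * K / δ * maxLip K δ)) j

lemma tail_const_eq (hδ : 0 < δ) (hΛ : 2 * K * Λ < δ) :
    K / δ * Λ * (K / (1 - 2 * K / δ * Λ)) = K ^ 2 * Λ / (δ - 2 * K * Λ) := by
  have h1 : δ - 2 * K * Λ ≠ 0 := by linarith
  have h2 : 1 - 2 * K / δ * Λ = (δ - 2 * K * Λ) / δ := by field_simp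
  rw [h2]
  field_simp

namespace IsSplit

variable (I ℒ P B F α δ γj) in
/-- The map whose graph is the pseudo-stable bundle. -/
def stableGraph (τ : ℤ) (v : stableFiber I ℒ γj τ) : X :=
  stableFamily I ℒ P B F (α + δ) γj τ ⟨τ, self_mem_Ici⟩ v - v

variable (I ℒ P B F β δ γj) in
/-- The map whose graph is the pseudo-unstable bundle. -/
def unstableGraph (τ : ℤ) (v : unstableFiber I ℒ γj τ) : X :=
  unstableFamily I ℒ P B F (β - δ) γj τ ⟨τ, self_mem_Iic⟩ v - v

/-- The weight for derivatives of order l + 1 is again a pure power, with base (α + δ) max(1, α +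
δ)^l, so it is admissible as soon as this base stays in the gap. -/
lemma admissible_stable (h : IsSplit I ℒ P B K α β) (hδ : 0 < δ) {l : ℕ}
    (hl : (α + δ) * max 1 (α + δ) ^ l ∈ Icc (α + δ) (β - δ)) (τ : ℤ) :
    Admissible (fun t s : Ici τ => greenBound K α β t s) (2 * K / δ)
      (fun t : Ici τ => (α + δ) ^ ((t : ℤ) - τ) * (max 1 (α + δ) ^ ((t : ℤ) - τ)) ^ l) := by
  have := admissible_greenBound h.nonneg h.pos hδ hl (Ici τ) τ
  convert this using 2 with t
  rw [mul_zpow, ← zpow_natCast (_ ^ _), ← zpow_mul, ← zpow_natCast (max _ _), ← zpow_mul,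
    mul_comm (l : ℤ)]

lemma admissible_unstable (h : IsSplit I ℒ P B K α β) (hδ : 0 < δ) {l : ℕ}
    (hl : (β - δ) * min 1 (β - δ) ^ l ∈ Icc (α + δ) (β - δ)) (τ : ℤ) :
    Admissible (fun t s : Iic τ => greenBound K α β t s) (2 * K / δ)
      (fun t : Iic τ => (β - δ) ^ ((t : ℤ) - τ) * (min 1 (β - δ) ^ ((t : ℤ) - τ)) ^ l) := by
  have := admissible_greenBound h.nonneg h.pos hδ hl (Iic τ) τ
  convert this using 2 with t
  rw [mul_zpow, ← zpow_natCast (_ ^ _), ← zpow_mul, ← zpow_natCast (min _ _), ← zpow_mul,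
    mul_comm (l : ℤ)]

variable [CompleteSpace X]

section Stable

lemma stableSet_eq_graphOver (h : IsSplit I ℒ P B K α β) (hu : ¬ BddAbove I)
    (hγj : γj ∈ Ico α β) (hF : IsPerturbation I ℒ F Λ) (hδ : 0 < δ) (hΛ : 2 * K * Λ < δ)
    (hγ : γ ∈ Icc (α + δ) (β - δ)) :
    stableSet I F γ = graphOver I (stableFiber I ℒ γj) (stableGraph I ℒ P B F α γj δ) := by
  ext ⟨τ, u⟩
  constructor
  · intro hz
    obtain ⟨v, hv⟩ := (h.mem_stableSet_iff hu hz.1 hγj hF hδ hΛ hγ).1 hz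
    exact ⟨hz.1, v, by simpa [stableGraph] using hv⟩
  · rintro ⟨hτ, v, hv⟩
    exact (h.mem_stableSet_iff hu hτ hγj hF hδ hΛ hγ).2 ⟨v, by simpa [stableGraph] using hv⟩

lemma stableGap (hδ2 : δ ≤ (β - α) / 2) : α + δ ∈ Icc (α + δ) (β - δ) := ⟨le_rfl, by linarith⟩

lemma continuous_stableGraph (h : IsSplit I ℒ P B K α β) (hu : ¬ BddAbove I) (hτ : τ ∈ I)
    (hγj : γj ∈ Ico α β) (hF : IsPerturbation I ℒ F Λ) (hδ : 0 < δ) (hδ2 : δ ≤ (β - α) / 2)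
    (hΛ : 2 * K * Λ < δ) : Continuous (stableGraph I ℒ P B F α γj δ τ) :=
  ((h.stableFixedData hu hτ hγj hF hδ hΛ (stableGap hδ2)).continuous
    (h.stableFamily_isFixedFamily hu hτ hγj hF hδ hΛ (stableGap hδ2)) _).sub
    continuous_subtype_val

lemma stableGraph_zero (h : IsSplit I ℒ P B K α β) (hu : ¬ BddAbove I) (hτ : τ ∈ I)
    (hγj : γj ∈ Ico α β) (hF : IsPerturbation I ℒ F Λ) (hδ : 0 < δ) (hδ2 : δ ≤ (β - α) / 2)
    (hΛ : 2 * K * Λ < δ) : stableGraph I ℒ P B F α γj δ τ 0 = 0 := by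
  have := (h.stableFixedData hu hτ hγj hF hδ hΛ (stableGap hδ2)).apply_zero
    (h.stableFamily_isFixedFamily hu hτ hγj hF hδ hΛ (stableGap hδ2)) ⟨τ, self_mem_Ici⟩
  simp [stableGraph, this]

lemma norm_stableGraph_sub_le (h : IsSplit I ℒ P B K α β) (hu : ¬ BddAbove I) (hτ : τ ∈ I)
    (hγj : γj ∈ Ico α β) (hF : IsPerturbation I ℒ F Λ) (hδ : 0 < δ) (hδ2 : δ ≤ (β - α) / 2)
    (hΛ : 2 * K * Λ < δ) (v v' : stableFiber I ℒ γj τ) :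
    ‖stableGraph I ℒ P B F α γj δ τ v - stableGraph I ℒ P B F α γj δ τ v'‖ ≤
      K ^ 2 * Λ / (δ - 2 * K * Λ) * ‖v - v'‖ := by
  have hd := h.stableFixedData hu hτ hγj hF hδ hΛ (stableGap hδ2)
  have hα := h.pos
  have := hd.norm_tail_sub_le
    (h.stableFamily_isFixedFamily hu hτ hγj hF hδ hΛ (stableGap hδ2))
    (k := ⟨τ, self_mem_Ici⟩) (g' := fun s => greenBound K α β τ s) (c := K / δ)
    (hd.kernel _) (hd.adm.summable ⟨τ, self_mem_Ici⟩)
    (tsum_greenBound_Ici_le h.nonneg hδ (by linarith) (by linarith) τ) v v'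
  rw [tail_const_eq hδ hΛ] at this
  simpa [stableGraph, stableLin] using this

lemma norm_stableGraph_sub_stableGraph_le (h : IsSplit I ℒ P B K α β) (hu : ¬ BddAbove I)
    (hτ : τ ∈ I) (hγj : γj ∈ Ico α β) (hF : IsPerturbation I ℒ F (maxLip K δ))
    (hF' : IsPerturbation I ℒ F' (maxLip K δ)) (hδ : 0 < δ) (hδ2 : δ ≤ (β - α) / 2)
    (hε : 0 ≤ ε) (hR : ∀ s x, ‖resid I ℒ F s x - resid I ℒ F' s x‖ ≤ ε * ‖x‖)
    (v : stableFiber I ℒ γj τ) :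
    ‖stableGraph I ℒ P B F α γj δ τ v - stableGraph I ℒ P B F' α γj δ τ v‖ ≤
      distConst K δ * ε * ‖v‖ := by
  have hK : 0 < K := zero_lt_one.trans_le h.one_le
  have hΛ := two_mul_maxLip_lt hK hδ
  have := (h.stableFixedData hu hτ hγj hF hδ hΛ (stableGap hδ2)).norm_sub_le_of_close
    (h.stableFixedData hu hτ hγj hF' hδ hΛ (stableGap hδ2))
    (h.stableFamily_isFixedFamily hu hτ hγj hF hδ hΛ (stableGap hδ2))
    (h.stableFamily_isFixedFamily hu hτ hγj hF' hδ hΛ (stableGap hδ2)) hε (fun s x => hR s x)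
    v ⟨τ, self_mem_Ici⟩
  simp only [stableGraph, sub_sub_sub_cancel_right]
  refine this.trans (le_of_eq ?_)
  simp only [sub_self, zpow_zero, distConst]
  ring

lemma one_le_stableWeight (t : Ici τ) : 1 ≤ max 1 (α + δ) ^ ((t : ℤ) - τ) := by
  have : τ ≤ (t : ℤ) := t.2
  exact one_le_zpow₀ (le_max_left _ _) (by omega)

lemma stableWeight_le (hα : 0 < α) (hδ : 0 < δ) (t : Ici τ) :
    (α + δ) ^ ((t : ℤ) - τ) ≤ max 1 (α + δ) ^ ((t : ℤ) - τ) := by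
  have : τ ≤ (t : ℤ) := t.2
  exact zpow_le_zpow_left₀ (by omega) (by linarith) (le_max_right _ _)

theorem contDiff_stableGraph (h : IsSplit I ℒ P B K α β) (hu : ¬ BddAbove I) (hτ : τ ∈ I)
    (hγj : γj ∈ Ico α β) (hF : IsPerturbation I ℒ F (maxLip K δ)) (hδ : 0 < δ)
    (hδ2 : δ ≤ (β - α) / 2) (hCR : maxLip K δ ≤ CR)
    (hgap : ∀ l ≤ n, (α + δ) * max 1 (α + δ) ^ l ∈ Icc (α + δ) (β - δ))
    (hS : IsSmoothPerturbation I ℒ F (n + 1) CR) :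
    ContDiff 𝕂 (n + 1 : ℕ) (stableGraph I ℒ P B F α γj δ τ) := by
  have hK : 0 < K := zero_lt_one.trans_le h.one_le
  have hΛ := two_mul_maxLip_lt hK hδ
  have h1 := (h.stableFixedData hu hτ hγj hF hδ hΛ (stableGap hδ2)).contDiff
    (h.stableFamily_isFixedFamily hu hτ hγj hF hδ hΛ (stableGap hδ2))
    (ρ := fun t : Ici τ => max 1 (α + δ) ^ ((t : ℤ) - τ)) one_le_stableWeight
    (stableWeight_le h.pos hδ) hCR n (fun l hl => h.admissible_stable hδ (hgap l hl) τ)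
    (fun s => hS.contDiff s) (fun s => hS.bound s) ⟨τ, self_mem_Ici⟩
  exact h1.sub (stableFiber I ℒ γj τ).subtypeL.contDiff

theorem norm_iteratedFDeriv_stableGraph_sub_le (h : IsSplit I ℒ P B K α β) (hu : ¬ BddAbove I)
    (hτ : τ ∈ I) (hγj : γj ∈ Ico α β) (hF : IsPerturbation I ℒ F (maxLip K δ))
    (hF' : IsPerturbation I ℒ F' (maxLip K δ)) (hδ : 0 < δ)
    (hδ2 : δ ≤ (β - α) / 2) (hCR : maxLip K δ ≤ CR) (hCE : 0 ≤ CE) (hε : 0 ≤ ε)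
    (hgap : ∀ l ≤ n + 1, (α + δ) * max 1 (α + δ) ^ l ∈ Icc (α + δ) (β - δ))
    (hS : IsSmoothPerturbation I ℒ F (n + 2) CR) (hS' : IsSmoothPerturbation I ℒ F' (n + 2) CR)
    (hE0 : ∀ s x, ‖resid I ℒ F s x - resid I ℒ F' s x‖ ≤ ε * CE * ‖x‖)
    (hEb : ∀ s l, 1 ≤ l → l ≤ n + 2 → ∀ x,
      ‖iteratedFDeriv 𝕂 l (fun x => resid I ℒ F s x - resid I ℒ F' s x) x‖ ≤ ε * CE)
    {j : ℕ} (hj : j ≤ n + 1) (v : stableFiber I ℒ γj τ) :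
    ‖iteratedFDeriv 𝕂 j (stableGraph I ℒ P B F α γj δ τ) v -
      iteratedFDeriv 𝕂 j (stableGraph I ℒ P B F' α γj δ τ) v‖ ≤
      derivDistConst K δ CR CE n j * ε * (1 + ‖v‖) := by
  have hK : 0 < K := zero_lt_one.trans_le h.one_le
  have hΛ := two_mul_maxLip_lt hK hδ
  have c1 := h.contDiff_stableGraph hu hτ hγj hF hδ hδ2 hCR (n := n + 1) hgap hS
  have c2 := h.contDiff_stableGraph hu hτ hγj hF' hδ hδ2 hCR (n := n + 1) hgap hS'
  have h1 := (h.stableFixedData hu hτ hγj hF hδ hΛ (stableGap hδ2)).cBound_sub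
    (h.stableFixedData hu hτ hγj hF' hδ hΛ (stableGap hδ2))
    (h.stableFamily_isFixedFamily hu hτ hγj hF hδ hΛ (stableGap hδ2))
    (h.stableFamily_isFixedFamily hu hτ hγj hF' hδ hΛ (stableGap hδ2))
    (ρ := fun t : Ici τ => max 1 (α + δ) ^ ((t : ℤ) - τ)) one_le_stableWeight
    (stableWeight_le h.pos hδ) (by positivity) hCE hCR hε (n := n)
    (fun l hl => h.admissible_stable hδ (hgap l hl) τ)
    (fun s => hS.contDiff s) (fun s => hS'.contDiff s) (fun s => hS.bound s)
    (fun s => hS'.bound s) (fun s => hE0 s) (fun s => hEb s) j hj ⟨τ, self_mem_Ici⟩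
  have hjn : ((j : ℕ) : WithTop ℕ∞) ≤ ((n + 1 + 1 : ℕ) : WithTop ℕ∞) := by
    exact_mod_cast (by omega)
  have e := congrFun (iteratedFDeriv_sub (𝕜 := 𝕂) (c1.of_le hjn) (c2.of_le hjn)) v
  rw [Pi.sub_apply] at e
  rw [← e]
  have e2 : stableGraph I ℒ P B F α γj δ τ - stableGraph I ℒ P B F' α γj δ τ = fun v =>
      stableFamily I ℒ P B F (α + δ) γj τ ⟨τ, self_mem_Ici⟩ v -
      stableFamily I ℒ P B F' (α + δ) γj τ ⟨τ, self_mem_Ici⟩ v := by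
    funext v
    simp [stableGraph]
  rw [e2]
  refine (h1.2 j le_rfl v).trans (le_of_eq ?_)
  simp only [sub_self, zpow_zero, one_pow, derivDistConst]
  ring

end Stable

section Unstable

lemma unstableSet_eq_graphOver (h : IsSplit I ℒ P B K α β) (hu : ¬ BddBelow I)
    (hγj : γj ∈ Ioc α β) (hF : IsPerturbation I ℒ F Λ) (hδ : 0 < δ) (hΛ : 2 * K * Λ < δ)
    (hγ : γ ∈ Icc (α + δ) (β - δ)) :
    unstableSet I F γ = graphOver I (unstableFiber I ℒ γj) (unstableGraph I ℒ P B F β γj δ) := by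
  ext ⟨τ, u⟩
  constructor
  · intro hz
    obtain ⟨v, hv⟩ := (h.mem_unstableSet_iff hu hz.1 hγj hF hδ hΛ hγ).1 hz
    exact ⟨hz.1, v, by simpa [unstableGraph] using hv⟩
  · rintro ⟨hτ, v, hv⟩
    exact (h.mem_unstableSet_iff hu hτ hγj hF hδ hΛ hγ).2 ⟨v, by simpa [unstableGraph] using hv⟩

lemma unstableGap (hδ2 : δ ≤ (β - α) / 2) : β - δ ∈ Icc (α + δ) (β - δ) := ⟨by linarith, le_rfl⟩

lemma continuous_unstableGraph (h : IsSplit I ℒ P B K α β) (hu : ¬ BddBelow I) (hτ : τ ∈ I)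
    (hF : IsPerturbation I ℒ F Λ) (hδ : 0 < δ) (hδ2 : δ ≤ (β - α) / 2)
    (hΛ : 2 * K * Λ < δ) : Continuous (unstableGraph I ℒ P B F β γj δ τ) :=
  ((h.unstableFixedData (γj := γj) hu hτ hF hδ hΛ (unstableGap hδ2)).continuous
    (h.unstableFamily_isFixedFamily (γj := γj) hu hτ hF hδ hΛ (unstableGap hδ2)) _).sub
    continuous_subtype_val

lemma unstableGraph_zero (h : IsSplit I ℒ P B K α β) (hu : ¬ BddBelow I) (hτ : τ ∈ I)
    (hF : IsPerturbation I ℒ F Λ) (hδ : 0 < δ) (hδ2 : δ ≤ (β - α) / 2)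
    (hΛ : 2 * K * Λ < δ) : unstableGraph I ℒ P B F β γj δ τ 0 = 0 := by
  have := (h.unstableFixedData (γj := γj) hu hτ hF hδ hΛ (unstableGap hδ2)).apply_zero
    (h.unstableFamily_isFixedFamily (γj := γj) hu hτ hF hδ hΛ (unstableGap hδ2)) ⟨τ, self_mem_Iic⟩
  simp [unstableGraph, this]

lemma norm_unstableGraph_sub_le (h : IsSplit I ℒ P B K α β) (hu : ¬ BddBelow I) (hτ : τ ∈ I)
    (hγj : γj ∈ Ioc α β) (hF : IsPerturbation I ℒ F Λ) (hδ : 0 < δ) (hδ2 : δ ≤ (β - α) / 2)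
    (hΛ : 2 * K * Λ < δ) (v v' : unstableFiber I ℒ γj τ) :
    ‖unstableGraph I ℒ P B F β γj δ τ v - unstableGraph I ℒ P B F β γj δ τ v'‖ ≤
      K ^ 2 * Λ / (δ - 2 * K * Λ) * ‖v - v'‖ := by
  have hd := h.unstableFixedData (γj := γj) hu hτ hF hδ hΛ (unstableGap hδ2)
  have hα := h.pos
  -- At time τ the inverse evolution is id - P, which is the identity on the fiber.
  have hτ' : unstableLin I ℒ B γj τ ⟨τ, self_mem_Iic⟩ =
      (unstableFiber I ℒ γj τ).subtypeL := by
    ext v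
    have h1 := (h.mem_unstableFiber_iff h.ordConnected hu hγj.1 hγj.2 hτ).1 v.2
    have h2 := h.evol_back τ hτ τ hτ le_rfl v
    simpa [unstableLin, h1] using h2
  -- The row of the kernel at τ is replaced by its strict past, which improves its bound from 2K/δ
  -- to K/δ.
  have hgr : ∀ s : Iic τ, (if (s : ℤ) < τ then greenBound K α β τ s else 0) *
      (β - δ) ^ ((s : ℤ) - τ) =
      if (s : ℤ) < τ then greenBound K α β τ s * (β - δ) ^ ((s : ℤ) - τ) else 0 := fun s => by
    split_ifs <;> simp
  have hnn : ∀ s : Iic τ, 0 ≤ greenBound K α β τ s * (β - δ) ^ ((s : ℤ) - τ) := fun s =>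
    mul_nonneg (hd.adm.kernel_nonneg ⟨τ, self_mem_Iic⟩ s) (hd.adm.pos s).le
  have := hd.norm_tail_sub_le
    (h.unstableFamily_isFixedFamily (γj := γj) hu hτ hF hδ hΛ (unstableGap hδ2))
    (k := ⟨τ, self_mem_Iic⟩) (g' := fun s => if (s : ℤ) < τ then greenBound K α β τ s else 0)
    (c := K / δ) (fun s => ?_) ?_ ?_ v v'
  · rw [tail_const_eq hδ hΛ, hτ'] at this
    simpa [unstableGraph] using this
  · split_ifs with hs
    · exact hd.kernel ⟨τ, self_mem_Iic⟩ s
    · have : ¬ (s : ℤ) + 1 ≤ τ := by omega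
      simp [green, this]
  · simp_rw [hgr]
    refine Summable.of_nonneg_of_le (fun s => ?_) (fun s => ?_)
      (hd.adm.summable ⟨τ, self_mem_Iic⟩)
    · split_ifs
      exacts [hnn s, le_rfl]
    · split_ifs
      exacts [le_rfl, hnn s]
  · simp_rw [hgr]
    exact tsum_greenBound_Iic_le h.nonneg hα hδ (by linarith) τ

lemma norm_unstableGraph_sub_unstableGraph_le (h : IsSplit I ℒ P B K α β) (hu : ¬ BddBelow I)
    (hτ : τ ∈ I) (hF : IsPerturbation I ℒ F (maxLip K δ))
    (hF' : IsPerturbation I ℒ F' (maxLip K δ)) (hδ : 0 < δ) (hδ2 : δ ≤ (β - α) / 2)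
    (hε : 0 ≤ ε) (hR : ∀ s x, ‖resid I ℒ F s x - resid I ℒ F' s x‖ ≤ ε * ‖x‖)
    (v : unstableFiber I ℒ γj τ) :
    ‖unstableGraph I ℒ P B F β γj δ τ v - unstableGraph I ℒ P B F' β γj δ τ v‖ ≤
      distConst K δ * ε * ‖v‖ := by
  have hK : 0 < K := zero_lt_one.trans_le h.one_le
  have hΛ := two_mul_maxLip_lt hK hδ
  have := (h.unstableFixedData (γj := γj) hu hτ hF hδ hΛ (unstableGap hδ2)).norm_sub_le_of_close
    (h.unstableFixedData (γj := γj) hu hτ hF' hδ hΛ (unstableGap hδ2))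
    (h.unstableFamily_isFixedFamily (γj := γj) hu hτ hF hδ hΛ (unstableGap hδ2))
    (h.unstableFamily_isFixedFamily (γj := γj) hu hτ hF' hδ hΛ (unstableGap hδ2)) hε (fun s x => hR s x)
    v ⟨τ, self_mem_Iic⟩
  simp only [unstableGraph, sub_sub_sub_cancel_right]
  refine this.trans (le_of_eq ?_)
  simp only [sub_self, zpow_zero, distConst]
  ring

/-- Backward exponents are nonpositive, so here a base at most 1 makes the weight at least 1. -/
lemma one_le_unstableWeight (hβ : 0 < β - δ) (t : Iic τ) :
    1 ≤ min 1 (β - δ) ^ ((t : ℤ) - τ) := by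
  have : (t : ℤ) ≤ τ := t.2
  simpa using zpow_anti (lt_min one_pos hβ) (min_le_left 1 (β - δ))
    (by omega : (t : ℤ) - τ ≤ 0)

lemma unstableWeight_le (hβ : 0 < β - δ) (t : Iic τ) :
    (β - δ) ^ ((t : ℤ) - τ) ≤ min 1 (β - δ) ^ ((t : ℤ) - τ) := by
  have : (t : ℤ) ≤ τ := t.2
  exact zpow_anti (lt_min one_pos hβ) (min_le_right _ _) (by omega)

theorem contDiff_unstableGraph (h : IsSplit I ℒ P B K α β) (hu : ¬ BddBelow I) (hτ : τ ∈ I)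
    (hF : IsPerturbation I ℒ F (maxLip K δ)) (hδ : 0 < δ)
    (hδ2 : δ ≤ (β - α) / 2) (hCR : maxLip K δ ≤ CR)
    (hgap : ∀ l ≤ n, (β - δ) * min 1 (β - δ) ^ l ∈ Icc (α + δ) (β - δ))
    (hS : IsSmoothPerturbation I ℒ F (n + 1) CR) :
    ContDiff 𝕂 (n + 1 : ℕ) (unstableGraph I ℒ P B F β γj δ τ) := by
  have hK : 0 < K := zero_lt_one.trans_le h.one_le
  have hΛ := two_mul_maxLip_lt hK hδ
  have hβ : 0 < β - δ := by linarith [h.pos]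
  have h1 := (h.unstableFixedData (γj := γj) hu hτ hF hδ hΛ (unstableGap hδ2)).contDiff
    (h.unstableFamily_isFixedFamily (γj := γj) hu hτ hF hδ hΛ (unstableGap hδ2))
    (ρ := fun t : Iic τ => min 1 (β - δ) ^ ((t : ℤ) - τ)) (one_le_unstableWeight hβ)
    (unstableWeight_le hβ) hCR n (fun l hl => h.admissible_unstable hδ (hgap l hl) τ)
    (fun s => hS.contDiff s) (fun s => hS.bound s) ⟨τ, self_mem_Iic⟩
  exact h1.sub (unstableFiber I ℒ γj τ).subtypeL.contDiff

theorem norm_iteratedFDeriv_unstableGraph_sub_le (h : IsSplit I ℒ P B K α β) (hu : ¬ BddBelow I)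
    (hτ : τ ∈ I) (hF : IsPerturbation I ℒ F (maxLip K δ))
    (hF' : IsPerturbation I ℒ F' (maxLip K δ)) (hδ : 0 < δ)
    (hδ2 : δ ≤ (β - α) / 2) (hCR : maxLip K δ ≤ CR) (hCE : 0 ≤ CE) (hε : 0 ≤ ε)
    (hgap : ∀ l ≤ n + 1, (β - δ) * min 1 (β - δ) ^ l ∈ Icc (α + δ) (β - δ))
    (hS : IsSmoothPerturbation I ℒ F (n + 2) CR) (hS' : IsSmoothPerturbation I ℒ F' (n + 2) CR)
    (hE0 : ∀ s x, ‖resid I ℒ F s x - resid I ℒ F' s x‖ ≤ ε * CE * ‖x‖)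
    (hEb : ∀ s l, 1 ≤ l → l ≤ n + 2 → ∀ x,
      ‖iteratedFDeriv 𝕂 l (fun x => resid I ℒ F s x - resid I ℒ F' s x) x‖ ≤ ε * CE)
    {j : ℕ} (hj : j ≤ n + 1) (v : unstableFiber I ℒ γj τ) :
    ‖iteratedFDeriv 𝕂 j (unstableGraph I ℒ P B F β γj δ τ) v -
      iteratedFDeriv 𝕂 j (unstableGraph I ℒ P B F' β γj δ τ) v‖ ≤
      derivDistConst K δ CR CE n j * ε * (1 + ‖v‖) := by
  have hK : 0 < K := zero_lt_one.trans_le h.one_le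
  have hΛ := two_mul_maxLip_lt hK hδ
  have hβ : 0 < β - δ := by linarith [h.pos]
  have c1 := h.contDiff_unstableGraph (γj := γj) hu hτ hF hδ hδ2 hCR (n := n + 1) hgap hS
  have c2 := h.contDiff_unstableGraph (γj := γj) hu hτ hF' hδ hδ2 hCR (n := n + 1) hgap hS'
  have h1 := (h.unstableFixedData (γj := γj) hu hτ hF hδ hΛ (unstableGap hδ2)).cBound_sub
    (h.unstableFixedData (γj := γj) hu hτ hF' hδ hΛ (unstableGap hδ2))
    (h.unstableFamily_isFixedFamily (γj := γj) hu hτ hF hδ hΛ (unstableGap hδ2))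
    (h.unstableFamily_isFixedFamily (γj := γj) hu hτ hF' hδ hΛ (unstableGap hδ2))
    (ρ := fun t : Iic τ => min 1 (β - δ) ^ ((t : ℤ) - τ)) (one_le_unstableWeight hβ)
    (unstableWeight_le hβ) (by positivity) hCE hCR hε (n := n)
    (fun l hl => h.admissible_unstable hδ (hgap l hl) τ)
    (fun s => hS.contDiff s) (fun s => hS'.contDiff s) (fun s => hS.bound s)
    (fun s => hS'.bound s) (fun s => hE0 s) (fun s => hEb s) j hj ⟨τ, self_mem_Iic⟩
  have hjn : ((j : ℕ) : WithTop ℕ∞) ≤ ((n + 1 + 1 : ℕ) : WithTop ℕ∞) := by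
    exact_mod_cast (by omega)
  have e := congrFun (iteratedFDeriv_sub (𝕜 := 𝕂) (c1.of_le hjn) (c2.of_le hjn)) v
  rw [Pi.sub_apply] at e
  rw [← e]
  have e2 : unstableGraph I ℒ P B F β γj δ τ - unstableGraph I ℒ P B F' β γj δ τ = fun v =>
      unstableFamily I ℒ P B F (β - δ) γj τ ⟨τ, self_mem_Iic⟩ v -
      unstableFamily I ℒ P B F' (β - δ) γj τ ⟨τ, self_mem_Iic⟩ v := by
    funext v
    simp [unstableGraph]
  rw [e2]
  refine (h1.2 j le_rfl v).trans (le_of_eq ?_)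
  simp only [sub_self, zpow_zero, one_pow, derivDistConst]
  ring

end Unstable

end IsSplit

end Graphs

/-! ### Superposition operators on Lebesgue spaces -/

section Superposition

universe u

variable {A : Type*} [MeasurableSpace A] {μ : Measure A} {𝕂 : Type*} [RCLike 𝕂]

section Measurability

variable {E Z : Type*} [NormedAddCommGroup E] [NormedAddCommGroup Z]

lemma coeFn_lpClass {r : ℝ≥0∞} {f : A → E} (h : MemLp f r μ) : lpClass r μ f =ᵐ[μ] f := by
  rw [lpClass, dif_pos h]
  exact h.coeFn_toLp

lemma norm_lpClass_le {r : ℝ≥0∞} [Fact (1 ≤ r)] {f : A → E} {b : A → ℝ} (hb : MemLp b r μ)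
    (hfb : ∀ᵐ x ∂μ, ‖f x‖ ≤ b x) : ‖lpClass r μ f‖ ≤ (eLpNorm b r μ).toReal := by
  by_cases h : MemLp f r μ
  · rw [lpClass, dif_pos h, Lp.norm_toLp]
    refine ENNReal.toReal_mono hb.2.ne (eLpNorm_mono_ae ?_)
    filter_upwards [hfb] with x hx
    exact hx.trans (le_abs_self _)
  · rw [lpClass, dif_neg h]; simp

/-- For a simple function the superposition is a finite sum over its values; continuity in the
second argument carries measurability to the limit. -/
lemma aestronglyMeasurable_superposition {h : A → E → Z} (hc : ∀ᵐ x ∂μ, Continuous (h x))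
    (hm : ∀ z, AEStronglyMeasurable (fun x => h x z) μ) {u : A → E}
    (hu : AEStronglyMeasurable u μ) : AEStronglyMeasurable (fun x => h x (u x)) μ := by
  obtain ⟨v, ⟨f, hf⟩, huv⟩ := hu
  have key : ∀ f : SimpleFunc A E, AEStronglyMeasurable (fun x => h x (f x)) μ := by
    intro f
    have e : (fun x => h x (f x)) =
        ∑ z ∈ f.range, (f ⁻¹' {z}).indicator (fun x => h x z) := by
      funext x
      rw [Finset.sum_apply, Finset.sum_eq_single (f x)]
      · simp
      · intro z _ hz
        exact indicator_of_notMem (fun hx => hz hx.symm) _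
      · intro hx
        exact absurd (f.mem_range_self x) hx
    rw [e]
    exact Finset.aestronglyMeasurable_sum _ fun z _ =>
      (hm z).indicator (f.measurableSet_fiber z)
  have h1 : AEStronglyMeasurable (fun x => h x (v x)) μ :=
    aestronglyMeasurable_of_tendsto_ae atTop (fun n => key (f n)) (by
      filter_upwards [hc] with x hx
      exact (hx.tendsto _).comp (hf x))
  refine h1.congr ?_
  filter_upwards [huv] with x hx
  rw [hx]

/-- Dominated convergence along sequences converging almost everywhere. -/
lemma tendsto_eLpNorm_of_dominated {p s : ℝ≥0∞} [Fact (1 ≤ p)] (hs0 : s ≠ 0) (hs : s ≠ ⊤)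
    {T : Lp E p μ → A → Z} {b : A → ℝ} (hb : MemLp b s μ) {u : Lp E p μ}
    (hm : ∀ w, AEStronglyMeasurable (T w) μ) (hTb : ∀ w, ∀ᵐ x ∂μ, ‖T w x‖ ≤ b x)
    (hT : ∀ w : ℕ → Lp E p μ, (∀ᵐ x ∂μ, Tendsto (fun n => w n x) atTop (𝓝 (u x))) →
      ∀ᵐ x ∂μ, Tendsto (fun n => T (w n) x) atTop (𝓝 0)) :
    Tendsto (fun w => eLpNorm (T w) s μ) (𝓝 u) (𝓝 0) := by
  -- An L^p-convergent sequence has a subsequence converging almost everywhere, and limits may be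
  -- tested on subsequences.
  refine tendsto_of_subseq_tendsto fun w hw => ?_
  obtain ⟨ns, -, hns⟩ := (tendstoInMeasure_of_tendsto_Lp hw).exists_seq_tendsto_ae
  refine ⟨ns, ?_⟩
  have hsp : 0 < s.toReal := ENNReal.toReal_pos hs0 hs
  have h1 : Tendsto (fun n => ∫⁻ x, ‖T (w (ns n)) x‖ₑ ^ s.toReal ∂μ) atTop
      (𝓝 (∫⁻ _, 0 ∂μ)) := by
    refine tendsto_lintegral_of_dominated_convergence' (fun x => ‖b x‖ₑ ^ s.toReal)
      (fun n => (hm _).enorm.pow_const _) (fun n => ?_)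
      (lintegral_rpow_enorm_lt_top_of_eLpNorm_lt_top hs0 hs hb.2).ne ?_
    · filter_upwards [hTb (w (ns n))] with x hx
      refine ENNReal.rpow_le_rpow ?_ hsp.le
      rw [← ofReal_norm, ← ofReal_norm]
      exact ENNReal.ofReal_le_ofReal (hx.trans (le_abs_self _))
    · filter_upwards [hT (fun n => w (ns n)) hns] with x hx
      have := (ENNReal.continuous_rpow_const (y := s.toReal)).tendsto _ |>.comp hx.enorm
      simpa [hsp, Function.comp_def] using this
  have h2 := (ENNReal.continuous_rpow_const (y := 1 / s.toReal)).tendsto _ |>.comp h1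
  simp_rw [eLpNorm_eq_lintegral_rpow_enorm_toReal hs0 hs]
  simpa [hsp, Function.comp_def] using h2

/-- Continuity of a dominated superposition operator. -/
lemma continuous_superposition {p s : ℝ≥0∞} [Fact (1 ≤ p)] [hs1 : Fact (1 ≤ s)] (hs : s ≠ ⊤)
    {h : A → E → Z} (hc : ∀ᵐ x ∂μ, Continuous (h x))
    (hm : ∀ z, AEStronglyMeasurable (fun x => h x z) μ) {b : A → ℝ} (hb : MemLp b s μ)
    (hhb : ∀ᵐ x ∂μ, ∀ z, ‖h x z‖ ≤ b x) :
    Continuous fun u : Lp E p μ => lpClass s μ fun x => h x (u x) := by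
  have hmem : ∀ u : Lp E p μ, MemLp (fun x => h x (u x)) s μ := fun u =>
    hb.mono' (aestronglyMeasurable_superposition hc hm (Lp.aestronglyMeasurable u))
      (hhb.mono fun x hx => hx _)
  refine continuous_iff_continuousAt.2 fun u => ?_
  refine (Lp.tendsto_Lp_iff_tendsto_eLpNorm' _ _).2 ?_
  have h1 := tendsto_eLpNorm_of_dominated (one_pos.trans_le hs1.out).ne' hs
    (T := fun (w : Lp E p μ) x => h x (w x) - h x (u x)) (hb.add hb) (u := u)
    (fun w => (hmem w).1.sub (hmem u).1)
    (fun w => hhb.mono fun x hx => (norm_sub_le _ _).trans (add_le_add (hx _) (hx _)))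
    (fun w hw => by
      filter_upwards [hw, hc] with x hx hcx
      simpa using ((hcx.tendsto _).comp hx).sub_const (h x (u x)))
  refine h1.congr fun w => eLpNorm_congr_ae ?_
  filter_upwards [coeFn_lpClass (hmem w), coeFn_lpClass (hmem u)] with x h2 h3
  simp [h2, h3]

end Measurability

variable {E Y : Type u} [NormedAddCommGroup E] [NormedSpace 𝕂 E] [NormedAddCommGroup Y]
  [NormedSpace 𝕂 Y]

lemma norm_sub_le_of_fderiv {f : E → Y} (hf : Differentiable 𝕂 f) {C : ℝ}
    (hC : ∀ z, ‖fderiv 𝕂 f z‖ ≤ C) (z z' : E) : ‖f z - f z'‖ ≤ C * ‖z - z'‖ := by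
  have hC0 : 0 ≤ C := (norm_nonneg _).trans (hC z)
  have := (lipschitzWith_of_nnnorm_fderiv_le (𝕜 := 𝕂) (C := ⟨C, hC0⟩) hf hC).dist_le_mul z z'
  rwa [dist_eq_norm, dist_eq_norm] at this

variable (𝕂 E Y μ) in
/-- Multiplication of an operator-valued with a vector-valued function. -/
def mulL (r p q : ℝ≥0∞) [Fact (1 ≤ r)] [Fact (1 ≤ p)] [Fact (1 ≤ q)]
    [ENNReal.HolderTriple r p q] : Lp (E →L[𝕂] Y) r μ →L[𝕂] Lp E p μ →L[𝕂] Lp Y q μ :=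
  (ContinuousLinearMap.id 𝕂 (E →L[𝕂] Y)).holderL μ r p q

section

variable {r p q : ℝ≥0∞} [Fact (1 ≤ r)] [Fact (1 ≤ p)] [Fact (1 ≤ q)] [ENNReal.HolderTriple r p q]

lemma coeFn_mulL (a : Lp (E →L[𝕂] Y) r μ) (v : Lp E p μ) :
    mulL μ 𝕂 E Y r p q a v =ᵐ[μ] fun x => a x (v x) :=
  (ContinuousLinearMap.id 𝕂 (E →L[𝕂] Y)).coeFn_holder a v

lemma norm_mulL_le : ‖mulL μ 𝕂 E Y r p q‖ ≤ 1 :=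
  ((ContinuousLinearMap.id 𝕂 (E →L[𝕂] Y)).norm_holderL_le).trans
    ContinuousLinearMap.norm_id_le

/-- Differentiability of a superposition operator. -/
lemma hasFDerivAt_superposition (hr : r ≠ ⊤) {g : A → E → Y} {b : A → ℝ}
    (hg : ∀ᵐ x ∂μ, ContDiff 𝕂 1 (g x))
    (hdm : ∀ z, AEStronglyMeasurable (fun x => fderiv 𝕂 (g x) z) μ)
    (hmem : ∀ u : Lp E p μ, MemLp (fun x => g x (u x)) q μ) (hb : MemLp b r μ)
    (hgb : ∀ᵐ x ∂μ, ∀ z, ‖fderiv 𝕂 (g x) z‖ ≤ b x) (u : Lp E p μ) :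
    HasFDerivAt (fun u : Lp E p μ => lpClass q μ fun x => g x (u x))
      (mulL μ 𝕂 E Y r p q (lpClass r μ fun x => fderiv 𝕂 (g x) (u x))) u := by
  have hr0 : r ≠ 0 := (one_pos.trans_le (Fact.out : 1 ≤ r)).ne'
  have hgd : ∀ᵐ x ∂μ, Differentiable 𝕂 (g x) := hg.mono fun x hx => hx.differentiable (by simp)
  have hdc : ∀ᵐ x ∂μ, Continuous (fderiv 𝕂 (g x)) :=
    hg.mono fun x hx => hx.continuous_fderiv (by simp)
  have hdmem : MemLp (fun x => fderiv 𝕂 (g x) (u x)) r μ :=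
    hb.mono' (aestronglyMeasurable_superposition hdc hdm (Lp.aestronglyMeasurable u))
      (hgb.mono fun x hx => hx _)
  let rem : Lp E p μ → A → Y := fun w x =>
    g x (w x) - g x (u x) - fderiv 𝕂 (g x) (u x) (w x - u x)
  -- The remainder divided pointwise by |w(x) - u(x)| is dominated by 2b in L^r and tends to 0 by
  -- differentiability of g(x, ·). Hölder's inequality restores the factor w - u in L^p.
  let T : Lp E p μ → A → Y := fun w x => ((‖w x - u x‖⁻¹ : ℝ) : 𝕂) • rem w x
  have hremm : ∀ w, AEStronglyMeasurable (rem w) μ := fun w =>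
    ((hmem w).1.sub (hmem u).1).sub
      ((ContinuousLinearMap.id 𝕂 (E →L[𝕂] Y)).aestronglyMeasurable_comp₂ hdmem.1
        ((Lp.aestronglyMeasurable w).sub (Lp.aestronglyMeasurable u)))
  have hsubm : ∀ w : Lp E p μ, AEStronglyMeasurable (fun x => w x - u x) μ := fun w =>
    (Lp.aestronglyMeasurable w).sub (Lp.aestronglyMeasurable u)
  have hTm : ∀ w, AEStronglyMeasurable (T w) μ := fun w => by
    refine AEStronglyMeasurable.smul ?_ (hremm w)
    exact RCLike.continuous_ofReal.comp_aestronglyMeasurable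
      ((hsubm w).norm.aemeasurable.inv.aestronglyMeasurable)
  have hnormT : ∀ w x, ‖T w x‖ = ‖w x - u x‖⁻¹ * ‖rem w x‖ := fun w x => by
    rw [norm_smul, RCLike.norm_ofReal, abs_of_nonneg (inv_nonneg.2 (norm_nonneg _))]
  have hTb : ∀ w, ∀ᵐ x ∂μ, ‖T w x‖ ≤ (b + b) x := fun w => by
    filter_upwards [hgb, hgd] with x hx hd
    have h2 : ‖rem w x‖ ≤ (b x + b x) * ‖w x - u x‖ := by
      rw [add_mul]
      exact (norm_sub_le _ _).trans (add_le_add (norm_sub_le_of_fderiv hd hx _ _)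
        (ContinuousLinearMap.le_of_opNorm_le _ (hx _) _))
    have hb0 : 0 ≤ b x := (norm_nonneg _).trans (hx 0)
    rw [hnormT]
    calc ‖w x - u x‖⁻¹ * ‖rem w x‖ ≤ ‖w x - u x‖⁻¹ * ((b x + b x) * ‖w x - u x‖) :=
          mul_le_mul_of_nonneg_left h2 (inv_nonneg.2 (norm_nonneg _))
      _ = (b x + b x) * (‖w x - u x‖⁻¹ * ‖w x - u x‖) := by ring
      _ ≤ (b x + b x) * 1 := mul_le_mul_of_nonneg_left inv_mul_le_one (by linarith)
      _ = _ := by simp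
  have h1 : Tendsto (fun w => eLpNorm (T w) r μ) (𝓝 u) (𝓝 0) := by
    refine tendsto_eLpNorm_of_dominated hr0 hr (hb.add hb) hTm hTb fun w hw => ?_
    filter_upwards [hw, hgd] with x hx hd
    rw [tendsto_zero_iff_norm_tendsto_zero]
    simp_rw [hnormT]
    exact (hasFDerivAt_iff_tendsto.1 (hd (u x)).hasFDerivAt).comp hx
  have h2 : Tendsto (fun w => (eLpNorm (T w) r μ).toReal) (𝓝 u) (𝓝 0) := by
    simpa [Function.comp_def] using (ENNReal.tendsto_toReal ENNReal.zero_ne_top).comp h1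
  have hTmem : ∀ w, eLpNorm (T w) r μ ≠ ⊤ := fun w =>
    (MemLp.mono' (hb.add hb) (hTm w) (hTb w)).2.ne
  rw [hasFDerivAt_iff_tendsto]
  refine squeeze_zero (fun w => by positivity) (fun w => ?_) h2
  have h3 : ‖(lpClass q μ fun x => g x (w x)) - (lpClass q μ fun x => g x (u x)) -
      mulL μ 𝕂 E Y r p q (lpClass r μ fun x => fderiv 𝕂 (g x) (u x)) (w - u)‖ ≤
      (eLpNorm (T w) r μ).toReal * ‖w - u‖ := by
    rw [Lp.norm_def, Lp.norm_def, ← ENNReal.toReal_mul]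
    refine ENNReal.toReal_mono (ENNReal.mul_ne_top (hTmem w) (Lp.eLpNorm_ne_top _)) ?_
    have h4 := eLpNorm_le_eLpNorm_mul_eLpNorm'_of_norm (p := r) (q := p) (r := q) (hTm w)
      (Lp.aestronglyMeasurable (w - u)) (fun a h => ((‖h‖ : ℝ) : 𝕂) • a) 1
      (Eventually.of_forall fun x => by rw [norm_smul, RCLike.norm_ofReal]; simp [mul_comm])
    rw [ENNReal.coe_one, one_mul] at h4
    refine le_trans (le_of_eq (eLpNorm_congr_ae ?_)) h4
    filter_upwards [Lp.coeFn_sub w u, coeFn_lpClass (hmem w), coeFn_lpClass (hmem u),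
      coeFn_lpClass hdmem, coeFn_mulL (q := q) (lpClass r μ fun x => fderiv 𝕂 (g x) (u x)) (w - u),
      Lp.coeFn_sub ((lpClass q μ fun x => g x (w x)) - (lpClass q μ fun x => g x (u x)))
        (mulL μ 𝕂 E Y r p q (lpClass r μ fun x => fderiv 𝕂 (g x) (u x)) (w - u)),
      Lp.coeFn_sub (lpClass q μ fun x => g x (w x)) (lpClass q μ fun x => g x (u x))]
      with x e1 e2 e3 e4 e5 e6 e7
    rw [e6, Pi.sub_apply, e7, Pi.sub_apply, e2, e3, e5, e4, e1, Pi.sub_apply]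
    by_cases h0 : w x - u x = 0
    · have : w x = u x := sub_eq_zero.1 h0
      simp [this]
    · have : ((‖w x - u x‖ : ℝ) : 𝕂) ≠ 0 := by simpa using h0
      simp only [T, rem]
      rw [smul_smul, RCLike.ofReal_inv, mul_inv_cancel₀ this, one_smul]
  rcases eq_or_ne w u with rfl | hwu
  · simp
  · have hpos : 0 < ‖w - u‖ := norm_pos_iff.2 (sub_ne_zero.2 hwu)
    rw [inv_mul_le_iff₀ hpos, mul_comm]
    exact h3

end

variable (𝕂 μ) in
/-- Carathéodory functions of class `C^m`. -/
structure IsCaratheodory (m : ℕ) (g : A → E → Y) : Prop where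
  contDiff : ∀ᵐ x ∂μ, ContDiff 𝕂 m (g x)
  measurable : ∀ l ≤ m, ∀ z, AEStronglyMeasurable (fun x => iteratedFDeriv 𝕂 l (g x) z) μ

namespace IsCaratheodory

variable {m : ℕ} {g : A → E → Y}

lemma measurable_apply (h : IsCaratheodory μ 𝕂 m g) (z : E) :
    AEStronglyMeasurable (fun x => g x z) μ := by
  have := (continuousMultilinearCurryFin0 𝕂 E Y).continuous.comp_aestronglyMeasurable
    (h.measurable 0 (Nat.zero_le m) z)
  refine this.congr (Eventually.of_forall fun x => ?_)
  simp [iteratedFDeriv_zero_eq_comp]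

lemma fderiv (h : IsCaratheodory μ 𝕂 (m + 1) g) :
    IsCaratheodory μ 𝕂 m (fun x => _root_.fderiv 𝕂 (g x)) := by
  refine ⟨h.contDiff.mono fun x hx => hx.fderiv_right (by norm_cast), fun l hl z => ?_⟩
  have := (continuousMultilinearCurryRightEquiv' 𝕂 l E Y).continuous.comp_aestronglyMeasurable
    (h.measurable (l + 1) (by omega) z)
  refine this.congr (Eventually.of_forall fun x => ?_)
  simp [iteratedFDeriv_succ_eq_comp_right]

end IsCaratheodory

/-- Smoothness of superposition operators, with bounds for the derivatives. -/
theorem contDiff_superposition {p : ℝ≥0∞} [Fact (1 ≤ p)] (m : ℕ) :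
    ∀ {Y : Type u} [NormedAddCommGroup Y] [NormedSpace 𝕂 Y] {q : ℝ≥0∞} [Fact (1 ≤ q)]
      {s : ℕ → ℝ≥0∞} {g : A → E → Y} {b : ℕ → A → ℝ},
      IsCaratheodory μ 𝕂 (m + 1) g → (∀ u : Lp E p μ, MemLp (fun x => g x (u x)) q μ) →
      (∀ l ≤ m, ∀ᵐ x ∂μ, ∀ z, ‖iteratedFDeriv 𝕂 (l + 1) (g x) z‖ ≤ b l x) →
      (∀ l ≤ m, MemLp (b l) (s l) μ) → (∀ l ≤ m, 1 ≤ s l ∧ s l ≠ ⊤) →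
      ENNReal.HolderTriple (s 0) p q →
      (∀ l < m, ENNReal.HolderTriple (s (l + 1)) p (s l)) →
      ContDiff 𝕂 (m + 1 : ℕ) (fun u : Lp E p μ => lpClass q μ fun x => g x (u x)) ∧
      ∀ l ≤ m, ∀ u : Lp E p μ,
        ‖iteratedFDeriv 𝕂 (l + 1) (fun u : Lp E p μ => lpClass q μ fun x => g x (u x)) u‖ ≤
          (eLpNorm (b l) (s l) μ).toReal := by
  induction m with
  | zero =>
    intro Y _ _ q _ s g b hg hmem hb hbm hs hH _
    have : Fact (1 ≤ s 0) := ⟨(hs 0 le_rfl).1⟩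
    have hb0 : ∀ᵐ x ∂μ, ∀ z, ‖fderiv 𝕂 (g x) z‖ ≤ b 0 x := (hb 0 le_rfl).mono fun x hx z => by
      have := hx z
      rwa [zero_add, norm_iteratedFDeriv_one] at this
    have hd := fun u => hasFDerivAt_superposition (hs 0 le_rfl).2
      (hg.contDiff.mono fun x hx => by simpa using hx)
      hg.fderiv.measurable_apply hmem (hbm 0 le_rfl) hb0 u
    have hfd := funext fun u => (hd u).fderiv
    have hc : Continuous fun u : Lp E p μ => lpClass (s 0) μ fun x => fderiv 𝕂 (g x) (u x) :=
      continuous_superposition (hs 0 le_rfl).2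
        (hg.fderiv.contDiff.mono fun x hx => hx.continuous) hg.fderiv.measurable_apply
        (hbm 0 le_rfl) hb0
    refine ⟨contDiff_succ_of_fderiv (fun u => (hd u).differentiableAt) ?_, fun l hl u => ?_⟩
    · rw [hfd]
      exact contDiff_zero.2 ((mulL μ 𝕂 E Y (s 0) p q).continuous.comp hc)
    · obtain rfl : l = 0 := by omega
      rw [zero_add, norm_iteratedFDeriv_one, (hd u).fderiv]
      refine ((mulL μ 𝕂 E Y (s 0) p q).le_of_opNorm_le norm_mulL_le _).trans ?_
      rw [one_mul]
      exact norm_lpClass_le (hbm 0 le_rfl) (hb0.mono fun x hx => hx _)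
  | succ m ih =>
    intro Y _ _ q _ s g b hg hmem hb hbm hs hH hH'
    have : Fact (1 ≤ s 0) := ⟨(hs 0 (Nat.zero_le _)).1⟩
    have hb0 : ∀ᵐ x ∂μ, ∀ z, ‖fderiv 𝕂 (g x) z‖ ≤ b 0 x :=
      (hb 0 (Nat.zero_le _)).mono fun x hx z => by
        have := hx z
        rwa [zero_add, norm_iteratedFDeriv_one] at this
    have hd := fun u => hasFDerivAt_superposition (hs 0 (Nat.zero_le _)).2
      (hg.contDiff.mono fun x hx => hx.of_le (by exact_mod_cast (by omega)))
      hg.fderiv.measurable_apply hmem (hbm 0 (Nat.zero_le _)) hb0 u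
    have hfd := funext fun u => (hd u).fderiv
    have hdmem : ∀ u : Lp E p μ, MemLp (fun x => fderiv 𝕂 (g x) (u x)) (s 0) μ := fun u =>
      (hbm 0 (Nat.zero_le _)).mono' (aestronglyMeasurable_superposition
        (hg.fderiv.contDiff.mono fun x hx => hx.continuous) hg.fderiv.measurable_apply
        (Lp.aestronglyMeasurable u)) (hb0.mono fun x hx => hx _)
    -- The derivative is multiplication by the superposition operator of D₂g, which maps L^p into
    -- L^(s 0); the induction hypothesis applies to it with all exponents shifted by one.
    obtain ⟨hc, hcb⟩ := ih (q := s 0) (s := fun l => s (l + 1)) (b := fun l => b (l + 1))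
      hg.fderiv hdmem (fun l hl => (hb (l + 1) (by omega)).mono fun x hx z => by
        rw [norm_iteratedFDeriv_fderiv]; exact hx z)
      (fun l hl => hbm (l + 1) (by omega)) (fun l hl => hs (l + 1) (by omega))
      (hH' 0 (by omega)) (fun l hl => hH' (l + 1) (by omega))
    refine ⟨contDiff_succ_of_fderiv (fun u => (hd u).differentiableAt) ?_, fun l hl u => ?_⟩
    · rw [hfd]
      exact (mulL μ 𝕂 E Y (s 0) p q).contDiff.comp hc
    · cases l with
      | zero =>
        rw [zero_add, norm_iteratedFDeriv_one, (hd u).fderiv]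
        refine ((mulL μ 𝕂 E Y (s 0) p q).le_of_opNorm_le norm_mulL_le _).trans ?_
        rw [one_mul]
        exact norm_lpClass_le (hbm 0 (Nat.zero_le _)) (hb0.mono fun x hx => hx _)
      | succ l =>
        rw [← norm_iteratedFDeriv_fderiv, hfd]
        refine ((mulL μ 𝕂 E Y (s 0) p q).norm_iteratedFDeriv_comp_left hc.contDiffAt
          (by exact_mod_cast hl)).trans ?_
        refine (mul_le_mul_of_nonneg_right norm_mulL_le (norm_nonneg _)).trans ?_
        rw [one_mul]
        exact hcb l (by omega) u

end Superposition

/-! ### Fredholm operators -/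

section Fredholm

variable {𝕂 : Type*} [RCLike 𝕂] {κ : ℕ} {Ω : Set (EuclideanSpace ℝ (Fin κ))}
  {p q : ℝ≥0∞} [Fact (1 ≤ p)] [Fact (1 ≤ q)] {d e : ℕ}
  {k : EuclideanSpace ℝ (Fin κ) → EuclideanSpace ℝ (Fin κ) → (Vec 𝕂 q e →L[𝕂] Vec 𝕂 p d)}

/-- `(∫_Ω |k(x, y)|^{q'} dy)^{1/q'}`. -/
def kernelNorm (Ω : Set (EuclideanSpace ℝ (Fin κ)))
    (k : EuclideanSpace ℝ (Fin κ) → EuclideanSpace ℝ (Fin κ) → (Vec 𝕂 q e →L[𝕂] Vec 𝕂 p d))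
    (x : EuclideanSpace ℝ (Fin κ)) : ℝ≥0∞ :=
  (∫⁻ y in Ω, ‖k x y‖ₑ ^ (q.toReal / (q.toReal - 1))) ^ (1 / (q.toReal / (q.toReal - 1)))

lemma hilleTamarkin_eq (Ω : Set (EuclideanSpace ℝ (Fin κ)))
    (k : EuclideanSpace ℝ (Fin κ) → EuclideanSpace ℝ (Fin κ) → (Vec 𝕂 q e →L[𝕂] Vec 𝕂 p d)) :
    hilleTamarkin Ω k = (∫⁻ x in Ω, kernelNorm Ω k x ^ p.toReal) ^ (1 / p.toReal) := by
  unfold hilleTamarkin kernelNorm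
  congr 1
  refine lintegral_congr fun x => ?_
  rw [← ENNReal.rpow_mul]
  congr 1
  ring

/-- Joint measurability of the kernel on `Ω × Ω`. -/
abbrev MeasurableKernel (Ω : Set (EuclideanSpace ℝ (Fin κ)))
    (k : EuclideanSpace ℝ (Fin κ) → EuclideanSpace ℝ (Fin κ) → (Vec 𝕂 q e →L[𝕂] Vec 𝕂 p d)) :
    Prop :=
  AEStronglyMeasurable
    (fun z : EuclideanSpace ℝ (Fin κ) × EuclideanSpace ℝ (Fin κ) => k z.1 z.2)
    ((leb Ω).prod (leb Ω))

lemma aemeasurable_kernelNorm (hk : MeasurableKernel Ω k) :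
    AEMeasurable (kernelNorm Ω k) (leb Ω) :=
  (AEMeasurable.lintegral_prod_right' (hk.enorm.pow_const _)).pow_const _

lemma ae_kernelNorm_lt_top (hk : MeasurableKernel Ω k)
    (hp : p ≠ ⊤) (hfin : hilleTamarkin Ω k < ⊤) :
    ∀ᵐ x ∂(leb Ω), kernelNorm Ω k x < ⊤ := by
  have hp0 : 0 < p.toReal :=
    ENNReal.toReal_pos (one_pos.trans_le (Fact.out : 1 ≤ p)).ne' hp
  rw [hilleTamarkin_eq] at hfin
  have h1 : ∫⁻ x in Ω, kernelNorm Ω k x ^ p.toReal ≠ ⊤ := fun h => by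
    rw [h, ENNReal.top_rpow_of_pos (by positivity)] at hfin
    exact lt_irrefl _ hfin
  filter_upwards [ae_lt_top' ((aemeasurable_kernelNorm hk).pow_const _) h1] with x hx
  exact (ENNReal.rpow_lt_top_iff_of_pos hp0).1 hx

lemma aestronglyMeasurable_kernel_apply (hk : MeasurableKernel Ω k)
    (v : LpSpace 𝕂 Ω q e) : AEStronglyMeasurable
    (fun z : EuclideanSpace ℝ (Fin κ) × EuclideanSpace ℝ (Fin κ) => k z.1 z.2 (v z.2))
    ((leb Ω).prod (leb Ω)) :=
  (ContinuousLinearMap.id 𝕂 (Vec 𝕂 q e →L[𝕂] Vec 𝕂 p d)).aestronglyMeasurable_comp₂ hk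
    (Lp.aestronglyMeasurable v).comp_snd

/-- Hölder's inequality in y with exponents q' and q. -/
lemma ae_lintegral_kernel_le (hk : MeasurableKernel Ω k)
    (hq1 : 1 < q) (hq : q ≠ ⊤) (v : LpSpace 𝕂 Ω q e) :
    ∀ᵐ x ∂(leb Ω), ∫⁻ y in Ω, ‖k x y (v y)‖ₑ ≤ kernelNorm Ω k x * ‖v‖ₑ := by
  have hQ : 1 < q.toReal := by
    rw [← ENNReal.toReal_one]; exact (ENNReal.toReal_lt_toReal (by simp) hq).2 hq1
  have hc : (q.toReal / (q.toReal - 1)).HolderConjugate q.toReal :=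
    (Real.HolderConjugate.conjExponent hQ).symm
  filter_upwards [hk.prodMk_left] with x hx
  have h1 := ENNReal.lintegral_mul_le_Lp_mul_Lq (leb Ω) hc hx.enorm
    (Lp.aestronglyMeasurable v).enorm
  have h2 : ‖v‖ₑ = (∫⁻ y in Ω, ‖v y‖ₑ ^ q.toReal) ^ (1 / q.toReal) := by
    rw [Lp.enorm_def, eLpNorm_eq_lintegral_rpow_enorm_toReal (zero_lt_one.trans hq1).ne' hq]
  rw [h2]
  refine le_trans (lintegral_mono fun y => ?_) h1
  exact (k x y).le_opENorm (v y)

lemma memLp_fredholm (hk : MeasurableKernel Ω k)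
    (hq1 : 1 < q) (hq : q ≠ ⊤) (hp : p ≠ ⊤) (hfin : hilleTamarkin Ω k < ⊤)
    (v : LpSpace 𝕂 Ω q e) :
    MemLp (fun x => ∫ y in Ω, k x y (v y)) p (leb Ω) ∧
      eLpNorm (fun x => ∫ y in Ω, k x y (v y)) p (leb Ω) ≤ hilleTamarkin Ω k * ‖v‖ₑ := by
  have hp0 : p ≠ 0 := (one_pos.trans_le (Fact.out : 1 ≤ p)).ne'
  have hP0 : 0 < p.toReal := ENNReal.toReal_pos hp0 hp
  have hm : AEStronglyMeasurable (fun x => ∫ y in Ω, k x y (v y)) (leb Ω) :=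
    (aestronglyMeasurable_kernel_apply hk v).integral_prod_right'
  have hle : eLpNorm (fun x => ∫ y in Ω, k x y (v y)) p (leb Ω) ≤
      hilleTamarkin Ω k * ‖v‖ₑ := by
    rw [eLpNorm_eq_lintegral_rpow_enorm_toReal hp0 hp, hilleTamarkin_eq]
    have e : ‖v‖ₑ = (‖v‖ₑ ^ p.toReal) ^ (1 / p.toReal) := by
      rw [← ENNReal.rpow_mul, mul_one_div_cancel hP0.ne', ENNReal.rpow_one]
    rw [e, ← ENNReal.mul_rpow_of_nonneg _ _ (by positivity)]
    refine ENNReal.rpow_le_rpow ?_ (by positivity)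
    rw [← lintegral_mul_const'' _ ((aemeasurable_kernelNorm hk).pow_const _)]
    refine lintegral_mono_ae ?_
    filter_upwards [ae_lintegral_kernel_le hk hq1 hq v] with x hx
    rw [← ENNReal.mul_rpow_of_nonneg _ _ hP0.le]
    exact ENNReal.rpow_le_rpow ((enorm_integral_le_lintegral_enorm _).trans hx) hP0.le
  exact ⟨⟨hm, hle.trans_lt (ENNReal.mul_lt_top hfin enorm_lt_top)⟩, hle⟩

/-- Integrability is what justifies additivity of the Bochner integral in `exists_fredholmL`. -/
lemma ae_integrable_kernel (hk : MeasurableKernel Ω k)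
    (hq1 : 1 < q) (hq : q ≠ ⊤) (hp : p ≠ ⊤)
    (hfin : hilleTamarkin Ω k < ⊤) (v : LpSpace 𝕂 Ω q e) :
    ∀ᵐ x ∂(leb Ω), Integrable (fun y => k x y (v y)) (leb Ω) := by
  filter_upwards [ae_lintegral_kernel_le hk hq1 hq v, ae_kernelNorm_lt_top hk hp hfin,
    (aestronglyMeasurable_kernel_apply hk v).prodMk_left] with x h1 h2 h3
  exact ⟨h3, h1.trans_lt (ENNReal.mul_lt_top h2 enorm_lt_top)⟩

/-- A Hille–Tamarkin kernel defines a bounded operator. -/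
theorem exists_fredholmL (hk : MeasurableKernel Ω k)
    (hq1 : 1 < q) (hq : q ≠ ⊤) (hp : p ≠ ⊤)
    (hfin : hilleTamarkin Ω k < ⊤) :
    ∃ T : LpSpace 𝕂 Ω q e →L[𝕂] LpSpace 𝕂 Ω p d, (∀ v, T v = fredholm k v) ∧
      ‖T‖ ≤ (hilleTamarkin Ω k).toReal ∧
      ∀ v, T v =ᵐ[leb Ω] fun x => ∫ y in Ω, k x y (v y) := by
  have hmem := fun v => memLp_fredholm hk hq1 hq hp hfin v
  have hcoe : ∀ v, fredholm k v =ᵐ[leb Ω] fun x => ∫ y in Ω, k x y (v y) := fun v =>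
    coeFn_lpClass (hmem v).1
  let T : LpSpace 𝕂 Ω q e →ₗ[𝕂] LpSpace 𝕂 Ω p d :=
    { toFun := fredholm k
      map_add' := fun v w => by
        refine Lp.ext ?_
        filter_upwards [hcoe (v + w), hcoe v, hcoe w, Lp.coeFn_add (fredholm k v) (fredholm k w),
          ae_integrable_kernel hk hq1 hq hp hfin v, ae_integrable_kernel hk hq1 hq hp hfin w]
          with x h1 h2 h3 h4 h5 h6
        rw [h1, h4, Pi.add_apply, h2, h3, ← integral_add h5 h6]
        refine integral_congr_ae ?_
        filter_upwards [Lp.coeFn_add v w] with y hy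
        rw [hy, Pi.add_apply, map_add]
      map_smul' := fun c v => by
        refine Lp.ext ?_
        filter_upwards [hcoe (c • v), hcoe v, Lp.coeFn_smul c (fredholm k v)] with x h1 h2 h3
        rw [h1, RingHom.id_apply, h3, Pi.smul_apply, h2, ← integral_smul]
        refine integral_congr_ae ?_
        filter_upwards [Lp.coeFn_smul c v] with y hy
        rw [hy, Pi.smul_apply, map_smul] }
  have hb : ∀ v, ‖T v‖ ≤ (hilleTamarkin Ω k).toReal * ‖v‖ := fun v => by
    have h1 : ‖T v‖ = (eLpNorm (fun x => ∫ y in Ω, k x y (v y)) p (leb Ω)).toReal := by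
      rw [Lp.norm_def]
      exact congrArg ENNReal.toReal (eLpNorm_congr_ae (hcoe v))
    rw [h1, ← toReal_enorm v, ← ENNReal.toReal_mul]
    exact ENNReal.toReal_mono (ENNReal.mul_ne_top hfin.ne enorm_ne_top) (hmem v).2
  exact ⟨T.mkContinuous _ hb, fun _ => rfl, T.mkContinuous_norm_le ENNReal.toReal_nonneg hb, hcoe⟩

end Fredholm

/-! ### Lipschitz estimates by Hölder's inequality -/

section Lipschitz

variable {A : Type*} [MeasurableSpace A] {μ : Measure A} {E Y : Type*} [NormedAddCommGroup E]
  [NormedAddCommGroup Y] {r p q : ℝ≥0∞}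
  [ENNReal.HolderTriple r p q]

lemma memLp_of_le_mul {f : A → Y} {b : A → ℝ} {u : A → E} (hf : AEStronglyMeasurable f μ)
    (hb : MemLp b r μ) (hu : MemLp u p μ) (h : ∀ᵐ x ∂μ, ‖f x‖ ≤ b x * ‖u x‖) :
    MemLp f q μ ∧ eLpNorm f q μ ≤ eLpNorm b r μ * eLpNorm u p μ := by
  have h1 := eLpNorm_le_eLpNorm_mul_eLpNorm'_of_norm (p := r) (q := p) (r := q) hb.1 hu.norm.1
    (fun a h => a * h) 1 (Eventually.of_forall fun x => by simp)
  rw [ENNReal.coe_one, one_mul, eLpNorm_norm] at h1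
  have h2 : eLpNorm f q μ ≤ eLpNorm (fun x => b x * ‖u x‖) q μ := by
    refine eLpNorm_mono_ae ?_
    filter_upwards [h] with x hx
    exact hx.trans (le_abs_self _)
  exact ⟨⟨hf, (h2.trans h1).trans_lt (ENNReal.mul_lt_top hb.2 hu.2)⟩, h2.trans h1⟩

lemma norm_lpClass_sub_le [Fact (1 ≤ p)] [Fact (1 ≤ q)] {f f' : A → Y} {b : A → ℝ} {u u' : Lp E p μ} (hf : MemLp f q μ)
    (hf' : MemLp f' q μ) (hb : MemLp b r μ)
    (h : ∀ᵐ x ∂μ, ‖f x - f' x‖ ≤ b x * ‖u x - u' x‖) :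
    ‖lpClass q μ f - lpClass q μ f'‖ ≤ (eLpNorm b r μ).toReal * ‖u - u'‖ := by
  have h1 := memLp_of_le_mul (q := q) (f := fun x => f x - f' x) (u := (u - u' : Lp E p μ))
    (hf.1.sub hf'.1) hb (Lp.memLp (u - u')) (by
      filter_upwards [h, Lp.coeFn_sub u u'] with x hx hx'
      rwa [hx'])
  rw [Lp.norm_def, Lp.norm_def, ← ENNReal.toReal_mul]
  refine ENNReal.toReal_mono (ENNReal.mul_ne_top hb.2.ne (Lp.eLpNorm_ne_top _)) ?_
  refine le_trans (le_of_eq (eLpNorm_congr_ae ?_)) h1.2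
  filter_upwards [Lp.coeFn_sub (lpClass q μ f) (lpClass q μ f'), coeFn_lpClass hf,
    coeFn_lpClass hf'] with x h1 h2 h3
  rw [h1, Pi.sub_apply, h2, h3]

end Lipschitz

/-! ### Exponents -/

section Exponents

lemma holderTriple_ofReal {a b c : ℝ} (ha : 0 < a) (hb : 0 < b) (hc : 0 < c)
    (h : a⁻¹ + b⁻¹ = c⁻¹) :
    ENNReal.HolderTriple (ENNReal.ofReal a) (ENNReal.ofReal b) (ENNReal.ofReal c) := by
  refine ⟨?_⟩
  rw [← ENNReal.ofReal_inv_of_pos ha, ← ENNReal.ofReal_inv_of_pos hb,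
    ← ENNReal.ofReal_inv_of_pos hc, ← ENNReal.ofReal_add (by positivity) (by positivity), h]

/-- The exponent `pq/(p - (l + 1)q)` of the derivative of order `l + 1`. -/
def derivExp (p q : ℝ≥0∞) (l : ℕ) : ℝ≥0∞ :=
  ENNReal.ofReal (p.toReal * q.toReal / (p.toReal - (l + 1 : ℕ) * q.toReal))

/-- The standing assumptions `1 < q` and `mq < p < ∞` on the exponents. -/
structure ExpHyp (p q : ℝ≥0∞) (m : ℕ) : Prop where
  one_le : 1 ≤ m
  one_lt : 1 < q
  p_lt : p < ⊤
  mul_lt : m * q < p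

namespace ExpHyp

variable {p q : ℝ≥0∞} {m : ℕ}

lemma q_ne_top (h : ExpHyp p q m) : q ≠ ⊤ := by
  rintro rfl
  have h1 := h.mul_lt
  rw [ENNReal.mul_top (by have := h.one_le; simp; omega)] at h1
  exact not_top_lt h1

lemma one_lt_toReal (h : ExpHyp p q m) : 1 < q.toReal := by
  rw [← ENNReal.toReal_one]
  exact (ENNReal.toReal_lt_toReal (by simp) h.q_ne_top).2 h.one_lt

lemma mul_lt_toReal (h : ExpHyp p q m) : m * q.toReal < p.toReal := by
  have := (ENNReal.toReal_lt_toReal (ENNReal.mul_ne_top (by simp) h.q_ne_top) h.p_lt.ne).2 h.mul_lt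
  simpa using this

lemma sub_pos (h : ExpHyp p q m) {l : ℕ} (hl : l ≤ m) : 0 < p.toReal - l * q.toReal := by
  have h1 := h.mul_lt_toReal
  have h2 := h.one_lt_toReal
  have h3 : (l : ℝ) ≤ m := by exact_mod_cast hl
  nlinarith

lemma toReal_pos (h : ExpHyp p q m) : 0 < p.toReal := by
  simpa using h.sub_pos (Nat.zero_le m)

lemma derivExp_pos (h : ExpHyp p q m) {l : ℕ} (hl : l + 1 ≤ m) :
    0 < p.toReal * q.toReal / (p.toReal - (l + 1 : ℕ) * q.toReal) :=
  div_pos (mul_pos h.toReal_pos (zero_lt_one.trans h.one_lt_toReal)) (h.sub_pos hl)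

lemma one_le_derivExp (h : ExpHyp p q m) {l : ℕ} (hl : l + 1 ≤ m) : 1 ≤ derivExp p q l := by
  rw [derivExp, ENNReal.one_le_ofReal, one_le_div (h.sub_pos hl)]
  have h1 := h.one_lt_toReal
  have h2 := h.toReal_pos
  have h3 : (0 : ℝ) ≤ (l + 1 : ℕ) * q.toReal := by positivity
  nlinarith

lemma holderTriple_zero (h : ExpHyp p q m) : ENNReal.HolderTriple (derivExp p q 0) p q := by
  have h1 := h.one_lt_toReal
  have h2 := h.toReal_pos
  have := holderTriple_ofReal (h.derivExp_pos (l := 0) h.one_le) h2 (by linarith) (by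
    have := h.sub_pos (l := 1) h.one_le
    push_cast at this ⊢
    have hq : q.toReal ≠ 0 := by linarith
    rw [inv_div]
    field_simp
    ring : _ = (q.toReal)⁻¹)
  rwa [ENNReal.ofReal_toReal h.p_lt.ne, ENNReal.ofReal_toReal h.q_ne_top] at this

/-- The reciprocal of the exponent of order l is 1/q - (l+1)/p, so each further differentiation is
compensated by one more factor in L^p. -/
lemma holderTriple_succ (h : ExpHyp p q m) {l : ℕ} (hl : l + 2 ≤ m) :
    ENNReal.HolderTriple (derivExp p q (l + 1)) p (derivExp p q l) := by
  have h1 := h.one_lt_toReal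
  have h2 := h.toReal_pos
  have := holderTriple_ofReal (h.derivExp_pos (l := l + 1) hl) h2
    (h.derivExp_pos (l := l) (by omega)) (by
    have hq : q.toReal ≠ 0 := by linarith
    rw [inv_div, inv_div]
    push_cast
    field_simp
    ring)
  rwa [ENNReal.ofReal_toReal h.p_lt.ne] at this

/-- On the bounded set Ω integrability with the largest exponent implies it for all orders, so one
majorant c serves every derivative. -/
lemma derivExp_le (h : ExpHyp p q m) {l : ℕ} (hl : l + 1 ≤ m) :
    derivExp p q l ≤ ENNReal.ofReal (p.toReal * q.toReal / (p.toReal - m * q.toReal)) := by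
  have h1 := h.one_lt_toReal
  have h2 := h.toReal_pos
  have h3 : ((l + 1 : ℕ) : ℝ) ≤ m := by exact_mod_cast hl
  refine ENNReal.ofReal_le_ofReal (div_le_div_of_nonneg_left (by positivity)
    (h.sub_pos le_rfl) ?_)
  nlinarith

end ExpHyp

end Exponents

lemma norm_fderiv_le_of_norm_sub_le {𝕂 E Y : Type*} [RCLike 𝕂] [NormedAddCommGroup E]
    [NormedSpace 𝕂 E] [NormedAddCommGroup Y] [NormedSpace 𝕂 Y] {f : E → Y} {C : ℝ} (hC : 0 ≤ C)
    (hf : ∀ x y, ‖f x - f y‖ ≤ C * ‖x - y‖) (x : E) : ‖fderiv 𝕂 f x‖ ≤ C :=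
  norm_fderiv_le_of_lipschitz 𝕂 (C := ⟨C, hC⟩) (LipschitzWith.of_dist_le_mul fun x y => by
    rw [dist_eq_norm, dist_eq_norm]; exact hf x y)

/-! ### Hammerstein operators -/

section Hammerstein

variable {𝕂 : Type*} [RCLike 𝕂] {κ : ℕ} {Ω : Set (EuclideanSpace ℝ (Fin κ))}
  {p q : ℝ≥0∞} {d e : ℕ}

lemma isFiniteMeasure_leb (hΩ : Bornology.IsBounded Ω) : IsFiniteMeasure (leb Ω) :=
  ⟨by rw [Measure.restrict_apply_univ]; exact hΩ.measure_lt_top⟩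

lemma weightNorm_eq {m : ℕ} (h : ExpHyp p q m) (l : EuclideanSpace ℝ (Fin κ) → ℝ≥0) :
    weightNorm Ω p q l = eLpNorm (fun y => (l y : ℝ)) (derivExp p q 0) (leb Ω) := by
  have hpos := h.derivExp_pos (l := 0) h.one_le
  have e : (derivExp p q 0).toReal = p.toReal * q.toReal / (p.toReal - q.toReal) := by
    rw [derivExp, ENNReal.toReal_ofReal hpos.le]; simp
  rw [eLpNorm_eq_lintegral_rpow_enorm_toReal
    (one_pos.trans_le (h.one_le_derivExp (l := 0) h.one_le)).ne' (by simp [derivExp]), e,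
    weightNorm, one_div_div]
  simp

lemma memLp_weight {m : ℕ} (h : ExpHyp p q m) {l : EuclideanSpace ℝ (Fin κ) → ℝ≥0}
    (hl : AEMeasurable l (leb Ω)) (hfin : weightNorm Ω p q l ≠ ⊤) :
    MemLp (fun y => (l y : ℝ)) (derivExp p q 0) (leb Ω) := by
  refine ⟨hl.coe_nnreal_real.aestronglyMeasurable, ?_⟩
  rw [← weightNorm_eq h]
  exact hfin.lt_top

variable [Fact (1 ≤ p)] [Fact (1 ≤ q)]

/-- Settles times with κ_t = 0: there a finite product with κ_t says nothing about the norm of the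
weights. -/
lemma ae_kernel_eq_zero {k : EuclideanSpace ℝ (Fin κ) → EuclideanSpace ℝ (Fin κ) →
      (Vec 𝕂 q e →L[𝕂] Vec 𝕂 p d)} {m : ℕ} (h : ExpHyp p q m) (hk : MeasurableKernel Ω k)
    (h0 : hilleTamarkin Ω k = 0) : ∀ᵐ x ∂(leb Ω), ∀ᵐ y ∂(leb Ω), k x y = 0 := by
  have hP := h.toReal_pos
  have hQ := h.one_lt_toReal
  have hq' : 0 < q.toReal / (q.toReal - 1) := div_pos (by linarith) (by linarith)
  rw [hilleTamarkin_eq, ENNReal.rpow_eq_zero_iff_of_pos (by positivity),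
    lintegral_eq_zero_iff' ((aemeasurable_kernelNorm hk).pow_const _)] at h0
  filter_upwards [h0, hk.prodMk_left] with x hx hx'
  rw [Pi.zero_apply, ENNReal.rpow_eq_zero_iff_of_pos hP, kernelNorm,
    ENNReal.rpow_eq_zero_iff_of_pos (by positivity),
    lintegral_eq_zero_iff' (hx'.enorm.pow_const _)] at hx
  filter_upwards [hx] with y hy
  rw [Pi.zero_apply, ENNReal.rpow_eq_zero_iff_of_pos hq'] at hy
  exact enorm_eq_zero.1 hy

/-- A factorization of the right-hand side into a linear operator `T` and a smooth Lipschitz map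
`N`, where `T ∘ A` is the linearization. -/
structure Factorization (D : Hammerstein 𝕂 Ω p q d e) (m : ℕ) (t : ℤ)
    (ℓ : LpSpace 𝕂 Ω p d →L[𝕂] LpSpace 𝕂 Ω p d) (L CB cB : ℝ)
    (T : LpSpace 𝕂 Ω q e →L[𝕂] LpSpace 𝕂 Ω p d) (N : LpSpace 𝕂 Ω p d → LpSpace 𝕂 Ω q e)
    (A : LpSpace 𝕂 Ω p d →L[𝕂] LpSpace 𝕂 Ω q e) (a b : ℝ) : Prop where
  rhs_eq : ∀ u, D.rhs t u = T (N u)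
  lin_eq : ∀ u, ℓ u = T (A u)
  norm_T : ‖T‖ ≤ (hilleTamarkin Ω (D.k t)).toReal
  smoothing : ∀ v, ∃ h : T v ∈ D.XΩ, D.normX ⟨T v, h⟩ ≤ D.C t * ‖v‖
  zero : N 0 = 0
  lip_sub : ∀ u u', ‖(N u - A u) - (N u' - A u')‖ ≤ a * ‖u - u'‖
  a_le : (hilleTamarkin Ω (D.k t)).toReal * a ≤ L
  lip : ∀ u u', ‖N u - N u'‖ ≤ b * ‖u - u'‖
  b_le : D.C t * b ≤ CB
  contDiff : ContDiff 𝕂 m N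
  bound : ∀ l, 2 ≤ l → l ≤ m → ∀ u, ‖iteratedFDeriv 𝕂 l N u‖ ≤ cB

/-- The supremum of `C_t ‖λ̄_t‖`. -/
def smoothConst (D : Hammerstein 𝕂 Ω p q d e) (I : Set ℤ) : ℝ :=
  (⨆ t ∈ prime I, ENNReal.ofReal (D.C t) * weightNorm Ω p q (D.lamBar t)).toReal

theorem exists_factorization (hΩ : Bornology.IsBounded Ω) {m : ℕ} (hpq : ExpHyp p q m)
    {D : Hammerstein 𝕂 Ω p q d e} {I : Set ℤ}
    {ℒ : ℤ → LpSpace 𝕂 Ω p d →L[𝕂] LpSpace 𝕂 Ω p d}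
    (hK : D.KernelHyp I) (hG : D.GrowthHyp I m) (hV : D.IsVariational I ℒ) :
    ∃ cB, 0 ≤ cB ∧ ∀ t ∈ prime I, ∃ T N A a b, Factorization D m t (ℒ t)
      (D.lipConst I).toReal (smoothConst D I) cB T N A a b := by
  have := isFiniteMeasure_leb hΩ
  obtain ⟨c, cc, hc, hcc, hcc0, hbound⟩ := hG.bound
  have hcm : ∀ l, l + 1 ≤ m → MemLp c (derivExp p q l) (leb Ω) := fun l hl =>
    hc.mono_exponent (hpq.derivExp_le hl)
  -- The majorant c does not depend on t, so the sum of its norms over all orders bounds the higher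
  -- derivatives uniformly in time.
  refine ⟨∑ l ∈ Finset.range m, (eLpNorm c (derivExp p q l) (leb Ω)).toReal,
    Finset.sum_nonneg fun _ _ => ENNReal.toReal_nonneg, fun t ht => ?_⟩
  obtain ⟨T, hT, hTn, hTae⟩ := exists_fredholmL (hK.measurable t ht) hpq.one_lt hpq.q_ne_top
    hpq.p_lt.ne (hK.finite t ht)
  have hsm : ∀ v, ∃ h : T v ∈ D.XΩ, D.normX ⟨T v, h⟩ ≤ D.C t * ‖v‖ := fun v => by
    simp only [hT]; exact hK.smoothing t ht v
  have hcB : (0 : ℝ) ≤ ∑ l ∈ Finset.range m, (eLpNorm c (derivExp p q l) (leb Ω)).toReal :=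
    Finset.sum_nonneg fun _ _ => ENNReal.toReal_nonneg
  -- If κ_t = 0 the weights may have infinite norm, but then T = 0 and N = A = 0 is a valid
  -- factorization.
  by_cases h0 : hilleTamarkin Ω (D.k t) = 0
  · have hT0 : T = 0 := by
      rw [← norm_le_zero_iff]
      simpa [h0] using hTn
    refine ⟨T, 0, 0, 0, 0, fun u => ?_, fun u => ?_, hTn, hsm, rfl, by simp,
      by simp, by simp, by simp [smoothConst], contDiff_const, fun l _ _ u => ?_⟩
    · rw [Hammerstein.rhs, ← hT, hT0]; simp
    · rw [hT0, zero_apply]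
      refine Lp.ext ?_
      filter_upwards [hV t ht u, ae_kernel_eq_zero hpq (hK.measurable t ht) h0,
        Lp.coeFn_zero (Vec 𝕂 p d) p (leb Ω)] with x h1 h2 h3
      rw [h1, h3, Pi.zero_apply]
      refine integral_eq_zero_of_ae ?_
      filter_upwards [h2] with y hy
      simp [hy]
    · have e : (0 : LpSpace 𝕂 Ω p d → LpSpace 𝕂 Ω q e) = fun _ => 0 := rfl
      rw [e, iteratedFDeriv_fun_zero]
      simpa using hcB
  have hfin : ∀ {l : EuclideanSpace ℝ (Fin κ) → ℝ≥0} {S : ℝ≥0∞}, S < ⊤ →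
      hilleTamarkin Ω (D.k t) * weightNorm Ω p q l ≤ S → weightNorm Ω p q l ≠ ⊤ := by
    intro l S hS hle htop
    rw [htop, ENNReal.mul_top h0] at hle
    exact absurd (top_le_iff.1 hle) hS.ne
  have hle1 : hilleTamarkin Ω (D.k t) * weightNorm Ω p q (D.lam t) ≤ D.lipConst I :=
    le_iSup₂ (f := fun t _ => hilleTamarkin Ω (D.k t) * weightNorm Ω p q (D.lam t)) t ht
  have hle2 : hilleTamarkin Ω (D.k t) * weightNorm Ω p q (D.lamBar t) ≤ _ :=
    le_iSup₂ (f := fun t _ => hilleTamarkin Ω (D.k t) * weightNorm Ω p q (D.lamBar t)) t ht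
  have hle3 : ENNReal.ofReal (D.C t) * weightNorm Ω p q (D.lamBar t) ≤ _ :=
    le_iSup₂ (f := fun t _ => ENNReal.ofReal (D.C t) * weightNorm Ω p q (D.lamBar t)) t ht
  have hlam := memLp_weight hpq (hG.lam_measurable t ht) (hfin hG.lipConst_finite hle1)
  have hbar := memLp_weight hpq (hG.lamBar_measurable t ht) (hfin hG.lamBar_finite hle2)
  have hcar : IsCaratheodory (leb Ω) 𝕂 m (D.g t) := ⟨hG.smooth t ht, hG.measurable t ht⟩
  have hdiff : ∀ᵐ x ∂(leb Ω), Differentiable 𝕂 (D.g t x) := (hG.smooth t ht).mono fun x hx =>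
    hx.differentiable (by exact_mod_cast (by have := hpq.one_le; omega))
  have hder : ∀ᵐ x ∂(leb Ω), ∀ z, ‖fderiv 𝕂 (D.g t x) z‖ ≤ D.lamBar t x :=
    (hG.lipschitz t ht).mono fun x hx z =>
      norm_fderiv_le_of_norm_sub_le (D.lamBar t x).2 hx z
  obtain ⟨m, rfl⟩ : ∃ m', m = m' + 1 := ⟨m - 1, by have := hpq.one_le; omega⟩
  have : Fact (1 ≤ derivExp p q 0) := ⟨hpq.one_le_derivExp (l := 0) hpq.one_le⟩
  have := hpq.holderTriple_zero
  have hcont : ∀ᵐ x ∂(leb Ω), Continuous (D.g t x) := hdiff.mono fun x hx => hx.continuous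
  have hmem : ∀ u : LpSpace 𝕂 Ω p d, MemLp (fun x => D.g t x (u x)) q (leb Ω) := fun u =>
    (memLp_of_le_mul (r := derivExp p q 0) (p := p) (u := u)
      (aestronglyMeasurable_superposition hcont hcar.measurable_apply
        (Lp.aestronglyMeasurable u)) hbar (Lp.memLp u) (by
        filter_upwards [hG.lipschitz t ht, hG.zero t ht] with x h1 h2
        simpa [h2] using h1 (u x) 0)).1
  have hd0 : MemLp (fun x => fderiv 𝕂 (D.g t x) 0) (derivExp p q 0) (leb Ω) :=
    hbar.mono' (hcar.fderiv.measurable_apply 0) (hder.mono fun x hx => hx 0)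
  let A := mulL (leb Ω) 𝕂 (Vec 𝕂 p d) (Vec 𝕂 q e) (derivExp p q 0) p q
    (lpClass (derivExp p q 0) (leb Ω) fun x => fderiv 𝕂 (D.g t x) 0)
  have hA : ∀ u, A u =ᵐ[leb Ω] fun x => fderiv 𝕂 (D.g t x) 0 (u x) := fun u => by
    filter_upwards [coeFn_mulL (q := q) (lpClass (derivExp p q 0) (leb Ω) fun x =>
      fderiv 𝕂 (D.g t x) 0) u, coeFn_lpClass hd0] with x h1 h2
    rw [h1, h2]
  have hAm : ∀ u : LpSpace 𝕂 Ω p d,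
      MemLp (fun x => fderiv 𝕂 (D.g t x) 0 (u x)) q (leb Ω) := fun u =>
    (memLp_congr_ae (hA u)).1 (Lp.memLp (A u))
  have hNA : ∀ u, nemytskii (D.g t) u - A u = lpClass q (leb Ω) (fun x =>
      D.g t x (u x) - fderiv 𝕂 (D.g t x) 0 (u x)) := fun u => by
    refine Lp.ext ?_
    filter_upwards [Lp.coeFn_sub (nemytskii (D.g t) u) (A u), coeFn_lpClass (hmem u), hA u,
      coeFn_lpClass ((hmem u).sub (hAm u))] with x h1 h2 h3 h4
    rw [h1, Pi.sub_apply, h3, nemytskii, h2]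
    exact h4.symm
  -- First derivatives are dominated by λ̄, derivatives of order at least 2 by c alone, since their
  -- growth coefficients vanish.
  obtain ⟨hcd, hcdb⟩ := contDiff_superposition m (p := p) (q := q) (s := derivExp p q)
    (b := fun l => if l = 0 then fun x => (D.lamBar t x : ℝ) else c) hcar hmem (fun l hl => by
      split_ifs with h
      · subst h
        filter_upwards [hder] with x hx z
        rw [zero_add, norm_iteratedFDeriv_one]
        exact hx z
      · filter_upwards [hbound t ht (l + 1) (by omega)] with x hx z
        simpa [hcc0 (l + 1) (by omega)] using hx z)
    (fun l hl => by
      split_ifs with h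
      · subst h; exact hbar
      · exact hcm l (by omega))
    (fun l hl => ⟨hpq.one_le_derivExp (by omega), by simp [derivExp]⟩) this
    (fun l hl => hpq.holderTriple_succ (by omega))
  refine ⟨T, nemytskii (D.g t), A, (weightNorm Ω p q (D.lam t)).toReal,
    (weightNorm Ω p q (D.lamBar t)).toReal,
    fun u => (hT _).symm, fun u => ?_, hTn, hsm, ?_, fun u u' => ?_, ?_, fun u u' => ?_, ?_, hcd,
    fun l hl hl' u => ?_⟩
  · refine Lp.ext ?_
    filter_upwards [hV t ht u, hTae (A u)] with x h1 h2
    rw [h1, h2]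
    refine integral_congr_ae ?_
    filter_upwards [hA u] with y hy
    rw [hy]
  · refine Lp.ext ?_
    filter_upwards [coeFn_lpClass (hmem 0), hG.zero t ht, Lp.coeFn_zero (Vec 𝕂 p d) p (leb Ω),
      Lp.coeFn_zero (Vec 𝕂 q e) q (leb Ω)] with x h1 h2 h3 h4
    rw [nemytskii, h1, h3, h4]
    simpa using h2
  · rw [hNA, hNA, weightNorm_eq hpq]
    refine norm_lpClass_sub_le ((hmem u).sub (hAm u)) ((hmem u').sub (hAm u')) hlam ?_
    filter_upwards [hG.deriv_bound t ht, hdiff] with x hx hd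
    refine norm_sub_le_of_fderiv (𝕂 := 𝕂)
      (f := fun z => D.g t x z - fderiv 𝕂 (D.g t x) 0 z)
      (hd.sub (fderiv 𝕂 (D.g t x) 0).differentiable) (fun z => ?_) _ _
    rw [fderiv_fun_sub (hd z) (fderiv 𝕂 (D.g t x) 0).differentiableAt, ContinuousLinearMap.fderiv]
    exact hx z
  · rw [← ENNReal.toReal_mul]
    exact ENNReal.toReal_mono hG.lipConst_finite.ne hle1
  · rw [weightNorm_eq hpq]
    refine norm_lpClass_sub_le (hmem u) (hmem u') hbar ?_
    filter_upwards [hG.lipschitz t ht] with x hx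
    exact hx _ _
  · rw [← ENNReal.toReal_ofReal (hK.C_nonneg t ht), ← ENNReal.toReal_mul]
    exact ENNReal.toReal_mono hG.smoothing_finite.ne hle3
  · obtain ⟨l, rfl⟩ : ∃ l', l = l' + 1 := ⟨l - 1, by omega⟩
    refine (hcdb l (by omega) u).trans ?_
    rw [if_neg (by omega)]
    exact Finset.single_le_sum (f := fun l => (eLpNorm c (derivExp p q l) (leb Ω)).toReal)
      (fun _ _ => ENNReal.toReal_nonneg) (Finset.mem_range.2 (by omega))

end Hammerstein

/-! ### Discretizations -/

section SubLinear

variable {𝕂 E Y : Type*} [RCLike 𝕂] [NormedAddCommGroup E] [NormedSpace 𝕂 E]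
  [NormedAddCommGroup Y] [NormedSpace 𝕂 Y]

lemma iteratedFDeriv_clm_eq_zero (ℓ : E →L[𝕂] Y) {l : ℕ} (hl : 2 ≤ l) (x : E) :
    iteratedFDeriv 𝕂 l ℓ x = 0 := by
  obtain ⟨l, rfl⟩ : ∃ l', l = l' + 1 := ⟨l - 1, by omega⟩
  rw [← norm_eq_zero, ← norm_iteratedFDeriv_fderiv, norm_eq_zero]
  have : _root_.fderiv 𝕂 ℓ = fun _ => ℓ := by funext x; exact ℓ.fderiv
  rw [this, iteratedFDeriv_const_of_ne (by omega)]
  rfl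

lemma iteratedFDeriv_sub_clm {f : E → Y} (ℓ : E →L[𝕂] Y) {l : ℕ} (hl : 2 ≤ l)
    (hf : ContDiff 𝕂 l f) (x : E) :
    iteratedFDeriv 𝕂 l (fun x => f x - ℓ x) x = iteratedFDeriv 𝕂 l f x := by
  have := iteratedFDeriv_sub_apply (x := x) hf.contDiffAt (ℓ.contDiff (n := l)).contDiffAt
  rw [iteratedFDeriv_clm_eq_zero ℓ hl, sub_zero] at this
  exact this

end SubLinear

/-! ### Componentwise projections -/

section Proj

variable {𝕂 : Type*} [RCLike 𝕂] {κ : ℕ} {Ω : Set (EuclideanSpace ℝ (Fin κ))}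
  {p : ℝ≥0∞} [Fact (1 ≤ p)] {d : ℕ}

lemma component_embed (i j : Fin d) (f : Lp 𝕂 p (leb Ω)) :
    component 𝕂 Ω p i (embed 𝕂 Ω p j f) = if i = j then f else 0 := by
  refine Lp.ext ?_
  filter_upwards [ContinuousLinearMap.coeFn_compLpL
      (PiLp.proj (𝕜 := 𝕂) p (fun _ : Fin d => 𝕂) i) (embed 𝕂 Ω p j f), ContinuousLinearMap.coeFn_compLpL
      ((((PiLp.continuousLinearEquiv p 𝕂 (fun _ : Fin d => 𝕂)).symm :
      (Fin d → 𝕂) →L[𝕂] Vec 𝕂 p d).comp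
    (ContinuousLinearMap.single 𝕂 (fun _ : Fin d => 𝕂) j))) f,
    Lp.coeFn_zero 𝕂 p (leb Ω)] with x h1 h2 h3
  rw [component, h1, embed, h2]
  split_ifs with h
  · subst h; simp
  · rw [h3]; simp [h]

namespace ProjectionMethod

lemma Proj_apply (M : ProjectionMethod 𝕂 Ω p) (n : ℕ) (u : LpSpace 𝕂 Ω p d) :
    M.Proj d n u = ∑ i : Fin d, embed 𝕂 Ω p i (M.π n (component 𝕂 Ω p i u)) := by
  simp [Proj]

lemma component_Proj (M : ProjectionMethod 𝕂 Ω p) (n : ℕ) (u : LpSpace 𝕂 Ω p d) (i : Fin d) :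
    component 𝕂 Ω p i (M.Proj d n u) = M.π n (component 𝕂 Ω p i u) := by
  rw [Proj_apply, map_sum]
  simp [component_embed]

lemma Proj_mem_space (M : ProjectionMethod 𝕂 Ω p) (n : ℕ) (u : LpSpace 𝕂 Ω p d) :
    M.Proj d n u ∈ M.space d n := fun i => ⟨_, (M.component_Proj n u i).symm⟩

/-- The components of `Π_n u` as elements of the range of `π_n`. -/
def coords (M : ProjectionMethod 𝕂 Ω p) (d n : ℕ) :
    LpSpace 𝕂 Ω p d →ₗ[𝕂] (Fin d → LinearMap.range (M.π n).toLinearMap) :=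
  LinearMap.pi fun i =>
    (M.π n).toLinearMap.rangeRestrict.comp (component 𝕂 Ω p i).toLinearMap

lemma Proj_eq_zero (M : ProjectionMethod 𝕂 Ω p) {n : ℕ} {u : LpSpace 𝕂 Ω p d}
    (h : M.coords d n u = 0) : M.Proj d n u = 0 := by
  rw [Proj_apply]
  refine Finset.sum_eq_zero fun i _ => ?_
  have h1 : M.π n (component 𝕂 Ω p i u) = 0 := congrArg Subtype.val (congrFun h i)
  rw [h1, map_zero]

end ProjectionMethod

end Proj

section Discretization

variable {𝕂 : Type*} [RCLike 𝕂] {κ : ℕ} {Ω : Set (EuclideanSpace ℝ (Fin κ))}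
  {p q : ℝ≥0∞} [Fact (1 ≤ p)] {d e : ℕ} {D : Hammerstein 𝕂 Ω p q d e}
  {M : ProjectionMethod 𝕂 Ω p} {Γ : ℝ → ℝ} {I : Set ℤ} {m n : ℕ} {t : ℤ}
  {ℒ : ℤ → LpSpace 𝕂 Ω p d →L[𝕂] LpSpace 𝕂 Ω p d}
  {ℓ : LpSpace 𝕂 Ω p d →L[𝕂] LpSpace 𝕂 Ω p d} {L CB cB a b : ℝ}

/-- The convergence rate `Γ(1/n)`, and `0` for the original equation. -/
def rate (Γ : ℝ → ℝ) (n : ℕ) : ℝ := if n = 0 then 0 else Γ (1 / n)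

lemma rate_of_one_le (h : 1 ≤ n) : rate Γ n = Γ (1 / n) := if_neg (by omega)

lemma ProjectionMethod.ErrorHyp.rate_nonneg (h : M.ErrorHyp D Γ) (n : ℕ) : 0 ≤ rate Γ n := by
  rw [rate]
  split_ifs with h0
  · exact le_rfl
  · exact (h.pos _ (by positivity)).le

lemma ProjectionMethod.ErrorHyp.tendsto_rate (h : M.ErrorHyp D Γ) :
    Tendsto (rate Γ) atTop (𝓝 0) := by
  have h1 : Tendsto (fun n : ℕ => (1 : ℝ) / n) atTop (𝓝[>] 0) :=
    tendsto_nhdsWithin_iff.2 ⟨tendsto_one_div_atTop_nhds_zero_nat, by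
      filter_upwards [eventually_gt_atTop 0] with n hn
      exact one_div_pos.2 (Nat.cast_pos.2 hn : (0 : ℝ) < n)⟩
  refine (h.tendsto.comp h1).congr' ?_
  filter_upwards [eventually_ge_atTop 1] with n hn
  rw [rate_of_one_le hn]; rfl

variable [Fact (1 ≤ q)]
  {T : LpSpace 𝕂 Ω q e →L[𝕂] LpSpace 𝕂 Ω p d} {N : LpSpace 𝕂 Ω p d → LpSpace 𝕂 Ω q e}
  {A : LpSpace 𝕂 Ω p d →L[𝕂] LpSpace 𝕂 Ω q e}

namespace Factorization

lemma norm_sub_Proj_le (hf : Factorization D m t ℓ L CB cB T N A a b) (hM : M.ErrorHyp D Γ)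
    (hn : 1 ≤ n) (w : LpSpace 𝕂 Ω q e) :
    ‖T w - M.Proj d n (T w)‖ ≤ Γ (1 / n) * D.C t * ‖w‖ := by
  obtain ⟨h, hle⟩ := hf.smoothing w
  refine (hM.error n hn ⟨T w, h⟩).trans ?_
  rw [mul_assoc]
  exact mul_le_mul_of_nonneg_left hle (hM.pos _ (by positivity)).le

/-- E = (id - Π_n) T is small in operator norm because T maps into X(Ω), where the projection error
is controlled; E = 0 for n = 0 treats the original equation on the same footing. -/
lemma exists_errorOp (hf : Factorization D m t ℓ L CB cB T N A a b) (hC : 0 ≤ D.C t)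
    (hM : M.ErrorHyp D Γ) (n : ℕ) :
    ∃ E : LpSpace 𝕂 Ω q e →L[𝕂] LpSpace 𝕂 Ω p d, ‖E‖ ≤ rate Γ n * D.C t ∧
      ∀ u, rhsN D M n t u = T (N u) - E (N u) := by
  by_cases h0 : n = 0
  · exact ⟨0, by simp [rate, h0], fun u => by simp [rhsN, h0, hf.rhs_eq]⟩
  · refine ⟨T - (M.Proj d n).comp T,
      ContinuousLinearMap.opNorm_le_bound _ (mul_nonneg (hM.rate_nonneg n) hC) fun w => ?_,
      fun u => by simp [rhsN, h0, hf.rhs_eq]⟩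
    rw [rate_of_one_le (by omega)]
    exact hf.norm_sub_Proj_le hM (by omega) w

lemma norm_lin_sub_Proj_le (hf : Factorization D m t ℓ L CB cB T N A a b) (hC : 0 ≤ D.C t)
    (hM : M.ErrorHyp D Γ) (hn : 1 ≤ n) (v : LpSpace 𝕂 Ω p d) :
    ‖ℓ v - M.Proj d n (ℓ v)‖ ≤ Γ (1 / n) * (D.C t * ‖A‖) * ‖v‖ := by
  rw [hf.lin_eq]
  refine (hf.norm_sub_Proj_le hM hn _).trans ?_
  have h1 := (hM.pos (1 / n) (by positivity)).le
  calc Γ (1 / n) * D.C t * ‖A v‖ ≤ Γ (1 / n) * D.C t * (‖A‖ * ‖v‖) :=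
        mul_le_mul_of_nonneg_left (A.le_opNorm v) (mul_nonneg h1 hC)
    _ = _ := by ring

end Factorization


/-- The nonlinear part is T(N - A) - E N. The first term has Lipschitz constant κ_t ‖λ_t‖ ≤ L, the
second at most Γ(1/n) C_t ‖λ̄_t‖. -/
lemma isPerturbation_rhsN
    (hfac : ∀ t ∈ prime I, ∃ T N A a b, Factorization D m t (ℒ t) L CB cB T N A a b)
    (hC : ∀ t ∈ prime I, 0 ≤ D.C t) (hM : M.ErrorHyp D Γ) (hL : 0 ≤ L) (hCB : 0 ≤ CB) (n : ℕ) :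
    IsPerturbation I ℒ (rhsN D M n) (L + rate Γ n * CB) := by
  have hr := hM.rate_nonneg n
  have hΛ : 0 ≤ L + rate Γ n * CB := by positivity
  refine ⟨hΛ, fun t => ?_, fun t x y => ?_⟩ <;> by_cases ht : t ∈ prime I
  · obtain ⟨T, N, A, a, b, hf⟩ := hfac t ht
    obtain ⟨E, hE, hEq⟩ := hf.exists_errorOp (hC t ht) hM n
    simp [resid, ht, hEq, hf.zero]
  · simp [resid, ht]
  · obtain ⟨T, N, A, a, b, hf⟩ := hfac t ht
    obtain ⟨E, hE, hEq⟩ := hf.exists_errorOp (hC t ht) hM n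
    have e : resid I ℒ (rhsN D M n) t x - resid I ℒ (rhsN D M n) t y =
        T ((N x - A x) - (N y - A y)) - E (N x - N y) := by
      simp only [resid, if_pos ht, hEq, hf.lin_eq, map_sub]
      abel
    rw [e]
    refine (_root_.norm_sub_le _ _).trans ?_
    have h1 : ‖T ((N x - A x) - (N y - A y))‖ ≤ L * ‖x - y‖ :=
      calc _ ≤ (hilleTamarkin Ω (D.k t)).toReal * (a * ‖x - y‖) :=
            T.le_of_opNorm_le_of_le hf.norm_T (hf.lip_sub x y)
        _ = (hilleTamarkin Ω (D.k t)).toReal * a * ‖x - y‖ := by ring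
        _ ≤ _ := mul_le_mul_of_nonneg_right hf.a_le (norm_nonneg _)
    have h2 : ‖E (N x - N y)‖ ≤ rate Γ n * CB * ‖x - y‖ :=
      calc _ ≤ rate Γ n * D.C t * (b * ‖x - y‖) := E.le_of_opNorm_le_of_le hE (hf.lip x y)
        _ = rate Γ n * (D.C t * b) * ‖x - y‖ := by ring
        _ ≤ _ := by gcongr; exact hf.b_le
    linarith
  · simp only [resid, if_neg ht, sub_self, norm_zero]
    positivity

/-- Order 1 is bounded by the Lipschitz constant. From order 2 on the linear part drops out and the
bound involves the norms of T and E themselves, not only their products with the weights. -/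
lemma isSmoothPerturbation_rhsN
    (hfac : ∀ t ∈ prime I, ∃ T N A a b, Factorization D m t (ℒ t) L CB cB T N A a b)
    (hC : ∀ t ∈ prime I, 0 ≤ D.C t) (hM : M.ErrorHyp D Γ) {Λ CR : ℝ} {k : ℕ} (hk : k ≤ m)
    (hF : IsPerturbation I ℒ (rhsN D M n) Λ) (hΛ : Λ ≤ CR)
    (hCR : 2 ≤ k → ∀ t ∈ prime I,
      ((hilleTamarkin Ω (D.k t)).toReal + rate Γ n * D.C t) * cB ≤ CR) :
    IsSmoothPerturbation I ℒ (rhsN D M n) k CR := by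
  refine ⟨fun t => ?_, fun t l hl hlk x => ?_⟩ <;> by_cases ht : t ∈ prime I
  · obtain ⟨T, N, A, a, b, hf⟩ := hfac t ht
    obtain ⟨E, hE, hEq⟩ := hf.exists_errorOp (hC t ht) hM n
    have e : resid I ℒ (rhsN D M n) t = fun x => (T - E) (N x) - ℒ t x := by
      funext x; simp [resid, ht, hEq]
    rw [e]
    exact ((T - E).contDiff.comp (hf.contDiff.of_le (by exact_mod_cast hk))).sub (ℒ t).contDiff
  · have e : resid I ℒ (rhsN D M n) t = fun _ => 0 := by funext x; simp [resid, ht]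
    rw [e]; exact contDiff_const
  · rcases Nat.lt_or_ge l 2 with h2 | h2
    · obtain rfl : l = 1 := by omega
      rw [norm_iteratedFDeriv_one]
      exact (norm_fderiv_le_of_norm_sub_le hF.nonneg (hF.lip t) x).trans hΛ
    obtain ⟨T, N, A, a, b, hf⟩ := hfac t ht
    obtain ⟨E, hE, hEq⟩ := hf.exists_errorOp (hC t ht) hM n
    have e : resid I ℒ (rhsN D M n) t = fun x => ((T - E) ∘ N) x - ℒ t x := by
      funext x; simp [resid, ht, hEq]
    have hN : ContDiff 𝕂 l N := hf.contDiff.of_le (by exact_mod_cast hlk.trans hk)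
    rw [e, iteratedFDeriv_sub_clm _ h2 ((T - E).contDiff.comp hN)]
    refine ((T - E).norm_iteratedFDeriv_comp_left hN.contDiffAt le_rfl).trans
      (le_trans ?_ (hCR (h2.trans hlk) t ht))
    exact mul_le_mul ((_root_.norm_sub_le _ _).trans (add_le_add hf.norm_T hE))
      (hf.bound l h2 (hlk.trans hk) x) (norm_nonneg _)
      (add_nonneg ENNReal.toReal_nonneg (mul_nonneg (hM.rate_nonneg n) (hC t ht)))
  · have e : resid I ℒ (rhsN D M n) t = fun _ => 0 := by funext x; simp [resid, ht]
    rw [e, iteratedFDeriv_fun_zero]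
    simpa using hF.nonneg.trans hΛ

/-- The linear parts cancel in the difference, which is -E N; its Lipschitz constant is proportional
to the rate. -/
lemma norm_resid_sub_le
    (hfac : ∀ t ∈ prime I, ∃ T N A a b, Factorization D m t (ℒ t) L CB cB T N A a b)
    (hC : ∀ t ∈ prime I, 0 ≤ D.C t) (hM : M.ErrorHyp D Γ) (hCB : 0 ≤ CB) (n : ℕ) (t : ℤ)
    (x y : LpSpace 𝕂 Ω p d) :
    ‖(resid I ℒ (rhsN D M n) t x - resid I ℒ (rhsN D M 0) t x) -
      (resid I ℒ (rhsN D M n) t y - resid I ℒ (rhsN D M 0) t y)‖ ≤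
      rate Γ n * CB * ‖x - y‖ := by
  have hr := hM.rate_nonneg n
  by_cases ht : t ∈ prime I
  · obtain ⟨T, N, A, a, b, hf⟩ := hfac t ht
    obtain ⟨E, hE, hEq⟩ := hf.exists_errorOp (hC t ht) hM n
    have e : (resid I ℒ (rhsN D M n) t x - resid I ℒ (rhsN D M 0) t x) -
        (resid I ℒ (rhsN D M n) t y - resid I ℒ (rhsN D M 0) t y) = - E (N x - N y) := by
      have h0 : ∀ x, rhsN D M 0 t x = T (N x) := fun x => by simp [rhsN, hf.rhs_eq]
      simp only [resid, if_pos ht, hEq, h0, map_sub]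
      abel
    rw [e, norm_neg]
    calc _ ≤ rate Γ n * D.C t * (b * ‖x - y‖) := E.le_of_opNorm_le_of_le hE (hf.lip x y)
      _ = rate Γ n * (D.C t * b) * ‖x - y‖ := by ring
      _ ≤ _ := by gcongr; exact hf.b_le
  · simp only [resid, if_neg ht, sub_self, norm_zero]
    positivity

lemma norm_iteratedFDeriv_resid_sub_le
    (hfac : ∀ t ∈ prime I, ∃ T N A a b, Factorization D m t (ℒ t) L CB cB T N A a b)
    (hC : ∀ t ∈ prime I, 0 ≤ D.C t) (hM : M.ErrorHyp D Γ) (hCB : 0 ≤ CB)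
    {CE : ℝ} (hCE : CB ≤ CE) (hCE' : ∀ t ∈ prime I, D.C t * cB ≤ CE) (n : ℕ) (t : ℤ) {l : ℕ}
    (hl : 1 ≤ l) (hlm : l ≤ m) (x : LpSpace 𝕂 Ω p d) :
    ‖iteratedFDeriv 𝕂 l (fun x => resid I ℒ (rhsN D M n) t x -
      resid I ℒ (rhsN D M 0) t x) x‖ ≤ rate Γ n * CE := by
  have hr := hM.rate_nonneg n
  rcases Nat.lt_or_ge l 2 with h2 | h2
  · obtain rfl : l = 1 := by omega
    rw [norm_iteratedFDeriv_one]
    exact (norm_fderiv_le_of_norm_sub_le (by positivity)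
      (norm_resid_sub_le hfac hC hM hCB n t) x).trans (mul_le_mul_of_nonneg_left hCE hr)
  by_cases ht : t ∈ prime I
  · obtain ⟨T, N, A, a, b, hf⟩ := hfac t ht
    obtain ⟨E, hE, hEq⟩ := hf.exists_errorOp (hC t ht) hM n
    have h0 : ∀ x, rhsN D M 0 t x = T (N x) := fun x => by simp [rhsN, hf.rhs_eq]
    have e : (fun x => resid I ℒ (rhsN D M n) t x - resid I ℒ (rhsN D M 0) t x) =
        (-E) ∘ N := by
      funext x
      simp [resid, ht, hEq, h0]
    have hN : ContDiff 𝕂 l N := hf.contDiff.of_le (by exact_mod_cast hlm)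
    rw [e]
    refine ((-E).norm_iteratedFDeriv_comp_left hN.contDiffAt le_rfl).trans ?_
    rw [norm_neg]
    calc _ ≤ rate Γ n * D.C t * cB :=
          mul_le_mul hE (hf.bound l h2 hlm x) (norm_nonneg _) (mul_nonneg hr (hC t ht))
      _ = rate Γ n * (D.C t * cB) := by ring
      _ ≤ _ := mul_le_mul_of_nonneg_left (hCE' t ht) hr
  · have e : (fun x => resid I ℒ (rhsN D M n) t x - resid I ℒ (rhsN D M 0) t x) =
        fun _ => 0 := by funext x; simp [resid, ht]
    rw [e, iteratedFDeriv_fun_zero]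
    simpa using mul_nonneg hr (hCB.trans hCE)

/-- Time being unbounded below, each point of the set is the image of an earlier one, hence lies in
the range of T or of Π_n. -/
lemma unstableSet_subset
    (hfac : ∀ t ∈ prime I, ∃ T N A a b, Factorization D m t (ℒ t) L CB cB T N A a b)
    (hI : I.OrdConnected) (hu : ¬ BddBelow I) (γ : ℝ) :
    unstableSet I (rhsN D M n) γ ⊆
      I ×ˢ (if n = 0 then (D.XΩ : Set (LpSpace 𝕂 Ω p d)) else M.space d n) := by
  rintro ⟨τ, u⟩ ⟨hτ, φ, hφ, -, hu'⟩
  dsimp only at hτ hu'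
  subst hu'
  have ht : τ - 1 ∈ prime I :=
    ⟨mem_of_le_of_not_bddBelow hI hu hτ (by omega), by simpa using hτ⟩
  have h1 := hφ _ ht
  rw [sub_add_cancel] at h1
  refine ⟨hτ, ?_⟩
  dsimp only
  rw [h1]
  split_ifs with h0
  · obtain ⟨T, N, A, a, b, hf⟩ := hfac _ ht
    rw [rhsN, if_pos h0, hf.rhs_eq]
    exact (hf.smoothing _).1
  · rw [rhsN, if_neg h0]
    exact M.Proj_mem_space n _

/-- On N(P_t) the operator ℒ_t is bounded below, while ℒ_t - Π_n ℒ_t has arbitrarily small norm. For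
suitable n the map Π_n ℒ_t is therefore injective there, with values in a finite-dimensional space.
-/
lemma finiteDimensional_of_splitting {P : ℤ → LpSpace 𝕂 Ω p d →L[𝕂] LpSpace 𝕂 Ω p d}
    {K α β : ℝ}
    (hfac : ∀ t ∈ prime I, ∃ T N A a b, Factorization D m t (ℒ t) L CB cB T N A a b)
    (hC : ∀ t ∈ prime I, 0 ≤ D.C t) (hM : M.ErrorHyp D Γ) (h : IsSplitting I ℒ P K α β)
    (ht : t ∈ prime I) {V : Submodule 𝕂 (LpSpace 𝕂 Ω p d)} (hV : ∀ v ∈ V, P t v = 0) :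
    FiniteDimensional 𝕂 V := by
  obtain ⟨T, N, A, a, b, hf⟩ := hfac t ht
  have hc0 : Tendsto (fun n => K * β ^ (t - (t + 1)) * (rate Γ n * (D.C t * ‖A‖))) atTop
      (𝓝 0) := by
    simpa using (hM.tendsto_rate.mul_const (D.C t * ‖A‖)).const_mul (K * β ^ (t - (t + 1)))
  obtain ⟨n, hn, hn1⟩ := ((hc0.eventually_lt_const zero_lt_one).and
    (eventually_ge_atTop 1)).exists
  rw [rate_of_one_le hn1] at hn
  have := M.finite n hn1
  have hβ : 0 < β := h.pos.trans h.lt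
  have hK : 0 < K := zero_lt_one.trans_le h.one_le
  refine FiniteDimensional.of_injective
    ((M.coords d n).comp ((ℒ t).toLinearMap.comp V.subtype)) ?_
  rw [← LinearMap.ker_eq_bot, LinearMap.ker_eq_bot']
  intro v hv
  have h1 : M.Proj d n (ℒ t v) = 0 := M.Proj_eq_zero hv
  have h2 := hf.norm_lin_sub_Proj_le (hC t ht) hM hn1 (v : LpSpace 𝕂 Ω p d)
  rw [h1, sub_zero] at h2
  have h3 := h.backward t ht.1 (t + 1) ht.2 (by omega) (ℒ t v) v (hV v v.2) (by
    rw [evol_succ ℒ le_rfl, h.comm t ht, hV v v.2]; simp)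
  have h4 : ‖(v : LpSpace 𝕂 Ω p d)‖ ≤
      K * β ^ (t - (t + 1)) * (Γ (1 / n) * (D.C t * ‖A‖)) * ‖(v : LpSpace 𝕂 Ω p d)‖ := by
    refine h3.trans ?_
    rw [mul_assoc _ _ ‖(v : LpSpace 𝕂 Ω p d)‖]
    exact mul_le_mul_of_nonneg_left h2 (by positivity)
  have h5 : ‖(v : LpSpace 𝕂 Ω p d)‖ = 0 := by
    nlinarith [norm_nonneg (v : LpSpace 𝕂 Ω p d)]
  exact Subtype.ext (norm_eq_zero.1 h5)

/-- ℒ_t maps the fiber at t isomorphically onto the fiber at t + 1, so all dimensions agree. -/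
lemma exists_finrank_unstableFiber {P : ℤ → LpSpace 𝕂 Ω p d →L[𝕂] LpSpace 𝕂 Ω p d}
    {K α β γ : ℝ}
    (hfac : ∀ t ∈ prime I, ∃ T N A a b, Factorization D m t (ℒ t) L CB cB T N A a b)
    (hC : ∀ t ∈ prime I, 0 ≤ D.C t) (hM : M.ErrorHyp D Γ) (h : IsSplitting I ℒ P K α β)
    (hI : I.OrdConnected) (hu : ¬ BddBelow I) (hγ : γ ∈ Ioc α β) :
    ∃ dim : ℕ, ∀ τ ∈ I, FiniteDimensional 𝕂 (unstableFiber I ℒ γ τ) ∧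
      Module.finrank 𝕂 (unstableFiber I ℒ γ τ) = dim := by
  have hmem : ∀ τ ∈ I, ∀ u, u ∈ unstableFiber I ℒ γ τ ↔ P τ u = 0 := fun τ hτ u =>
    h.mem_unstableFiber_iff hI hu hγ.1 hγ.2 hτ
  have heq : ∀ t ∈ prime I, Nonempty (unstableFiber I ℒ γ t ≃ₗ[𝕂] unstableFiber I ℒ γ (t + 1)) := by
    intro t ht
    have hb := h.bij t ht
    refine ⟨LinearEquiv.ofBijective ((ℒ t).toLinearMap.restrict (p := unstableFiber I ℒ γ t)
      (q := unstableFiber I ℒ γ (t + 1)) fun v hv => ?_) ⟨fun v w hvw => ?_, fun w => ?_⟩⟩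
    · exact (hmem _ ht.2 _).2 (hb.mapsTo ((hmem _ ht.1 _).1 hv))
    · exact Subtype.ext (hb.injOn ((hmem _ ht.1 _).1 v.2) ((hmem _ ht.1 _).1 w.2)
        (congrArg Subtype.val hvw))
    · obtain ⟨v, hv, hvw⟩ := hb.surjOn ((hmem _ ht.2 _).1 w.2)
      exact ⟨⟨v, (hmem _ ht.1 _).2 hv⟩, Subtype.ext hvw⟩
  have hle : ∀ s t, s ≤ t → t ∈ I → Module.finrank 𝕂 (unstableFiber I ℒ γ t) =
      Module.finrank 𝕂 (unstableFiber I ℒ γ s) := by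
    intro s t hst
    induction t, hst using Int.leInduction with
    | base => exact fun _ => rfl
    | succ t hst ih =>
      intro ht
      have ht' : t ∈ I := mem_of_le_of_not_bddBelow hI hu ht (by omega)
      obtain ⟨f⟩ := heq t ⟨ht', ht⟩
      rw [← f.finrank_eq, ih ht']
  have hne : I.Nonempty := by
    by_contra h0
    rw [not_nonempty_iff_eq_empty] at h0
    exact hu (h0 ▸ bddBelow_empty)
  obtain ⟨s, hs⟩ := hne
  refine ⟨Module.finrank 𝕂 (unstableFiber I ℒ γ s), fun τ hτ => ⟨?_, ?_⟩⟩
  -- Finiteness is transported from τ - 1, since τ may be the last point of 𝕀.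
  · have ht : τ - 1 ∈ prime I :=
      ⟨mem_of_le_of_not_bddBelow hI hu hτ (by omega), by simpa using hτ⟩
    have := finiteDimensional_of_splitting hfac hC hM h ht fun v hv => (hmem _ ht.1 v).1 hv
    obtain ⟨f⟩ := heq _ ht
    rw [sub_add_cancel] at f
    exact f.finiteDimensional
  · rcases le_total s τ with hst | hst
    · exact hle s τ hst hτ
    · exact (hle τ s hst hs).symm

end Discretization

/-! ### Bounds uniform in time and discretization -/

section Uniform

variable {𝕂 : Type*} [RCLike 𝕂] {κ : ℕ} {Ω : Set (EuclideanSpace ℝ (Fin κ))}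
  {p q : ℝ≥0∞} [Fact (1 ≤ p)] [Fact (1 ≤ q)] {d e : ℕ} {D : Hammerstein 𝕂 Ω p q d e}
  {M : ProjectionMethod 𝕂 Ω p} {Γ : ℝ → ℝ} {I : Set ℤ} {m k N : ℕ}
  {ℒ : ℤ → LpSpace 𝕂 Ω p d →L[𝕂] LpSpace 𝕂 Ω p d} {L CB cB Λ : ℝ}

/-- Up to order 1 the Lipschitz constant suffices; the uniform bounds on κ_t and C_t enter from
order 2 on. -/
lemma exists_isSmoothPerturbation
    (hfac : ∀ t ∈ prime I, ∃ T N A a b, Factorization D m t (ℒ t) L CB cB T N A a b)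
    (hC : ∀ t ∈ prime I, 0 ≤ D.C t) (hM : M.ErrorHyp D Γ) (hcB : 0 ≤ cB) (hk : k ≤ m)
    (hU : 2 ≤ k → D.UniformKernel I)
    (hF : ∀ n, n = 0 ∨ N ≤ n → IsPerturbation I ℒ (rhsN D M n) Λ)
    (hr : ∀ n, n = 0 ∨ N ≤ n → rate Γ n ≤ 1) :
    ∃ CR, Λ ≤ CR ∧ ∀ n, n = 0 ∨ N ≤ n → IsSmoothPerturbation I ℒ (rhsN D M n) k CR := by
  by_cases h2 : 2 ≤ k
  · obtain ⟨hfin, B, hB⟩ := hU h2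
    refine ⟨max Λ (((⨆ t ∈ prime I, hilleTamarkin Ω (D.k t)).toReal + B) * cB),
      le_max_left _ _, fun n hn => isSmoothPerturbation_rhsN hfac hC hM hk (hF n hn)
        (le_max_left _ _) fun _ t ht => le_trans ?_ (le_max_right _ _)⟩
    have h1 : (hilleTamarkin Ω (D.k t)).toReal ≤
        (⨆ t ∈ prime I, hilleTamarkin Ω (D.k t)).toReal :=
      ENNReal.toReal_mono hfin.ne (le_iSup₂ (f := fun t _ => hilleTamarkin Ω (D.k t)) t ht)
    have h3 : rate Γ n * D.C t ≤ B :=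
      (mul_le_of_le_one_left (hC t ht) (hr n hn)).trans (hB t ht)
    gcongr
  · exact ⟨Λ, le_rfl, fun n hn => isSmoothPerturbation_rhsN hfac hC hM hk (hF n hn) le_rfl
      fun h => absurd h h2⟩

lemma exists_residual_bound
    (hfac : ∀ t ∈ prime I, ∃ T N A a b, Factorization D m t (ℒ t) L CB cB T N A a b)
    (hC : ∀ t ∈ prime I, 0 ≤ D.C t) (hM : M.ErrorHyp D Γ) (hCB : 0 ≤ CB) (hcB : 0 ≤ cB)
    (hU : D.UniformKernel I) :
    ∃ CE, CB ≤ CE ∧ ∀ n t l, 1 ≤ l → l ≤ m → ∀ x,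
      ‖iteratedFDeriv 𝕂 l (fun x => resid I ℒ (rhsN D M n) t x -
        resid I ℒ (rhsN D M 0) t x) x‖ ≤ rate Γ n * CE := by
  obtain ⟨-, B, hB⟩ := hU
  exact ⟨max CB (B * cB), le_max_left _ _, fun n t l hl hlm x =>
    norm_iteratedFDeriv_resid_sub_le hfac hC hM hCB (le_max_left _ _) (fun t ht =>
      (mul_le_mul_of_nonneg_right (hB t ht) hcB).trans (le_max_right _ _)) n t hl hlm x⟩

end Uniform

end IDE

end

/-! ### The main theorem -/

theorem theorem3p1 {𝕂 : Type*} [RCLike 𝕂] {κ d : ℕ}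
    (Ω : Set (EuclideanSpace ℝ (Fin κ))) (hΩ : IsOpen Ω) (hΩb : Bornology.IsBounded Ω)
    (p : ℝ≥0∞) [Fact (1 ≤ p)]
    (I : Set ℤ) (hI : I.OrdConnected) (hIu : ¬ BddAbove I ∨ ¬ BddBelow I)
    (ℒ : ℤ → IDE.LpSpace 𝕂 Ω p d →L[𝕂] IDE.LpSpace 𝕂 Ω p d)
    (α γj β : ℝ) (hα : 0 < α) (hαγ : α < γj) (hγβ : γj < β)
    (hgap : Icc α β ∩ IDE.dichotomySpectrum I ℒ = ∅) :
    -- `K` depends only on the variational equation and the gap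
    ∃ K : ℝ, 1 ≤ K ∧
    ∀ (e m : ℕ) (q : ℝ≥0∞) [Fact (1 ≤ q)] (D : IDE.Hammerstein 𝕂 Ω p q d e)
      (M : IDE.ProjectionMethod 𝕂 Ω p) (Γ : ℝ → ℝ),
    1 ≤ m → 1 < q → p < ⊤ → m * q < p →
    D.KernelHyp I → D.GrowthHyp I m → M.ErrorHyp D Γ → D.IsVariational I ℒ →
    ∀ L : ℝ, L = (D.lipConst I).toReal →
    ∀ δ : ℝ, 4 * K * L < δ → δ ≤ (β - α) / 2 →
    ∃ N : ℕ, 1 ≤ N ∧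
    -- (a) pseudo-stable bundles
    (¬ BddAbove I →
      ∃ (w : ℕ → (τ : ℤ) → IDE.stableFiber I ℒ γj τ → IDE.LpSpace 𝕂 Ω p d)
        (C₀ : ℕ → ℝ) (N₀ : ℝ),
        (∀ n : ℕ, n = 0 ∨ N ≤ n →
          (∀ γ ∈ Icc (α + δ) (β - δ),
            IDE.ForwardInvariant I (IDE.rhsN D M n) (IDE.stableSet I (IDE.rhsN D M n) γ) ∧
            IDE.stableSet I (IDE.rhsN D M n) γ =
              IDE.graphOver I (IDE.stableFiber I ℒ γj) (w n)) ∧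
          ∀ τ ∈ I, Continuous (w n τ) ∧ w n τ 0 = 0 ∧
            ∀ v v' : IDE.stableFiber I ℒ γj τ, ‖w n τ v - w n τ v'‖ ≤ C₀ n * ‖v - v'‖) ∧
        C₀ 0 = K ^ 2 * L / (δ - 2 * K * L) ∧ (∀ n, N ≤ n → 0 < C₀ n) ∧
        Tendsto C₀ atTop (𝓝 (C₀ 0)) ∧
        0 < N₀ ∧
        (∀ n, N ≤ n → ∀ τ ∈ I, ∀ v : IDE.stableFiber I ℒ γj τ,
          ‖w n τ v - w 0 τ v‖ ≤ N₀ * Γ (1 / n) * ‖v‖) ∧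
        (∀ mp : ℕ, 1 ≤ mp → mp ≤ m → α ^ mp < β →
          δ ≤ α * (((α + β) / (α + α ^ mp)) ^ (1 / (mp : ℝ)) - 1) →
          (2 ≤ mp → D.UniformKernel I) →
          (∀ n : ℕ, n = 0 ∨ N ≤ n → ∀ τ ∈ I, ContDiff 𝕂 mp (w n τ)) ∧
          ∀ l : ℕ, 1 ≤ l → l < mp → ∃ Nl : ℝ, 0 < Nl ∧
            ∀ n, N ≤ n → ∀ τ ∈ I, ∀ v : IDE.stableFiber I ℒ γj τ,
              ‖iteratedFDeriv 𝕂 l (w n τ) v - iteratedFDeriv 𝕂 l (w 0 τ) v‖ ≤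
                Nl * Γ (1 / n) * (1 + ‖v‖))) ∧
    -- (b) pseudo-unstable bundles
    (¬ BddBelow I →
      (∃ dim : ℕ, ∀ τ ∈ I, FiniteDimensional 𝕂 (IDE.unstableFiber I ℒ γj τ) ∧
        Module.finrank 𝕂 (IDE.unstableFiber I ℒ γj τ) = dim) ∧
      ∃ (w : ℕ → (τ : ℤ) → IDE.unstableFiber I ℒ γj τ → IDE.LpSpace 𝕂 Ω p d)
        (C₀ : ℕ → ℝ) (N₀ : ℝ),
        (∀ n : ℕ, n = 0 ∨ N ≤ n →
          (∀ γ ∈ Icc (α + δ) (β - δ),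
            IDE.Invariant I (IDE.rhsN D M n) (IDE.unstableSet I (IDE.rhsN D M n) γ) ∧
            IDE.unstableSet I (IDE.rhsN D M n) γ =
              IDE.graphOver I (IDE.unstableFiber I ℒ γj) (w n) ∧
            IDE.unstableSet I (IDE.rhsN D M n) γ ⊆
              I ×ˢ (if n = 0 then (D.XΩ : Set (IDE.LpSpace 𝕂 Ω p d)) else M.space d n)) ∧
          ∀ τ ∈ I, Continuous (w n τ) ∧ w n τ 0 = 0 ∧
            ∀ v v' : IDE.unstableFiber I ℒ γj τ, ‖w n τ v - w n τ v'‖ ≤ C₀ n * ‖v - v'‖) ∧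
        C₀ 0 = K ^ 2 * L / (δ - 2 * K * L) ∧ (∀ n, N ≤ n → 0 < C₀ n) ∧
        Tendsto C₀ atTop (𝓝 (C₀ 0)) ∧
        0 < N₀ ∧
        (∀ n, N ≤ n → ∀ τ ∈ I, ∀ v : IDE.unstableFiber I ℒ γj τ,
          ‖w n τ v - w 0 τ v‖ ≤ N₀ * Γ (1 / n) * ‖v‖) ∧
        (∀ mm : ℕ, 1 ≤ mm → mm ≤ m → α < β ^ mm →
          δ ≤ β * (1 - ((α + β) / (β + β ^ mm)) ^ (1 / (mm : ℝ))) →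
          (2 ≤ mm → D.UniformKernel I) →
          (∀ n : ℕ, n = 0 ∨ N ≤ n → ∀ τ ∈ I, ContDiff 𝕂 mm (w n τ)) ∧
          ∀ l : ℕ, 1 ≤ l → l < mm → ∃ Nl : ℝ, 0 < Nl ∧
            ∀ n, N ≤ n → ∀ τ ∈ I, ∀ v : IDE.unstableFiber I ℒ γj τ,
              ‖iteratedFDeriv 𝕂 l (w n τ) v - iteratedFDeriv 𝕂 l (w 0 τ) v‖ ≤
                Nl * Γ (1 / n) * (1 + ‖v‖))) ∧
    -- (c) intersection and entire solutions
    (I = univ → L < δ / (6 * K) → ∀ n : ℕ, n = 0 ∨ N ≤ n →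
      ∀ γ ∈ Icc (α + δ) (β - δ),
        IDE.stableSet I (IDE.rhsN D M n) γ ∩ IDE.unstableSet I (IDE.rhsN D M n) γ =
          I ×ˢ {0} ∧
        ∀ φ : ℤ → IDE.LpSpace 𝕂 Ω p d, IDE.IsSolution I (IDE.rhsN D M n) φ →
          (∃ B : ℝ, ∀ t : ℤ, γ ^ (-t) * ‖φ t‖ ≤ B) → ∀ t : ℤ, φ t = 0) := by
  -- The splitting uses only ℒ and the gap, so K is fixed before the nonlinearity, the projections
  -- and δ.
  obtain ⟨P, K, hsp⟩ := IDE.exists_isSplitting_of_gap hI hIu hα (hαγ.trans hγβ) hgap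
  obtain ⟨B, h⟩ := hsp.exists_isSplit hI
  refine ⟨K, h.one_le, ?_⟩
  intro e m q _ D M Γ hm hq hp hmq hK hG hM hV L hL δ hδL hδ2
  obtain ⟨cB, hcB, hfac⟩ := IDE.exists_factorization hΩb ⟨hm, hq, hp, hmq⟩ hK hG hV
  rw [← hL] at hfac
  set CB := IDE.smoothConst D I with hCBdef
  have hCB : 0 ≤ CB := ENNReal.toReal_nonneg
  have hC := hK.C_nonneg
  have hL0 : 0 ≤ L := hL ▸ ENNReal.toReal_nonneg
  have hK0 : 0 < K := zero_lt_one.trans_le h.one_le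
  have hδ : 0 < δ := lt_of_le_of_lt (by positivity) hδL
  -- The summand 1 keeps Λ n, and with it C₀ n, positive for n ≥ 1 even if L and CB vanish.
  let Λ : ℕ → ℝ := fun n => L + IDE.rate Γ n * (CB + 1)
  let C₀ : ℕ → ℝ := fun n => K ^ 2 * Λ n / (δ - 2 * K * Λ n)
  have hr := hM.rate_nonneg
  have hΛ0 : Λ 0 = L := by simp [Λ, IDE.rate]
  have hΛt : Tendsto Λ atTop (𝓝 L) := by
    simpa using (hM.tendsto_rate.mul_const (CB + 1)).const_add L
  have hF : ∀ n, IDE.IsPerturbation I ℒ (IDE.rhsN D M n) (Λ n) := fun n =>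
    (IDE.isPerturbation_rhsN hfac hC hM hL0 hCB n).mono
      (add_le_add_right (mul_le_mul_of_nonneg_left (by linarith) (hr n)) L)
  have hres : ∀ n s x, ‖IDE.resid I ℒ (IDE.rhsN D M n) s x -
      IDE.resid I ℒ (IDE.rhsN D M 0) s x‖ ≤ IDE.rate Γ n * (CB + 1) * ‖x‖ := fun n s x => by
    have h1 := IDE.norm_resid_sub_le hfac hC hM hCB n s x 0
    rw [(hF n).zero, (hF 0).zero] at h1
    simp only [sub_zero] at h1
    exact h1.trans (by gcongr; exacts [hr n, by linarith])
  -- N is chosen so that 4K Λ n < δ persists from the strict inequality 4KL < δ, and so that rates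
  -- are at most 1.
  obtain ⟨N, hN⟩ := (((hΛt.const_mul (4 * K)).eventually_lt_const hδL).and
    (hM.tendsto_rate.eventually_le_const zero_lt_one)).exists_forall_of_atTop
  have hN' : ∀ n, n = 0 ∨ max 1 N ≤ n → 4 * K * Λ n < δ ∧ IDE.rate Γ n ≤ 1 := by
    rintro n (rfl | hn)
    · exact ⟨by rwa [hΛ0], by simp [IDE.rate]⟩
    · exact hN n (le_trans (le_max_right _ _) hn)
  have h2Λ : ∀ n, n = 0 ∨ max 1 N ≤ n → 2 * K * Λ n < δ := fun n hn => by
    have h1 := (hN' n hn).1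
    have h2 := mul_nonneg hK0.le (hF n).nonneg
    linarith
  -- The common Lipschitz bound δ/(4K) serves the distance and smoothness estimates, whose constants
  -- must not depend on n. The sharper Λ n is used for the Lipschitz constants C₀ n.
  have hFmax : ∀ n, n = 0 ∨ max 1 N ≤ n →
      IDE.IsPerturbation I ℒ (IDE.rhsN D M n) (IDE.maxLip K δ) := fun n hn =>
    (hF n).mono (by
      rw [IDE.maxLip, le_div_iff₀ (by positivity)]
      linarith [(hN' n hn).1])
  have hΓ : ∀ n, max 1 N ≤ n → IDE.rate Γ n = Γ (1 / n) ∧ 0 < Γ (1 / n) := fun n hn => by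
    have h1 : 1 ≤ n := (le_max_left _ _).trans hn
    exact ⟨IDE.rate_of_one_le h1, hM.pos _ (by positivity)⟩
  have hC₀0 : C₀ 0 = K ^ 2 * L / (δ - 2 * K * L) := by simp only [C₀, hΛ0]
  have hC₀pos : ∀ n, max 1 N ≤ n → 0 < C₀ n := fun n hn => by
    have h1 : 0 < IDE.rate Γ n := (hΓ n hn).1 ▸ (hΓ n hn).2
    exact div_pos (by positivity) (by linarith [h2Λ n (Or.inr hn)])
  have hC₀t : Tendsto C₀ atTop (𝓝 (C₀ 0)) := by
    rw [hC₀0]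
    refine (hΛt.const_mul _).div ((hΛt.const_mul _).const_sub δ) ?_
    have := h2Λ 0 (Or.inl rfl)
    rw [hΛ0] at this
    exact (sub_pos.2 this).ne'
  have hγs : γj ∈ Ico α β := ⟨hαγ.le, hγβ⟩
  have hγu : γj ∈ Ioc α β := ⟨hαγ, hγβ.le⟩
  have hdist := IDE.distConst_nonneg hK0 hδ
  have h0 : (0 : ℕ) = 0 ∨ max 1 N ≤ 0 := Or.inl rfl
  refine ⟨max 1 N, le_max_left _ _, fun hu => ?_, fun hu => ?_, ?_⟩
  · refine ⟨fun n => IDE.IsSplit.stableGraph I ℒ P B (IDE.rhsN D M n) α γj δ, C₀,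
      IDE.distConst K δ * (CB + 1) + 1, fun n hn => ⟨fun γ hγ => ⟨?_, ?_⟩, fun τ hτ =>
        ⟨?_, ?_, ?_⟩⟩, hC₀0, hC₀pos, hC₀t, by positivity, fun n hn τ hτ v => ?_,
      fun k hk hkm hαk hδk hU => ⟨fun n hn τ hτ => ?_, fun l hl hlk => ?_⟩⟩
    · exact IDE.forwardInvariant_stableSet (by linarith [hγ.1])
    · exact h.stableSet_eq_graphOver hu hγs (hF n) hδ (h2Λ n hn) hγ
    · exact h.continuous_stableGraph hu hτ hγs (hF n) hδ hδ2 (h2Λ n hn)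
    · exact h.stableGraph_zero hu hτ hγs (hF n) hδ hδ2 (h2Λ n hn)
    · exact h.norm_stableGraph_sub_le hu hτ hγs (hF n) hδ hδ2 (h2Λ n hn)
    · refine (h.norm_stableGraph_sub_stableGraph_le hu hτ hγs (hFmax n (Or.inr hn))
        (hFmax 0 h0) hδ hδ2 (mul_nonneg (hr n) (by positivity)) (hres n) v).trans ?_
      have h1 := mul_nonneg (hΓ n hn).2.le (norm_nonneg v)
      rw [(hΓ n hn).1]
      linarith
    · obtain ⟨CR, hCR, hS⟩ := IDE.exists_isSmoothPerturbation hfac hC hM hcB hkm hU hFmax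
        fun n hn => (hN' n hn).2
      obtain ⟨k, rfl⟩ : ∃ k', k = k' + 1 := ⟨k - 1, by omega⟩
      exact h.contDiff_stableGraph hu hτ hγs (hFmax n hn) hδ hδ2 hCR
        (fun l hl => IDE.pow_mem_of_gap hα hδ hδ2 hk hαk hδk (by omega)) (hS n hn)
    · obtain ⟨CR, hCR, hS⟩ := IDE.exists_isSmoothPerturbation hfac hC hM hcB hkm hU hFmax
        fun n hn => (hN' n hn).2
      -- 1 ≤ l < k forces k ≥ 2, so the uniform kernel bounds are available.
      obtain ⟨CE, hCE, hE⟩ := IDE.exists_residual_bound hfac hC hM hCB hcB (hU (by omega))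
      obtain ⟨k, rfl⟩ : ∃ k', k = k' + 2 := ⟨k - 2, by omega⟩
      -- Absolute value and the summand 1 serve only to make the constant positive.
      refine ⟨|IDE.derivDistConst K δ CR (CE + 1) k l| + 1, by positivity, fun n hn τ hτ v => ?_⟩
      refine (h.norm_iteratedFDeriv_stableGraph_sub_le hu hτ hγs (hFmax n (Or.inr hn))
        (hFmax 0 h0) hδ hδ2 hCR (by linarith : 0 ≤ CE + 1) (hr n)
        (fun l hl => IDE.pow_mem_of_gap hα hδ hδ2 hk hαk hδk (by omega)) (hS n (Or.inr hn))
        (hS 0 h0) (fun s x => (hres n s x).trans ?_) (fun s i hi hik x =>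
          (hE n s i hi (hik.trans hkm) x).trans ?_) (by omega) v).trans ?_
      · exact mul_le_mul_of_nonneg_right
          (mul_le_mul_of_nonneg_left (by linarith) (hr n)) (norm_nonneg x)
      · exact mul_le_mul_of_nonneg_left (by linarith) (hr n)
      · rw [(hΓ n hn).1]
        have h1 := (hΓ n hn).2.le
        gcongr
        linarith [le_abs_self (IDE.derivDistConst K δ CR (CE + 1) k l)]
  · refine ⟨IDE.exists_finrank_unstableFiber hfac hC hM hsp hI hu hγu,
      fun n => IDE.IsSplit.unstableGraph I ℒ P B (IDE.rhsN D M n) β γj δ, C₀,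
      IDE.distConst K δ * (CB + 1) + 1, fun n hn => ⟨fun γ hγ => ⟨?_, ?_, ?_⟩, fun τ hτ =>
        ⟨?_, ?_, ?_⟩⟩, hC₀0, hC₀pos, hC₀t, by positivity, fun n hn τ hτ v => ?_,
      fun k hk hkm hαk hδk hU => ⟨fun n hn τ hτ => ?_, fun l hl hlk => ?_⟩⟩
    · exact IDE.invariant_unstableSet (by linarith [hγ.1])
    · exact h.unstableSet_eq_graphOver hu hγu (hF n) hδ (h2Λ n hn) hγ
    · exact IDE.unstableSet_subset hfac hI hu γ
    · exact h.continuous_unstableGraph hu hτ (hF n) hδ hδ2 (h2Λ n hn)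
    · exact h.unstableGraph_zero hu hτ (hF n) hδ hδ2 (h2Λ n hn)
    · exact h.norm_unstableGraph_sub_le hu hτ hγu (hF n) hδ hδ2 (h2Λ n hn)
    · refine (h.norm_unstableGraph_sub_unstableGraph_le hu hτ (hFmax n (Or.inr hn))
        (hFmax 0 h0) hδ hδ2 (mul_nonneg (hr n) (by positivity)) (hres n) v).trans ?_
      have h1 := mul_nonneg (hΓ n hn).2.le (norm_nonneg v)
      rw [(hΓ n hn).1]
      linarith
    · obtain ⟨CR, hCR, hS⟩ := IDE.exists_isSmoothPerturbation hfac hC hM hcB hkm hU hFmax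
        fun n hn => (hN' n hn).2
      obtain ⟨k, rfl⟩ : ∃ k', k = k' + 1 := ⟨k - 1, by omega⟩
      exact h.contDiff_unstableGraph hu hτ (hFmax n hn) hδ hδ2 hCR
        (fun l hl => IDE.pow_mem_of_gap' hα hδ hδ2 hk hαk hδk (by omega)) (hS n hn)
    · obtain ⟨CR, hCR, hS⟩ := IDE.exists_isSmoothPerturbation hfac hC hM hcB hkm hU hFmax
        fun n hn => (hN' n hn).2
      obtain ⟨CE, hCE, hE⟩ := IDE.exists_residual_bound hfac hC hM hCB hcB (hU (by omega))
      obtain ⟨k, rfl⟩ : ∃ k', k = k' + 2 := ⟨k - 2, by omega⟩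
      refine ⟨|IDE.derivDistConst K δ CR (CE + 1) k l| + 1, by positivity, fun n hn τ hτ v => ?_⟩
      refine (h.norm_iteratedFDeriv_unstableGraph_sub_le hu hτ (hFmax n (Or.inr hn))
        (hFmax 0 h0) hδ hδ2 hCR (by linarith : 0 ≤ CE + 1) (hr n)
        (fun l hl => IDE.pow_mem_of_gap' hα hδ hδ2 hk hαk hδk (by omega)) (hS n (Or.inr hn))
        (hS 0 h0) (fun s x => (hres n s x).trans ?_) (fun s i hi hik x =>
          (hE n s i hi (hik.trans hkm) x).trans ?_) (by omega) v).trans ?_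
      · exact mul_le_mul_of_nonneg_right
          (mul_le_mul_of_nonneg_left (by linarith) (hr n)) (norm_nonneg x)
      · exact mul_le_mul_of_nonneg_left (by linarith) (hr n)
      · rw [(hΓ n hn).1]
        have h1 := (hΓ n hn).2.le
        gcongr
        linarith [le_abs_self (IDE.derivDistConst K δ CR (CE + 1) k l)]
  -- Both claims follow from the contraction condition 2K Λ n < δ on the full time axis.
  · rintro rfl - n hn γ hγ
    refine ⟨h.stableSet_inter_unstableSet (hF n) hδ (h2Λ n hn) hγ, fun φ hφ ⟨C, hφC⟩ => ?_⟩
    have hγ0 : 0 < γ := by linarith [hγ.1]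
    refine h.eq_zero_of_bdd (hF n) hδ (h2Λ n hn) hγ hφ (D := C) fun t => ?_
    have h1 := hφC t
    rwa [zpow_neg, inv_mul_le_iff₀ (zpow_pos hγ0 t), mul_comm] at h1
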